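/- Let $d\in\mathbb N$, $m>0$, $T>0$, and let $V:\mathbb R^d\to\mathbb R$ be Lipschitz continuous. For each $\hbar\in(0,1]$ let $t\mapsto R_\hbar(t)$, $t\in[-T,T]$, be a family of density operators on $L^2(\mathbb R^d;\mathbb C)$ (self-adjoint, nonnegative, of trace $1$), continuous on $[-T,T]$ for the weak operator topology, which is a weak solution on $(-T,T)$ of the von Neumann equation $$i\hbar\,\partial_t R_\hbar=[\mathcal H,R_\hbar],\qquad \mathcal H=-\frac{\hbar^2}{2m}\Delta+V,$$ i.e. for all $\phi,\chi\in C_c^\infty(\mathbb R^d)$, $i\hbar\frac{d}{dt}\langle\phi,R_\hbar(t)\chi\rangle=\langle\mathcal H\phi,R_\hbar(t)\chi\rangle-\langle\phi,R_\hbar(t)\mathcal H\chi\rangle$ in $\mathcal D'((-T,T))$. Assume that for some constant $C>0$ independent of $\hbar$, $$\sup_{|t|\le T}\operatorname{tr}\big(R_\hbar(t)^2\big)\le C^2(2\pi\hbar)^d\qquad\text{for all }\hbar\in(0,1].$$ Let $R_\hbar(t,X,Y)$ be the integral kernel of $R_\hbar(t)$ and let $$w_\hbar(t,x,v)=\frac1{(2\pi)^d}\int_{\mathbb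 R^d}e^{-iv\cdot y}R_\hbar\big(t,x+\tfrac{\hbar}{2}y,x-\tfrac{\hbar}{2}y\big)\,dy$$ be its Wigner function (for a.e. $t$ an $L^2(\mathbb R^d_x\times\mathbb R^d_v)$ function, the integral being a partial Fourier transform in $L^2$; a jointly measurable function of $(t,x,v)$ with this property exists). Then for each $\psi\in\mathcal S(\mathbb R^d)$ the velocity averages $$\rho_\psi[w_\hbar](t,x)=\int_{\mathbb R^d}w_\hbar(t,x,v)\psi(v)\,dv$$ (the integral converges for a.e. $(t,x)$) satisfy $$\sup_{0<\hbar\le1}\|\rho_\psi[w_\hbar]\|_{H^{1/4}((-T,T)\times\mathbb R^d)}<\infty,$$ where, for open $\Omega\subset\mathbb R\times\mathbb R^d$ and $0<s<1$, $\|u\|_{H^s(\Omega)}^2=\int_\Omega|u|^2\,dz+\iint_{\Omega\times\Omega}\frac{|u(z)-u(z')|^2}{|z-z'|^{d+1+2s}}\,dz\,dz'$. -/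

import Mathlib

open MeasureTheory Set
open scoped ENNReal NNReal SchwartzMap Distributions

noncomputable section

namespace SemiclassicalAveraging

/-- Position (or velocity) space `ℝ^d` with its Euclidean structure. -/
abbrev Space (d : ℕ) : Type := EuclideanSpace ℝ (Fin d)

/-- The Hilbert space `L²(ℝ^d; ℂ)`. -/
abbrev L2 (d : ℕ) : Type := Lp ℂ 2 (volume : Measure (Space d))

/-- The whole space as an open set, the domain of the test functions. -/
abbrev wholeSpace (d : ℕ) : TopologicalSpace.Opens (Space d) := ⊤

/-- The open time interval `(-T, T)`. -/
abbrev timeInterval (T : ℝ) : TopologicalSpace.Opens ℝ := ⟨Ioo (-T) T, isOpen_Ioo⟩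

/-! ### Density operators -/

/-- `A` is of trace class with `tr A = τ`: for every Hilbert basis `b`, the series
`∑ ⟨b i, A (b i)⟩` converges (unconditionally) to `τ`. -/
def HasTrace {d : ℕ} (A : L2 d →L[ℂ] L2 d) (τ : ℂ) : Prop :=
  ∀ (w : Set (L2 d)) (b : HilbertBasis w ℂ (L2 d)),
    HasSum (fun i => inner ℂ (b i) (A (b i))) τ

/-- A density operator: self-adjoint, nonnegative, of trace one. -/
structure IsDensityOperator {d : ℕ} (A : L2 d →L[ℂ] L2 d) : Prop where
  isPositive : A.IsPositive
  hasTrace_one : HasTrace A 1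

/-! ### The von Neumann equation -/

/-- The Hamilton operator `-ħ²/(2m) Δ + V` acting on functions. -/
def hamiltonianFun {d : ℕ} (ħ m : ℝ) (V : C(Space d, ℝ)) (φ : Space d → ℂ) : Space d → ℂ :=
  fun x => -((ħ ^ 2 / (2 * m) : ℝ) : ℂ) * Laplacian.laplacian φ x + (V x : ℂ) * φ x

theorem memLp_testFunction {d : ℕ} (φ : 𝓓(wholeSpace d, ℂ)) :
    MemLp (φ : Space d → ℂ) 2 volume :=
  φ.continuous.memLp_of_hasCompactSupport φ.hasCompactSupport

theorem memLp_hamiltonianFun {d : ℕ} (ħ m : ℝ) (V : C(Space d, ℝ)) (φ : 𝓓(wholeSpace d, ℂ)) :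
    MemLp (hamiltonianFun ħ m V φ) 2 volume := by
  have hφ : ContDiff ℝ 2 (φ : Space d → ℂ) :=
    φ.contDiff.of_le (WithTop.coe_le_coe.2 le_top)
  have hΔ : Laplacian.laplacian (φ : Space d → ℂ) = fun x => ∑ i,
      iteratedFDeriv ℝ 2 (φ : Space d → ℂ) x
        ![stdOrthonormalBasis ℝ (Space d) i, stdOrthonormalBasis ℝ (Space d) i] :=
    InnerProductSpace.laplacian_eq_iteratedFDeriv_stdOrthonormalBasis _
  have hc : Continuous (Laplacian.laplacian (φ : Space d → ℂ)) := by
    rw [hΔ]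
    refine continuous_finsetSum _ fun i _ => ?_
    exact (ContinuousMultilinearMap.apply ℝ (fun _ : Fin 2 => Space d) ℂ
      ![stdOrthonormalBasis ℝ (Space d) i, stdOrthonormalBasis ℝ (Space d) i]).continuous.comp
      (hφ.continuous_iteratedFDeriv le_rfl)
  refine Continuous.memLp_of_hasCompactSupport ?_ ?_
  · unfold hamiltonianFun
    exact (continuous_const.mul hc).add
      ((Complex.continuous_ofReal.comp V.continuous).mul φ.continuous)
  · refine HasCompactSupport.intro φ.hasCompactSupport fun x hx => ?_
    have h1 : iteratedFDeriv ℝ 2 (φ : Space d → ℂ) x = 0 := by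
      by_contra h
      exact hx (support_iteratedFDeriv_subset 2 h)
    simp [hamiltonianFun, hΔ, h1, image_eq_zero_of_notMem_tsupport hx]

/-- A test function as an element of `L²(ℝ^d)`. -/
def testL2 {d : ℕ} (φ : 𝓓(wholeSpace d, ℂ)) : L2 d := (memLp_testFunction φ).toLp _

/-- The Hamilton operator applied to a test function, as an element of `L²(ℝ^d)`. -/
def hamiltonianL2 {d : ℕ} (ħ m : ℝ) (V : C(Space d, ℝ)) (φ : 𝓓(wholeSpace d, ℂ)) : L2 d :=
  (memLp_hamiltonianFun ħ m V φ).toLp _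

/-- `R` is a weak solution on `(-T, T)` of `iħ ∂ₜ R = [H, R]`, `H = -ħ²/(2m) Δ + V`: for all test
functions `φ, χ` on `ℝ^d`, the equation
`iħ d/dt ⟨φ, R(t) χ⟩ = ⟨H φ, R(t) χ⟩ - ⟨φ, R(t) H χ⟩` holds in the sense of distributions
on `(-T, T)`. -/
def IsWeakVonNeumannSolution {d : ℕ} (ħ m T : ℝ) (V : C(Space d, ℝ))
    (R : ℝ → L2 d →L[ℂ] L2 d) : Prop :=
  ∀ (φ χ : 𝓓(wholeSpace d, ℂ)) (θ : 𝓓(timeInterval T, ℂ)),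
    -(Complex.I * (ħ : ℂ)) * ∫ t : ℝ, deriv θ t * inner ℂ (testL2 φ) (R t (testL2 χ)) =
      ∫ t : ℝ, θ t *
        (inner ℂ (hamiltonianL2 ħ m V φ) (R t (testL2 χ)) -
          inner ℂ (testL2 φ) (R t (hamiltonianL2 ħ m V χ)))

/-! ### The Wigner transform -/

/-- `k ∈ L²(ℝ^d × ℝ^d)` is the integral kernel (density matrix) of the operator `A`. -/
structure IsIntegralKernel {d : ℕ} (A : L2 d →L[ℂ] L2 d) (k : Space d × Space d → ℂ) : Prop where
  memLp : MemLp k 2 volume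
  apply_eq : ∀ f : L2 d, (A f : Space d → ℂ) =ᵐ[volume] fun X => ∫ Y, k (X, Y) * f Y

/-- The density matrix in centre of mass and relative variables,
`(x, y) ↦ k(x + ħ y / 2, x - ħ y / 2)`. -/
def weylKernel {d : ℕ} (ħ : ℝ) (k : Space d × Space d → ℂ) : Space d × Space d → ℂ :=
  fun p => k (p.1 + (ħ / 2) • p.2, p.1 - (ħ / 2) • p.2)

/-- `W ∈ L²(ℝ^d × ℝ^d)` is the partial Fourier transform
`W(x, v) = ∫ exp(-i v · y) g(x, y) dy` of `g ∈ L²(ℝ^d × ℝ^d)`, in the sense of tempered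
distributions (the integral need not converge absolutely). -/
structure IsPartialFourier {d : ℕ} (g W : Space d × Space d → ℂ) : Prop where
  memLp : MemLp W 2 volume
  integral_eq : ∀ Φ : 𝓢(Space d × Space d, ℂ),
    ∫ p : Space d × Space d, W p * Φ p =
      ∫ p : Space d × Space d, g p *
        ∫ v : Space d, Complex.exp (-(Complex.I * ((inner ℝ v p.2 : ℝ) : ℂ))) * Φ (p.1, v)

/-- `W` is the Wigner transform of the operator `A`:
`W(x, v) = (2π)^{-d} ∫ exp(-i v · y) k(x + ħ y / 2, x - ħ y / 2) dy`, `k` the kernel of `A`. -/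
def IsWignerTransform {d : ℕ} (ħ : ℝ) (A : L2 d →L[ℂ] L2 d) (W : Space d × Space d → ℂ) : Prop :=
  ∃ k : Space d × Space d → ℂ, IsIntegralKernel A k ∧
    IsPartialFourier (fun p => (((2 * Real.pi) ^ d)⁻¹ : ℝ) * weylKernel ħ k p) W

/-- `w(t, x, v)` is (a jointly measurable representative of) the Wigner function of the
time dependent operator `R(t)`, `t ∈ (-T, T)`. It is unique almost everywhere. -/
structure IsWignerFunction {d : ℕ} (ħ T : ℝ) (R : ℝ → L2 d →L[ℂ] L2 d)
    (w : ℝ × Space d × Space d → ℂ) : Prop where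
  aestronglyMeasurable :
    AEStronglyMeasurable w (volume.restrict (Ioo (-T) T ×ˢ (univ : Set (Space d × Space d))))
  isWignerTransform :
    ∀ᵐ t ∂(volume.restrict (Ioo (-T) T)), IsWignerTransform ħ (R t) fun p => w (t, p)

/-- The velocity average `ρ_ψ[w](t, x) = ∫ w(t, x, v) ψ(v) dv`. -/
def velocityAverage {d : ℕ} (ψ : 𝓢(Space d, ℂ)) (w : ℝ × Space d × Space d → ℂ) :
    ℝ × Space d → ℂ :=
  fun z => ∫ v : Space d, w (z.1, z.2, v) * ψ v

/-! ### Fractional Sobolev norm -/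

/-- The Euclidean distance on space-time `ℝ × ℝ^d` (the product type carries the sup metric). -/
def spaceTimeDist {d : ℕ} (z z' : ℝ × Space d) : ℝ :=
  Real.sqrt ((z.1 - z'.1) ^ 2 + ‖z.2 - z'.2‖ ^ 2)

/-- The Sobolev-Slobodeckij norm of `H^s(Ω)`, `0 < s < 1`, for an open set `Ω ⊆ ℝ × ℝ^d`:
`(∫_Ω |u|² + ∫_Ω ∫_Ω |u(z) - u(z')|² / |z - z'|^{(d+1) + 2s})^{1/2}`, with values in `[0, ∞]`. -/
def sobolevNorm {d : ℕ} (s : ℝ) (Ω : Set (ℝ × Space d)) (u : ℝ × Space d → ℂ) : ℝ≥0∞ :=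
  ((∫⁻ z in Ω, ‖u z‖ₑ ^ 2) +
    ∫⁻ z in Ω, ∫⁻ z' in Ω,
      ‖u z - u z'‖ₑ ^ 2 /
        ENNReal.ofReal (spaceTimeDist z z' ^ ((d : ℝ) + 1 + 2 * s))) ^ (1 / 2 : ℝ)

end SemiclassicalAveraging

end

noncomputable section

namespace SemiclassicalAveraging

section

open Filter Topology

/-! ### Measurability of Hilbert space valued maps -/

/-! The proof is a velocity averaging argument carried out on the density matrix in relative
variables, where every bound is visibly independent of `ħ`.

Since `R(t)` is self-adjoint, `tr (R(t)²)` is its squared Hilbert-Schmidt norm, so it has a square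
integrable kernel. In the variables `X = x + ħy/2`, `Y = x - ħy/2` the Jacobian cancels the factor
`ħ^d` of the hypothesis, and the kernel `G(t, y, x)` has squared `L²` norm at most `C²(2π)^d`
(`exists_isRelKernel`). Let `h(t, y, ξ)` be its Fourier transform in `x`. The von Neumann equation
becomes `∂ₜh + β ξ·∂_y h = ⟨y⟩ K` with `β = 2π/m` and `⟨y⟩ = (1 + |y|²)^{1/2}`. Because `X - Y = ħy`
and `V` is Lipschitz, `(V(X) - V(Y))/ħ` is at most `L|y|`, so `K` is bounded in `L²` uniformly in
`ħ`; the factor `⟨y⟩` is the price of one velocity derivative on the source. The equation is only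
given against compactly supported test functions. It is reached through cut-off plane waves,
superposed into wave packets, with the cut-off removed by dominated convergence
(`packetPairing_transport`, `IsRelKernel.exists_transportPair`).

Up to `(2π)^{-d}`, the Fourier transform in `x` of the velocity average is `A(t, ξ) = ∫ h(t, y, ξ)
χ(y) dy` with `χ` the Fourier transform of `ψ`. Following characteristics from time `s` replaces
`χ(y)` by `χ(y - (s - t)βξ)`. For fixed `y` this profile sweeps past at speed `β|ξ|`, so its time
integral is `O(1/(1 + |ξ|))` (`exists_bound_time_integral`). Averaging in `s` over `|s - t| < δ(ξ) =
T(1 + |ξ|)^{-1/2}` balances the gain on the transported term against the source, whose weight `⟨y⟩`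
has size at most about `1 + δ|ξ|` along the characteristic. The outcome is `∫∫ (1 + |ξ|)^{1/2} |A|²
dξ dt ≤ C`, a quarter of a derivative in space (`exists_bound_sqrt_weight`).

For the time variable, the equation tested at rest bounds `∂ₜA` by `|ξ|` times the averages against
`v_j ψ`, plus a square integrable source. The space estimate applies to these averages too.
Splitting time increments at `|t - s| = 1/(1 + |ξ|)`, using the derivative below and the triangle
inequality above, yields a quarter of a derivative in time (`lintegral_time_increment_le`,
`exists_isAverageBound`). No cut-off or extension in time is needed.

Finally the space-time Slobodeckij integral is split into a time and a space increment, and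
Plancherel's theorem in `x` converts both into the Fourier side bounds (`exists_sobolevNorm_le`).
The identification of the velocity average with `A` is `IsWignerTransform.integral_mul_fourier`. -/

theorem countable_of_orthonormal {H : Type*} [NormedAddCommGroup H] [InnerProductSpace ℂ H]
    [SecondCountableTopology H] {ι : Type*} {v : ι → H} (hv : Orthonormal ℂ v) : Countable ι := by
  have hdist : ∀ i j, i ≠ j → 1 ≤ dist (v i) (v j) := by
    intro i j hij
    have h1 : ‖v i - v j‖ ^ 2 = 2 := by
      rw [@norm_sub_sq ℂ, hv.1 i, hv.1 j, hv.2 hij]; norm_num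
    rw [dist_eq_norm]
    nlinarith [norm_nonneg (v i - v j)]
  -- A separable space contains only countably many disjoint nonempty open sets.
  have hdisj : (univ : Set ι).PairwiseDisjoint fun i => Metric.ball (v i) (1 / 2) := by
    intro i _ j _ hij
    refine Metric.ball_disjoint_ball ?_
    have := hdist i j hij
    linarith
  have := hdisj.countable_of_isOpen (fun i _ => Metric.isOpen_ball)
    (fun i _ => ⟨v i, Metric.mem_ball_self (by norm_num)⟩)
  exact countable_univ_iff.1 this

/-- A weakly measurable map into a separable Hilbert space is strongly measurable. -/
theorem stronglyMeasurable_of_inner {T H : Type*} [MeasurableSpace T] [NormedAddCommGroup H]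
    [InnerProductSpace ℂ H] [CompleteSpace H] [SecondCountableTopology H] {F : T → H}
    (hF : ∀ f : H, Measurable fun t => inner ℂ f (F t)) : StronglyMeasurable F := by
  obtain ⟨w, b, -⟩ := exists_hilbertBasis ℂ H
  have : Countable w := countable_of_orthonormal b.orthonormal
  refine stronglyMeasurable_of_tendsto (f := fun (s : Finset w) t =>
    ∑ i ∈ s, b.repr (F t) i • b i) atTop (fun s => ?_) ?_
  · refine Finset.stronglyMeasurable_fun_sum _ fun i _ => ?_
    refine StronglyMeasurable.smul_const (f := fun t => b.repr (F t) i) ?_ (b i)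
    simp_rw [b.repr_apply_apply]
    exact (hF (b i)).stronglyMeasurable
  · rw [tendsto_pi_nhds]
    exact fun t => b.hasSum_repr (F t)

/-- A strongly measurable map into `L²(μ)` has a jointly measurable representative. -/
theorem exists_jointlyMeasurable {T P : Type*} [MeasurableSpace T] [MeasurableSpace P]
    {μ : Measure P} [SecondCountableTopology (Lp ℂ 2 μ)] {F : T → Lp ℂ 2 μ}
    (hF : StronglyMeasurable F) :
    ∃ f : T × P → ℂ, StronglyMeasurable f ∧ ∀ t, (fun p => f (t, p)) =ᵐ[μ] F t := by
  classical
  -- `F(t)` is approximated by an element of a countable dense set whose least admissible index is a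
  -- measurable function of `t`. As only countably many functions of `p` occur, the approximants are
  -- jointly measurable.
  let d : ℕ → Lp ℂ 2 μ := TopologicalSpace.denseSeq _
  have hd : ∀ n : ℕ, ∀ t, ∃ j, dist (F t) (d j) < (1 / 2 : ℝ) ^ (n + 2) := fun n t =>
    (TopologicalSpace.denseRange_denseSeq (Lp ℂ 2 μ)).exists_dist_lt (F t) (by positivity)
  let j : ℕ → T → ℕ := fun n t => Nat.find (hd n t)
  have hj : ∀ n t, dist (F t) (d (j n t)) < (1 / 2 : ℝ) ^ (n + 2) := fun n t =>
    Nat.find_spec (hd n t)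
  have hjm : ∀ n, Measurable (j n) := fun n => by
    refine measurable_find (hd n) fun k => ?_
    have : Measurable fun t => dist (F t) (d k) := (hF.dist stronglyMeasurable_const).measurable
    exact this measurableSet_Iio
  let f : ℕ → T × P → ℂ := fun n q => (d (j n q.1) : P → ℂ) q.2
  have hfm : ∀ n, StronglyMeasurable (f n) := fun n => by
    have h1 : Measurable fun q : ℕ × P => (d q.1 : P → ℂ) q.2 :=
      measurable_from_prod_countable_right fun i => (Lp.stronglyMeasurable (d i)).measurable
    exact (h1.comp (((hjm n).comp measurable_fst).prodMk measurable_snd)).stronglyMeasurable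
  have hfn : ∀ n t, eLpNorm (fun p => f n (t, p) - F t p) 2 μ ≤
      ENNReal.ofReal ((1 / 2 : ℝ) ^ (n + 2)) := fun n t => by
    have h1 : eLpNorm (fun p => f n (t, p) - F t p) 2 μ = edist (d (j n t)) (F t) := by
      rw [Lp.edist_def]; rfl
    rw [h1, edist_comm, edist_dist]
    exact ENNReal.ofReal_le_ofReal (hj n t).le
  -- The geometric rate makes the whole sequence converge almost everywhere, so its pointwise limit
  -- is a representative chosen without a subsequence depending on `t`.
  have hlim : ∀ t, ∀ᵐ p ∂μ, ∃ l, Tendsto (fun n => f n (t, p)) atTop (𝓝 l) := fun t => by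
    refine Lp.ae_tendsto_of_cauchy_eLpNorm (f := fun n p => f n (t, p)) (p := 2)
      (B := fun n => ENNReal.ofReal ((1 / 2 : ℝ) ^ n))
      (fun n => Lp.aestronglyMeasurable (d (j n t))) (by norm_num) ?_ ?_
    · rw [← ENNReal.ofReal_tsum_of_nonneg (fun n => by positivity) summable_geometric_two]
      exact ENNReal.ofReal_ne_top
    · intro N n m hn hm
      have e : (fun p => f n (t, p)) - (fun p => f m (t, p)) =
          (fun p => f n (t, p) - F t p) - (fun p => f m (t, p) - F t p) := by
        ext p; simp
      rw [e]
      refine (eLpNorm_sub_le ((Lp.aestronglyMeasurable (d (j n t))).sub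
        (Lp.aestronglyMeasurable _)) ((Lp.aestronglyMeasurable (d (j m t))).sub
        (Lp.aestronglyMeasurable _)) (by norm_num)).trans_lt ?_
      refine (add_le_add (hfn n t) (hfn m t)).trans_lt ?_
      rw [← ENNReal.ofReal_add (by positivity) (by positivity)]
      refine (ENNReal.ofReal_lt_ofReal_iff (by positivity)).2 ?_
      have h1 : (1 / 2 : ℝ) ^ (n + 2) ≤ (1 / 2 : ℝ) ^ (N + 2) :=
        pow_le_pow_of_le_one (by norm_num) (by norm_num) (by omega)
      have h2 : (1 / 2 : ℝ) ^ (m + 2) ≤ (1 / 2 : ℝ) ^ (N + 2) :=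
        pow_le_pow_of_le_one (by norm_num) (by norm_num) (by omega)
      have h3 : (1 / 2 : ℝ) ^ (N + 2) = (1 / 2 : ℝ) ^ N / 4 := by ring
      have h4 : (0 : ℝ) < (1 / 2 : ℝ) ^ N := by positivity
      linarith
  refine ⟨fun q => limUnder atTop fun n => f n q, StronglyMeasurable.limUnder hfm, fun t => ?_⟩
  have hm : TendstoInMeasure μ (fun n p => f n (t, p)) atTop (F t) := by
    refine tendstoInMeasure_of_tendsto_eLpNorm (p := 2) (by norm_num)
      (fun n => Lp.aestronglyMeasurable (d (j n t))) (Lp.aestronglyMeasurable _) ?_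
    refine tendsto_of_tendsto_of_tendsto_of_le_of_le tendsto_const_nhds
      (h := fun n => ENNReal.ofReal ((1 / 2 : ℝ) ^ (n + 2))) ?_ (fun _ => bot_le)
      (fun n => hfn n t)
    rw [← ENNReal.ofReal_zero]
    refine ENNReal.tendsto_ofReal ?_
    exact (tendsto_pow_atTop_nhds_zero_of_lt_one (by norm_num) (by norm_num)).comp
      (tendsto_add_atTop_nat 2)
  obtain ⟨ns, hns, hae⟩ := hm.exists_seq_tendsto_ae
  filter_upwards [hlim t, hae] with p hp hp'
  obtain ⟨l, hl⟩ := hp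
  rw [hl.limUnder_eq]
  exact tendsto_nhds_unique (hl.comp hns.tendsto_atTop) hp'

end

section

open Filter Topology

/-! ### Square integrable functions -/

section SquareIntegrable

variable {α : Type*} [MeasurableSpace α] {μ : Measure α}

theorem lintegral_mul_sq_le {f g : α → ℝ≥0∞} (hf : AEMeasurable f μ) (hg : AEMeasurable g μ) :
    (∫⁻ a, f a * g a ∂μ) ^ 2 ≤ (∫⁻ a, f a ^ 2 ∂μ) * ∫⁻ a, g a ^ 2 ∂μ := by
  have h := ENNReal.lintegral_mul_le_Lp_mul_Lq μ Real.HolderConjugate.two_two hf hg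
  have e : ∀ x : ℝ≥0∞, (x ^ (1 / 2 : ℝ)) ^ 2 = x := fun x => by
    rw [← ENNReal.rpow_natCast, ← ENNReal.rpow_mul]; norm_num
  calc (∫⁻ a, f a * g a ∂μ) ^ 2
      ≤ ((∫⁻ a, f a ^ (2 : ℝ) ∂μ) ^ (1 / 2 : ℝ) * (∫⁻ a, g a ^ (2 : ℝ) ∂μ) ^ (1 / 2 : ℝ)) ^ 2 := by
        gcongr; exact h
    _ = _ := by
        rw [mul_pow, e, e]
        simp only [ENNReal.rpow_ofNat]

theorem enorm_integral_mul_sq_le {f g : α → ℂ} (hf : AEStronglyMeasurable f μ)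
    (hg : AEStronglyMeasurable g μ) :
    ‖∫ a, f a * g a ∂μ‖ₑ ^ 2 ≤ (∫⁻ a, ‖f a‖ₑ ^ 2 ∂μ) * ∫⁻ a, ‖g a‖ₑ ^ 2 ∂μ := by
  refine le_trans ?_ (lintegral_mul_sq_le hf.enorm hg.enorm)
  gcongr
  refine (enorm_integral_le_lintegral_enorm _).trans (le_of_eq ?_)
  simp_rw [enorm_mul]

theorem eLpNorm_two_sq (f : α → ℂ) : eLpNorm f 2 μ ^ 2 = ∫⁻ a, ‖f a‖ₑ ^ 2 ∂μ := by
  rw [eLpNorm_eq_lintegral_rpow_enorm_toReal (by norm_num) (by norm_num)]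
  simp only [ENNReal.toReal_ofNat, ENNReal.rpow_ofNat]
  rw [← ENNReal.rpow_natCast, ← ENNReal.rpow_mul]; norm_num

theorem memLp_two_iff_lintegral {f : α → ℂ} (hf : AEStronglyMeasurable f μ) :
    MemLp f 2 μ ↔ ∫⁻ a, ‖f a‖ₑ ^ 2 ∂μ < ∞ := by
  rw [← eLpNorm_two_sq]
  simp [MemLp, hf]

theorem lintegral_sq_lt_top_of_memLp {f : α → ℂ} (hf : MemLp f 2 μ) :
    ∫⁻ a, ‖f a‖ₑ ^ 2 ∂μ < ∞ := (memLp_two_iff_lintegral hf.1).1 hf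

theorem enorm_toLp_sq {f : α → ℂ} (hf : MemLp f 2 μ) :
    ‖hf.toLp f‖ₑ ^ 2 = ∫⁻ a, ‖f a‖ₑ ^ 2 ∂μ := by
  rw [Lp.enorm_toLp, eLpNorm_two_sq]

theorem enorm_Lp_sq (f : Lp ℂ 2 μ) : ‖f‖ₑ ^ 2 = ∫⁻ a, ‖f a‖ₑ ^ 2 ∂μ := by
  rw [Lp.enorm_def, eLpNorm_two_sq]

theorem integrable_mul_of_memLp {f g : α → ℂ} (hf : MemLp f 2 μ) (hg : MemLp g 2 μ) :
    Integrable (fun a => f a * g a) μ := hf.integrable_mul hg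

theorem memLp_conj {f : α → ℂ} (hf : MemLp f 2 μ) : MemLp (fun x => starRingEnd ℂ (f x)) 2 μ :=
  hf.star

theorem inner_L2_eq (f g : Lp ℂ 2 μ) : inner ℂ f g = ∫ a, g a * starRingEnd ℂ (f a) ∂μ := by
  rw [L2.inner_def]; rfl

end SquareIntegrable

/-! ### Tensor products of square integrable functions -/

section Tensor

variable {α β : Type*} [MeasurableSpace α] [MeasurableSpace β] {μ : Measure α} {ν : Measure β}
  [SigmaFinite ν]

theorem lintegral_tensor_sq {f : α → ℂ} {g : β → ℂ} (hf : AEStronglyMeasurable f μ)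
    (hg : AEStronglyMeasurable g ν) :
    ∫⁻ p, ‖f p.1 * g p.2‖ₑ ^ 2 ∂(μ.prod ν) =
      (∫⁻ x, ‖f x‖ₑ ^ 2 ∂μ) * ∫⁻ y, ‖g y‖ₑ ^ 2 ∂ν := by
  rw [← lintegral_prod_mul (hf.enorm.pow_const 2) (hg.enorm.pow_const 2)]
  simp only [enorm_mul, mul_pow]

theorem memLp_tensor {f : α → ℂ} {g : β → ℂ} (hf : MemLp f 2 μ) (hg : MemLp g 2 ν) :
    MemLp (fun p : α × β => f p.1 * g p.2) 2 (μ.prod ν) := by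
  have hm : AEStronglyMeasurable (fun p : α × β => f p.1 * g p.2) (μ.prod ν) :=
    hf.1.comp_fst.mul hg.1.comp_snd
  rw [memLp_two_iff_lintegral hm, lintegral_tensor_sq hf.1 hg.1]
  exact ENNReal.mul_lt_top (lintegral_sq_lt_top_of_memLp hf) (lintegral_sq_lt_top_of_memLp hg)

/-- The map `f ↦ ((x, y) ↦ f(x) conj(g(y)))` on `L²`. -/
def tensorConj (g : Lp ℂ 2 ν) : Lp ℂ 2 μ →L[ℂ] Lp ℂ 2 (μ.prod ν) :=
  LinearMap.mkContinuous
    { toFun := fun f => (memLp_tensor (Lp.memLp f) (memLp_conj (Lp.memLp g))).toLp _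
      map_add' := fun f f' => by
        rw [← MemLp.toLp_add]
        refine (MemLp.toLp_eq_toLp_iff _ _).2 ?_
        filter_upwards [Measure.quasiMeasurePreserving_fst.ae_eq_comp (Lp.coeFn_add f f')] with p hp
        simp only [Function.comp, Pi.add_apply] at hp
        simp only [Pi.add_apply, hp, add_mul]
      map_smul' := fun c f => by
        rw [RingHom.id_apply, ← MemLp.toLp_const_smul]
        refine (MemLp.toLp_eq_toLp_iff _ _).2 ?_
        filter_upwards [Measure.quasiMeasurePreserving_fst.ae_eq_comp (Lp.coeFn_smul c f)] with p hp
        simp only [Function.comp, Pi.smul_apply] at hp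
        simp only [Pi.smul_apply, hp, smul_mul_assoc] } ‖g‖ fun f => by
    have h : ‖(memLp_tensor (Lp.memLp f) (memLp_conj (Lp.memLp g))).toLp _‖ₑ ^ 2 =
        (‖g‖ₑ * ‖f‖ₑ) ^ 2 := by
      rw [enorm_toLp_sq, lintegral_tensor_sq (Lp.aestronglyMeasurable f)
        (memLp_conj (Lp.memLp g)).1, mul_pow, enorm_Lp_sq, enorm_Lp_sq, mul_comm]
      simp
    have h' := (ENNReal.pow_right_strictMono two_ne_zero).injective h
    rw [← enorm_norm, ← enorm_norm g, ← enorm_norm f, ← enorm_mul] at h'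
    simpa using (congrArg ENNReal.toReal h').le

theorem tensorConj_apply (g : Lp ℂ 2 ν) (f : Lp ℂ 2 μ) :
    tensorConj g f =ᵐ[μ.prod ν] fun p => f p.1 * starRingEnd ℂ (g p.2) :=
  MemLp.coeFn_toLp (memLp_tensor (Lp.memLp f) (memLp_conj (Lp.memLp g)))

variable [SigmaFinite μ]

/-- When `k` is the kernel of an operator `A`, this is the matrix element `⟨f, A g⟩`. Operators and
kernels are compared below through such pairings. -/
theorem inner_tensorConj_left (g : Lp ℂ 2 ν) (f : Lp ℂ 2 μ) (k : Lp ℂ 2 (μ.prod ν)) :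
    inner ℂ (tensorConj g f) k = ∫ x, (∫ y, k (x, y) * g y ∂ν) * starRingEnd ℂ (f x) ∂μ := by
  rw [inner_L2_eq]
  have h1 : ∫ p, k p * starRingEnd ℂ (tensorConj g f p) ∂(μ.prod ν) =
      ∫ p, k p * (starRingEnd ℂ (f p.1) * g p.2) ∂(μ.prod ν) := by
    refine integral_congr_ae ?_
    filter_upwards [tensorConj_apply g f] with p hp
    rw [hp]; simp
  rw [h1, integral_prod]
  · refine integral_congr_ae (.of_forall fun x => ?_)
    simp only
    rw [← integral_mul_const]
    congr 1; ext y; ring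
  · exact integrable_mul_of_memLp (Lp.memLp k)
      (memLp_tensor (memLp_conj (Lp.memLp f)) (Lp.memLp g))

theorem inner_tensorConj (g g' : Lp ℂ 2 ν) (f f' : Lp ℂ 2 μ) :
    inner ℂ (tensorConj g f) (tensorConj g' f') = inner ℂ f f' * inner ℂ g' g := by
  rw [inner_L2_eq, inner_L2_eq, inner_L2_eq, ← integral_prod_mul]
  refine integral_congr_ae ?_
  filter_upwards [tensorConj_apply g f, tensorConj_apply g' f'] with p hp hp'
  rw [hp, hp']; simp; ring

end Tensor

end

section

open Filter Topology

/-! ### Integral kernels of Hilbert-Schmidt operators -/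

section Kernel

variable {d : ℕ} {w : Set (L2 d)}

/-- `L²(ℝ^d × ℝ^d; ℂ)`. -/
abbrev L2Prod (d : ℕ) : Type := Lp ℂ 2 (volume : Measure (Space d × Space d))

/-- The map `f ↦ ((x, y) ↦ f(x) conj(g(y)))`. -/
def tensorL2 (g : L2 d) : L2 d →L[ℂ] L2Prod d := tensorConj (μ := volume) (ν := volume) g

theorem inner_tensorL2_left (g f : L2 d) (k : L2Prod d) :
    inner ℂ (tensorL2 g f) k = ∫ x, (∫ y, k (x, y) * g y) * starRingEnd ℂ (f x) :=
  inner_tensorConj_left (μ := volume) (ν := volume) g f k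

theorem inner_tensorL2 (g g' f f' : L2 d) :
    inner ℂ (tensorL2 g f) (tensorL2 g' f') = inner ℂ f f' * inner ℂ g' g :=
  inner_tensorConj (μ := volume) (ν := volume) g g' f f'

/-- The kernel `∑ (A b_j)(x) conj(b_j(y))` of an operator `A`. -/
def hsKernel (b : HilbertBasis w ℂ (L2 d)) (A : L2 d →L[ℂ] L2 d) : L2Prod d :=
  ∑' j, tensorL2 (b j) (A (b j))

/-- The maps `f ↦ f ⊗ conj (b j)` are isometries with mutually orthogonal ranges, so the series is
orthogonal and converges once the squared norms are summable. -/
theorem summable_hsKernel (b : HilbertBasis w ℂ (L2 d)) {A : L2 d →L[ℂ] L2 d}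
    (hA : Summable fun j => ‖A (b j)‖ ^ 2) : Summable fun j => tensorL2 (b j) (A (b j)) := by
  have hb : ∀ j, ‖b j‖ = 1 := fun j => b.orthonormal.1 j
  have hiso : ∀ j (f : L2 d), ‖tensorL2 (b j) f‖ = ‖f‖ := fun j f => by
    have h : inner ℂ (tensorL2 (b j) f) (tensorL2 (b j) f) = inner ℂ f f := by
      rw [inner_tensorL2, inner_self_eq_norm_sq_to_K (b j), hb j]; simp
    rw [inner_self_eq_norm_sq_to_K, inner_self_eq_norm_sq_to_K] at h
    exact (sq_eq_sq₀ (norm_nonneg _) (norm_nonneg _)).1 (by exact_mod_cast h)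
  let V : ∀ _ : w, L2 d →ₗᵢ[ℂ] L2Prod d := fun j =>
    { toLinearMap := (tensorL2 (b j)).toLinearMap, norm_map' := hiso j }
  have hV : OrthogonalFamily ℂ (fun _ : w => L2 d) V := fun i j hij f g => by
    change inner ℂ (tensorL2 (b i) f) (tensorL2 (b j) g) = 0
    rw [inner_tensorL2, b.orthonormal.2 hij.symm, mul_zero]
  exact (hV.summable_iff_norm_sq_summable fun j => A (b j)).2 hA

theorem inner_tensorL2_hsKernel (b : HilbertBasis w ℂ (L2 d)) {A : L2 d →L[ℂ] L2 d}
    (hA : Summable fun j => ‖A (b j)‖ ^ 2) (f g : L2 d) :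
    inner ℂ (tensorL2 g f) (hsKernel b A) = inner ℂ f (A g) := by
  have h1 : HasSum (fun j => inner ℂ (tensorL2 g f) (tensorL2 (b j) (A (b j))))
      (inner ℂ (tensorL2 g f) (hsKernel b A)) :=
    (summable_hsKernel b hA).hasSum.mapL (innerSL ℂ (tensorL2 g f))
  have h2 : HasSum (fun j => inner ℂ f (A (b.repr g j • b j))) (inner ℂ f (A g)) :=
    ((b.hasSum_repr g).mapL A).mapL (innerSL ℂ f)
  refine h1.unique ?_
  convert h2 using 2 with j
  rw [inner_tensorL2, map_smul, inner_smul_right, b.repr_apply_apply, mul_comm]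

/-- The pairing of the kernel with its own `j`-th summand is the matrix element `⟨A (b j), A (b
j)⟩`; summing over `j` gives Parseval's identity. -/
theorem norm_sq_hsKernel (b : HilbertBasis w ℂ (L2 d)) {A : L2 d →L[ℂ] L2 d} {τ : ℝ}
    (hA : HasSum (fun j => ‖A (b j)‖ ^ 2) τ) : ‖hsKernel b A‖ ^ 2 = τ := by
  have h1 : HasSum (fun j => inner ℂ (hsKernel b A) (tensorL2 (b j) (A (b j))))
      (inner ℂ (hsKernel b A) (hsKernel b A)) :=
    (summable_hsKernel b hA.summable).hasSum.mapL (innerSL ℂ (hsKernel b A))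
  have h2 : ∀ j, inner ℂ (hsKernel b A) (tensorL2 (b j) (A (b j))) =
      ((‖A (b j)‖ ^ 2 : ℝ) : ℂ) := fun j => by
    rw [← inner_conj_symm, inner_tensorL2_hsKernel b hA.summable, inner_self_eq_norm_sq_to_K]
    simp
  simp_rw [h2] at h1
  have h3 := h1.unique (Complex.hasSum_ofReal.2 hA)
  rw [inner_self_eq_norm_sq_to_K] at h3
  exact Complex.ofReal_injective (by simpa using h3)

/-- Self-adjointness moves one factor of `A ∘ A` to the left of the inner product, which turns the
trace hypothesis into a Hilbert-Schmidt bound. -/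
theorem hasSum_norm_sq_of_hasTrace (b : HilbertBasis w ℂ (L2 d)) {A : L2 d →L[ℂ] L2 d} {τ : ℝ}
    (hA : A.IsPositive) (h : HasTrace (A ∘L A) (τ : ℂ)) :
    HasSum (fun j => ‖A (b j)‖ ^ 2) τ := by
  have h1 := h w b
  have h2 : ∀ j, inner ℂ (b j) ((A ∘L A) (b j)) = ((‖A (b j)‖ ^ 2 : ℝ) : ℂ) := fun j => by
    have := hA.isSelfAdjoint.isSymmetric (b j) (A (b j))
    simp only [ContinuousLinearMap.coe_coe] at this
    rw [ContinuousLinearMap.comp_apply, ← this, inner_self_eq_norm_sq_to_K]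
    simp
  simp_rw [h2] at h1
  exact Complex.hasSum_ofReal.1 h1

theorem stronglyMeasurable_hsKernel {T : Type*} [MeasurableSpace T]
    (b : HilbertBasis w ℂ (L2 d)) {A : T → L2 d →L[ℂ] L2 d}
    (hA : ∀ t, Summable fun j => ‖A t (b j)‖ ^ 2)
    (hm : ∀ f g : L2 d, Measurable fun t => inner ℂ f (A t g)) :
    StronglyMeasurable fun t => hsKernel b (A t) := by
  have : Fact ((2 : ℝ≥0∞) ≠ ∞) := ⟨by norm_num⟩
  have : Countable w := countable_of_orthonormal b.orthonormal
  refine stronglyMeasurable_of_tendsto (f := fun (s : Finset w) t =>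
    ∑ j ∈ s, tensorL2 (b j) (A t (b j))) atTop (fun s => ?_) ?_
  · refine Finset.stronglyMeasurable_fun_sum _ fun j _ => ?_
    exact (tensorL2 (b j)).continuous.comp_stronglyMeasurable
      (stronglyMeasurable_of_inner fun f => hm f (b j))
  · rw [tendsto_pi_nhds]
    exact fun t => (summable_hsKernel b (hA t)).hasSum

/-- For a square integrable kernel, `x ↦ ∫ k(x, y) g(y) dy` is square integrable. -/
theorem memLp_integral_kernel_mul {k : Space d × Space d → ℂ} (hk : MemLp k 2 volume)
    {g : Space d → ℂ} (hg : MemLp g 2 volume) :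
    MemLp (fun x => ∫ y, k (x, y) * g y) 2 volume := by
  have hm : AEStronglyMeasurable (fun p : Space d × Space d => k p * g p.2)
      (volume.prod volume) := hk.1.mul (hg.1.comp_snd (μ := volume))
  have hm' : AEStronglyMeasurable (fun x => ∫ y, k (x, y) * g y) volume := hm.integral_prod_right'
  refine (memLp_two_iff_lintegral hm').2 ?_
  have hk1 : AEStronglyMeasurable k (volume.prod volume) := hk.1
  calc ∫⁻ x, ‖∫ y, k (x, y) * g y‖ₑ ^ 2
      ≤ ∫⁻ x, (∫⁻ y, ‖k (x, y)‖ₑ ^ 2) * ∫⁻ y, ‖g y‖ₑ ^ 2 := by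
        refine lintegral_mono_ae ?_
        filter_upwards [hk1.prodMk_left] with x hx
        exact enorm_integral_mul_sq_le hx hg.1
    _ = (∫⁻ p, ‖k p‖ₑ ^ 2) * ∫⁻ y, ‖g y‖ₑ ^ 2 := by
        rw [lintegral_mul_const'' _ (hk1.enorm.pow_const 2).lintegral_prod_right',
          Measure.volume_eq_prod, lintegral_prod _ (hk1.enorm.pow_const 2)]
    _ < ∞ := ENNReal.mul_lt_top (lintegral_sq_lt_top_of_memLp hk) (lintegral_sq_lt_top_of_memLp hg)

/-- The matrix elements determine `A g` in `L²`, and `x ↦ ∫ k(x, y) g(y) dy` is square integrable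
with the same ones. -/
theorem isIntegralKernel_of_inner {A : L2 d →L[ℂ] L2 d} {k : Space d × Space d → ℂ}
    (hk : MemLp k 2 volume)
    (h : ∀ f g, inner ℂ (tensorL2 g f) (hk.toLp k) = inner ℂ f (A g)) :
    IsIntegralKernel A k := by
  refine ⟨hk, fun g => ?_⟩
  have hu := memLp_integral_kernel_mul hk (Lp.memLp g)
  have e : A g = hu.toLp _ := by
    refine ext_inner_left ℂ fun f => ?_
    rw [← h, inner_tensorL2_left, inner_L2_eq]
    have h1 : ∀ᵐ x, ∀ᵐ y, (hk.toLp k) (x, y) = k (x, y) :=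
      Measure.ae_ae_of_ae_prod (μ := volume) (ν := volume) hk.coeFn_toLp
    refine integral_congr_ae ?_
    filter_upwards [h1, hu.coeFn_toLp] with x hx hx'
    rw [hx']
    congr 1
    refine integral_congr_ae ?_
    filter_upwards [hx] with y hy
    rw [hy]
  rw [e]
  exact hu.coeFn_toLp

theorem ae_memLp_slice {k : Space d × Space d → ℂ} (hk : MemLp k 2 volume) :
    ∀ᵐ x, MemLp (fun y => k (x, y)) 2 volume := by
  have hk1 : AEStronglyMeasurable k (volume.prod volume) := hk.1
  have h2 := lintegral_sq_lt_top_of_memLp hk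
  rw [Measure.volume_eq_prod, lintegral_prod _ (hk1.enorm.pow_const 2)] at h2
  filter_upwards [hk1.prodMk_left,
    ae_lt_top' (hk1.enorm.pow_const 2).lintegral_prod_right' h2.ne] with x hx hx'
  exact (memLp_two_iff_lintegral hx).2 hx'

/-- The integral kernel is unique almost everywhere. -/
theorem IsIntegralKernel.ae_eq {A : L2 d →L[ℂ] L2 d} {k k' : Space d × Space d → ℂ}
    (hk : IsIntegralKernel A k) (hk' : IsIntegralKernel A k') : k =ᵐ[volume] k' := by
  have : Fact ((2 : ℝ≥0∞) ≠ ∞) := ⟨by norm_num⟩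
  -- A countable dense set of functions allows one exceptional null set of `x` for all of them; for
  -- the other `x` the difference of the two slices is orthogonal to a dense set.
  obtain ⟨s, hs, hsd⟩ := TopologicalSpace.exists_countable_dense (L2 d)
  have h1 : ∀ᵐ x, ∀ f ∈ s, ∫ y, k (x, y) * f y = ∫ y, k' (x, y) * f y := by
    rw [ae_ball_iff hs]
    intro f _
    filter_upwards [hk.apply_eq f, hk'.apply_eq f] with x hx hx'
    rw [← hx, ← hx']
  have h2 : ∀ᵐ x, ∀ᵐ y, k (x, y) = k' (x, y) := by
    filter_upwards [h1, ae_memLp_slice hk.memLp, ae_memLp_slice hk'.memLp] with x hx hkx hkx'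
    have hc := memLp_conj (hkx.sub hkx')
    have h0 : hc.toLp _ = 0 := by
      refine hsd.eq_zero_of_inner_left ℂ fun f hf => ?_
      rw [inner_L2_eq]
      have e : ∫ y, f y * starRingEnd ℂ (hc.toLp _ y) =
          ∫ y, (k (x, y) * f y - k' (x, y) * f y) := by
        refine integral_congr_ae ?_
        filter_upwards [hc.coeFn_toLp] with y hy
        rw [hy]
        simp only [Pi.sub_apply, RingHomCompTriple.comp_apply, RingHom.id_apply]
        ring
      rw [e, integral_sub (integrable_mul_of_memLp hkx (Lp.memLp f))
        (integrable_mul_of_memLp hkx' (Lp.memLp f)), hx f hf, sub_self]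
    filter_upwards [hc.coeFn_toLp, (Lp.eq_zero_iff_ae_eq_zero).1 h0] with y hy hy'
    rw [hy] at hy'
    exact (starRingEnd ℂ).injective (by simpa [sub_eq_zero] using hy')
  have hm : AEStronglyMeasurable (fun p => k p - k' p) (volume.prod volume) :=
    hk.memLp.1.sub hk'.memLp.1
  have h3 : ∫⁻ p, ‖k p - k' p‖ₑ ∂((volume : Measure (Space d)).prod volume) = 0 := by
    rw [lintegral_prod _ hm.enorm, lintegral_eq_zero_iff' hm.enorm.lintegral_prod_right']
    filter_upwards [h2] with x hx
    refine (lintegral_congr_ae (g := fun _ => 0) ?_).trans lintegral_zero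
    filter_upwards [hx] with y hy
    simp [hy]
  rw [lintegral_eq_zero_iff' hm.enorm] at h3
  filter_upwards [h3] with p hp
  simpa [sub_eq_zero] using hp

end Kernel

end

section

open Filter Topology
open scoped FourierTransform

/-! ### The partial Fourier transform on `L²` -/

section PartialFourier

variable {d : ℕ}

instance : (volume : Measure (Space d × Space d)).IsAddHaarMeasure :=
  inferInstanceAs ((volume : Measure (Space d)).prod volume).IsAddHaarMeasure

instance : (volume : Measure (Space d × Space d)).HasTemperateGrowth :=
  Measure.IsAddHaarMeasure.instHasTemperateGrowth

theorem hasTemperateGrowth_mk (x : Space d) :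
    Function.HasTemperateGrowth fun v : Space d => (x, v) := by
  have h : (fun v : Space d => (x, v)) =
      (fun _ : Space d => (x, (0 : Space d))) +
        (ContinuousLinearMap.inr ℝ (Space d) (Space d) : Space d → Space d × Space d) := by
    ext v <;> simp
  rw [h]
  exact (Function.HasTemperateGrowth.const _).add (ContinuousLinearMap.hasTemperateGrowth _)

/-- The slice `v ↦ Φ(x, v)`. -/
def slice (Φ : 𝓢(Space d × Space d, ℂ)) (x : Space d) : 𝓢(Space d, ℂ) :=
  SchwartzMap.compCLM ℂ (hasTemperateGrowth_mk x)
    ⟨1, 1, fun v => by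
      have : ‖v‖ ≤ ‖(x, v)‖ := norm_snd_le (x, v)
      linarith⟩ Φ

theorem slice_apply (Φ : 𝓢(Space d × Space d, ℂ)) (x v : Space d) : slice Φ x v = Φ (x, v) := rfl

/-- The partial Fourier transform `(x, y) ↦ ∫ exp(-2πi v · y) Φ(x, v) dv`. -/
def partialFourier (Φ : 𝓢(Space d × Space d, ℂ)) (p : Space d × Space d) : ℂ :=
  𝓕 (slice Φ p.1) p.2

theorem partialFourier_eq_integral (Φ : 𝓢(Space d × Space d, ℂ)) (p : Space d × Space d) :
    partialFourier Φ p =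
      ∫ v, Complex.exp (-(2 * Real.pi * inner ℝ v p.2 : ℝ) * Complex.I) * Φ (p.1, v) := by
  rw [partialFourier, SchwartzMap.fourier_coe, Real.fourier_eq']
  simp [slice_apply, mul_assoc]

theorem stronglyMeasurable_partialFourier (Φ : 𝓢(Space d × Space d, ℂ)) :
    StronglyMeasurable (partialFourier Φ) := by
  have h : partialFourier Φ = fun p => ∫ v,
      Complex.exp (-(2 * Real.pi * inner ℝ v p.2 : ℝ) * Complex.I) * Φ (p.1, v) :=
    funext (partialFourier_eq_integral Φ)
  rw [h]
  refine StronglyMeasurable.integral_prod_right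
    (f := fun (p : Space d × Space d) v =>
      Complex.exp (-(2 * Real.pi * inner ℝ v p.2 : ℝ) * Complex.I) * Φ (p.1, v)) ?_
  refine Continuous.stronglyMeasurable ?_
  have := Φ.continuous
  fun_prop

theorem lintegral_fourier_sq (f : 𝓢(Space d, ℂ)) :
    ∫⁻ x, ‖𝓕 f x‖ₑ ^ 2 = ∫⁻ x, ‖f x‖ₑ ^ 2 := by
  have h := SchwartzMap.norm_fourier_toL2_eq f
  have h' : ‖(𝓕 f).toLp 2‖ₑ = ‖f.toLp 2‖ₑ := by
    rw [← enorm_norm, h, enorm_norm]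
  have h2 := congrArg (· ^ 2) h'
  simp only [SchwartzMap.toLp] at h2
  rwa [enorm_toLp_sq, enorm_toLp_sq] at h2

/-- Plancherel's theorem on each slice, then Tonelli. -/
theorem lintegral_partialFourier_sq (Φ : 𝓢(Space d × Space d, ℂ)) :
    ∫⁻ p, ‖partialFourier Φ p‖ₑ ^ 2 = ∫⁻ p, ‖Φ p‖ₑ ^ 2 := by
  rw [Measure.volume_eq_prod,
    lintegral_prod _ ((stronglyMeasurable_partialFourier Φ).enorm.pow_const 2).aemeasurable,
    lintegral_prod _ (Φ.continuous.enorm.measurable.pow_const 2).aemeasurable]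
  exact lintegral_congr fun x => lintegral_fourier_sq (slice Φ x)

theorem memLp_partialFourier (Φ : 𝓢(Space d × Space d, ℂ)) : MemLp (partialFourier Φ) 2 volume := by
  rw [memLp_two_iff_lintegral (stronglyMeasurable_partialFourier Φ).aestronglyMeasurable,
    lintegral_partialFourier_sq]
  exact lintegral_sq_lt_top_of_memLp (Φ.memLp 2)

theorem slice_add (Φ Ψ : 𝓢(Space d × Space d, ℂ)) (x : Space d) :
    slice (Φ + Ψ) x = slice Φ x + slice Ψ x := by ext; rfl

theorem slice_smul (c : ℂ) (Φ : 𝓢(Space d × Space d, ℂ)) (x : Space d) :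
    slice (c • Φ) x = c • slice Φ x := by ext; rfl

/-- The partial Fourier transform as a map from Schwartz functions to `L²`. -/
def partialFourierLM : 𝓢(Space d × Space d, ℂ) →ₗ[ℂ] L2Prod d where
  toFun Φ := (memLp_partialFourier Φ).toLp _
  map_add' Φ Ψ := by
    rw [← MemLp.toLp_add]
    congr 1
    ext p
    simp only [partialFourier, Pi.add_apply, slice_add, FourierTransform.fourier_add]
    rfl
  map_smul' c Φ := by
    rw [RingHom.id_apply, ← MemLp.toLp_const_smul]
    congr 1
    ext p
    simp only [partialFourier, Pi.smul_apply, slice_smul, FourierTransform.fourier_smul]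
    rfl

theorem norm_partialFourierLM (Φ : 𝓢(Space d × Space d, ℂ)) :
    ‖partialFourierLM Φ‖ = ‖SchwartzMap.toLpCLM ℂ ℂ 2 volume Φ‖ := by
  have h : ‖(memLp_partialFourier Φ).toLp _‖ₑ ^ 2 = ‖(Φ.memLp 2).toLp _‖ₑ ^ 2 := by
    rw [enorm_toLp_sq, enorm_toLp_sq, lintegral_partialFourier_sq]
  have h' := (ENNReal.pow_right_strictMono two_ne_zero).injective h
  rw [← enorm_norm, ← enorm_norm (MemLp.toLp _ _)] at h'
  have h2 := congrArg ENNReal.toReal h'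
  rwa [toReal_enorm, toReal_enorm, norm_norm, norm_norm] at h2

/-- The partial Fourier transform on `L²(ℝ^d × ℝ^d)`. -/
def partialFourierL2 : L2Prod d →L[ℂ] L2Prod d :=
  partialFourierLM.extendOfNorm (SchwartzMap.toLpCLM ℂ ℂ 2 volume).toLinearMap

theorem denseRange_toL2Prod :
    DenseRange (SchwartzMap.toLpCLM ℂ (E := Space d × Space d) ℂ 2 volume).toLinearMap :=
  SchwartzMap.denseRange_toLpCLM ENNReal.ofNat_ne_top

theorem norm_partialFourierL2_le (g : L2Prod d) : ‖partialFourierL2 g‖ ≤ ‖g‖ := by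
  have := LinearMap.norm_extendOfNorm_apply_le (f := partialFourierLM (d := d))
    denseRange_toL2Prod 1
    (fun Φ => by rw [one_mul]; exact (norm_partialFourierLM Φ).le) g
  rwa [one_mul] at this

theorem integral_partialFourier_mul (Φ Ψ : 𝓢(Space d × Space d, ℂ)) :
    ∫ p, partialFourier Φ p * Ψ p = ∫ p, Φ p * partialFourier Ψ p := by
  rw [Measure.volume_eq_prod, integral_prod, integral_prod]
  · refine integral_congr_ae (.of_forall fun x => ?_)
    exact SchwartzMap.integral_fourier_mul_eq (slice Φ x) (slice Ψ x)
  · exact integrable_mul_of_memLp (Φ.memLp 2) (memLp_partialFourier Ψ)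
  · exact integrable_mul_of_memLp (memLp_partialFourier Φ) (Ψ.memLp 2)

theorem continuous_integral_mul {α : Type*} [MeasurableSpace α] {μ : Measure α} {f : α → ℂ}
    (hf : MemLp f 2 μ) : Continuous fun g : Lp ℂ 2 μ => ∫ a, g a * f a ∂μ := by
  have h : (fun g : Lp ℂ 2 μ => ∫ a, g a * f a ∂μ) =
      fun g => inner ℂ ((memLp_conj hf).toLp _) g := by
    ext g
    rw [inner_L2_eq]
    refine integral_congr_ae ?_
    filter_upwards [(memLp_conj hf).coeFn_toLp] with a ha
    rw [ha]; simp
  rw [h]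
  exact continuous_const.inner continuous_id

/-- The transposition identity for Schwartz functions extends by density, both sides being
continuous in `g`. Together with the norm bound it is all that is used of the extended transform. -/
theorem integral_partialFourierL2_mul (g : L2Prod d) (Φ : 𝓢(Space d × Space d, ℂ)) :
    ∫ p, partialFourierL2 g p * Φ p = ∫ p, g p * partialFourier Φ p := by
  refine denseRange_toL2Prod.induction_on
    (p := fun g => ∫ p, partialFourierL2 g p * Φ p = ∫ p, g p * partialFourier Φ p) g ?_ ?_
  · exact isClosed_eq ((continuous_integral_mul (Φ.memLp 2)).comp partialFourierL2.continuous)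
      (continuous_integral_mul (memLp_partialFourier Φ))
  · intro Ψ
    have h1 : partialFourierL2 ((SchwartzMap.toLpCLM ℂ (E := Space d × Space d) ℂ 2
        volume).toLinearMap Ψ) = partialFourierLM Ψ :=
      LinearMap.extendOfNorm_eq denseRange_toL2Prod
        ⟨1, fun Φ => by rw [one_mul]; exact (norm_partialFourierLM Φ).le⟩ Ψ
    rw [h1]
    refine Eq.trans ?_ ((integral_partialFourier_mul Ψ Φ).trans ?_)
    · refine integral_congr_ae ?_
      filter_upwards [(memLp_partialFourier Ψ).coeFn_toLp] with p hp
      rw [← hp]; rfl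
    · refine integral_congr_ae ?_
      filter_upwards [(Ψ.memLp 2).coeFn_toLp] with p hp
      rw [← hp]; rfl

end PartialFourier

end

section

open Filter Topology
open scoped FourierTransform

/-! ### Schwartz functions on a product -/

section SchwartzProduct

variable {d : ℕ}

theorem norm_iteratedFDeriv_comp_le {G : Type*} [NormedAddCommGroup G] [NormedSpace ℝ G]
    {f : Space d → ℂ} (hf : ContDiff ℝ ((⊤ : ℕ∞) : WithTop ℕ∞) f) (L : G →L[ℝ] Space d) (hL : ‖L‖ ≤ 1) (i : ℕ)
    (p : G) : ‖iteratedFDeriv ℝ i (fun q => f (L q)) p‖ ≤ ‖iteratedFDeriv ℝ i f (L p)‖ := by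
  have h : iteratedFDeriv ℝ i (fun q => f (L q)) p =
      (iteratedFDeriv ℝ i f (L p)).compContinuousLinearMap fun _ => L :=
    L.iteratedFDeriv_comp_right hf p (mod_cast le_top)
  rw [h]
  refine (ContinuousMultilinearMap.norm_compContinuousLinearMap_le _ _).trans ?_
  refine mul_le_of_le_one_right (norm_nonneg _) ?_
  exact Finset.prod_le_one (fun _ _ => norm_nonneg _) fun _ _ => hL

/-- The tensor product `(x, y) ↦ f(x) g(y)` of Schwartz functions. -/
def schwartzTensor (f g : 𝓢(Space d, ℂ)) : 𝓢(Space d × Space d, ℂ) where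
  toFun p := f p.1 * g p.2
  smooth' := ((f.smooth ⊤).comp contDiff_fst).mul ((g.smooth ⊤).comp contDiff_snd)
  decay' k n := by
    refine ⟨∑ i ∈ Finset.range (n + 1), (n.choose i : ℝ) *
      (SchwartzMap.seminorm ℝ k i f * SchwartzMap.seminorm ℝ 0 (n - i) g +
        SchwartzMap.seminorm ℝ 0 i f * SchwartzMap.seminorm ℝ k (n - i) g), fun p => ?_⟩
    have hf : ContDiff ℝ ((⊤ : ℕ∞) : WithTop ℕ∞) fun q : Space d × Space d => f q.1 :=
      (f.smooth ⊤).comp contDiff_fst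
    have hg : ContDiff ℝ ((⊤ : ℕ∞) : WithTop ℕ∞) fun q : Space d × Space d => g q.2 :=
      (g.smooth ⊤).comp contDiff_snd
    have h1 := norm_iteratedFDeriv_mul_le (n := n) hf hg p (mod_cast le_top)
    refine (mul_le_mul_of_nonneg_left h1 (by positivity)).trans ?_
    rw [Finset.mul_sum]
    refine Finset.sum_le_sum fun i _ => ?_
    have hfi := norm_iteratedFDeriv_comp_le (f.smooth ⊤)
      (ContinuousLinearMap.fst ℝ (Space d) (Space d)) (ContinuousLinearMap.norm_fst_le ..) i p
    have hgi := norm_iteratedFDeriv_comp_le (g.smooth ⊤)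
      (ContinuousLinearMap.snd ℝ (Space d) (Space d)) (ContinuousLinearMap.norm_snd_le ..) (n - i) p
    simp only [ContinuousLinearMap.coe_fst', ContinuousLinearMap.coe_snd'] at hfi hgi
    -- With the sup norm on the product, the polynomial weight falls on one factor at a time, so
    -- each Leibniz term is bounded by two products of seminorms.
    have hp : ‖p‖ ^ k ≤ ‖p.1‖ ^ k + ‖p.2‖ ^ k := by
      rw [Prod.norm_def]
      rcases max_choice ‖p.1‖ ‖p.2‖ with h | h <;> rw [h]
      · exact le_add_of_nonneg_right (by positivity)
      · exact le_add_of_nonneg_left (by positivity)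
    have f0 := f.le_seminorm ℝ 0 i p.1
    have g0 := g.le_seminorm ℝ 0 (n - i) p.2
    have fk := f.le_seminorm ℝ k i p.1
    have gk := g.le_seminorm ℝ k (n - i) p.2
    rw [pow_zero, one_mul] at f0 g0
    set a := ‖iteratedFDeriv ℝ i f p.1‖
    set b := ‖iteratedFDeriv ℝ (n - i) g p.2‖
    have ha : 0 ≤ a := norm_nonneg _
    have hb : 0 ≤ b := norm_nonneg _
    calc ‖p‖ ^ k * ((n.choose i : ℝ) * ‖iteratedFDeriv ℝ i (fun q => f q.1) p‖ *
          ‖iteratedFDeriv ℝ (n - i) (fun q => g q.2) p‖)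
        ≤ (‖p.1‖ ^ k + ‖p.2‖ ^ k) * ((n.choose i : ℝ) * a * b) := by gcongr
      _ = (n.choose i : ℝ) * (‖p.1‖ ^ k * a * b + a * (‖p.2‖ ^ k * b)) := by ring
      _ ≤ _ := by gcongr

theorem schwartzTensor_apply (f g : 𝓢(Space d, ℂ)) (p : Space d × Space d) :
    schwartzTensor f g p = f p.1 * g p.2 := rfl

/-- The shear `(y, ξ) ↦ (y - c ξ, ξ)`. -/
def shear (c : ℝ) : (Space d × Space d) ≃L[ℝ] (Space d × Space d) :=
  ContinuousLinearEquiv.equivOfInverse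
    (ContinuousLinearMap.prod (ContinuousLinearMap.fst ℝ (Space d) (Space d) -
      c • ContinuousLinearMap.snd ℝ (Space d) (Space d)) (ContinuousLinearMap.snd ℝ _ _))
    (ContinuousLinearMap.prod (ContinuousLinearMap.fst ℝ (Space d) (Space d) +
      c • ContinuousLinearMap.snd ℝ (Space d) (Space d)) (ContinuousLinearMap.snd ℝ _ _)) (fun p => by simp) (fun p => by simp)

/-- The test function `(y, ξ) ↦ χ(y - c ξ) η(ξ)`. -/
def shearedTest (χ η : 𝓢(Space d, ℂ)) (c : ℝ) : 𝓢(Space d × Space d, ℂ) :=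
  SchwartzMap.compCLMOfContinuousLinearEquiv ℂ (shear c) (schwartzTensor χ η)

theorem shearedTest_apply (χ η : 𝓢(Space d, ℂ)) (c : ℝ) (p : Space d × Space d) :
    shearedTest χ η c p = χ (p.1 - c • p.2) * η p.2 := rfl

/-- The weight `(1 + |y|²)^{1/2}`. -/
def japaneseBracket (y : Space d) : ℝ := (1 + ‖y‖ ^ 2) ^ (1 / 2 : ℝ)

theorem japaneseBracket_eq (y : Space d) : japaneseBracket y = Real.sqrt (1 + ‖y‖ ^ 2) := by
  rw [japaneseBracket, Real.sqrt_eq_rpow]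

theorem japaneseBracket_sq (y : Space d) : japaneseBracket y ^ 2 = 1 + ‖y‖ ^ 2 := by
  rw [japaneseBracket_eq, Real.sq_sqrt (by positivity)]

theorem japaneseBracket_pos (y : Space d) : 0 < japaneseBracket y := by
  rw [japaneseBracket_eq]; positivity

theorem continuous_japaneseBracket : Continuous (japaneseBracket (d := d)) := by
  have : japaneseBracket (d := d) = fun y => Real.sqrt (1 + ‖y‖ ^ 2) :=
    funext japaneseBracket_eq
  rw [this]; fun_prop

theorem norm_le_japaneseBracket (y : Space d) : ‖y‖ ≤ japaneseBracket y := by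
  have := japaneseBracket_sq y
  nlinarith [japaneseBracket_pos y, norm_nonneg y]

theorem hasTemperateGrowth_bracket_fst : Function.HasTemperateGrowth
    fun p : Space d × Space d => ((japaneseBracket p.1 : ℝ) : ℂ) :=
  Function.HasTemperateGrowth.comp Function.Complex.hasTemperateGrowth_ofReal
    ((Function.hasTemperateGrowth_one_add_norm_sq_rpow (Space d) (1 / 2)).comp
      (ContinuousLinearMap.hasTemperateGrowth (ContinuousLinearMap.fst ℝ (Space d) (Space d))))

/-- The test function `(y, ξ) ↦ (1 + |y|²)^{1/2} Φ(y, ξ)`. -/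
def bracketMul (Φ : 𝓢(Space d × Space d, ℂ)) : 𝓢(Space d × Space d, ℂ) :=
  SchwartzMap.smulLeftCLM ℂ (fun p : Space d × Space d => ((japaneseBracket p.1 : ℝ) : ℂ)) Φ

theorem bracketMul_apply (Φ : 𝓢(Space d × Space d, ℂ)) (p : Space d × Space d) :
    bracketMul Φ p = (japaneseBracket p.1 : ℂ) * Φ p := by
  rw [bracketMul, SchwartzMap.smulLeftCLM_apply_apply hasTemperateGrowth_bracket_fst, smul_eq_mul]

theorem hasTemperateGrowth_coord (j : Fin d) :
    Function.HasTemperateGrowth fun x : Space d => ((x j : ℝ) : ℂ) :=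
  Function.HasTemperateGrowth.comp Function.Complex.hasTemperateGrowth_ofReal
    (ContinuousLinearMap.hasTemperateGrowth (EuclideanSpace.proj (𝕜 := ℝ) j))

/-- The Schwartz function `x ↦ x_j f(x)`. -/
def coordMul (j : Fin d) (f : 𝓢(Space d, ℂ)) : 𝓢(Space d, ℂ) :=
  SchwartzMap.smulLeftCLM ℂ (fun x : Space d => ((x j : ℝ) : ℂ)) f

theorem coordMul_apply (j : Fin d) (f : 𝓢(Space d, ℂ)) (x : Space d) :
    coordMul j f x = (x j : ℂ) * f x := by
  rw [coordMul, SchwartzMap.smulLeftCLM_apply_apply (hasTemperateGrowth_coord j), smul_eq_mul]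

/-- The Schwartz function `z ↦ ∫ exp(-i v · z) ψ(v) dv`. -/
def angularFourier (ψ : 𝓢(Space d, ℂ)) : 𝓢(Space d, ℂ) :=
  SchwartzMap.compCLMOfContinuousLinearEquiv ℂ
    (ContinuousLinearEquiv.smulLeft (Units.mk0 ((2 * Real.pi)⁻¹ : ℝ) (by positivity))) (𝓕 ψ)

theorem angularFourier_apply (ψ : 𝓢(Space d, ℂ)) (z : Space d) :
    angularFourier ψ z = ∫ v, Complex.exp (-(inner ℝ v z : ℝ) * Complex.I) * ψ v := by
  have h : angularFourier ψ z = 𝓕 ψ ((2 * Real.pi)⁻¹ • z) := rfl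
  rw [h, SchwartzMap.fourier_coe, Real.fourier_eq']
  congr 1
  ext v
  rw [smul_eq_mul, inner_smul_right]
  congr 3
  push_cast
  field_simp

end SchwartzProduct

end

section

open Filter Topology
open scoped FourierTransform ContDiff

/-! ### Weak derivatives on an interval -/

section WeakDerivative

variable {T : ℝ}

/-- A smooth compactly supported function of mean zero on `(-T, T)` is the derivative of a test
function. -/
theorem exists_testFunction_deriv_eq (hT : 0 < T) {f : ℝ → ℂ} (hf : ContDiff ℝ ∞ f)
    (hfc : HasCompactSupport f) (hfs : tsupport f ⊆ Ioo (-T) T) (h0 : ∫ t, f t = 0) :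
    ∃ θ : 𝓓(timeInterval T, ℂ), ∀ t, deriv θ t = f t := by
  -- The point `0` is added only to have a nonempty compact set when `f` vanishes identically.
  set K := insert (0 : ℝ) (tsupport f)
  have hKc : IsCompact K := hfc.isCompact.insert 0
  have hKs : K ⊆ Ioo (-T) T := insert_subset ⟨by linarith, hT⟩ hfs
  have hne : K.Nonempty := ⟨0, mem_insert _ _⟩
  set a := sInf K
  set b := sSup K
  have ha : a ∈ Ioo (-T) T := hKs (hKc.sInf_mem hne)
  have hb : b ∈ Ioo (-T) T := hKs (hKc.sSup_mem hne)
  have hK : tsupport f ⊆ Icc a b := fun x hx =>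
    ⟨csInf_le hKc.bddBelow (mem_insert_of_mem _ hx), le_csSup hKc.bddAbove (mem_insert_of_mem _ hx)⟩
  have hfi : Integrable f := hf.continuous.integrable_of_hasCompactSupport hfc
  -- This primitive vanishes to the left of the support, and to the right of it because `f` has mean
  -- zero.
  let F : ℝ → ℂ := fun t => ∫ s in Iic t, f s
  have hFd : ∀ t, HasDerivAt F (f t) t := fun t => by
    have e : F = fun t => (∫ s in Iic (0 : ℝ), f s) + ∫ s in (0 : ℝ)..t, f s := by
      ext t
      rw [← intervalIntegral.integral_Iic_sub_Iic hfi.integrableOn hfi.integrableOn]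
      simp [F]
    rw [e]
    exact (hf.continuous.integral_hasStrictDerivAt 0 t).hasDerivAt.const_add _
  have hderiv : deriv F = f := funext fun t => (hFd t).deriv
  have hFz : ∀ t, t ∉ Icc a b → F t = 0 := fun t ht => by
    rcases lt_or_ge t a with h | h
    · refine setIntegral_eq_zero_of_forall_eq_zero fun s hs => ?_
      refine image_eq_zero_of_notMem_tsupport fun hs' => ?_
      exact absurd (hK hs').1 (not_le.2 (lt_of_le_of_lt hs h))
    · have hbt : b < t := by
        by_contra hc
        exact ht ⟨h, not_lt.1 hc⟩
      change ∫ s in Iic t, f s = 0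
      rw [← h0]
      refine setIntegral_eq_integral_of_forall_compl_eq_zero fun s hs => ?_
      refine image_eq_zero_of_notMem_tsupport fun hs' => ?_
      exact hs (le_trans (hK hs').2 hbt.le)
  have hts : tsupport F ⊆ Icc a b := by
    refine closure_minimal (fun t ht => ?_) isClosed_Icc
    by_contra h
    exact ht (hFz t h)
  refine ⟨⟨F, contDiff_infty_iff_deriv.2 ⟨fun t => (hFd t).differentiableAt, hderiv ▸ hf⟩,
    HasCompactSupport.intro isCompact_Icc fun t ht => hFz t ht,
    hts.trans (Icc_subset_Ioo ha.1 hb.2)⟩, fun t => congrFun hderiv t⟩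

/-- The lemma of du Bois-Reymond: `u` minus a primitive of `r` has vanishing distributional
derivative on `(-T, T)`, so it is constant there, and up to the endpoints by continuity. -/
theorem sub_eq_integral_of_weakDeriv_of_continuous (hT : 0 < T) {u r : ℝ → ℂ} (hu : Continuous u)
    (hr : Continuous r)
    (h : ∀ θ : 𝓓(timeInterval T, ℂ), ∫ t, deriv θ t * u t = -∫ t, θ t * r t) {s t : ℝ}
    (hs : s ∈ Icc (-T) T) (ht : t ∈ Icc (-T) T) : u t - u s = ∫ x in s..t, r x := by
  let G : ℝ → ℂ := fun t => ∫ x in (0 : ℝ)..t, r x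
  have hG : ∀ t, HasDerivAt G (r t) t := fun t => (hr.integral_hasStrictDerivAt 0 t).hasDerivAt
  have hGc : Continuous G := continuous_iff_continuousAt.2 fun t => (hG t).continuousAt
  let U : ℝ → ℂ := fun t => u t - G t
  have hUc : Continuous U := hu.sub hGc
  have hU : ∀ θ : 𝓓(timeInterval T, ℂ), ∫ t, deriv θ t * U t = 0 := fun θ => by
    have hθd : ∀ t, HasDerivAt θ (deriv θ t) t := fun t =>
      ((θ.contDiff.differentiable (by simp)) t).hasDerivAt
    have hθ'c : Continuous (deriv θ) := θ.contDiff.continuous_deriv (by simp)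
    have hs' : HasCompactSupport (deriv θ) := θ.hasCompactSupport.deriv
    have i1 : Integrable fun t => deriv θ t * u t :=
      (hθ'c.mul hu).integrable_of_hasCompactSupport hs'.mul_right
    have i2 : Integrable fun t => deriv θ t * G t :=
      (hθ'c.mul hGc).integrable_of_hasCompactSupport hs'.mul_right
    have i3 : Integrable fun t => θ t * r t :=
      (θ.continuous.mul hr).integrable_of_hasCompactSupport θ.hasCompactSupport.mul_right
    have i4 : Integrable fun t => θ t * G t :=
      (θ.continuous.mul hGc).integrable_of_hasCompactSupport θ.hasCompactSupport.mul_right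
    have hp := integral_mul_deriv_eq_deriv_mul_of_integrable (u := θ) (v := G)
      (fun x _ => hθd x) (fun x _ => hG x) i3 i2 i4
    simp only [U, mul_sub]
    rw [integral_sub i1 i2, h θ, hp, neg_neg, sub_self]
  -- Subtracting `(∫ g) b`, with `b` of integral one, makes an arbitrary `g` mean zero, hence the
  -- derivative of a test function; this exhibits `∫ b U` as the constant value.
  let β : ContDiffBump (0 : ℝ) := ⟨T / 4, T / 2, by positivity, by linarith⟩
  let b : ℝ → ℝ := β.normed volume
  have hbs : tsupport b ⊆ Ioo (-T) T := by
    rw [β.tsupport_normed_eq, Real.closedBall_eq_Icc]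
    have : β.rOut = T / 2 := rfl
    rw [this]
    exact Icc_subset_Ioo (by linarith) (by linarith)
  have hbc : HasCompactSupport b := β.hasCompactSupport_normed
  have hbd : ContDiff ℝ ∞ b := β.contDiff_normed
  have hb1 : ∫ t, b t = 1 := β.integral_normed
  set c : ℂ := ∫ t, b t • U t
  have hae : ∀ᵐ t, t ∈ Ioo (-T) T → U t - c = 0 := by
    refine isOpen_Ioo.ae_eq_zero_of_integral_contDiff_smul_eq_zero
      ((hUc.sub continuous_const).locallyIntegrable.locallyIntegrableOn _) fun g hg hgc hgs => ?_
    set m : ℝ := ∫ t, g t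
    have hgi : Integrable g := hg.continuous.integrable_of_hasCompactSupport hgc
    have hbi : Integrable b := hbd.continuous.integrable_of_hasCompactSupport hbc
    have hfd : ContDiff ℝ ∞ fun t => ((g t - m * b t : ℝ) : ℂ) :=
      Complex.ofRealCLM.contDiff.comp (hg.sub (contDiff_const.mul hbd))
    have hsub : tsupport (fun t => ((g t - m * b t : ℝ) : ℂ)) ⊆ tsupport g ∪ tsupport b := by
      refine closure_minimal (fun t ht => ?_)
        ((isClosed_tsupport g).union (isClosed_tsupport b))
      by_contra hc
      rw [mem_union, not_or] at hc
      refine ht ?_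
      simp [image_eq_zero_of_notMem_tsupport hc.1, image_eq_zero_of_notMem_tsupport hc.2]
    have hfc : HasCompactSupport fun t => ((g t - m * b t : ℝ) : ℂ) :=
      (hgc.isCompact.union hbc.isCompact).of_isClosed_subset (isClosed_tsupport _) hsub
    obtain ⟨θ, hθ⟩ := exists_testFunction_deriv_eq hT hfd hfc
      (hsub.trans (union_subset hgs hbs)) (by
        rw [integral_complex_ofReal, integral_sub hgi (hbi.const_mul m), integral_const_mul, hb1]
        simp [m])
    have h1 := hU θ
    simp_rw [hθ] at h1
    have igU : Integrable fun t => g t • U t :=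
      (hg.continuous.smul hUc).integrable_of_hasCompactSupport hgc.smul_right
    have ibU : Integrable fun t => b t • U t :=
      (hbd.continuous.smul hUc).integrable_of_hasCompactSupport hbc.smul_right
    have e1 : ∀ t, ((g t - m * b t : ℝ) : ℂ) * U t = g t • U t - m • (b t • U t) := fun t => by
      simp only [Complex.real_smul]; push_cast; ring
    simp_rw [e1] at h1
    have ibU' : Integrable fun t => m • (b t • U t) := ibU.smul m
    rw [integral_sub igU ibU', integral_smul] at h1
    have igc : Integrable fun t => g t • c := hgi.smul_const c
    simp_rw [smul_sub]
    rw [integral_sub igU igc, integral_smul_const]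
    exact h1
  have hIoo : ∀ t ∈ Ioo (-T) T, U t = c := by
    have h1 : EqOn U (fun _ => c) (Ioo (-T) T) := by
      refine Measure.eqOn_of_ae_eq (μ := volume) (?_ : U =ᵐ[volume.restrict (Ioo (-T) T)] _)
        hUc.continuousOn continuousOn_const (by rw [interior_Ioo]; exact subset_closure)
      rw [EventuallyEq, ae_restrict_iff' measurableSet_Ioo]
      filter_upwards [hae] with t ht htI
      exact sub_eq_zero.1 (ht htI)
    exact h1
  have hIcc : ∀ t ∈ Icc (-T) T, U t = c := by
    have h1 : EqOn U (fun _ => c) (closure (Ioo (-T) T)) :=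
      (EqOn.closure (fun t ht => hIoo t ht) hUc continuous_const)
    rwa [closure_Ioo (by linarith)] at h1
  have hd := (hIcc t ht).trans (hIcc s hs).symm
  have hGd : G t - G s = ∫ x in s..t, r x :=
    intervalIntegral.integral_interval_sub_left (hr.intervalIntegrable _ _)
      (hr.intervalIntegrable _ _)
  rw [← hGd]
  simp only [U] at hd
  linear_combination hd

/-- If `u' = r` weakly on `(-T, T)` with `u`, `r` continuous on `[-T, T]`, then the product rule
for `E u` holds in integrated form. -/
theorem mul_sub_mul_eq_integral_of_weakDeriv (hT : 0 < T) {u r : ℝ → ℂ}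
    (hu : ContinuousOn u (Icc (-T) T)) (hr : ContinuousOn r (Icc (-T) T))
    (h : ∀ θ : 𝓓(timeInterval T, ℂ), ∫ t, deriv θ t * u t = -∫ t, θ t * r t)
    {E E' : ℝ → ℂ} (hE : ∀ t, HasDerivAt E (E' t) t) (hE' : Continuous E') {s t : ℝ}
    (hs : s ∈ Icc (-T) T) (ht : t ∈ Icc (-T) T) :
    E t * u t - E s * u s = ∫ x in s..t, (E' x * u x + E x * r x) := by
  have hTT : -T ≤ T := by linarith
  -- The functions are continued by their endpoint values to all of `ℝ`; test functions supported in
  -- `(-T, T)` do not see the change.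
  let u' : ℝ → ℂ := IccExtend hTT ((Icc (-T) T).domRestrict u)
  let r' : ℝ → ℂ := IccExtend hTT ((Icc (-T) T).domRestrict r)
  have hu' : Continuous u' := (continuousOn_iff_continuous_domRestrict.1 hu).Icc_extend'
  have hr' : Continuous r' := (continuousOn_iff_continuous_domRestrict.1 hr).Icc_extend'
  have eu : ∀ x ∈ Icc (-T) T, u' x = u x := fun x hx => IccExtend_of_mem hTT _ hx
  have er : ∀ x ∈ Icc (-T) T, r' x = r x := fun x hx => IccExtend_of_mem hTT _ hx
  have hw : ∀ θ : 𝓓(timeInterval T, ℂ), ∫ t, deriv θ t * u' t = -∫ t, θ t * r' t := fun θ => by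
    have h0 : ∀ x, x ∉ Icc (-T) T → θ x = 0 := fun x hx =>
      image_eq_zero_of_notMem_tsupport fun hx' => hx (Ioo_subset_Icc_self (θ.tsupport_subset hx'))
    have h1 : ∀ x, x ∉ Icc (-T) T → deriv θ x = 0 := fun x hx =>
      image_eq_zero_of_notMem_tsupport fun hx' =>
        hx (Ioo_subset_Icc_self (θ.tsupport_subset (tsupport_deriv_subset hx')))
    have e1 : ∀ x, deriv θ x * u' x = deriv θ x * u x := fun x => by
      by_cases hx : x ∈ Icc (-T) T
      · rw [eu x hx]
      · rw [h1 x hx, zero_mul, zero_mul]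
    have e2 : ∀ x, θ x * r' x = θ x * r x := fun x => by
      by_cases hx : x ∈ Icc (-T) T
      · rw [er x hx]
      · rw [h0 x hx, zero_mul, zero_mul]
    simp_rw [e1, e2]
    exact h θ
  have hint : ∀ x ∈ Icc (-T) T, u' x = u' s + ∫ y in s..x, r' y := fun x hx => by
    rw [← sub_eq_integral_of_weakDeriv_of_continuous hT hu' hr' hw hs hx]; ring
  let v : ℝ → ℂ := fun x => u' s + ∫ y in s..x, r' y
  have hv : ∀ x, HasDerivAt v (r' x) x := fun x =>
    (hr'.integral_hasStrictDerivAt s x).hasDerivAt.const_add _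
  have hvc : Continuous v := continuous_iff_continuousAt.2 fun x => (hv x).continuousAt
  have hEc : Continuous E := continuous_iff_continuousAt.2 fun x => (hE x).continuousAt
  have hftc : ∫ x in s..t, (E' x * v x + E x * r' x) = E t * v t - E s * v s :=
    intervalIntegral.integral_eq_sub_of_hasDerivAt (fun x _ => (hE x).mul (hv x))
      (((hE'.mul hvc).add (hEc.mul hr')).intervalIntegrable _ _)
  have ev : ∀ x ∈ Icc (-T) T, v x = u x := fun x hx => by rw [← eu x hx, hint x hx]
  rw [ev t ht, ev s hs] at hftc
  rw [← hftc]
  refine intervalIntegral.integral_congr fun x hx => ?_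
  have hx' : x ∈ Icc (-T) T := uIcc_subset_Icc hs ht hx
  simp only [ev x hx', er x hx']

end WeakDerivative

end

section

open Filter Topology
open scoped FourierTransform ContDiff

/-! ### Cut-off plane waves -/

section Cutoff

variable {d : ℕ}

/-- The derivative in the direction of the `j`-th coordinate. -/
def coordDeriv {F : Type*} [NormedAddCommGroup F] [NormedSpace ℝ F] (j : Fin d)
    (f : Space d → F) (x : Space d) : F :=
  fderiv ℝ f x (EuclideanSpace.basisFun (Fin d) ℝ j)

/-- The plane wave `x ↦ exp(i p · x)`. -/
def planeWave (p x : Space d) : ℂ := Complex.exp ((inner ℝ p x : ℝ) * Complex.I)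

theorem contDiff_planeWave (p : Space d) : ContDiff ℝ ∞ (planeWave p) := by
  unfold planeWave
  have : ContDiff ℝ ∞ fun x : Space d => ((inner ℝ p x : ℝ) : ℂ) :=
    Complex.ofRealCLM.contDiff.comp (contDiff_const.inner ℝ contDiff_id)
  fun_prop

theorem contDiff_coordDeriv {F : Type*} [NormedAddCommGroup F] [NormedSpace ℝ F] (j : Fin d)
    {f : Space d → F} (hf : ContDiff ℝ ∞ f) : ContDiff ℝ ∞ (coordDeriv j f) := by
  have h1 : ContDiff ℝ ∞ (fderiv ℝ f) := hf.fderiv_right (by simp)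
  exact h1.clm_apply contDiff_const

theorem laplacian_eq_sum_coordDeriv {f : Space d → ℂ} (hf : ContDiff ℝ ∞ f) (x : Space d) :
    Laplacian.laplacian f x = ∑ j, coordDeriv j (coordDeriv j f) x := by
  rw [InnerProductSpace.laplacian_eq_iteratedFDeriv_orthonormalBasis f
    (EuclideanSpace.basisFun (Fin d) ℝ)]
  refine Finset.sum_congr rfl fun j _ => ?_
  have h1 : Differentiable ℝ (fderiv ℝ f) :=
    (hf.fderiv_right (m := ∞) (by simp)).differentiable (by simp)
  rw [iteratedFDeriv_two_apply]
  simp only [Matrix.cons_val_zero, Matrix.cons_val_one]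
  change _ = (fderiv ℝ (fun y => fderiv ℝ f y (EuclideanSpace.basisFun (Fin d) ℝ j)) x) _
  rw [fderiv_clm_apply (h1 x) (differentiableAt_const _)]
  simp

theorem coordDeriv_mul_planeWave (j : Fin d) (p : Space d) {a : Space d → ℂ}
    (ha : ContDiff ℝ ∞ a) :
    coordDeriv j (fun x => a x * planeWave p x) =
      fun x => (coordDeriv j a x + Complex.I * p j * a x) * planeWave p x := by
  ext x
  have h1 : HasFDerivAt a (fderiv ℝ a x) x := ((ha.differentiable (by simp)) x).hasFDerivAt
  have h2 : HasFDerivAt (fun x : Space d => inner ℝ p x) (innerSL ℝ p) x :=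
    (innerSL ℝ p).hasFDerivAt
  have h3 : HasFDerivAt (fun x : Space d => ((inner ℝ p x : ℝ) : ℂ))
      (Complex.ofRealCLM.comp (innerSL ℝ p)) x := Complex.ofRealCLM.hasFDerivAt.comp x h2
  have h4 := (h3.mul_const Complex.I).cexp
  have h5 := h1.mul h4
  have h6 := h5.fderiv
  simp only [coordDeriv]
  change (fderiv ℝ (a * fun x : Space d =>
    Complex.exp ((inner ℝ p x : ℝ) * Complex.I)) x) _ = _
  rw [h6]
  simp [planeWave, EuclideanSpace.inner_single_right]
  ring

theorem laplacian_mul_planeWave (p : Space d) {a : Space d → ℂ} (ha : ContDiff ℝ ∞ a)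
    (x : Space d) :
    Laplacian.laplacian (fun x => a x * planeWave p x) x =
      ((∑ j, coordDeriv j (coordDeriv j a) x) + 2 * Complex.I * (∑ j, p j * coordDeriv j a x) -
        (‖p‖ ^ 2 : ℝ) * a x) * planeWave p x := by
  rw [laplacian_eq_sum_coordDeriv (ha.mul (contDiff_planeWave p))]
  have h : ∀ j, coordDeriv j (coordDeriv j fun x => a x * planeWave p x) x =
      (coordDeriv j (coordDeriv j a) x + 2 * Complex.I * (p j * coordDeriv j a x) -
        ((p j : ℂ) ^ 2 * a x)) * planeWave p x := fun j => by
    have hb : ContDiff ℝ ∞ fun x => coordDeriv j a x + Complex.I * p j * a x :=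
      (contDiff_coordDeriv j ha).add (contDiff_const.mul ha)
    rw [coordDeriv_mul_planeWave j p ha, coordDeriv_mul_planeWave j p hb]
    have h1 : coordDeriv j (fun x => coordDeriv j a x + Complex.I * p j * a x) x =
        coordDeriv j (coordDeriv j a) x + Complex.I * p j * coordDeriv j a x := by
      simp only [coordDeriv]
      have i1 : DifferentiableAt ℝ (coordDeriv j a) x :=
        (contDiff_coordDeriv j ha).differentiable (by simp) x
      have i2 : DifferentiableAt ℝ a x := ha.differentiable (by simp) x
      change (fderiv ℝ (coordDeriv j a + fun y => Complex.I * p j * a y) x) _ = _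
      rw [fderiv_add i1 (i2.const_mul _), fderiv_const_mul i2]
      simp
    simp only [h1]
    linear_combination (p j : ℂ) ^ 2 * a x * planeWave p x * Complex.I_sq
  simp_rw [h]
  rw [← Finset.sum_mul, Finset.sum_sub_distrib, Finset.sum_add_distrib, ← Finset.mul_sum,
    ← Finset.sum_mul]
  congr 3
  rw [EuclideanSpace.norm_sq_eq]
  push_cast
  refine Finset.sum_congr rfl fun j _ => ?_
  rw [Real.norm_eq_abs, ← Complex.ofReal_pow, ← Complex.ofReal_pow, sq_abs]

/-- A smooth cut-off function, equal to `1` on the ball of radius `n + 1`. -/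
def cutoff (d n : ℕ) (x : Space d) : ℝ :=
  (⟨1, 2, one_pos, one_lt_two⟩ : ContDiffBump (0 : Space d)) ((1 / ((n : ℝ) + 1)) • x)

/-- The partial derivatives of the cut-off function. -/
def cutoffDeriv (n : ℕ) (j : Fin d) : Space d → ℝ := coordDeriv j (cutoff d n)

/-- The Laplacian of the cut-off function. -/
def cutoffLaplacian (d n : ℕ) (x : Space d) : ℝ := ∑ j, coordDeriv j (cutoffDeriv n j) x

theorem contDiff_cutoff (d n : ℕ) : ContDiff ℝ ∞ (cutoff d n) :=
  (ContDiffBump.contDiff _).comp (contDiff_const_smul _)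

theorem contDiff_cutoffDeriv (n : ℕ) (j : Fin d) : ContDiff ℝ ∞ (cutoffDeriv n j) :=
  contDiff_coordDeriv j (contDiff_cutoff d n)

theorem continuous_cutoffLaplacian (d n : ℕ) : Continuous (cutoffLaplacian d n) :=
  continuous_finsetSum _ fun j _ => (contDiff_coordDeriv j (contDiff_cutoffDeriv n j)).continuous

theorem hasCompactSupport_cutoff (d n : ℕ) : HasCompactSupport (cutoff d n) := by
  refine HasCompactSupport.comp_homeomorph
    (ContDiffBump.hasCompactSupport (⟨1, 2, one_pos, one_lt_two⟩ : ContDiffBump (0 : Space d)))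
    (Homeomorph.smulOfNeZero (1 / ((n : ℝ) + 1)) (by positivity))

theorem hasCompactSupport_coordDeriv {F : Type*} [NormedAddCommGroup F] [NormedSpace ℝ F]
    (j : Fin d) {f : Space d → F} (hf : HasCompactSupport f) :
    HasCompactSupport (coordDeriv j f) := hf.fderiv_apply ℝ _

theorem coordDeriv_comp_smul {F : Type*} [NormedAddCommGroup F] [NormedSpace ℝ F]
    (j : Fin d) (f : Space d → F) (c : ℝ) :
    coordDeriv j (fun x => f (c • x)) = fun x => c • coordDeriv j f (c • x) := by
  ext x
  simp only [coordDeriv]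
  rw [fderiv_comp_smul]
  rfl

theorem coordDeriv_ofReal (j : Fin d) {f : Space d → ℝ} (hf : ContDiff ℝ ∞ f) :
    coordDeriv j (fun x => (f x : ℂ)) = fun x => ((coordDeriv j f x : ℝ) : ℂ) := by
  ext x
  have h1 : HasFDerivAt f (fderiv ℝ f x) x := ((hf.differentiable (by simp)) x).hasFDerivAt
  have h2 : HasFDerivAt (fun x => (f x : ℂ)) (Complex.ofRealCLM.comp (fderiv ℝ f x)) x :=
    Complex.ofRealCLM.hasFDerivAt.comp x h1
  simp [coordDeriv, h2.fderiv]

theorem laplacian_cutoff_mul_planeWave (n : ℕ) (p x : Space d) :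
    Laplacian.laplacian (fun x => (cutoff d n x : ℂ) * planeWave p x) x =
      ((cutoffLaplacian d n x : ℂ) + 2 * Complex.I * (∑ j, p j * (cutoffDeriv n j x : ℂ)) -
        (‖p‖ ^ 2 : ℝ) * cutoff d n x) * planeWave p x := by
  have hc : ContDiff ℝ ∞ fun x => (cutoff d n x : ℂ) :=
    Complex.ofRealCLM.contDiff.comp (contDiff_cutoff d n)
  rw [laplacian_mul_planeWave p hc]
  simp_rw [coordDeriv_ofReal _ (contDiff_cutoff d n)]
  have h : ∀ j : Fin d, coordDeriv j (fun x => ((coordDeriv j (cutoff d n) x : ℝ) : ℂ)) =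
      fun x => ((coordDeriv j (cutoffDeriv n j) x : ℝ) : ℂ) := fun j =>
    coordDeriv_ofReal j (contDiff_cutoffDeriv n j)
  simp_rw [h]
  simp [cutoffLaplacian, cutoffDeriv]

/-- The cut-off is a fixed bump dilated by `n + 1`, so each derivative brings a factor `1/(n + 1)`.
The bounds uniform in `n` and the pointwise limits are what dominated convergence needs to pass from
cut-off to genuine plane waves. -/
theorem exists_bound_cutoff (d : ℕ) : ∃ M : ℝ, 0 ≤ M ∧ (∀ n x, |cutoff d n x| ≤ M) ∧
    (∀ n (j : Fin d) x, |cutoffDeriv n j x| ≤ M) ∧ (∀ n x, |cutoffLaplacian d n x| ≤ M) ∧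
    (∀ x, Tendsto (fun n => cutoff d n x) atTop (𝓝 1)) ∧
    (∀ (j : Fin d) x, Tendsto (fun n => cutoffDeriv n j x) atTop (𝓝 0)) ∧
    ∀ x, Tendsto (fun n => cutoffLaplacian d n x) atTop (𝓝 0) := by
  set β : ContDiffBump (0 : Space d) := ⟨1, 2, one_pos, one_lt_two⟩
  let c : ℕ → ℝ := fun n => 1 / ((n : ℝ) + 1)
  have hc0 : ∀ n, 0 ≤ c n := fun n => by positivity
  have hc1 : ∀ n, c n ≤ 1 := fun n => by
    have : (0 : ℝ) ≤ n := n.cast_nonneg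
    rw [div_le_one (by positivity)]; linarith
  have hct : Tendsto c atTop (𝓝 0) := tendsto_one_div_add_atTop_nhds_zero_nat
  have hβ : ContDiff ℝ ∞ (β : Space d → ℝ) := β.contDiff
  have hβc : HasCompactSupport (β : Space d → ℝ) := β.hasCompactSupport
  have e0 : ∀ n, cutoff d n = fun x => β (c n • x) := fun n => rfl
  have e1 : ∀ n (j : Fin d), cutoffDeriv n j = fun x => c n • coordDeriv j β (c n • x) :=
    fun n j => by rw [cutoffDeriv, e0, coordDeriv_comp_smul]
  have e2 : ∀ n x, cutoffLaplacian d n x =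
      c n * (c n * ∑ j, coordDeriv j (coordDeriv j β) (c n • x)) := fun n x => by
    rw [cutoffLaplacian, Finset.mul_sum, Finset.mul_sum]
    refine Finset.sum_congr rfl fun j _ => ?_
    have hd : Differentiable ℝ fun x : Space d => coordDeriv j β (c n • x) :=
      ((contDiff_coordDeriv j hβ).comp (contDiff_const_smul (c n))).differentiable (by simp)
    have e3 : coordDeriv j (fun x => c n • coordDeriv j β (c n • x)) x =
        c n • coordDeriv j (fun x => coordDeriv j β (c n • x)) x := by
      change fderiv ℝ (fun x => c n • coordDeriv j β (c n • x)) x _ = _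
      rw [fderiv_fun_const_smul (hd x)]
      rfl
    rw [e1, e3, coordDeriv_comp_smul]
    simp
  have hΔ : Continuous fun x => ∑ j, coordDeriv j (coordDeriv j (β : Space d → ℝ)) x :=
    continuous_finsetSum _ fun j _ =>
      (contDiff_coordDeriv j (contDiff_coordDeriv j hβ)).continuous
  have hΔc : HasCompactSupport fun x => ∑ j, coordDeriv j (coordDeriv j (β : Space d → ℝ)) x := by
    refine HasCompactSupport.intro hβc.isCompact fun x hx => Finset.sum_eq_zero fun j _ => ?_
    have h : tsupport (coordDeriv j (coordDeriv j (β : Space d → ℝ))) ⊆ tsupport β :=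
      (tsupport_fderiv_apply_subset ℝ _).trans (tsupport_fderiv_apply_subset ℝ _)
    exact image_eq_zero_of_notMem_tsupport fun hx' => hx (h hx')
  obtain ⟨M0, hM0⟩ := hβ.continuous.bounded_above_of_compact_support hβc
  obtain ⟨M2, hM2⟩ := hΔ.bounded_above_of_compact_support hΔc
  have h1 : ∀ j : Fin d, ∃ M1, ∀ x, ‖coordDeriv j (β : Space d → ℝ) x‖ ≤ M1 := fun j =>
    (contDiff_coordDeriv j hβ).continuous.bounded_above_of_compact_support
      (hasCompactSupport_coordDeriv j hβc)
  choose M1 hM1 using h1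
  have hM1' : ∀ j, 0 ≤ M1 j := fun j => (norm_nonneg _).trans (hM1 j 0)
  have hM0' : 0 ≤ M0 := (norm_nonneg _).trans (hM0 0)
  have hM2' : 0 ≤ M2 := (norm_nonneg _).trans (hM2 0)
  have hS : ∀ j, M1 j ≤ ∑ j, M1 j := fun j =>
    Finset.single_le_sum (fun j _ => hM1' j) (Finset.mem_univ j)
  have hS0 : 0 ≤ ∑ j, M1 j := Finset.sum_nonneg fun j _ => hM1' j
  have b1 : ∀ n (j : Fin d) x, |cutoffDeriv n j x| ≤ c n * M1 j := fun n j x => by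
    simp only [e1]
    rw [smul_eq_mul, abs_mul, abs_of_nonneg (hc0 n)]
    exact mul_le_mul_of_nonneg_left (hM1 j _) (hc0 n)
  have b2 : ∀ n x, |cutoffLaplacian d n x| ≤ c n * M2 := fun n x => by
    rw [e2, abs_mul, abs_mul, abs_of_nonneg (hc0 n)]
    refine mul_le_mul_of_nonneg_left ?_ (hc0 n)
    calc c n * |∑ j, coordDeriv j (coordDeriv j β) (c n • x)| ≤ 1 * M2 :=
          mul_le_mul (hc1 n) (hM2 _) (abs_nonneg _) zero_le_one
      _ = M2 := one_mul _
  refine ⟨M0 + ∑ j, M1 j + M2, by positivity, fun n x => ?_, fun n j x => ?_, fun n x => ?_,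
    fun x => ?_, fun j x => ?_, fun x => ?_⟩
  · rw [e0]
    have := hM0 (c n • x)
    rw [Real.norm_eq_abs] at this
    linarith
  · have := mul_le_of_le_one_left (hM1' j) (hc1 n)
    linarith [b1 n j x, hS j]
  · have := mul_le_of_le_one_left hM2' (hc1 n)
    linarith [b2 n x]
  · have h : Tendsto (fun n => c n • x) atTop (𝓝 0) := by simpa using hct.smul_const x
    have h' := (hβ.continuous.tendsto 0).comp h
    rwa [β.one_of_mem_closedBall (by simp [β])] at h'
  · refine squeeze_zero_norm (a := fun n => c n * M1 j) (fun n => b1 n j x) ?_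
    simpa using hct.mul_const (M1 j)
  · refine squeeze_zero_norm (a := fun n => c n * M2) (fun n => b2 n x) ?_
    simpa using hct.mul_const M2

/-- The cut-off plane wave as a test function. -/
def cutoffWave (n : ℕ) (p : Space d) : 𝓓(wholeSpace d, ℂ) where
  toFun x := (cutoff d n x : ℂ) * planeWave p x
  contDiff' := (Complex.ofRealCLM.contDiff.comp (contDiff_cutoff d n)).mul (contDiff_planeWave p)
  hasCompactSupport' :=
    ((hasCompactSupport_cutoff d n).comp_left (g := ((↑) : ℝ → ℂ)) Complex.ofReal_zero).mul_right
  tsupport_subset' := subset_univ _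

theorem cutoffWave_apply (n : ℕ) (p x : Space d) :
    cutoffWave n p x = (cutoff d n x : ℂ) * planeWave p x := rfl

theorem hamiltonianFun_cutoffWave (ħ m : ℝ) (V : C(Space d, ℝ)) (n : ℕ) (p x : Space d) :
    hamiltonianFun ħ m V (cutoffWave n p) x =
      ((V x * cutoff d n x : ℝ) - ((ħ ^ 2 / (2 * m) : ℝ) : ℂ) *
        ((cutoffLaplacian d n x : ℂ) + 2 * Complex.I * (∑ j, p j * (cutoffDeriv n j x : ℂ)) -
        (‖p‖ ^ 2 : ℝ) * cutoff d n x)) * planeWave p x := by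
  have h : ((cutoffWave n p : 𝓓(wholeSpace d, ℂ)) : Space d → ℂ) =
      fun x => (cutoff d n x : ℂ) * planeWave p x := rfl
  rw [hamiltonianFun, h, laplacian_cutoff_mul_planeWave]
  push_cast
  ring

end Cutoff

end

section

open Filter Topology
open scoped FourierTransform ContDiff

/-! ### Relative variables -/

section RelativeVariables

variable {d : ℕ}

/-- `(y, x) ↦ (x + ħ y / 2, x - ħ y / 2)`. -/
def relMap (ħ : ℝ) (q : Space d × Space d) : Space d × Space d :=
  (q.2 + (ħ / 2) • q.1, q.2 - (ħ / 2) • q.1)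

theorem continuous_relMap (ħ : ℝ) : Continuous (relMap (d := d) ħ) := by
  unfold relMap; fun_prop

/-- The relative variables as a homeomorphism. -/
def relHomeomorph {ħ : ℝ} (hħ : 0 < ħ) : (Space d × Space d) ≃ₜ (Space d × Space d) where
  toFun := relMap ħ
  invFun p := (ħ⁻¹ • (p.1 - p.2), (2⁻¹ : ℝ) • (p.1 + p.2))
  left_inv q := by
    ext1
    · simp only [relMap]
      rw [add_sub_sub_cancel, ← add_smul, add_halves, smul_smul, inv_mul_cancel₀ hħ.ne', one_smul]
    · simp only [relMap]
      rw [add_add_sub_cancel, ← two_smul ℝ q.2, smul_smul]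
      norm_num
  right_inv p := by
    have h : ħ / 2 * ħ⁻¹ = 2⁻¹ := by field_simp
    ext1
    · simp only [relMap]
      rw [smul_smul, h, ← smul_add, add_add_sub_cancel, ← two_smul ℝ p.1, smul_smul]
      norm_num
    · simp only [relMap]
      rw [smul_smul, h, ← smul_sub, add_sub_sub_cancel, ← two_smul ℝ p.2, smul_smul]
      norm_num
  continuous_toFun := continuous_relMap ħ
  continuous_invFun := by fun_prop

theorem measurableEmbedding_relMap {ħ : ℝ} (hħ : 0 < ħ) : MeasurableEmbedding (relMap (d := d) ħ) :=
  (relHomeomorph hħ).measurableEmbedding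

theorem lintegral_addHaar_comp_smul {E : Type*} [NormedAddCommGroup E] [NormedSpace ℝ E]
    [MeasurableSpace E] [BorelSpace E] [FiniteDimensional ℝ E] (μ : Measure E) [μ.IsAddHaarMeasure]
    {r : ℝ} (hr : 0 < r) {f : E → ℝ≥0∞} (hf : Measurable f) :
    ∫⁻ x, f (r • x) ∂μ = ENNReal.ofReal ((r ^ Module.finrank ℝ E)⁻¹) * ∫⁻ x, f x ∂μ := by
  have h := Measure.map_addHaar_smul μ hr.ne'
  rw [← lintegral_map (g := fun x : E => r • x) hf (measurable_const_smul r)]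
  rw [show Measure.map (fun x : E => r • x) μ = _ from h, lintegral_smul_measure, smul_eq_mul,
    abs_of_pos (by positivity)]

theorem lintegral_comp_smul {r : ℝ} (hr : 0 < r) {f : Space d → ℝ≥0∞} (hf : Measurable f) :
    ∫⁻ x, f (r • x) = ENNReal.ofReal ((r ^ d)⁻¹) * ∫⁻ x, f x := by
  rw [lintegral_addHaar_comp_smul volume hr hf, finrank_euclideanSpace, Fintype.card_fin]

/-- The factor `ħ^{-d}` is the one that compensates the `ħ^d` in the bound on `tr (R²)`. -/
theorem lintegral_comp_relMap {ħ : ℝ} (hħ : 0 < ħ) {F : Space d × Space d → ℝ≥0∞}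
    (hF : Measurable F) :
    ∫⁻ q, F (relMap ħ q) = ENNReal.ofReal ((ħ ^ d)⁻¹) * ∫⁻ p, F p := by
  have hm : Measurable fun q : Space d × Space d => F (q.2, q.2 - ħ • q.1) := by fun_prop
  rw [Measure.volume_eq_prod,
    lintegral_prod (fun q => F (relMap ħ q))
      (hF.comp (continuous_relMap ħ).measurable).aemeasurable]
  calc ∫⁻ y, ∫⁻ x, F (relMap ħ (y, x))
      = ∫⁻ y, ∫⁻ x, F (x, x - ħ • y) := by
        refine lintegral_congr fun y => ?_
        -- For fixed `y` the shift of `x` by `ħy/2` removes `y` from the first argument; what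
        -- remains is a dilation and a reflection in `y` at fixed `x`.
        rw [← lintegral_add_right_eq_self (fun x => F (x, x - ħ • y)) ((ħ / 2) • y)]
        refine lintegral_congr fun x => ?_
        have e : x + (ħ / 2) • y - ħ • y = x - (ħ / 2) • y := by
          rw [add_sub_assoc, ← sub_smul, sub_eq_add_neg x, ← neg_smul]
          congr 2
          ring
        rw [e, relMap]
    _ = ∫⁻ x, ∫⁻ y, F (x, x - ħ • y) := lintegral_lintegral_swap hm.aemeasurable
    _ = ∫⁻ x, ENNReal.ofReal ((ħ ^ d)⁻¹) * ∫⁻ z, F (x, z) := by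
        refine lintegral_congr fun x => ?_
        rw [lintegral_comp_smul hħ (f := fun y => F (x, x - y)) (by fun_prop),
          lintegral_sub_left_eq_self (fun z => F (x, z)) x]
    _ = _ := by
        rw [lintegral_const_mul _ hF.lintegral_prod_right', lintegral_prod _ hF.aemeasurable]

theorem map_relMap {ħ : ℝ} (hħ : 0 < ħ) :
    Measure.map (relMap (d := d) ħ) volume =
      ENNReal.ofReal ((ħ ^ d)⁻¹) • (volume : Measure (Space d × Space d)) := by
  refine Measure.ext_of_lintegral _ fun f hf => ?_
  rw [lintegral_map hf (continuous_relMap ħ).measurable, lintegral_comp_relMap hħ hf,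
    lintegral_smul_measure, smul_eq_mul]

theorem quasiMeasurePreserving_relMap {ħ : ℝ} (hħ : 0 < ħ) :
    Measure.QuasiMeasurePreserving (relMap (d := d) ħ) volume volume :=
  ⟨(continuous_relMap ħ).measurable, by
    rw [map_relMap hħ]; exact Measure.smul_absolutelyContinuous⟩

theorem integral_comp_relMap {ħ : ℝ} (hħ : 0 < ħ) (F : Space d × Space d → ℂ) :
    ∫ q, F (relMap ħ q) = ((ħ ^ d)⁻¹ : ℝ) * ∫ p, F p := by
  rw [← (measurableEmbedding_relMap hħ).integral_map, map_relMap hħ, integral_smul_measure,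
    ENNReal.toReal_ofReal (by positivity), Complex.real_smul]

theorem lintegral_sq_comp_relMap {ħ : ℝ} (hħ : 0 < ħ) {k : Space d × Space d → ℂ} :
    ∫⁻ q, ‖k (relMap ħ q)‖ₑ ^ 2 = ENNReal.ofReal ((ħ ^ d)⁻¹) * ∫⁻ p, ‖k p‖ₑ ^ 2 := by
  rw [← (measurableEmbedding_relMap hħ).lintegral_map (fun p => ‖k p‖ₑ ^ 2), map_relMap hħ,
    lintegral_smul_measure, smul_eq_mul]

theorem memLp_comp_relMap {ħ : ℝ} (hħ : 0 < ħ) {k : Space d × Space d → ℂ}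
    (hk : MemLp k 2 volume) : MemLp (fun q => k (relMap ħ q)) 2 volume := by
  have hm : AEStronglyMeasurable (fun q => k (relMap ħ q)) volume :=
    hk.1.comp_quasiMeasurePreserving (quasiMeasurePreserving_relMap hħ)
  rw [memLp_two_iff_lintegral hm, lintegral_sq_comp_relMap hħ]
  exact ENNReal.mul_lt_top ENNReal.ofReal_lt_top (lintegral_sq_lt_top_of_memLp hk)

end RelativeVariables

end

section

open Filter Topology
open scoped FourierTransform ContDiff

/-! ### The von Neumann equation for plane waves -/

section PlaneWaves

variable {d : ℕ}

/-- `G(t, y, x)` is a jointly measurable representative of the density matrices of `R(t)` in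
relative variables, `t ∈ [-T, T]`, bounded in `L²`. -/
structure IsRelKernel (ħ T : ℝ) (R : ℝ → L2 d →L[ℂ] L2 d) (G : ℝ × Space d × Space d → ℂ)
    (M : ℝ≥0) : Prop where
  stronglyMeasurable : StronglyMeasurable G
  exists_kernel : ∀ t ∈ Icc (-T) T, ∃ k, IsIntegralKernel (R t) k ∧
    (fun q => G (t, q)) =ᵐ[volume] fun q => k (relMap ħ q)
  lintegral_sq_le : ∀ t, ∫⁻ q, ‖G (t, q)‖ₑ ^ 2 ≤ M

theorem IsRelKernel.memLp {ħ T : ℝ} {R : ℝ → L2 d →L[ℂ] L2 d} {G : ℝ × Space d × Space d → ℂ}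
    {M : ℝ≥0} (hG : IsRelKernel ħ T R G M) (t : ℝ) : MemLp (fun q => G (t, q)) 2 volume :=
  (memLp_two_iff_lintegral
    (hG.stronglyMeasurable.comp_measurable measurable_prodMk_left).aestronglyMeasurable).2
    ((hG.lintegral_sq_le t).trans_lt ENNReal.coe_lt_top)

theorem inner_eq_integral_kernel {A : L2 d →L[ℂ] L2 d} {k : Space d × Space d → ℂ}
    (hk : IsIntegralKernel A k) {f g : Space d → ℂ} (hf : MemLp f 2 volume)
    (hg : MemLp g 2 volume) :
    inner ℂ (hf.toLp f) (A (hg.toLp g)) = ∫ p, k p * (starRingEnd ℂ (f p.1) * g p.2) := by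
  rw [inner_L2_eq, Measure.volume_eq_prod, integral_prod]
  · refine integral_congr_ae ?_
    filter_upwards [hk.apply_eq (hg.toLp g), hf.coeFn_toLp] with x hx hx'
    rw [hx, hx', ← integral_mul_const]
    refine integral_congr_ae ?_
    filter_upwards [hg.coeFn_toLp] with y hy
    rw [hy]; ring
  · exact integrable_mul_of_memLp hk.memLp (memLp_tensor (memLp_conj hf) hg)

theorem IsRelKernel.inner_eq {ħ T : ℝ} (hħ : 0 < ħ) {R : ℝ → L2 d →L[ℂ] L2 d}
    {G : ℝ × Space d × Space d → ℂ} {M : ℝ≥0} (hG : IsRelKernel ħ T R G M) {t : ℝ}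
    (ht : t ∈ Icc (-T) T) {f g : Space d → ℂ} (hf : MemLp f 2 volume) (hg : MemLp g 2 volume) :
    inner ℂ (hf.toLp f) (R t (hg.toLp g)) = ((ħ ^ d : ℝ) : ℂ) *
      ∫ q, G (t, q) * (starRingEnd ℂ (f (relMap ħ q).1) * g (relMap ħ q).2) := by
  obtain ⟨k, hk, hGk⟩ := hG.exists_kernel t ht
  rw [inner_eq_integral_kernel hk hf hg]
  have h := integral_comp_relMap hħ fun p => k p * (starRingEnd ℂ (f p.1) * g p.2)
  have e : ∫ q, G (t, q) * (starRingEnd ℂ (f (relMap ħ q).1) * g (relMap ħ q).2) =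
      ∫ q, k (relMap ħ q) * (starRingEnd ℂ (f (relMap ħ q).1) * g (relMap ħ q).2) := by
    refine integral_congr_ae ?_
    filter_upwards [hGk] with q hq
    rw [hq]
  rw [e, h, ← mul_assoc, ← Complex.ofReal_mul, mul_inv_cancel₀ (by positivity)]
  simp

/-- The character `(y, x) ↦ exp(-i (2π ξ · x + v · y))`. -/
def relPhase (ξ v : Space d) (q : Space d × Space d) : ℂ :=
  Complex.exp (-(2 * Real.pi * inner ℝ ξ q.2 + inner ℝ v q.1 : ℝ) * Complex.I)

/-- The momenta `πξ + v/ħ` and `v/ħ - πξ` are chosen so that the two plane waves in `X` and `Y`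
combine to the character of frequency `2πξ` in `x` and `v` in `y`. -/
theorem conj_planeWave_mul_planeWave {ħ : ℝ} (hħ : 0 < ħ) (ξ v : Space d) (q : Space d × Space d) :
    starRingEnd ℂ (planeWave (Real.pi • ξ + ħ⁻¹ • v) (relMap ħ q).1) *
      planeWave (ħ⁻¹ • v - Real.pi • ξ) (relMap ħ q).2 = relPhase ξ v q := by
  rw [planeWave, planeWave, relPhase, ← Complex.exp_conj, ← Complex.exp_add]
  congr 1
  simp only [map_mul, Complex.conj_ofReal, Complex.conj_I, relMap, inner_add_left, inner_add_right,
    inner_sub_left, inner_sub_right, real_inner_smul_left, real_inner_smul_right]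
  push_cast
  have : (ħ : ℂ) ≠ 0 := by exact_mod_cast hħ.ne'
  field_simp
  ring

/-- Multiplied by `ħ/(2m)`, this difference of kinetic energies becomes `(2π/m) ξ·v`: the symbol of
free transport, in which `ħ` has cancelled. -/
theorem norm_sq_sub_norm_sq {ħ : ℝ} (hħ : 0 < ħ) (ξ v : Space d) :
    ‖Real.pi • ξ + ħ⁻¹ • v‖ ^ 2 - ‖ħ⁻¹ • v - Real.pi • ξ‖ ^ 2 =
      4 * Real.pi / ħ * inner ℝ ξ v := by
  rw [@norm_add_sq_real, @norm_sub_sq_real]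
  simp only [real_inner_smul_left, real_inner_smul_right, real_inner_comm ξ v]
  field_simp
  ring

/-- The product `κ(X) κ(Y)` of two cut-offs. -/
def cutoffProd (ħ : ℝ) (n : ℕ) (q : Space d × Space d) : ℂ :=
  ((cutoff d n (relMap ħ q).1 * cutoff d n (relMap ħ q).2 : ℝ) : ℂ)

/-- The contribution of the potential, up to a cut-off error. -/
def cutoffPotential (ħ m : ℝ) (V : C(Space d, ℝ)) (n : ℕ) (q : Space d × Space d) : ℂ :=
  Complex.I * ((-ħ⁻¹ * (V (relMap ħ q).1 - V (relMap ħ q).2) *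
      (cutoff d n (relMap ħ q).1 * cutoff d n (relMap ħ q).2) +
    ħ / (2 * m) * (cutoffLaplacian d n (relMap ħ q).1 * cutoff d n (relMap ħ q).2 -
      cutoff d n (relMap ħ q).1 * cutoffLaplacian d n (relMap ħ q).2) : ℝ) : ℂ)

/-- The first order cut-off error multiplying `ξ_j`. -/
def cutoffErrorPos (ħ m : ℝ) (n : ℕ) (j : Fin d) (q : Space d × Space d) : ℂ :=
  ((ħ * Real.pi / m * (cutoffDeriv n j (relMap ħ q).1 * cutoff d n (relMap ħ q).2 -
    cutoff d n (relMap ħ q).1 * cutoffDeriv n j (relMap ħ q).2) : ℝ) : ℂ)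

/-- The first order cut-off error multiplying `v_j`. -/
def cutoffErrorVel (ħ m : ℝ) (n : ℕ) (j : Fin d) (q : Space d × Space d) : ℂ :=
  ((m⁻¹ * (cutoffDeriv n j (relMap ħ q).1 * cutoff d n (relMap ħ q).2 +
    cutoff d n (relMap ħ q).1 * cutoffDeriv n j (relMap ħ q).2) : ℝ) : ℂ)

/-- Where no derivative falls on a cut-off, the two kinetic terms leave the transport symbol and the
potential leaves `(iħ)⁻¹(V(X) - V(Y))`. All other terms carry a derivative of a cut-off and
disappear in the limit; they are sorted by their factor `ξ_j` or `v_j`, to be absorbed by test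
functions later. -/
theorem commutator_cutoffWave {ħ m : ℝ} (hħ : 0 < ħ) (hm : 0 < m) (V : C(Space d, ℝ)) (n : ℕ)
    (ξ v : Space d) (q : Space d × Space d) :
    (Complex.I * ħ)⁻¹ *
      (starRingEnd ℂ (hamiltonianFun ħ m V (cutoffWave n (Real.pi • ξ + ħ⁻¹ • v)) (relMap ħ q).1) *
        cutoffWave n (ħ⁻¹ • v - Real.pi • ξ) (relMap ħ q).2 -
      starRingEnd ℂ (cutoffWave n (Real.pi • ξ + ħ⁻¹ • v) (relMap ħ q).1) *
        hamiltonianFun ħ m V (cutoffWave n (ħ⁻¹ • v - Real.pi • ξ)) (relMap ħ q).2) =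
    (-Complex.I * (2 * Real.pi / m : ℝ) * (inner ℝ ξ v : ℝ) * cutoffProd ħ n q +
      cutoffPotential ħ m V n q + (∑ j, ξ j * cutoffErrorPos ħ m n j q) +
      ∑ j, v j * cutoffErrorVel ħ m n j q) * relPhase ξ v q := by
  rw [← conj_planeWave_mul_planeWave hħ, hamiltonianFun_cutoffWave, hamiltonianFun_cutoffWave,
    cutoffWave_apply, cutoffWave_apply]
  simp only [map_mul, map_sub, map_add, Complex.conj_ofReal, Complex.conj_I, map_sum, map_ofNat]
  set X := (relMap ħ q).1
  set Y := (relMap ħ q).2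
  set P := Real.pi • ξ + ħ⁻¹ • v
  set Q := ħ⁻¹ • v - Real.pi • ξ
  have hsq : (((‖P‖ ^ 2 : ℝ)) : ℂ) = (‖Q‖ ^ 2 : ℝ) + (4 * Real.pi / ħ * inner ℝ ξ v : ℝ) := by
    rw [← norm_sq_sub_norm_sq hħ ξ v]; push_cast; ring
  rw [hsq]
  -- The first order errors arise naturally with the momenta `P` and `Q`; rewriting these through
  -- `ξ` and `v` redistributes them.
  have hE : (∑ j, (ξ j : ℂ) * cutoffErrorPos ħ m n j q) + ∑ j, (v j : ℂ) * cutoffErrorVel ħ m n j q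
      = (ħ / m : ℝ) * ((∑ j, (P j : ℂ) * (cutoffDeriv n j X : ℂ)) * cutoff d n Y +
        cutoff d n X * ∑ j, (Q j : ℂ) * (cutoffDeriv n j Y : ℂ)) := by
    rw [← Finset.sum_add_distrib, Finset.sum_mul, Finset.mul_sum, ← Finset.sum_add_distrib,
      Finset.mul_sum]
    refine Finset.sum_congr rfl fun j _ => ?_
    simp only [cutoffErrorPos, cutoffErrorVel, P, Q, PiLp.add_apply, PiLp.sub_apply,
      PiLp.smul_apply, smul_eq_mul]
    rw [show (relMap ħ q).1 = X from rfl, show (relMap ħ q).2 = Y from rfl]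
    push_cast
    have h1 : (ħ : ℂ) ≠ 0 := by exact_mod_cast hħ.ne'
    have h2 : (m : ℂ) ≠ 0 := by exact_mod_cast hm.ne'
    field_simp
    ring
  rw [add_assoc _ (∑ j, (ξ j : ℂ) * cutoffErrorPos ħ m n j q), hE]
  simp only [cutoffProd, cutoffPotential]
  rw [show (relMap ħ q).1 = X from rfl, show (relMap ħ q).2 = Y from rfl]
  generalize (∑ j, (P j : ℂ) * (cutoffDeriv n j X : ℂ)) = S1
  generalize (∑ j, (Q j : ℂ) * (cutoffDeriv n j Y : ℂ)) = S2
  generalize planeWave Q Y = w2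
  generalize starRingEnd ℂ (planeWave P X) = w1
  push_cast
  have h1 : (ħ : ℂ) ≠ 0 := by exact_mod_cast hħ.ne'
  have h2 : (m : ℂ) ≠ 0 := by exact_mod_cast hm.ne'
  rw [mul_inv, Complex.inv_I]
  field_simp
  ring_nf
  simp only [Complex.I_sq]
  ring

end PlaneWaves

end

section

open Filter Topology
open scoped FourierTransform ContDiff

/-! ### The evolution of the plane wave coefficients. -/

section PlaneWaveEquation

variable {d : ℕ}

theorem hasCompactSupport_relProd {ħ : ℝ} (hħ : 0 < ħ) {f g : Space d → ℝ}
    (hf : HasCompactSupport f) (hg : HasCompactSupport g) :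
    HasCompactSupport fun q => f (relMap ħ q).1 * g (relMap ħ q).2 := by
  have h : HasCompactSupport fun p : Space d × Space d => f p.1 * g p.2 := by
    refine HasCompactSupport.intro (hf.isCompact.prod hg.isCompact) fun p hp => ?_
    rw [mem_prod, not_and_or] at hp
    rcases hp with hp | hp <;> simp [image_eq_zero_of_notMem_tsupport hp]
  exact h.comp_homeomorph (relHomeomorph hħ)

theorem hasCompactSupport_cutoffDeriv (n : ℕ) (j : Fin d) : HasCompactSupport (cutoffDeriv n j) :=
  hasCompactSupport_coordDeriv j (hasCompactSupport_cutoff d n)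

theorem hasCompactSupport_cutoffLaplacian (d n : ℕ) : HasCompactSupport (cutoffLaplacian d n) := by
  refine HasCompactSupport.intro (hasCompactSupport_cutoff d n).isCompact fun x hx =>
    Finset.sum_eq_zero fun j _ => ?_
  have h : tsupport (coordDeriv j (cutoffDeriv n j)) ⊆ tsupport (cutoff d n) :=
    (tsupport_fderiv_apply_subset ℝ _).trans (tsupport_fderiv_apply_subset ℝ _)
  exact image_eq_zero_of_notMem_tsupport fun hx' => hx (h hx')

theorem continuous_relProd (ħ : ℝ) {f g : Space d → ℝ} (hf : Continuous f) (hg : Continuous g) :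
    Continuous fun q => f (relMap ħ q).1 * g (relMap ħ q).2 :=
  (hf.comp (continuous_fst.comp (continuous_relMap ħ))).mul
    (hg.comp (continuous_snd.comp (continuous_relMap ħ)))

theorem continuous_cutoffProd (ħ : ℝ) (n : ℕ) : Continuous (cutoffProd (d := d) ħ n) :=
  Complex.continuous_ofReal.comp
    (continuous_relProd ħ (contDiff_cutoff d n).continuous (contDiff_cutoff d n).continuous)

theorem continuous_cutoffPotential (ħ m : ℝ) (V : C(Space d, ℝ)) (n : ℕ) :
    Continuous (cutoffPotential ħ m V n) := by
  have h0 := (contDiff_cutoff d n).continuous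
  have h1 := continuous_cutoffLaplacian d n
  have h2 := continuous_relMap (d := d) ħ
  have h3 := V.continuous
  unfold cutoffPotential
  fun_prop

theorem continuous_cutoffErrorPos (ħ m : ℝ) (n : ℕ) (j : Fin d) :
    Continuous (cutoffErrorPos ħ m n j) := by
  have h0 := (contDiff_cutoff d n).continuous
  have h1 := (contDiff_cutoffDeriv n j).continuous
  have h2 := continuous_relMap (d := d) ħ
  unfold cutoffErrorPos
  fun_prop

theorem continuous_cutoffErrorVel (ħ m : ℝ) (n : ℕ) (j : Fin d) :
    Continuous (cutoffErrorVel ħ m n j) := by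
  have h0 := (contDiff_cutoff d n).continuous
  have h1 := (contDiff_cutoffDeriv n j).continuous
  have h2 := continuous_relMap (d := d) ħ
  unfold cutoffErrorVel
  fun_prop

theorem hasCompactSupport_cutoffProd {ħ : ℝ} (hħ : 0 < ħ) (n : ℕ) :
    HasCompactSupport (cutoffProd (d := d) ħ n) :=
  (hasCompactSupport_relProd hħ (hasCompactSupport_cutoff d n)
    (hasCompactSupport_cutoff d n)).comp_left (g := ((↑) : ℝ → ℂ)) Complex.ofReal_zero

theorem hasCompactSupport_cutoffPotential {ħ : ℝ} (hħ : 0 < ħ) (m : ℝ) (V : C(Space d, ℝ)) (n : ℕ) :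
    HasCompactSupport (cutoffPotential ħ m V n) := by
  have h0 := hasCompactSupport_cutoff d n
  have h1 := hasCompactSupport_cutoffLaplacian d n
  refine HasCompactSupport.mul_left (HasCompactSupport.comp_left (g := ((↑) : ℝ → ℂ)) ?_
    Complex.ofReal_zero)
  refine HasCompactSupport.add ?_ ?_
  · exact (hasCompactSupport_relProd hħ h0 h0).mul_left
  · exact (HasCompactSupport.sub (hasCompactSupport_relProd hħ h1 h0)
      (hasCompactSupport_relProd hħ h0 h1)).mul_left

theorem hasCompactSupport_cutoffErrorPos {ħ : ℝ} (hħ : 0 < ħ) (m : ℝ) (n : ℕ) (j : Fin d) :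
    HasCompactSupport (cutoffErrorPos ħ m n j) := by
  have h0 := hasCompactSupport_cutoff d n
  have h1 := hasCompactSupport_cutoffDeriv n j
  refine HasCompactSupport.comp_left (g := ((↑) : ℝ → ℂ)) ?_ Complex.ofReal_zero
  exact (HasCompactSupport.sub (hasCompactSupport_relProd hħ h1 h0)
    (hasCompactSupport_relProd hħ h0 h1)).mul_left

theorem hasCompactSupport_cutoffErrorVel {ħ : ℝ} (hħ : 0 < ħ) (m : ℝ) (n : ℕ) (j : Fin d) :
    HasCompactSupport (cutoffErrorVel ħ m n j) := by
  have h0 := hasCompactSupport_cutoff d n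
  have h1 := hasCompactSupport_cutoffDeriv n j
  refine HasCompactSupport.comp_left (g := ((↑) : ℝ → ℂ)) ?_ Complex.ofReal_zero
  exact (HasCompactSupport.add (hasCompactSupport_relProd hħ h1 h0)
    (hasCompactSupport_relProd hħ h0 h1)).mul_left

theorem continuous_relPhase (ξ v : Space d) : Continuous (relPhase ξ v) := by
  unfold relPhase; fun_prop

/-- The pairing of the density matrix with `A(q) exp(-i (2π ξ · x + v · y))`. -/
def relPairing (G : ℝ × Space d × Space d → ℂ) (A : Space d × Space d → ℂ) (ξ v : Space d)
    (t : ℝ) : ℂ :=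
  ∫ q, G (t, q) * (A q * relPhase ξ v q)

theorem IsRelKernel.integrable_mul {ħ T : ℝ} {R : ℝ → L2 d →L[ℂ] L2 d}
    {G : ℝ × Space d × Space d → ℂ} {M : ℝ≥0} (hG : IsRelKernel ħ T R G M) (t : ℝ)
    {A : Space d × Space d → ℂ} (hA : Continuous A) (hAc : HasCompactSupport A) (ξ v : Space d) :
    Integrable fun q => G (t, q) * (A q * relPhase ξ v q) :=
  integrable_mul_of_memLp (hG.memLp t)
    ((hA.mul (continuous_relPhase ξ v)).memLp_of_hasCompactSupport hAc.mul_right)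

/-- The weak equation is tested with two cut-off plane waves and integrated in time. The exponential
is an integrating factor: `α = 1` removes the transport term, `α = 0` keeps it, and both cases are
needed. -/
theorem relPairing_equation {ħ m T : ℝ} (hħ : 0 < ħ) (hm : 0 < m) (hT : 0 < T) (V : C(Space d, ℝ))
    {R : ℝ → L2 d →L[ℂ] L2 d}
    (hcont : ∀ f g : L2 d, ContinuousOn (fun t => inner ℂ f (R t g)) (Icc (-T) T))
    (hsol : IsWeakVonNeumannSolution ħ m T V R)
    {G : ℝ × Space d × Space d → ℂ} {M : ℝ≥0} (hG : IsRelKernel ħ T R G M) (n : ℕ)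
    (α t₀ : ℝ) (ξ v : Space d) {s t : ℝ} (hs : s ∈ Icc (-T) T) (ht : t ∈ Icc (-T) T) :
    Complex.exp ((α * (t - t₀) * (2 * Real.pi / m) * inner ℝ ξ v : ℝ) * Complex.I) *
        relPairing G (cutoffProd ħ n) ξ v t -
      Complex.exp ((α * (s - t₀) * (2 * Real.pi / m) * inner ℝ ξ v : ℝ) * Complex.I) *
        relPairing G (cutoffProd ħ n) ξ v s =
    ∫ r in s..t, Complex.exp ((α * (r - t₀) * (2 * Real.pi / m) * inner ℝ ξ v : ℝ) * Complex.I) *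
      (Complex.I * ((α - 1) * (2 * Real.pi / m) : ℝ) * (inner ℝ ξ v : ℝ) *
          relPairing G (cutoffProd ħ n) ξ v r +
        relPairing G (cutoffPotential ħ m V n) ξ v r +
        (∑ j, ξ j * relPairing G (cutoffErrorPos ħ m n j) ξ v r) +
        ∑ j, v j * relPairing G (cutoffErrorVel ħ m n j) ξ v r) := by
  set P := Real.pi • ξ + ħ⁻¹ • v with hP
  set Q := ħ⁻¹ • v - Real.pi • ξ with hQ
  set φ := cutoffWave n P
  set χ := cutoffWave n Q
  let u : ℝ → ℂ := fun t => inner ℂ (testL2 φ) (R t (testL2 χ))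
  let r : ℝ → ℂ := fun t => (Complex.I * ħ)⁻¹ *
    (inner ℂ (hamiltonianL2 ħ m V φ) (R t (testL2 χ)) -
      inner ℂ (testL2 φ) (R t (hamiltonianL2 ħ m V χ)))
  have hIħ : Complex.I * (ħ : ℂ) ≠ 0 :=
    mul_ne_zero Complex.I_ne_zero (by exact_mod_cast hħ.ne')
  have hu : ContinuousOn u (Icc (-T) T) := hcont _ _
  have hr : ContinuousOn r (Icc (-T) T) := continuousOn_const.mul ((hcont _ _).sub (hcont _ _))
  -- Division by `iħ` puts the von Neumann equation in the form `u' = r`.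
  have hw : ∀ θ : 𝓓(timeInterval T, ℂ), ∫ t, deriv θ t * u t = -∫ t, θ t * r t := fun θ => by
    have h1 := hsol φ χ θ
    have h2 : ∫ t, θ t * r t = (Complex.I * ħ)⁻¹ * ∫ t : ℝ, θ t *
        (inner ℂ (hamiltonianL2 ħ m V φ) (R t (testL2 χ)) -
          inner ℂ (testL2 φ) (R t (hamiltonianL2 ħ m V χ))) := by
      rw [← integral_const_mul]
      congr 1; ext t; simp only [r]; ring
    rw [h2, ← h1, neg_mul, mul_neg, neg_neg, inv_mul_cancel_left₀ hIħ]
  have hE : ∀ x, HasDerivAt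
      (fun t => Complex.exp ((α * (t - t₀) * (2 * Real.pi / m) * inner ℝ ξ v : ℝ) * Complex.I))
      (Complex.exp ((α * (x - t₀) * (2 * Real.pi / m) * inner ℝ ξ v : ℝ) * Complex.I) *
        ((α * (2 * Real.pi / m) * inner ℝ ξ v : ℝ) * Complex.I)) x := fun x => by
    have h1 : HasDerivAt (fun t : ℝ => α * (t - t₀) * (2 * Real.pi / m) * inner ℝ ξ v)
        (α * 1 * (2 * Real.pi / m) * inner ℝ ξ v) x :=
      ((((hasDerivAt_id x).sub_const t₀).const_mul α).mul_const _).mul_const _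
    rw [mul_one] at h1
    exact (h1.ofReal_comp.mul_const Complex.I).cexp
  have key := mul_sub_mul_eq_integral_of_weakDeriv hT hu hr hw hE (by fun_prop) hs ht
  have hint := fun {A : Space d × Space d → ℂ} (hA : Continuous A) (hAc : HasCompactSupport A)
    (t : ℝ) => hG.integrable_mul t hA hAc ξ v
  have eu : ∀ x ∈ Icc (-T) T, u x = ((ħ ^ d : ℝ) : ℂ) * relPairing G (cutoffProd ħ n) ξ v x :=
    fun x hx => by
    refine (hG.inner_eq hħ hx (memLp_testFunction φ) (memLp_testFunction χ)).trans ?_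
    congr 2
    ext q
    rw [← conj_planeWave_mul_planeWave hħ]
    simp only [φ, χ, cutoffWave_apply, cutoffProd, map_mul, Complex.conj_ofReal]
    push_cast
    ring
  have er : ∀ x ∈ Icc (-T) T, r x = ((ħ ^ d : ℝ) : ℂ) *
      (-Complex.I * (2 * Real.pi / m : ℝ) * (inner ℝ ξ v : ℝ) *
          relPairing G (cutoffProd ħ n) ξ v x +
        relPairing G (cutoffPotential ħ m V n) ξ v x +
        (∑ j, ξ j * relPairing G (cutoffErrorPos ħ m n j) ξ v x) +
        ∑ j, v j * relPairing G (cutoffErrorVel ħ m n j) ξ v x) := fun x hx => by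
    have h1 := hG.inner_eq hħ hx (memLp_hamiltonianFun ħ m V φ) (memLp_testFunction χ)
    have h2 := hG.inner_eq hħ hx (memLp_testFunction φ) (memLp_hamiltonianFun ħ m V χ)
    have i1 : Integrable fun q => G (x, q) * (starRingEnd ℂ (hamiltonianFun ħ m V φ (relMap ħ q).1)
        * χ (relMap ħ q).2) := integrable_mul_of_memLp (hG.memLp x)
      (memLp_comp_relMap hħ (memLp_tensor (μ := volume) (ν := volume)
        (memLp_conj (memLp_hamiltonianFun ħ m V φ)) (memLp_testFunction χ)))
    have i2 : Integrable fun q => G (x, q) * (starRingEnd ℂ (φ (relMap ħ q).1)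
        * hamiltonianFun ħ m V χ (relMap ħ q).2) := integrable_mul_of_memLp (hG.memLp x)
      (memLp_comp_relMap hħ (memLp_tensor (μ := volume) (ν := volume)
        (memLp_conj (memLp_testFunction φ)) (memLp_hamiltonianFun ħ m V χ)))
    have h3 : r x = (Complex.I * ħ)⁻¹ * (_ - _) :=
      congrArg₂ (fun a b => (Complex.I * (ħ : ℂ))⁻¹ * (a - b)) h1 h2
    rw [h3, ← mul_sub, ← integral_sub i1 i2, mul_left_comm]
    congr 1
    rw [← integral_const_mul]
    have j0 := (hint (continuous_cutoffProd ħ n) (hasCompactSupport_cutoffProd hħ n) x).const_mul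
      (-Complex.I * (2 * Real.pi / m : ℝ) * (inner ℝ ξ v : ℝ))
    have j1 := hint (continuous_cutoffPotential ħ m V n)
      (hasCompactSupport_cutoffPotential hħ m V n) x
    have j2 : ∀ j : Fin d, Integrable fun q =>
        (ξ j : ℂ) * (G (x, q) * (cutoffErrorPos ħ m n j q * relPhase ξ v q)) := fun j =>
      (hint (continuous_cutoffErrorPos ħ m n j)
        (hasCompactSupport_cutoffErrorPos hħ m n j) x).const_mul _
    have j3 : ∀ j : Fin d, Integrable fun q =>
        (v j : ℂ) * (G (x, q) * (cutoffErrorVel ħ m n j q * relPhase ξ v q)) := fun j =>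
      (hint (continuous_cutoffErrorVel ħ m n j)
        (hasCompactSupport_cutoffErrorVel hħ m n j) x).const_mul _
    have j01 : Integrable fun q => (-Complex.I * (2 * Real.pi / m : ℝ) * (inner ℝ ξ v : ℝ)) *
        (G (x, q) * (cutoffProd ħ n q * relPhase ξ v q)) +
        G (x, q) * (cutoffPotential ħ m V n q * relPhase ξ v q) := j0.add j1
    have j2' : Integrable fun q => ∑ j,
        (ξ j : ℂ) * (G (x, q) * (cutoffErrorPos ħ m n j q * relPhase ξ v q)) :=
      integrable_finsetSum _ fun j _ => j2 j
    have j3' : Integrable fun q => ∑ j,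
        (v j : ℂ) * (G (x, q) * (cutoffErrorVel ħ m n j q * relPhase ξ v q)) :=
      integrable_finsetSum _ fun j _ => j3 j
    have j012 : Integrable fun q => ((-Complex.I * (2 * Real.pi / m : ℝ) * (inner ℝ ξ v : ℝ)) *
        (G (x, q) * (cutoffProd ħ n q * relPhase ξ v q)) +
        G (x, q) * (cutoffPotential ħ m V n q * relPhase ξ v q)) + ∑ j,
        (ξ j : ℂ) * (G (x, q) * (cutoffErrorPos ħ m n j q * relPhase ξ v q)) := j01.add j2'
    simp only [relPairing]
    simp_rw [← integral_const_mul]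
    rw [← integral_finsetSum _ fun j _ => j2 j, ← integral_finsetSum _ fun j _ => j3 j,
      ← integral_add j0 j1, ← integral_add j01 j2', ← integral_add j012 j3']
    congr 1
    ext q
    have hc := commutator_cutoffWave hħ hm V n ξ v q
    calc _ = G (x, q) * ((Complex.I * ħ)⁻¹ *
      (starRingEnd ℂ (hamiltonianFun ħ m V (cutoffWave n (Real.pi • ξ + ħ⁻¹ • v)) (relMap ħ q).1) *
        cutoffWave n (ħ⁻¹ • v - Real.pi • ξ) (relMap ħ q).2 -
      starRingEnd ℂ (cutoffWave n (Real.pi • ξ + ħ⁻¹ • v) (relMap ħ q).1) *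
        hamiltonianFun ħ m V (cutoffWave n (ħ⁻¹ • v - Real.pi • ξ)) (relMap ħ q).2)) := by
          simp only [φ, χ, hP, hQ]; ring
      _ = _ := by
          rw [hc]
          simp only [add_mul, mul_add, Finset.sum_mul, Finset.mul_sum]
          congr 1
          · congr 1
            · ring
            · exact Finset.sum_congr rfl fun j _ => by ring
          · exact Finset.sum_congr rfl fun j _ => by ring
  -- The Jacobian `ħ^d` from the change to relative variables occurs on both sides and is cancelled.
  have hħd : ((ħ ^ d : ℝ) : ℂ) ≠ 0 := by exact_mod_cast (pow_pos hħ d).ne'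
  refine mul_left_cancel₀ hħd ?_
  rw [← intervalIntegral.integral_const_mul, mul_sub]
  rw [eu t ht, eu s hs] at key
  rw [mul_left_comm, mul_left_comm (((ħ ^ d : ℝ) : ℂ)), key]
  refine intervalIntegral.integral_congr fun x hx => ?_
  have hx' : x ∈ Icc (-T) T := uIcc_subset_Icc hs ht hx
  simp only
  rw [eu x hx', er x hx']
  push_cast
  ring

end PlaneWaveEquation

end

section

open Filter Topology
open scoped FourierTransform ContDiff

/-! ### Superposition of plane waves -/

section Superposition

variable {d : ℕ}

/-- The amplitude `η(ξ) ψ(v) exp(i b ξ · v)`. -/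
def packetWeight (η ψ : 𝓢(Space d, ℂ)) (b : ℝ) (w : Space d × Space d) : ℂ :=
  η w.1 * ψ w.2 * Complex.exp ((b * inner ℝ w.1 w.2 : ℝ) * Complex.I)

/-- The superposition of the characters `relPhase ξ v` with amplitude `packetWeight`. -/
def wavePacket (η ψ : 𝓢(Space d, ℂ)) (b : ℝ) (q : Space d × Space d) : ℂ :=
  ∫ w, packetWeight η ψ b w * relPhase w.1 w.2 q

theorem norm_relPhase (ξ v : Space d) (q : Space d × Space d) : ‖relPhase ξ v q‖ = 1 := by
  rw [relPhase, ← Complex.ofReal_neg, Complex.norm_exp_ofReal_mul_I]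

theorem norm_packetWeight (η ψ : 𝓢(Space d, ℂ)) (b : ℝ) (w : Space d × Space d) :
    ‖packetWeight η ψ b w‖ = ‖η w.1 * ψ w.2‖ := by
  rw [packetWeight, norm_mul, Complex.norm_exp_ofReal_mul_I, mul_one]

theorem continuous_packetWeight (η ψ : 𝓢(Space d, ℂ)) :
    Continuous fun p : ℝ × Space d × Space d => packetWeight η ψ p.1 p.2 := by
  have h1 := η.continuous
  have h2 := ψ.continuous
  unfold packetWeight
  fun_prop

theorem continuous_relPhase_uncurry :
    Continuous fun p : (Space d × Space d) × Space d × Space d => relPhase p.1.1 p.1.2 p.2 := by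
  unfold relPhase
  fun_prop

theorem integrable_schwartz_tensor (η ψ : 𝓢(Space d, ℂ)) :
    Integrable fun w : Space d × Space d => η w.1 * ψ w.2 :=
  η.integrable.mul_prod ψ.integrable

theorem integrable_packetWeight (η ψ : 𝓢(Space d, ℂ)) (b : ℝ) :
    Integrable (packetWeight η ψ b) :=
  (integrable_schwartz_tensor η ψ).mono
    ((continuous_packetWeight η ψ).comp (Continuous.prodMk_right b)).aestronglyMeasurable
    (.of_forall fun w => (norm_packetWeight η ψ b w).le)

theorem stronglyMeasurable_wavePacket (η ψ : 𝓢(Space d, ℂ)) :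
    StronglyMeasurable fun p : ℝ × Space d × Space d => wavePacket η ψ p.1 p.2 := by
  refine StronglyMeasurable.integral_prod_right
    (f := fun (p : ℝ × Space d × Space d) w => packetWeight η ψ p.1 w * relPhase w.1 w.2 p.2) ?_
  have h1 : Continuous fun p : (ℝ × Space d × Space d) × Space d × Space d =>
      packetWeight η ψ p.1.1 p.2 := by
    have h1 := η.continuous
    have h2 := ψ.continuous
    unfold packetWeight
    fun_prop
  have h2 : Continuous fun p : (ℝ × Space d × Space d) × Space d × Space d =>
      relPhase p.2.1 p.2.2 p.1.2 := by
    unfold relPhase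
    fun_prop
  exact (h1.mul h2).stronglyMeasurable

/-- The phase `b ξ·v` combines with `-v·y` to `-v·(y - bξ)`, so the integral over `v` is the Fourier
transform of `ψ` at the sheared point. A quadratic phase in `(ξ, v)` is thus a displacement of the
profile along `ξ`. -/
theorem wavePacket_eq (η ψ : 𝓢(Space d, ℂ)) (b : ℝ) (q : Space d × Space d) :
    wavePacket η ψ b q = partialFourier (shearedTest (angularFourier ψ) η b) q := by
  rw [wavePacket, partialFourier_eq_integral, Measure.volume_eq_prod, integral_prod]
  · congr 1
    ext ξ
    rw [shearedTest_apply, angularFourier_apply, mul_comm _ (η ξ), ← mul_assoc,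
      ← integral_const_mul]
    congr 1
    ext v
    rw [packetWeight, relPhase]
    simp only
    have : Complex.exp ((b * inner ℝ ξ v : ℝ) * Complex.I) *
        Complex.exp (-(2 * Real.pi * inner ℝ ξ q.2 + inner ℝ v q.1 : ℝ) * Complex.I) =
        Complex.exp (-(2 * Real.pi * inner ℝ ξ q.2 : ℝ) * Complex.I) *
          Complex.exp (-(inner ℝ v (q.1 - b • ξ) : ℝ) * Complex.I) := by
      rw [← Complex.exp_add, ← Complex.exp_add, inner_sub_right, real_inner_smul_right,
        real_inner_comm ξ v]
      congr 1
      push_cast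
      ring
    linear_combination (η ξ * ψ v) * this
  · refine (integrable_packetWeight η ψ b).mul_of_top_left ?_
    refine memLp_top_of_bound ?_ 1 (.of_forall fun w => (norm_relPhase w.1 w.2 q).le)
    exact (continuous_relPhase_uncurry.comp (Continuous.prodMk_left q)).aestronglyMeasurable

/-- Polynomial factors in `ξ` and `v` become a change of the Schwartz functions, which keeps the
class of pairings closed under the equation. -/
theorem coordMul_packetWeight_left (η ψ : 𝓢(Space d, ℂ)) (b : ℝ) (j : Fin d)
    (w : Space d × Space d) :
    packetWeight (coordMul j η) ψ b w = w.1 j * packetWeight η ψ b w := by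
  simp only [packetWeight, coordMul_apply]; ring

theorem coordMul_packetWeight_right (η ψ : 𝓢(Space d, ℂ)) (b : ℝ) (j : Fin d)
    (w : Space d × Space d) :
    packetWeight η (coordMul j ψ) b w = w.2 j * packetWeight η ψ b w := by
  simp only [packetWeight, coordMul_apply]; ring

/-- The pairing of the density matrix with `A` times a wave packet. -/
def packetPairing (G : ℝ × Space d × Space d → ℂ) (A : Space d × Space d → ℂ)
    (η ψ : 𝓢(Space d, ℂ)) (b t : ℝ) : ℂ :=
  ∫ q, G (t, q) * (A q * wavePacket η ψ b q)

theorem integral_packetWeight_mul_relPairing {G : ℝ × Space d × Space d → ℂ}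
    {A : Space d × Space d → ℂ} {t : ℝ} (h : Integrable fun q => G (t, q) * A q)
    (η ψ : 𝓢(Space d, ℂ)) (b : ℝ) :
    ∫ w, packetWeight η ψ b w * relPairing G A w.1 w.2 t = packetPairing G A η ψ b t := by
  simp only [relPairing, packetPairing, wavePacket]
  simp_rw [← integral_const_mul (packetWeight _ _ _ _)]
  rw [integral_integral_swap]
  · refine integral_congr_ae (.of_forall fun q => ?_)
    refine Eq.trans ?_ ((integral_const_mul _ _).trans (congrArg _ (integral_const_mul _ _)))
    refine integral_congr_ae (.of_forall fun w => ?_)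
    simp only; ring
  · have h1 := (integrable_packetWeight η ψ b).mul_prod h
    refine (h1.mul_of_top_left (memLp_top_of_bound
      continuous_relPhase_uncurry.aestronglyMeasurable 1
        (.of_forall fun p => (norm_relPhase p.1.1 p.1.2 p.2).le))).congr (.of_forall fun p => ?_)
    simp only [Function.uncurry, Pi.mul_apply]; ring

theorem stronglyMeasurable_relPairing {G : ℝ × Space d × Space d → ℂ} (hG : StronglyMeasurable G)
    {A : Space d × Space d → ℂ} (hA : Continuous A) :
    StronglyMeasurable fun p : ℝ × Space d × Space d => relPairing G A p.2.1 p.2.2 p.1 := by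
  refine StronglyMeasurable.integral_prod_right (f := fun (p : ℝ × Space d × Space d) q =>
    G (p.1, q) * (A q * relPhase p.2.1 p.2.2 q)) ?_
  have h1 : StronglyMeasurable fun p : (ℝ × Space d × Space d) × Space d × Space d =>
      G (p.1.1, p.2) :=
    hG.comp_measurable ((measurable_fst.comp measurable_fst).prodMk measurable_snd)
  have h2 : Continuous fun p : (ℝ × Space d × Space d) × Space d × Space d =>
      A p.2 * relPhase p.1.2.1 p.1.2.2 p.2 := by
    unfold relPhase
    fun_prop
  exact h1.mul h2.stronglyMeasurable

/-- Cauchy-Schwarz, the character having modulus one. The uniformity in `ξ`, `v` and `t` gives the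
integrability behind the superposition and the exchange of integrals. -/
theorem IsRelKernel.exists_bound_relPairing {ħ T : ℝ} {R : ℝ → L2 d →L[ℂ] L2 d}
    {G : ℝ × Space d × Space d → ℂ} {M : ℝ≥0} (hG : IsRelKernel ħ T R G M)
    {A : Space d × Space d → ℂ} (hA : Continuous A) (hAc : HasCompactSupport A) :
    ∃ C : ℝ, ∀ ξ v t, ‖relPairing G A ξ v t‖ ≤ C := by
  have hfin : (M : ℝ≥0∞) * ∫⁻ q, ‖A q‖ₑ ^ 2 ≠ ⊤ := ENNReal.mul_ne_top ENNReal.coe_ne_top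
    (lintegral_sq_lt_top_of_memLp (hA.memLp_of_hasCompactSupport hAc)).ne
  refine ⟨Real.sqrt ((M : ℝ≥0∞) * ∫⁻ q, ‖A q‖ₑ ^ 2).toReal, fun ξ v t => ?_⟩
  refine Real.le_sqrt_of_sq_le ?_
  have h := enorm_integral_mul_sq_le (hG.memLp t).1
    (hA.mul (continuous_relPhase ξ v)).aestronglyMeasurable (μ := volume)
  have h2 : ‖relPairing G A ξ v t‖ₑ ^ 2 ≤ (M : ℝ≥0∞) * ∫⁻ q, ‖A q‖ₑ ^ 2 := by
    refine h.trans (mul_le_mul' (hG.lintegral_sq_le t) (lintegral_mono fun q => ?_))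
    rw [Pi.mul_apply, enorm_mul, ← enorm_norm (relPhase ξ v q), norm_relPhase]
    simp
  have h3 := ENNReal.toReal_mono hfin h2
  simpa using h3

theorem IsRelKernel.integrable_packet {ħ T : ℝ} {R : ℝ → L2 d →L[ℂ] L2 d}
    {G : ℝ × Space d × Space d → ℂ} {M : ℝ≥0} (hG : IsRelKernel ħ T R G M)
    {A : Space d × Space d → ℂ} (hA : Continuous A) (hAc : HasCompactSupport A)
    (η ψ : 𝓢(Space d, ℂ)) {c : ℝ → ℝ} (hc : Continuous c) (s t : ℝ) :
    Integrable (Function.uncurry fun r w =>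
      packetWeight η ψ (c r) w * relPairing G A w.1 w.2 r)
      ((volume.restrict (uIoc s t)).prod volume) := by
  obtain ⟨C, hC⟩ := hG.exists_bound_relPairing hA hAc
  have : IsFiniteMeasure (volume.restrict (uIoc s t)) := ⟨by simp [uIoc]⟩
  have h1 : Integrable (fun p : ℝ × Space d × Space d => (C : ℂ) * (η p.2.1 * ψ p.2.2))
      ((volume.restrict (uIoc s t)).prod volume) :=
    (integrable_const (C : ℂ)).mul_prod (integrable_schwartz_tensor η ψ)
  refine h1.mono ?_ (.of_forall fun p => ?_)
  · refine StronglyMeasurable.aestronglyMeasurable (StronglyMeasurable.mul ?_ ?_)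
    · exact ((continuous_packetWeight η ψ).comp (by fun_prop :
        Continuous fun p : ℝ × Space d × Space d => (c p.1, p.2))).stronglyMeasurable
    · exact stronglyMeasurable_relPairing hG.stronglyMeasurable hA
  · simp only [Function.uncurry]
    rw [norm_mul, norm_packetWeight, norm_mul (C : ℂ), mul_comm, Complex.norm_real]
    gcongr
    exact (hC _ _ _).trans (le_abs_self C)

theorem IsRelKernel.integrable_packet_apply {ħ T : ℝ} {R : ℝ → L2 d →L[ℂ] L2 d}
    {G : ℝ × Space d × Space d → ℂ} {M : ℝ≥0} (hG : IsRelKernel ħ T R G M)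
    {A : Space d × Space d → ℂ} (hA : Continuous A) (hAc : HasCompactSupport A)
    (η ψ : 𝓢(Space d, ℂ)) (b r : ℝ) :
    Integrable fun w : Space d × Space d =>
      packetWeight η ψ b w * relPairing G A w.1 w.2 r := by
  obtain ⟨C, hC⟩ := hG.exists_bound_relPairing hA hAc
  refine (integrable_packetWeight η ψ b).mul_of_top_left (memLp_top_of_bound ?_ C
    (.of_forall fun w => hC _ _ _))
  exact ((stronglyMeasurable_relPairing hG.stronglyMeasurable hA).comp_measurable
    measurable_prodMk_left).aestronglyMeasurable

/-- Superposition of the plane wave identities with amplitude `η(ξ) ψ(v)`. The integrating factor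
becomes the phase of the packet, whose displacement `b` therefore depends on time. -/
theorem packetPairing_equation {ħ m T : ℝ} (hħ : 0 < ħ) (hm : 0 < m) (hT : 0 < T)
    (V : C(Space d, ℝ)) {R : ℝ → L2 d →L[ℂ] L2 d}
    (hcont : ∀ f g : L2 d, ContinuousOn (fun t => inner ℂ f (R t g)) (Icc (-T) T))
    (hsol : IsWeakVonNeumannSolution ħ m T V R)
    {G : ℝ × Space d × Space d → ℂ} {M : ℝ≥0} (hG : IsRelKernel ħ T R G M) (n : ℕ)
    (α t₀ : ℝ) (η ψ : 𝓢(Space d, ℂ)) {s t : ℝ} (hs : s ∈ Icc (-T) T) (ht : t ∈ Icc (-T) T) :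
    packetPairing G (cutoffProd ħ n) η ψ (α * (t - t₀) * (2 * Real.pi / m)) t -
      packetPairing G (cutoffProd ħ n) η ψ (α * (s - t₀) * (2 * Real.pi / m)) s =
    ∫ r in s..t, (Complex.I * ((α - 1) * (2 * Real.pi / m) : ℝ) *
          (∑ j, packetPairing G (cutoffProd ħ n) (coordMul j η) (coordMul j ψ)
            (α * (r - t₀) * (2 * Real.pi / m)) r) +
        packetPairing G (cutoffPotential ħ m V n) η ψ (α * (r - t₀) * (2 * Real.pi / m)) r +
        (∑ j, packetPairing G (cutoffErrorPos ħ m n j) (coordMul j η) ψ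
          (α * (r - t₀) * (2 * Real.pi / m)) r) +
        ∑ j, packetPairing G (cutoffErrorVel ħ m n j) η (coordMul j ψ)
          (α * (r - t₀) * (2 * Real.pi / m)) r) := by
  have iG : ∀ {A : Space d × Space d → ℂ}, Continuous A → HasCompactSupport A → ∀ r,
      Integrable fun q => G (r, q) * A q := fun hA hAc r =>
    integrable_mul_of_memLp (hG.memLp r) (hA.memLp_of_hasCompactSupport hAc)
  set c : ℝ → ℝ := fun r => α * (r - t₀) * (2 * Real.pi / m) with hc
  have hcc : Continuous c := by fun_prop
  have a0 := continuous_cutoffProd (d := d) ħ n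
  have b0 := hasCompactSupport_cutoffProd (d := d) hħ n
  have a1 := continuous_cutoffPotential ħ m V n
  have b1 := hasCompactSupport_cutoffPotential hħ m V n
  have a2 := fun j : Fin d => continuous_cutoffErrorPos ħ m n j
  have b2 := fun j : Fin d => hasCompactSupport_cutoffErrorPos hħ m n j
  have a3 := fun j : Fin d => continuous_cutoffErrorVel ħ m n j
  have b3 := fun j : Fin d => hasCompactSupport_cutoffErrorVel hħ m n j
  let F : ℝ → Space d × Space d → ℂ := fun r w =>
    (((Complex.I * ((α - 1) * (2 * Real.pi / m) : ℝ)) * (∑ j,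
        packetWeight (coordMul j η) (coordMul j ψ) (c r) w *
          relPairing G (cutoffProd ħ n) w.1 w.2 r) +
      packetWeight η ψ (c r) w * relPairing G (cutoffPotential ħ m V n) w.1 w.2 r) +
      (∑ j, packetWeight (coordMul j η) ψ (c r) w *
          relPairing G (cutoffErrorPos ħ m n j) w.1 w.2 r)) +
      ∑ j, packetWeight η (coordMul j ψ) (c r) w *
          relPairing G (cutoffErrorVel ħ m n j) w.1 w.2 r
  have hF : Integrable (Function.uncurry F) ((volume.restrict (uIoc s t)).prod volume) :=
    ((((integrable_finsetSum _ fun j _ => hG.integrable_packet a0 b0 (coordMul j η) (coordMul j ψ)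
      hcc s t).const_mul _).add (hG.integrable_packet a1 b1 η ψ hcc s t)).add
      (integrable_finsetSum _ fun j _ => hG.integrable_packet (a2 j) (b2 j) (coordMul j η) ψ
        hcc s t)).add
      (integrable_finsetSum _ fun j _ => hG.integrable_packet (a3 j) (b3 j) η (coordMul j ψ)
        hcc s t)
  have key : ∀ w : Space d × Space d,
      packetWeight η ψ (c t) w * relPairing G (cutoffProd ħ n) w.1 w.2 t -
        packetWeight η ψ (c s) w * relPairing G (cutoffProd ħ n) w.1 w.2 s =
      ∫ r in s..t, F r w := fun w => by
    have h := congrArg (η w.1 * ψ w.2 * ·)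
      (relPairing_equation hħ hm hT V hcont hsol hG n α t₀ w.1 w.2 hs ht)
    simp only [← intervalIntegral.integral_const_mul] at h
    rw [mul_sub, ← mul_assoc, ← mul_assoc] at h
    refine h.trans (intervalIntegral.integral_congr fun r _ => ?_)
    have hi : ((inner ℝ w.1 w.2 : ℝ) : ℂ) = ∑ j, (w.1 j : ℂ) * w.2 j := by
      rw [PiLp.inner_apply]
      push_cast
      exact Finset.sum_congr rfl fun j _ => by simp [mul_comm]
    simp only [F, coordMul_packetWeight_left, coordMul_packetWeight_right]
    rw [← mul_assoc]
    change packetWeight η ψ (c r) w * _ = _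
    simp only [hi, mul_add, Finset.mul_sum, Finset.sum_mul]
    congr 1
    · congr 1
      · congr 1
        exact Finset.sum_congr rfl fun j _ => by ring
      · exact Finset.sum_congr rfl fun j _ => by ring
    · exact Finset.sum_congr rfl fun j _ => by ring
  have i0 := fun r => hG.integrable_packet_apply a0 b0 η ψ (c r) r
  rw [← integral_packetWeight_mul_relPairing (iG a0 b0 t),
    ← integral_packetWeight_mul_relPairing (iG a0 b0 s), ← integral_sub (i0 t) (i0 s)]
  simp_rw [key]
  rw [← intervalIntegral_integral_swap hF]
  refine intervalIntegral.integral_congr fun r _ => ?_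
  have j0 : Integrable fun w : Space d × Space d => (Complex.I * ((α - 1) * (2 * Real.pi / m) : ℝ)) *
      (∑ j, packetWeight (coordMul j η) (coordMul j ψ) (c r) w *
          relPairing G (cutoffProd ħ n) w.1 w.2 r) :=
    (integrable_finsetSum _ fun j _ =>
      hG.integrable_packet_apply a0 b0 (coordMul j η) (coordMul j ψ) (c r) r).const_mul _
  have j1 := hG.integrable_packet_apply a1 b1 η ψ (c r) r
  have j2 : Integrable fun w : Space d × Space d => ∑ j, packetWeight (coordMul j η) ψ (c r) w *
      relPairing G (cutoffErrorPos ħ m n j) w.1 w.2 r :=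
    integrable_finsetSum _ fun j _ =>
      hG.integrable_packet_apply (a2 j) (b2 j) (coordMul j η) ψ (c r) r
  have j3 : Integrable fun w : Space d × Space d => ∑ j, packetWeight η (coordMul j ψ) (c r) w *
      relPairing G (cutoffErrorVel ħ m n j) w.1 w.2 r :=
    integrable_finsetSum _ fun j _ =>
      hG.integrable_packet_apply (a3 j) (b3 j) η (coordMul j ψ) (c r) r
  have e1 := integral_add ((j0.add j1).add j2) j3
  have e2 := integral_add (j0.add j1) j2
  have e3 := integral_add j0 j1
  simp only [Pi.add_apply] at e1 e2 e3
  simp only [F]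
  rw [e1, e2, e3, integral_const_mul,
    integral_finsetSum _ fun j _ =>
      hG.integrable_packet_apply a0 b0 (coordMul j η) (coordMul j ψ) (c r) r,
    integral_finsetSum _ fun j _ =>
      hG.integrable_packet_apply (a2 j) (b2 j) (coordMul j η) ψ (c r) r,
    integral_finsetSum _ fun j _ =>
      hG.integrable_packet_apply (a3 j) (b3 j) η (coordMul j ψ) (c r) r]
  simp only [integral_packetWeight_mul_relPairing (iG a0 b0 r),
    integral_packetWeight_mul_relPairing (iG a1 b1 r),
    fun j => integral_packetWeight_mul_relPairing (iG (a2 j) (b2 j) r),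
    fun j => integral_packetWeight_mul_relPairing (iG (a3 j) (b3 j) r), hc]

end Superposition

end

section

open Filter Topology
open scoped FourierTransform ContDiff

/-! ### Removal of the cut-off -/

section CutoffLimit

variable {d : ℕ}

/-- The Schwartz function `y ↦ (1 + |y|²)^{1/2} f(y)`. -/
def japaneseMul (f : 𝓢(Space d, ℂ)) : 𝓢(Space d, ℂ) :=
  SchwartzMap.smulLeftCLM ℂ (fun y : Space d => ((japaneseBracket y : ℝ) : ℂ)) f

theorem japaneseMul_apply (f : 𝓢(Space d, ℂ)) (y : Space d) :
    japaneseMul f y = (japaneseBracket y : ℂ) * f y := by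
  have h : Function.HasTemperateGrowth fun y : Space d => ((japaneseBracket y : ℝ) : ℂ) :=
    Function.HasTemperateGrowth.comp Function.Complex.hasTemperateGrowth_ofReal
      (Function.hasTemperateGrowth_one_add_norm_sq_rpow (Space d) (1 / 2))
  rw [japaneseMul, SchwartzMap.smulLeftCLM_apply_apply h, smul_eq_mul]

theorem partialFourier_bracketMul (Φ : 𝓢(Space d × Space d, ℂ)) (p : Space d × Space d) :
    partialFourier (bracketMul Φ) p = (japaneseBracket p.1 : ℂ) * partialFourier Φ p := by
  rw [partialFourier_eq_integral, partialFourier_eq_integral, ← integral_const_mul]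
  refine integral_congr_ae (.of_forall fun v => ?_)
  simp only [bracketMul_apply]
  ring

/-- An inequality of Peetre type: growth in the displaced position is charged to the original
position and to `ξ`, where the profile and `η` decay rapidly. -/
theorem japaneseBracket_add_smul_sq_le (b : ℝ) (y ξ : Space d) :
    japaneseBracket (y + b • ξ) ^ 2 ≤
      2 * (1 + b ^ 2) * (japaneseBracket y ^ 2 * japaneseBracket ξ ^ 2) := by
  rw [japaneseBracket_sq, japaneseBracket_sq, japaneseBracket_sq]
  have h1 : ‖y + b • ξ‖ ^ 2 ≤ 2 * ‖y‖ ^ 2 + 2 * (b ^ 2 * ‖ξ‖ ^ 2) := by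
    have := norm_add_le y (b • ξ)
    rw [norm_smul, Real.norm_eq_abs] at this
    have h2 : |b| ^ 2 = b ^ 2 := sq_abs b
    nlinarith [norm_nonneg (y + b • ξ), sq_nonneg (‖y‖ - |b| * ‖ξ‖)]
  have h2 : 0 ≤ b ^ 2 * ‖y‖ ^ 2 := by positivity
  have h3 : 0 ≤ ‖y‖ ^ 2 * ‖ξ‖ ^ 2 := by positivity
  have h4 : 0 ≤ b ^ 2 * (‖y‖ ^ 2 * ‖ξ‖ ^ 2) := by positivity
  nlinarith [sq_nonneg b, sq_nonneg ‖y‖, sq_nonneg ‖ξ‖]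

theorem lintegral_bracketMul_shearedTest_le (χ η : 𝓢(Space d, ℂ)) (b : ℝ) :
    ∫⁻ p, ‖bracketMul (shearedTest χ η b) p‖ₑ ^ 2 ≤ ENNReal.ofReal (2 * (1 + b ^ 2)) *
      ((∫⁻ y, ‖japaneseMul χ y‖ₑ ^ 2) * ∫⁻ ξ, ‖japaneseMul η ξ‖ₑ ^ 2) := by
  have hp : ∀ y ξ : Space d, ‖bracketMul (shearedTest χ η b) (y, ξ)‖ₑ ^ 2 ≤
      ENNReal.ofReal (2 * (1 + b ^ 2)) *
        (‖japaneseMul χ (y - b • ξ)‖ₑ ^ 2 * ‖japaneseMul η ξ‖ₑ ^ 2) := fun y ξ => by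
    simp only [bracketMul_apply, shearedTest_apply, japaneseMul_apply, ← ofReal_norm,
      norm_mul, Complex.norm_real, Real.norm_eq_abs, abs_of_pos (japaneseBracket_pos _)]
    rw [← ENNReal.ofReal_pow (by have := (japaneseBracket_pos y).le; positivity),
      ← ENNReal.ofReal_pow (by have := (japaneseBracket_pos (y - b • ξ)).le; positivity),
      ← ENNReal.ofReal_pow (by have := (japaneseBracket_pos ξ).le; positivity),
      ← ENNReal.ofReal_mul (by positivity), ← ENNReal.ofReal_mul (by positivity)]
    refine ENNReal.ofReal_le_ofReal ?_
    have h := japaneseBracket_add_smul_sq_le b (y - b • ξ) ξ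
    rw [sub_add_cancel] at h
    nlinarith [mul_le_mul_of_nonneg_right h (by positivity : 0 ≤ (‖χ (y - b • ξ)‖ * ‖η ξ‖) ^ 2)]
  rw [Measure.volume_eq_prod, lintegral_prod_symm _
    ((bracketMul (shearedTest χ η b)).continuous.enorm.measurable.pow_const 2).aemeasurable]
  calc _ ≤ ∫⁻ ξ, ∫⁻ y, ENNReal.ofReal (2 * (1 + b ^ 2)) *
        (‖japaneseMul χ (y - b • ξ)‖ₑ ^ 2 * ‖japaneseMul η ξ‖ₑ ^ 2) :=
          lintegral_mono fun ξ => lintegral_mono fun y => hp y ξ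
    _ = ∫⁻ ξ, ENNReal.ofReal (2 * (1 + b ^ 2)) *
        ((∫⁻ y, ‖japaneseMul χ y‖ₑ ^ 2) * ‖japaneseMul η ξ‖ₑ ^ 2) := by
          refine lintegral_congr fun ξ => ?_
          have hm : Measurable fun y => ‖japaneseMul χ (y - b • ξ)‖ₑ ^ 2 := by
            have := (japaneseMul χ).continuous
            exact (by fun_prop : Continuous fun y => japaneseMul χ (y - b • ξ)).enorm.measurable.pow_const 2
          rw [lintegral_const_mul _ (hm.mul_const _), lintegral_mul_const _ hm,
            lintegral_sub_right_eq_self (fun y => ‖japaneseMul χ y‖ₑ ^ 2)]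
    _ = _ := by
          have hm : Measurable fun y => ‖japaneseMul η y‖ₑ ^ 2 :=
            (japaneseMul η).continuous.enorm.measurable.pow_const 2
          rw [lintegral_const_mul _ (hm.const_mul _), lintegral_const_mul _ hm]

/-- The weight depends on `y` alone and commutes with the Fourier transform in the other variable,
so Plancherel reduces the bound to sheared products. -/
theorem lintegral_bracket_wavePacket_le (η ψ : 𝓢(Space d, ℂ)) (b : ℝ) :
    ∫⁻ q, ‖(japaneseBracket q.1 : ℂ) * wavePacket η ψ b q‖ₑ ^ 2 ≤
      ENNReal.ofReal (2 * (1 + b ^ 2)) *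
      ((∫⁻ y, ‖japaneseMul (angularFourier ψ) y‖ₑ ^ 2) * ∫⁻ ξ, ‖japaneseMul η ξ‖ₑ ^ 2) := by
  simp_rw [wavePacket_eq, ← partialFourier_bracketMul]
  rw [lintegral_partialFourier_sq]
  exact lintegral_bracketMul_shearedTest_le _ _ _

theorem memLp_bracket_wavePacket (η ψ : 𝓢(Space d, ℂ)) (b : ℝ) :
    MemLp (fun q : Space d × Space d => (japaneseBracket q.1 : ℂ) * wavePacket η ψ b q) 2
      volume := by
  simp_rw [wavePacket_eq, ← partialFourier_bracketMul]
  exact memLp_partialFourier _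

theorem memLp_mul_wavePacket (η ψ : 𝓢(Space d, ℂ)) (b : ℝ) {A : Space d × Space d → ℂ}
    (hA : Measurable A) {C : ℝ} (hAC : ∀ q, ‖A q‖ ≤ C * japaneseBracket q.1) :
    MemLp (fun q => A q * wavePacket η ψ b q) 2 volume := by
  refine ((memLp_bracket_wavePacket η ψ b).const_mul (C : ℂ)).mono ?_ (.of_forall fun q => ?_)
  · exact (hA.stronglyMeasurable.mul ((stronglyMeasurable_wavePacket η ψ).comp_measurable
      measurable_prodMk_left)).aestronglyMeasurable
  · have h := hAC q
    have hC : 0 ≤ C * japaneseBracket q.1 := (norm_nonneg _).trans h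
    rw [norm_mul, norm_mul, norm_mul, Complex.norm_real, Complex.norm_real, Real.norm_eq_abs,
      Real.norm_eq_abs, ← mul_assoc, ← abs_mul, abs_of_nonneg hC]
    gcongr

/-- Dominated convergence: wave packets remain square integrable after multiplication by the weight,
so multipliers of linear growth in `y` are admissible. -/
theorem IsRelKernel.tendsto_packetPairing {ħ T : ℝ} {R : ℝ → L2 d →L[ℂ] L2 d}
    {G : ℝ × Space d × Space d → ℂ} {M : ℝ≥0} (hG : IsRelKernel ħ T R G M)
    (η ψ : 𝓢(Space d, ℂ)) (b t : ℝ) {A : ℕ → Space d × Space d → ℂ} {A' : Space d × Space d → ℂ}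
    (hA : ∀ n, Continuous (A n)) {C : ℝ} (hAC : ∀ n q, ‖A n q‖ ≤ C * japaneseBracket q.1)
    (hlim : ∀ q, Tendsto (fun n => A n q) atTop (𝓝 (A' q))) :
    Tendsto (fun n => packetPairing G (A n) η ψ b t) atTop (𝓝 (packetPairing G A' η ψ b t)) := by
  refine tendsto_integral_of_dominated_convergence
    (fun q => ‖G (t, q) * (C * ((japaneseBracket q.1 : ℂ) * wavePacket η ψ b q))‖)
    (fun n => ?_) ?_ (fun n => .of_forall fun q => ?_) (.of_forall fun q => ?_)
  · exact (hG.memLp t).1.mul (memLp_mul_wavePacket η ψ b (hA n).measurable (hAC n)).1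
  · exact (integrable_mul_of_memLp (hG.memLp t)
      ((memLp_bracket_wavePacket η ψ b).const_mul (C : ℂ))).norm
  · have h := hAC n q
    have hC : 0 ≤ C * japaneseBracket q.1 := (norm_nonneg _).trans h
    rw [norm_mul, norm_mul, norm_mul, norm_mul, norm_mul, Complex.norm_real, Complex.norm_real,
      Real.norm_eq_abs, Real.norm_eq_abs, ← mul_assoc |C|, ← abs_mul, abs_of_nonneg hC]
    gcongr
  · exact ((hlim q).mul_const _).const_mul _

theorem IsRelKernel.exists_bound_packetPairing {ħ T : ℝ} {R : ℝ → L2 d →L[ℂ] L2 d}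
    {G : ℝ × Space d × Space d → ℂ} {M : ℝ≥0} (hG : IsRelKernel ħ T R G M)
    (η ψ : 𝓢(Space d, ℂ)) (B C : ℝ) : ∃ K : ℝ, ∀ A : Space d × Space d → ℂ, Measurable A →
      (∀ q, ‖A q‖ ≤ C * japaneseBracket q.1) → ∀ b, |b| ≤ B → ∀ t,
        ‖packetPairing G A η ψ b t‖ ≤ K := by
  set Z := (M : ℝ≥0∞) * (ENNReal.ofReal (C ^ 2) * (ENNReal.ofReal (2 * (1 + B ^ 2)) *
      ((∫⁻ y, ‖japaneseMul (angularFourier ψ) y‖ₑ ^ 2) * ∫⁻ ξ, ‖japaneseMul η ξ‖ₑ ^ 2))) with hZ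
  have hfin : Z ≠ ⊤ := by
    refine ENNReal.mul_ne_top ENNReal.coe_ne_top (ENNReal.mul_ne_top ENNReal.ofReal_ne_top
      (ENNReal.mul_ne_top ENNReal.ofReal_ne_top (ENNReal.mul_ne_top ?_ ?_)))
    · exact (lintegral_sq_lt_top_of_memLp (μ := volume)
        ((japaneseMul (angularFourier ψ)).memLp 2)).ne
    · exact (lintegral_sq_lt_top_of_memLp (μ := volume) ((japaneseMul η).memLp 2)).ne
  refine ⟨Real.sqrt Z.toReal, fun A hA hAC b hb t => Real.le_sqrt_of_sq_le ?_⟩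
  have h : ‖packetPairing G A η ψ b t‖ₑ ^ 2 ≤ Z := by
    refine (enorm_integral_mul_sq_le (hG.memLp t).1 (memLp_mul_wavePacket η ψ b hA hAC).1).trans
      (mul_le_mul' (hG.lintegral_sq_le t) ?_)
    calc _ ≤ ∫⁻ q, ENNReal.ofReal (C ^ 2) *
          ‖(japaneseBracket q.1 : ℂ) * wavePacket η ψ b q‖ₑ ^ 2 := lintegral_mono fun q => by
            simp only [← ofReal_norm]
            rw [← ENNReal.ofReal_pow (norm_nonneg _), ← ENNReal.ofReal_pow (norm_nonneg _),
              ← ENNReal.ofReal_mul (by positivity)]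
            refine ENNReal.ofReal_le_ofReal ?_
            rw [norm_mul, norm_mul, Complex.norm_real, Real.norm_eq_abs,
              abs_of_pos (japaneseBracket_pos _), ← mul_pow, ← mul_assoc]
            have := hAC q
            gcongr
      _ ≤ _ := by
            rw [lintegral_const_mul' _ _ ENNReal.ofReal_ne_top]
            gcongr
            refine (lintegral_bracket_wavePacket_le η ψ b).trans ?_
            have hb' : b ^ 2 ≤ B ^ 2 := sq_le_sq' (abs_le.1 hb).1 (abs_le.1 hb).2
            exact mul_le_mul_left (ENNReal.ofReal_le_ofReal (by linarith)) _
  have h3 := ENNReal.toReal_mono hfin h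
  simpa using h3

theorem stronglyMeasurable_packetPairing {G : ℝ × Space d × Space d → ℂ}
    (hG : StronglyMeasurable G) {A : Space d × Space d → ℂ} (hA : Measurable A)
    (η ψ : 𝓢(Space d, ℂ)) {c : ℝ → ℝ} (hc : Continuous c) :
    StronglyMeasurable fun r => packetPairing G A η ψ (c r) r := by
  have h : StronglyMeasurable fun p : ℝ × Space d × Space d => wavePacket η ψ (c p.1) p.2 := by
    have h1 : Measurable fun p : ℝ × Space d × Space d => (c p.1, p.2) :=
      (hc.measurable.comp measurable_fst).prodMk measurable_snd
    simpa only [Function.comp_def] using (stronglyMeasurable_wavePacket η ψ).comp_measurable h1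
  exact (hG.mul ((hA.stronglyMeasurable.comp_measurable measurable_snd).mul h)).integral_prod_right

/-- The multiplier `(iħ)⁻¹ (V(X) - V(Y))`. -/
def relPotential (ħ : ℝ) (V : C(Space d, ℝ)) (q : Space d × Space d) : ℂ :=
  Complex.I * ((-ħ⁻¹ * (V (relMap ħ q).1 - V (relMap ħ q).2) : ℝ) : ℂ)

theorem continuous_relPotential (ħ : ℝ) (V : C(Space d, ℝ)) : Continuous (relPotential ħ V) := by
  have h2 := continuous_relMap (d := d) ħ
  have h3 := V.continuous
  unfold relPotential
  fun_prop

/-- Since `X - Y = ħy`, the Lipschitz bound absorbs `ħ⁻¹` and leaves a constant independent of `ħ`,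
at the cost of linear growth in `y`. -/
theorem norm_relPotential_le {ħ : ℝ} (hħ : 0 < ħ) {V : C(Space d, ℝ)} {L : ℝ≥0}
    (hL : LipschitzWith L V) (q : Space d × Space d) :
    ‖relPotential ħ V q‖ ≤ L * japaneseBracket q.1 := by
  have h := hL.dist_le_mul (relMap ħ q).1 (relMap ħ q).2
  rw [dist_eq_norm, dist_eq_norm, Real.norm_eq_abs] at h
  have h1 : (relMap ħ q).1 - (relMap ħ q).2 = ħ • q.1 := by
    simp only [relMap]
    rw [add_sub_sub_cancel, ← add_smul, add_halves]
  rw [h1, norm_smul, Real.norm_eq_abs, abs_of_pos hħ] at h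
  rw [relPotential, norm_mul, Complex.norm_I, one_mul, Complex.norm_real, Real.norm_eq_abs,
    abs_mul, abs_neg, abs_inv, abs_of_pos hħ]
  calc _ ≤ ħ⁻¹ * (L * (ħ * ‖q.1‖)) := by gcongr
    _ = L * ‖q.1‖ := by field_simp
    _ ≤ _ := by gcongr; exact norm_le_japaneseBracket _

theorem one_le_japaneseBracket (y : Space d) : 1 ≤ japaneseBracket y := by
  have := japaneseBracket_sq y
  nlinarith [japaneseBracket_pos y, sq_nonneg ‖y‖]

theorem exists_bound_cutoffProd (ħ : ℝ) : ∃ C : ℝ, ∀ n (q : Space d × Space d),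
    ‖cutoffProd ħ n q‖ ≤ C * japaneseBracket q.1 := by
  obtain ⟨M, hM, h0, -⟩ := exists_bound_cutoff d
  refine ⟨M * M, fun n q => ?_⟩
  rw [cutoffProd, Complex.norm_real, Real.norm_eq_abs, abs_mul]
  refine (mul_le_mul (h0 _ _) (h0 _ _) (abs_nonneg _) hM).trans ?_
  exact le_mul_of_one_le_right (by positivity) (one_le_japaneseBracket _)

theorem exists_bound_cutoffPotential {ħ : ℝ} (hħ : 0 < ħ) (m : ℝ) {V : C(Space d, ℝ)} {L : ℝ≥0}
    (hL : LipschitzWith L V) : ∃ C : ℝ, ∀ n (q : Space d × Space d),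
    ‖cutoffPotential ħ m V n q‖ ≤ C * japaneseBracket q.1 := by
  obtain ⟨M, hM, h0, -, h2, -⟩ := exists_bound_cutoff d
  refine ⟨L * (M * M) + |ħ / (2 * m)| * (2 * (M * M)), fun n q => ?_⟩
  have hV := norm_relPotential_le hħ hL q
  rw [relPotential, norm_mul, Complex.norm_I, one_mul, Complex.norm_real, Real.norm_eq_abs] at hV
  rw [cutoffPotential, norm_mul, Complex.norm_I, one_mul, Complex.norm_real, Real.norm_eq_abs]
  set κ := cutoff d n (relMap ħ q).1
  set κ' := cutoff d n (relMap ħ q).2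
  set l := cutoffLaplacian d n (relMap ħ q).1
  set l' := cutoffLaplacian d n (relMap ħ q).2
  have a1 : |κ * κ'| ≤ M * M := by
    rw [abs_mul]; exact mul_le_mul (h0 _ _) (h0 _ _) (abs_nonneg _) hM
  have a2 : |l * κ'| ≤ M * M := by
    rw [abs_mul]; exact mul_le_mul (h2 _ _) (h0 _ _) (abs_nonneg _) hM
  have a3 : |κ * l'| ≤ M * M := by
    rw [abs_mul]; exact mul_le_mul (h0 _ _) (h2 _ _) (abs_nonneg _) hM
  have a4 : |l * κ' - κ * l'| ≤ 2 * (M * M) := (abs_sub _ _).trans (by linarith)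
  have hJ := one_le_japaneseBracket q.1
  refine (abs_add_le _ _).trans ?_
  rw [abs_mul, abs_mul (ħ / (2 * m)), add_mul]
  refine add_le_add ?_ ?_
  · calc _ ≤ (L * japaneseBracket q.1) * (M * M) := by gcongr
      _ = _ := by ring
  · refine (mul_le_mul_of_nonneg_left a4 (abs_nonneg _)).trans ?_
    exact le_mul_of_one_le_right (by positivity) hJ

theorem exists_bound_cutoffErrorPos (ħ m : ℝ) (j : Fin d) :
    ∃ C : ℝ, ∀ n (q : Space d × Space d),
    ‖cutoffErrorPos ħ m n j q‖ ≤ C * japaneseBracket q.1 := by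
  obtain ⟨M, hM, h0, h1, -⟩ := exists_bound_cutoff d
  refine ⟨|ħ * Real.pi / m| * (2 * (M * M)), fun n q => ?_⟩
  rw [cutoffErrorPos, Complex.norm_real, Real.norm_eq_abs, abs_mul]
  have a2 : |cutoffDeriv n j (relMap ħ q).1 * cutoff d n (relMap ħ q).2| ≤ M * M := by
    rw [abs_mul]; exact mul_le_mul (h1 _ _ _) (h0 _ _) (abs_nonneg _) hM
  have a3 : |cutoff d n (relMap ħ q).1 * cutoffDeriv n j (relMap ħ q).2| ≤ M * M := by
    rw [abs_mul]; exact mul_le_mul (h0 _ _) (h1 _ _ _) (abs_nonneg _) hM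
  refine (mul_le_mul_of_nonneg_left ((abs_sub _ _).trans (add_le_add a2 a3))
    (abs_nonneg _)).trans ?_
  rw [← two_mul]
  exact le_mul_of_one_le_right (by positivity) (one_le_japaneseBracket _)

theorem exists_bound_cutoffErrorVel (ħ m : ℝ) (j : Fin d) :
    ∃ C : ℝ, ∀ n (q : Space d × Space d),
    ‖cutoffErrorVel ħ m n j q‖ ≤ C * japaneseBracket q.1 := by
  obtain ⟨M, hM, h0, h1, -⟩ := exists_bound_cutoff d
  refine ⟨|m⁻¹| * (2 * (M * M)), fun n q => ?_⟩
  rw [cutoffErrorVel, Complex.norm_real, Real.norm_eq_abs, abs_mul]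
  have a2 : |cutoffDeriv n j (relMap ħ q).1 * cutoff d n (relMap ħ q).2| ≤ M * M := by
    rw [abs_mul]; exact mul_le_mul (h1 _ _ _) (h0 _ _) (abs_nonneg _) hM
  have a3 : |cutoff d n (relMap ħ q).1 * cutoffDeriv n j (relMap ħ q).2| ≤ M * M := by
    rw [abs_mul]; exact mul_le_mul (h0 _ _) (h1 _ _ _) (abs_nonneg _) hM
  refine (mul_le_mul_of_nonneg_left ((abs_add_le _ _).trans (add_le_add a2 a3))
    (abs_nonneg _)).trans ?_
  rw [← two_mul]
  exact le_mul_of_one_le_right (by positivity) (one_le_japaneseBracket _)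

theorem tendsto_cutoffProd (ħ : ℝ) (q : Space d × Space d) :
    Tendsto (fun n => cutoffProd ħ n q) atTop (𝓝 1) := by
  obtain ⟨M, hM, -, -, -, t0, -⟩ := exists_bound_cutoff d
  have h := (t0 (relMap ħ q).1).mul (t0 (relMap ħ q).2)
  rw [mul_one] at h
  exact Complex.ofReal_one ▸ (Complex.continuous_ofReal.tendsto _).comp h

theorem tendsto_cutoffPotential (ħ m : ℝ) (V : C(Space d, ℝ)) (q : Space d × Space d) :
    Tendsto (fun n => cutoffPotential ħ m V n q) atTop (𝓝 (relPotential ħ V q)) := by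
  obtain ⟨M, hM, -, -, -, t0, -, t2⟩ := exists_bound_cutoff d
  have h := ((t0 (relMap ħ q).1).mul (t0 (relMap ħ q).2)).const_mul
    (-ħ⁻¹ * (V (relMap ħ q).1 - V (relMap ħ q).2))
  have h' := (((t2 (relMap ħ q).1).mul (t0 (relMap ħ q).2)).sub
    ((t0 (relMap ħ q).1).mul (t2 (relMap ħ q).2))).const_mul (ħ / (2 * m))
  have h3 := h.add h'
  simp only [mul_one, mul_zero, sub_zero, add_zero] at h3
  exact ((Complex.continuous_ofReal.tendsto _).comp h3).const_mul Complex.I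

theorem tendsto_cutoffErrorPos (ħ m : ℝ) (j : Fin d) (q : Space d × Space d) :
    Tendsto (fun n => cutoffErrorPos ħ m n j q) atTop (𝓝 0) := by
  obtain ⟨M, hM, -, -, -, t0, t1, -⟩ := exists_bound_cutoff d
  have h := (((t1 j (relMap ħ q).1).mul (t0 (relMap ħ q).2)).sub
    ((t0 (relMap ħ q).1).mul (t1 j (relMap ħ q).2))).const_mul (ħ * Real.pi / m)
  simp only [mul_one, mul_zero, sub_zero] at h
  exact (Complex.continuous_ofReal.tendsto _).comp h

theorem tendsto_cutoffErrorVel (ħ m : ℝ) (j : Fin d) (q : Space d × Space d) :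
    Tendsto (fun n => cutoffErrorVel ħ m n j q) atTop (𝓝 0) := by
  obtain ⟨M, hM, -, -, -, t0, t1, -⟩ := exists_bound_cutoff d
  have h := (((t1 j (relMap ħ q).1).mul (t0 (relMap ħ q).2)).add
    ((t0 (relMap ħ q).1).mul (t1 j (relMap ħ q).2))).const_mul m⁻¹
  simp only [mul_one, mul_zero, add_zero] at h
  exact (Complex.continuous_ofReal.tendsto _).comp h

theorem packetPairing_zero (G : ℝ × Space d × Space d → ℂ) (η ψ : 𝓢(Space d, ℂ)) (b t : ℝ) :
    packetPairing G (fun _ => 0) η ψ b t = 0 := by simp [packetPairing]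

/-- The transport equation for the density matrix in relative variables, tested against wave
packets moving with velocity `α`. -/
theorem packetPairing_transport {ħ m T : ℝ} (hħ : 0 < ħ) (hm : 0 < m) (hT : 0 < T)
    {V : C(Space d, ℝ)} {L : ℝ≥0} (hL : LipschitzWith L V) {R : ℝ → L2 d →L[ℂ] L2 d}
    (hcont : ∀ f g : L2 d, ContinuousOn (fun t => inner ℂ f (R t g)) (Icc (-T) T))
    (hsol : IsWeakVonNeumannSolution ħ m T V R)
    {G : ℝ × Space d × Space d → ℂ} {M : ℝ≥0} (hG : IsRelKernel ħ T R G M)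
    (α t₀ : ℝ) (η ψ : 𝓢(Space d, ℂ)) {s t : ℝ} (hs : s ∈ Icc (-T) T) (ht : t ∈ Icc (-T) T) :
    packetPairing G (fun _ => 1) η ψ (α * (t - t₀) * (2 * Real.pi / m)) t -
      packetPairing G (fun _ => 1) η ψ (α * (s - t₀) * (2 * Real.pi / m)) s =
    ∫ r in s..t, (Complex.I * ((α - 1) * (2 * Real.pi / m) : ℝ) *
          (∑ j, packetPairing G (fun _ => 1) (coordMul j η) (coordMul j ψ)
            (α * (r - t₀) * (2 * Real.pi / m)) r) +
        packetPairing G (relPotential ħ V) η ψ (α * (r - t₀) * (2 * Real.pi / m)) r) := by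
  have key := fun n => packetPairing_equation hħ hm hT V hcont hsol hG n α t₀ η ψ hs ht
  set c : ℝ → ℝ := fun r => α * (r - t₀) * (2 * Real.pi / m) with hc
  have hcc : Continuous c := by fun_prop
  obtain ⟨B, hB⟩ : ∃ B, ∀ r ∈ uIcc s t, |c r| ≤ B :=
    isCompact_uIcc.exists_bound_of_continuousOn hcc.continuousOn
  obtain ⟨C0, h0⟩ := exists_bound_cutoffProd (d := d) ħ
  obtain ⟨C1, h1⟩ := exists_bound_cutoffPotential hħ m hL
  choose C2 h2 using fun j : Fin d => exists_bound_cutoffErrorPos ħ m j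
  choose C3 h3 using fun j : Fin d => exists_bound_cutoffErrorVel ħ m j
  have a0 := fun n => continuous_cutoffProd (d := d) ħ n
  have a1 := fun n => continuous_cutoffPotential ħ m V n
  have a2 := fun n (j : Fin d) => continuous_cutoffErrorPos ħ m n j
  have a3 := fun n (j : Fin d) => continuous_cutoffErrorVel ħ m n j
  choose K0 k0 using fun j => hG.exists_bound_packetPairing (coordMul j η) (coordMul j ψ) B C0
  obtain ⟨K1, k1⟩ := hG.exists_bound_packetPairing η ψ B C1
  choose K2 k2 using fun j => hG.exists_bound_packetPairing (coordMul j η) ψ B (C2 j)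
  choose K3 k3 using fun j => hG.exists_bound_packetPairing η (coordMul j ψ) B (C3 j)
  have l0 := fun r => hG.tendsto_packetPairing η ψ (c r) r a0 h0 (tendsto_cutoffProd ħ)
  have lhs := (l0 t).sub (l0 s)
  simp only [hc] at lhs
  simp_rw [key] at lhs
  refine tendsto_nhds_unique lhs ?_
  -- As `n → ∞` the terms containing derivatives of cut-offs vanish. The constant majorant is
  -- available because the displacement stays bounded for times between `s` and `t`.
  refine intervalIntegral.tendsto_integral_filter_of_dominated_convergence
    (fun _ => ‖Complex.I * ((α - 1) * (2 * Real.pi / m) : ℝ)‖ * (∑ j, K0 j) + K1 + (∑ j, K2 j) +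
      ∑ j, K3 j) (.of_forall fun n => ?_) (.of_forall fun n => .of_forall fun r hr => ?_)
    intervalIntegrable_const (.of_forall fun r _ => ?_)
  · have sm := fun {A : Space d × Space d → ℂ} (hA : Continuous A) (η ψ : 𝓢(Space d, ℂ)) =>
      stronglyMeasurable_packetPairing hG.stronglyMeasurable hA.measurable η ψ hcc
    exact (((((Finset.stronglyMeasurable_fun_sum _ fun j _ =>
      sm (a0 n) (coordMul j η) (coordMul j ψ)).const_mul _).add (sm (a1 n) η ψ)).add
      (Finset.stronglyMeasurable_fun_sum _ fun j _ => sm (a2 n j) (coordMul j η) ψ)).add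
      (Finset.stronglyMeasurable_fun_sum _ fun j _ =>
        sm (a3 n j) η (coordMul j ψ))).aestronglyMeasurable
  · have hr' := hB r (uIoc_subset_uIcc hr)
    refine (norm_add_le _ _).trans (add_le_add ((norm_add_le _ _).trans (add_le_add
      ((norm_add_le _ _).trans (add_le_add ?_ ?_)) ?_)) ?_)
    · rw [norm_mul]
      gcongr
      exact norm_sum_le_of_le _ fun j _ => k0 j _ (a0 n).measurable (h0 n) _ hr' r
    · exact k1 _ (a1 n).measurable (h1 n) _ hr' r
    · exact norm_sum_le_of_le _ fun j _ => k2 j _ (a2 n j).measurable (h2 j n) _ hr' r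
    · exact norm_sum_le_of_le _ fun j _ => k3 j _ (a3 n j).measurable (h3 j n) _ hr' r
  · have m0 := fun j => hG.tendsto_packetPairing (coordMul j η) (coordMul j ψ) (c r) r a0 h0
      (tendsto_cutoffProd ħ)
    have m1 := hG.tendsto_packetPairing η ψ (c r) r a1 h1 (tendsto_cutoffPotential ħ m V)
    have m2 := fun j => hG.tendsto_packetPairing (coordMul j η) ψ (c r) r (fun n => a2 n j) (h2 j)
      (tendsto_cutoffErrorPos ħ m j)
    have m3 := fun j => hG.tendsto_packetPairing η (coordMul j ψ) (c r) r (fun n => a3 n j) (h3 j)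
      (tendsto_cutoffErrorVel ħ m j)
    have := ((((tendsto_finsetSum Finset.univ fun j _ => m0 j).const_mul
      (Complex.I * ((α - 1) * (2 * Real.pi / m) : ℝ))).add m1).add
      (tendsto_finsetSum Finset.univ fun j _ => m2 j)).add
      (tendsto_finsetSum Finset.univ fun j _ => m3 j)
    simpa only [packetPairing_zero, Finset.sum_const_zero, add_zero] using this

end CutoffLimit

end

section

open Filter Topology
open scoped FourierTransform ContDiff

/-! ### Families of partial Fourier transforms -/

section PartialFourierFamily

variable {d : ℕ}

instance : MeasureTheory.IsSeparable (volume : Measure (Space d × Space d)) := by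
  have : MeasurableSpace.CountablyGenerated (Space d × Space d) := inferInstance
  have : SFinite (volume : Measure (Space d × Space d)) := inferInstance
  infer_instance

/-- By Fubini `t ↦ G(t, ·)` is weakly, hence strongly, measurable into `L²`. The transform preserves
this, and a jointly measurable representative is then chosen. -/
theorem exists_partialFourier_family {G : ℝ × Space d × Space d → ℂ} (hG : StronglyMeasurable G)
    {M : ℝ≥0} (hM : ∀ t, ∫⁻ q, ‖G (t, q)‖ₑ ^ 2 ≤ M) :
    ∃ h : ℝ × Space d × Space d → ℂ, StronglyMeasurable h ∧
      (∀ t, ∫⁻ p, ‖h (t, p)‖ₑ ^ 2 ≤ M) ∧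
      ∀ t (Φ : 𝓢(Space d × Space d, ℂ)),
        ∫ p, h (t, p) * Φ p = ∫ p, G (t, p) * partialFourier Φ p := by
  have hfact : Fact ((2 : ℝ≥0∞) ≠ ⊤) := ⟨by norm_num⟩
  have hmem : ∀ t, MemLp (fun q => G (t, q)) 2 volume := fun t =>
    (memLp_two_iff_lintegral
      (hG.comp_measurable measurable_prodMk_left).aestronglyMeasurable).2
      ((hM t).trans_lt ENNReal.coe_lt_top)
  have hsm : StronglyMeasurable fun t => (hmem t).toLp _ := by
    refine stronglyMeasurable_of_inner fun f => ?_
    have e : ∀ t, inner ℂ f ((hmem t).toLp _) = ∫ q, G (t, q) * starRingEnd ℂ (f q) := fun t => by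
      rw [inner_L2_eq]
      refine integral_congr_ae ?_
      filter_upwards [(hmem t).coeFn_toLp] with q hq
      rw [hq]
    simp_rw [e]
    have hf : StronglyMeasurable (f : Space d × Space d → ℂ) := Lp.stronglyMeasurable f
    exact (hG.mul ((Complex.continuous_conj.comp_stronglyMeasurable hf).comp_measurable
      measurable_snd)).integral_prod_right.measurable
  obtain ⟨h, hh, he⟩ := exists_jointlyMeasurable
    (partialFourierL2.continuous.comp_stronglyMeasurable hsm)
  refine ⟨h, hh, fun t => ?_, fun t Φ => ?_⟩
  · have e : ∫⁻ p, ‖h (t, p)‖ₑ ^ 2 = ‖partialFourierL2 ((hmem t).toLp _)‖ₑ ^ 2 := by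
      rw [enorm_Lp_sq]
      refine lintegral_congr_ae ?_
      filter_upwards [he t] with p hp
      rw [hp]
    rw [e]
    refine le_trans ?_ (hM t)
    rw [← enorm_toLp_sq (hmem t)]
    gcongr
    rw [← ofReal_norm, ← ofReal_norm]
    exact ENNReal.ofReal_le_ofReal (norm_partialFourierL2_le _)
  · have e1 : ∫ p, h (t, p) * Φ p = ∫ p, partialFourierL2 ((hmem t).toLp _) p * Φ p := by
      refine integral_congr_ae ?_
      filter_upwards [he t] with p hp
      rw [hp]
    rw [e1, integral_partialFourierL2_mul]
    refine integral_congr_ae ?_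
    filter_upwards [(hmem t).coeFn_toLp] with p hp
    rw [hp]

end PartialFourierFamily

/-! ### Averages over moving profiles -/

section MovingAverage

variable {d : ℕ}

/-- A weight bounded by `(1 + |y|²)^{1/2}`. -/
structure IsBracketWeight (ρ : Space d → ℂ) : Prop where
  continuous : Continuous ρ
  norm_le : ∀ y, ‖ρ y‖ ≤ japaneseBracket y

theorem isBracketWeight_one : IsBracketWeight (fun _ : Space d => (1 : ℂ)) :=
  ⟨continuous_const, fun y => by simpa using one_le_japaneseBracket y⟩

theorem isBracketWeight_bracket : IsBracketWeight (fun y : Space d => (japaneseBracket y : ℂ)) :=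
  ⟨Complex.continuous_ofReal.comp continuous_japaneseBracket, fun y => by
    rw [Complex.norm_real, Real.norm_eq_abs, abs_of_pos (japaneseBracket_pos y)]⟩

/-- The average `∫ F(r, y, ξ) ρ(y) χ(y - b ξ) dy`. -/
def movingAverage (F : ℝ × Space d × Space d → ℂ) (ρ : Space d → ℂ) (χ : 𝓢(Space d, ℂ))
    (b r : ℝ) (ξ : Space d) : ℂ :=
  ∫ y, F (r, y, ξ) * (ρ y * χ (y - b • ξ))

/-- A jointly measurable family which is bounded in `L²`. -/
structure IsBoundedFamily (F : ℝ × Space d × Space d → ℂ) (N : ℝ≥0) : Prop where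
  stronglyMeasurable : StronglyMeasurable F
  lintegral_sq_le : ∀ r, ∫⁻ p, ‖F (r, p)‖ₑ ^ 2 ≤ N

variable {F : ℝ × Space d × Space d → ℂ} {N : ℝ≥0} {ρ : Space d → ℂ}

theorem IsBoundedFamily.memLp (hF : IsBoundedFamily F N) (r : ℝ) :
    MemLp (fun p => F (r, p)) 2 volume :=
  (memLp_two_iff_lintegral
    (hF.stronglyMeasurable.comp_measurable measurable_prodMk_left).aestronglyMeasurable).2
    ((hF.lintegral_sq_le r).trans_lt ENNReal.coe_lt_top)

theorem enorm_weight_mul_le (hρ : IsBracketWeight ρ) (Φ : 𝓢(Space d × Space d, ℂ))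
    (p : Space d × Space d) : ‖ρ p.1 * Φ p‖ₑ ≤ ‖bracketMul Φ p‖ₑ := by
  rw [bracketMul_apply, enorm_mul, enorm_mul]
  gcongr
  rw [← ofReal_norm, ← ofReal_norm, Complex.norm_real, Real.norm_eq_abs,
    abs_of_pos (japaneseBracket_pos _)]
  exact ENNReal.ofReal_le_ofReal (hρ.norm_le _)

theorem memLp_weight_mul (hρ : IsBracketWeight ρ) (Φ : 𝓢(Space d × Space d, ℂ)) :
    MemLp (fun p : Space d × Space d => ρ p.1 * Φ p) 2 volume :=
  MemLp.mono (g := bracketMul Φ) ((bracketMul Φ).memLp 2)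
    ((hρ.continuous.comp continuous_fst).mul Φ.continuous).aestronglyMeasurable
    (.of_forall fun p => by
      have := enorm_weight_mul_le hρ Φ p
      rw [← ofReal_norm, ← ofReal_norm] at this
      exact (ENNReal.ofReal_le_ofReal_iff (norm_nonneg _)).1 this)

theorem IsBoundedFamily.integrable_mul (hF : IsBoundedFamily F N) (hρ : IsBracketWeight ρ)
    (Φ : 𝓢(Space d × Space d, ℂ)) (r : ℝ) :
    Integrable fun p : Space d × Space d => F (r, p) * (ρ p.1 * Φ p) :=
  integrable_mul_of_memLp (hF.memLp r) (memLp_weight_mul hρ Φ)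

theorem stronglyMeasurable_movingIntegrand (hF : StronglyMeasurable F) (hρ : Continuous ρ)
    (χ : 𝓢(Space d, ℂ)) : StronglyMeasurable fun p : (ℝ × ℝ × Space d) × Space d =>
      F (p.1.2.1, p.2, p.1.2.2) * (ρ p.2 * χ (p.2 - p.1.1 • p.1.2.2)) := by
  have h1 : Measurable fun p : (ℝ × ℝ × Space d) × Space d => (p.1.2.1, p.2, p.1.2.2) := by
    fun_prop
  have h2 : Continuous fun p : (ℝ × ℝ × Space d) × Space d =>
      ρ p.2 * χ (p.2 - p.1.1 • p.1.2.2) := by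
    have := χ.continuous
    fun_prop
  exact (hF.comp_measurable h1).mul h2.stronglyMeasurable

theorem stronglyMeasurable_movingAverage (hF : StronglyMeasurable F) (hρ : Continuous ρ)
    (χ : 𝓢(Space d, ℂ)) :
    StronglyMeasurable fun p : ℝ × ℝ × Space d => movingAverage F ρ χ p.1 p.2.1 p.2.2 :=
  (stronglyMeasurable_movingIntegrand hF hρ χ).integral_prod_right

/-- Fubini. It translates identities between packet pairings, valid for every `η`, into identities
for almost every `ξ`. -/
theorem IsBoundedFamily.integral_mul_movingAverage (hF : IsBoundedFamily F N)
    (hρ : IsBracketWeight ρ) (χ η : 𝓢(Space d, ℂ)) (b r : ℝ) :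
    (Integrable fun ξ => η ξ * movingAverage F ρ χ b r ξ) ∧
      ∫ ξ, η ξ * movingAverage F ρ χ b r ξ =
        ∫ p : Space d × Space d, F (r, p) * (ρ p.1 * shearedTest χ η b p) := by
  have hi := hF.integrable_mul hρ (shearedTest χ η b) r
  have e : ∀ ξ, η ξ * movingAverage F ρ χ b r ξ =
      ∫ y, F (r, y, ξ) * (ρ y * shearedTest χ η b (y, ξ)) := fun ξ => by
    rw [movingAverage, ← integral_const_mul]
    refine integral_congr_ae (.of_forall fun y => ?_)
    simp only [shearedTest_apply]; ring
  rw [Measure.volume_eq_prod] at hi ⊢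
  refine ⟨?_, ?_⟩
  · simp_rw [e]
    exact hi.integral_prod_right
  · simp_rw [e]
    exact (integral_prod_symm _ hi).symm

theorem ENNReal_le_one_add_sq (x : ℝ≥0∞) : x ≤ 1 + x ^ 2 := by
  rcases le_total x 1 with h | h
  · exact h.trans le_self_add
  · refine le_add_left ?_
    rw [sq]
    exact le_mul_of_one_le_right' h

theorem IsBoundedFamily.exists_bound_lintegral (hF : IsBoundedFamily F N)
    (hρ : IsBracketWeight ρ) (χ η : 𝓢(Space d, ℂ)) (B : ℝ) : ∃ C : ℝ≥0, ∀ b, |b| ≤ B → ∀ r,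
      ∫⁻ ξ, ‖η ξ * movingAverage F ρ χ b r ξ‖ₑ ≤ C := by
  set Z := 1 + (N : ℝ≥0∞) * (ENNReal.ofReal (2 * (1 + B ^ 2)) *
      ((∫⁻ y, ‖japaneseMul χ y‖ₑ ^ 2) * ∫⁻ ξ, ‖japaneseMul η ξ‖ₑ ^ 2)) with hZ
  have hfin : Z ≠ ⊤ := by
    refine ENNReal.add_ne_top.2 ⟨ENNReal.one_ne_top, ENNReal.mul_ne_top ENNReal.coe_ne_top
      (ENNReal.mul_ne_top ENNReal.ofReal_ne_top (ENNReal.mul_ne_top ?_ ?_))⟩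
    · exact (lintegral_sq_lt_top_of_memLp (μ := volume) ((japaneseMul χ).memLp 2)).ne
    · exact (lintegral_sq_lt_top_of_memLp (μ := volume) ((japaneseMul η).memLp 2)).ne
  refine ⟨Z.toNNReal, fun b hb r => ?_⟩
  rw [ENNReal.coe_toNNReal hfin]
  have hm : AEStronglyMeasurable (fun p : Space d × Space d =>
      F (r, p) * (ρ p.1 * shearedTest χ η b p)) volume :=
    (hF.integrable_mul hρ (shearedTest χ η b) r).1
  calc ∫⁻ ξ, ‖η ξ * movingAverage F ρ χ b r ξ‖ₑ
      ≤ ∫⁻ ξ, ∫⁻ y, ‖F (r, y, ξ) * (ρ y * shearedTest χ η b (y, ξ))‖ₑ := by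
        refine lintegral_mono fun ξ => ?_
        rw [movingAverage, ← integral_const_mul]
        refine (enorm_integral_le_lintegral_enorm _).trans (le_of_eq ?_)
        refine lintegral_congr fun y => ?_
        simp only [shearedTest_apply]
        congr 1
        ring
    _ = ∫⁻ p : Space d × Space d, ‖F (r, p) * (ρ p.1 * shearedTest χ η b p)‖ₑ := by
        rw [Measure.volume_eq_prod] at hm ⊢
        exact (lintegral_prod_symm _ hm.enorm).symm
    -- Only finiteness matters, so `x ≤ 1 + x²` gives access to Cauchy-Schwarz in squared form.
    _ ≤ 1 + (∫⁻ p : Space d × Space d, ‖F (r, p) * (ρ p.1 * shearedTest χ η b p)‖ₑ) ^ 2 :=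
        ENNReal_le_one_add_sq _
    _ ≤ Z := by
        rw [hZ]
        gcongr
        simp_rw [enorm_mul (F _)]
        refine (lintegral_mul_sq_le (hF.memLp r).1.enorm
          (memLp_weight_mul hρ (shearedTest χ η b)).1.enorm).trans
          (mul_le_mul' (hF.lintegral_sq_le r) ?_)
        refine (lintegral_mono fun p => pow_le_pow_left' (enorm_weight_mul_le hρ _ p) 2).trans
          ((lintegral_bracketMul_shearedTest_le χ η b).trans ?_)
        have hb' : b ^ 2 ≤ B ^ 2 := sq_le_sq' (abs_le.1 hb).1 (abs_le.1 hb).2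
        exact mul_le_mul_left (ENNReal.ofReal_le_ofReal (by linarith)) _

theorem IsBoundedFamily.intervalIntegral_movingAverage (hF : IsBoundedFamily F N)
    (hρ : IsBracketWeight ρ) (χ η : 𝓢(Space d, ℂ)) {c : ℝ → ℝ} (hc : Continuous c) (s t : ℝ) :
    (Integrable fun ξ => η ξ * ∫ r in s..t, movingAverage F ρ χ (c r) r ξ) ∧
      ∫ ξ, η ξ * (∫ r in s..t, movingAverage F ρ χ (c r) r ξ) =
        ∫ r in s..t, ∫ p : Space d × Space d, F (r, p) * (ρ p.1 * shearedTest χ η (c r) p) := by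
  obtain ⟨B, hB⟩ : ∃ B, ∀ r ∈ uIcc s t, |c r| ≤ B :=
    isCompact_uIcc.exists_bound_of_continuousOn hc.continuousOn
  obtain ⟨C, hC⟩ := hF.exists_bound_lintegral hρ χ η B
  have hm : StronglyMeasurable fun p : ℝ × Space d =>
      η p.2 * movingAverage F ρ χ (c p.1) p.1 p.2 := by
    have h1 : Measurable fun p : ℝ × Space d => (c p.1, p.1, p.2) := by
      have := hc.measurable
      fun_prop
    have h2 := (stronglyMeasurable_movingAverage hF.stronglyMeasurable hρ.continuous χ
      ).comp_measurable h1
    have h3 : StronglyMeasurable fun p : ℝ × Space d => η p.2 :=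
      (η.continuous.comp continuous_snd).stronglyMeasurable
    exact h3.mul h2
  have hi : Integrable (Function.uncurry fun (r : ℝ) (ξ : Space d) =>
      η ξ * movingAverage F ρ χ (c r) r ξ) ((volume.restrict (uIoc s t)).prod volume) := by
    refine ⟨hm.aestronglyMeasurable, ?_⟩
    have he : ∫⁻ p, ‖η p.2 * movingAverage F ρ χ (c p.1) p.1 p.2‖ₑ
        ∂((volume.restrict (uIoc s t)).prod volume) < ⊤ := by
      rw [lintegral_prod _ hm.enorm.aemeasurable]
      calc _ ≤ ∫⁻ r in uIoc s t, (C : ℝ≥0∞) := by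
            refine setLIntegral_mono measurable_const fun r hr => ?_
            exact hC _ (hB r (uIoc_subset_uIcc hr)) r
        _ < ⊤ := by
            rw [setLIntegral_const]
            exact ENNReal.mul_lt_top ENNReal.coe_lt_top (by simp [uIoc])
    exact he
  have e : ∀ ξ, η ξ * (∫ r in s..t, movingAverage F ρ χ (c r) r ξ) =
      ∫ r in s..t, η ξ * movingAverage F ρ χ (c r) r ξ := fun ξ =>
    (intervalIntegral.integral_const_mul _ _).symm
  constructor
  · simp_rw [e, intervalIntegral.intervalIntegral_eq_integral_uIoc]
    exact (hi.integral_prod_right).smul (if s ≤ t then (1 : ℝ) else -1)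
  · simp_rw [e]
    rw [← intervalIntegral_integral_swap hi]
    exact intervalIntegral.integral_congr fun r _ =>
      (hF.integral_mul_movingAverage hρ χ η (c r) r).2

/-- A function whose products with Schwartz functions are integrable with integral zero
vanishes almost everywhere. -/
theorem ae_eq_zero_of_integral_schwartz_mul {f : Space d → ℂ}
    (hi : ∀ η : 𝓢(Space d, ℂ), Integrable fun ξ => η ξ * f ξ)
    (h0 : ∀ η : 𝓢(Space d, ℂ), ∫ ξ, η ξ * f ξ = 0) : ∀ᵐ ξ, f ξ = 0 := by
  have hs : ∀ g : Space d → ℝ, ContDiff ℝ ∞ g → HasCompactSupport g →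
      ∃ η : 𝓢(Space d, ℂ), ∀ ξ, η ξ = g ξ := fun g hg hgc =>
    ⟨(hgc.comp_left (g := ((↑) : ℝ → ℂ)) Complex.ofReal_zero).toSchwartzMap
      (Complex.ofRealCLM.contDiff.comp hg), fun ξ => rfl⟩
  refine ae_eq_zero_of_integral_contDiff_smul_eq_zero (fun x => ?_) fun g hg hgc => ?_
  · let β : ContDiffBump x := ⟨1, 2, one_pos, one_lt_two⟩
    obtain ⟨η, hη⟩ := hs β β.contDiff β.hasCompactSupport
    refine ⟨Metric.closedBall x 1, Metric.closedBall_mem_nhds x one_pos, ?_⟩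
    refine (hi η).integrableOn.congr_fun (fun ξ hξ => ?_) measurableSet_closedBall
    simp only [hη, β.one_of_mem_closedBall hξ, Complex.ofReal_one, one_mul]
  · obtain ⟨η, hη⟩ := hs g hg hgc
    rw [← h0 η]
    refine integral_congr_ae (.of_forall fun ξ => ?_)
    simp [hη]

end MovingAverage

/-! ### The transport equation on the Fourier side -/

section FourierTransport

variable {d : ℕ}

/-- `h` and `K` are bounded in `L²` and solve `∂ₜ h + β ξ · ∂_y h = (1 + |y|²)^{1/2} K` in a weak
form: tested against profiles `χ(y) η(ξ)`, moving with the flow or at rest. -/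
structure IsTransportPair (β T : ℝ) (h K : ℝ × Space d × Space d → ℂ) (M N : ℝ≥0) : Prop where
  fst : IsBoundedFamily h M
  snd : IsBoundedFamily K N
  moving : ∀ ψ : 𝓢(Space d, ℂ), ∀ s ∈ Icc (-T) T, ∀ t ∈ Icc (-T) T, ∀ᵐ ξ : Space d,
    movingAverage h (fun _ => 1) (angularFourier ψ) 0 t ξ =
      movingAverage h (fun _ => 1) (angularFourier ψ) ((s - t) * β) s ξ +
        ∫ r in s..t, movingAverage K (fun y => (japaneseBracket y : ℂ)) (angularFourier ψ)
          ((r - t) * β) r ξ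
  atRest : ∀ ψ : 𝓢(Space d, ℂ), ∀ s ∈ Icc (-T) T, ∀ t ∈ Icc (-T) T, ∀ᵐ ξ : Space d,
    movingAverage h (fun _ => 1) (angularFourier ψ) 0 t ξ -
      movingAverage h (fun _ => 1) (angularFourier ψ) 0 s ξ =
        (-(Complex.I * (β : ℂ)) * ∑ j, (ξ j : ℂ) * ∫ r in s..t,
          movingAverage h (fun _ => 1) (angularFourier (coordMul j ψ)) 0 r ξ) +
        ∫ r in s..t, movingAverage K (fun y => (japaneseBracket y : ℂ)) (angularFourier ψ) 0 r ξ

theorem IsRelKernel.intervalIntegrable_packetPairing {ħ T : ℝ} {R : ℝ → L2 d →L[ℂ] L2 d}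
    {G : ℝ × Space d × Space d → ℂ} {M : ℝ≥0} (hG : IsRelKernel ħ T R G M)
    (η ψ : 𝓢(Space d, ℂ)) {A : Space d × Space d → ℂ} (hA : Measurable A) {C : ℝ}
    (hAC : ∀ q, ‖A q‖ ≤ C * japaneseBracket q.1) (b s t : ℝ) :
    IntervalIntegrable (fun r => packetPairing G A η ψ b r) volume s t := by
  obtain ⟨K, hK⟩ := hG.exists_bound_packetPairing η ψ |b| C
  refine (intervalIntegrable_const (c := K)).mono_fun ?_ (.of_forall fun r => ?_)
  · exact (stronglyMeasurable_packetPairing hG.stronglyMeasurable hA η ψ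
      (continuous_const (y := b))).aestronglyMeasurable
  · exact (hK A hA hAC b le_rfl r).trans (Real.le_norm_self K)

theorem packetPairing_one_eq {G h : ℝ × Space d × Space d → ℂ} {t : ℝ}
    (hGh : ∀ Φ : 𝓢(Space d × Space d, ℂ),
      ∫ p, h (t, p) * Φ p = ∫ p, G (t, p) * partialFourier Φ p) (η ψ : 𝓢(Space d, ℂ)) (b : ℝ) :
    packetPairing G (fun _ => 1) η ψ b t =
      ∫ p : Space d × Space d, h (t, p) * ((fun _ => (1 : ℂ)) p.1 *
        shearedTest (angularFourier ψ) η b p) := by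
  simp only [one_mul, packetPairing, wavePacket_eq]
  exact (hGh _).symm

/-- The density matrix multiplied by the bounded function `(iħ)⁻¹ (V(X) - V(Y)) / (1 + |y|²)^{1/2}`. -/
def potentialSource (ħ : ℝ) (V : C(Space d, ℝ)) (G : ℝ × Space d × Space d → ℂ)
    (p : ℝ × Space d × Space d) : ℂ :=
  G p * (relPotential ħ V p.2 * (japaneseBracket p.2.1 : ℂ)⁻¹)

/-- The linear growth of the potential multiplier is divided out of the source, so that `K` is
square integrable, and returned to the test function, which can carry it. -/
theorem packetPairing_relPotential_eq {ħ : ℝ} {V : C(Space d, ℝ)}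
    {G K : ℝ × Space d × Space d → ℂ} {t : ℝ}
    (hGK : ∀ Φ : 𝓢(Space d × Space d, ℂ),
      ∫ p, K (t, p) * Φ p = ∫ p, potentialSource ħ V G (t, p) * partialFourier Φ p)
    (η ψ : 𝓢(Space d, ℂ)) (b : ℝ) :
    packetPairing G (relPotential ħ V) η ψ b t =
      ∫ p : Space d × Space d, K (t, p) * ((fun y => (japaneseBracket y : ℂ)) p.1 *
        shearedTest (angularFourier ψ) η b p) := by
  simp only [← bracketMul_apply]
  rw [hGK, packetPairing]
  refine integral_congr_ae (.of_forall fun p => ?_)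
  simp only [potentialSource, wavePacket_eq, partialFourier_bracketMul]
  have : (japaneseBracket p.1 : ℂ) ≠ 0 := by exact_mod_cast (japaneseBracket_pos p.1).ne'
  field_simp

/-- `h` and `K` are the Fourier transforms in `x` of the density matrix and of its product with the
normalised potential difference, which is at most `L` in modulus. Both identities follow from
`packetPairing_transport` by letting `η` vary. -/
theorem IsRelKernel.exists_transportPair {ħ m T : ℝ} (hħ : 0 < ħ) (hm : 0 < m) (hT : 0 < T)
    {V : C(Space d, ℝ)} {L : ℝ≥0} (hL : LipschitzWith L V) {R : ℝ → L2 d →L[ℂ] L2 d}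
    (hcont : ∀ f g : L2 d, ContinuousOn (fun t => inner ℂ f (R t g)) (Icc (-T) T))
    (hsol : IsWeakVonNeumannSolution ħ m T V R)
    {G : ℝ × Space d × Space d → ℂ} {M : ℝ≥0} (hG : IsRelKernel ħ T R G M) :
    ∃ h K, IsTransportPair (2 * Real.pi / m) T h K M (L ^ 2 * M) ∧
      ∀ t (Φ : 𝓢(Space d × Space d, ℂ)),
        ∫ p, h (t, p) * Φ p = ∫ p, G (t, p) * partialFourier Φ p := by
  obtain ⟨h, h1, h2, h3⟩ := exists_partialFourier_family hG.stronglyMeasurable hG.lintegral_sq_le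
  have s1 : StronglyMeasurable (potentialSource ħ V G) := by
    have c1 := (continuous_relPotential ħ V).comp (continuous_snd (X := ℝ))
    have c2 : Measurable fun p : ℝ × Space d × Space d => (japaneseBracket p.2.1 : ℂ)⁻¹ :=
      ((Complex.continuous_ofReal.comp continuous_japaneseBracket).measurable.comp
        (measurable_fst.comp measurable_snd)).inv
    exact hG.stronglyMeasurable.mul (c1.stronglyMeasurable.mul c2.stronglyMeasurable)
  have s2 : ∀ t, ∫⁻ q, ‖potentialSource ħ V G (t, q)‖ₑ ^ 2 ≤ (L ^ 2 * M : ℝ≥0) := fun t => by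
    calc _ ≤ ∫⁻ q, (L : ℝ≥0∞) ^ 2 * ‖G (t, q)‖ₑ ^ 2 := lintegral_mono fun q => by
          rw [potentialSource, mul_comm, enorm_mul, mul_pow]
          gcongr
          rw [← ofReal_norm, norm_mul, norm_inv, Complex.norm_real, Real.norm_eq_abs,
            abs_of_pos (japaneseBracket_pos _), ← div_eq_mul_inv]
          refine (ENNReal.ofReal_le_ofReal ((div_le_iff₀ (japaneseBracket_pos _)).2
            (norm_relPotential_le hħ hL q))).trans (le_of_eq ?_)
          simp
      _ ≤ _ := by
          rw [lintegral_const_mul' _ _ (by simp)]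
          push_cast
          gcongr
          exact hG.lintegral_sq_le t
  obtain ⟨K, k1, k2, k3⟩ := exists_partialFourier_family s1 s2
  have bh : IsBoundedFamily h M := ⟨h1, h2⟩
  have bK : IsBoundedFamily K (L ^ 2 * M) := ⟨k1, k2⟩
  refine ⟨h, K, ⟨bh, bK, fun ψ s hs t ht => ?_, fun ψ s hs t ht => ?_⟩, h3⟩
  · have hc : Continuous fun r : ℝ => (r - t) * (2 * Real.pi / m) := by fun_prop
    have i1 := fun η => bh.integral_mul_movingAverage isBracketWeight_one (angularFourier ψ) η 0 t
    have i2 := fun η => bh.integral_mul_movingAverage isBracketWeight_one (angularFourier ψ) η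
      ((s - t) * (2 * Real.pi / m)) s
    have i3 := fun η => bK.intervalIntegral_movingAverage isBracketWeight_bracket
      (angularFourier ψ) η hc s t
    have hz := ae_eq_zero_of_integral_schwartz_mul (f := fun ξ =>
      movingAverage h (fun _ => 1) (angularFourier ψ) 0 t ξ -
      movingAverage h (fun _ => 1) (angularFourier ψ) ((s - t) * (2 * Real.pi / m)) s ξ -
        ∫ r in s..t, movingAverage K (fun y => (japaneseBracket y : ℂ)) (angularFourier ψ)
          ((r - t) * (2 * Real.pi / m)) r ξ)
      (fun η => (((i1 η).1.sub (i2 η).1).sub (i3 η).1).congr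
        (.of_forall fun ξ => by simp only [Pi.sub_apply]; ring)) (fun η => by
        have e := integral_sub ((i1 η).1.sub (i2 η).1) (i3 η).1
        have e' := integral_sub (i1 η).1 (i2 η).1
        simp only [Pi.sub_apply] at e e'
        simp only [mul_sub]
        rw [e, e', (i1 η).2, (i2 η).2, (i3 η).2]
        -- With `α = 1` the transport term drops out, and the reference time `t` makes the packet
        -- undisplaced at the final time.
        have key := packetPairing_transport hħ hm hT hL hcont hsol hG 1 t η ψ hs ht
        simp only [sub_self, zero_mul, mul_zero, one_mul, Complex.ofReal_zero, zero_add] at key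
        rw [packetPairing_one_eq (h3 t), packetPairing_one_eq (h3 s)] at key
        simp only [packetPairing_relPotential_eq (k3 _)] at key
        rw [key, sub_self])
    filter_upwards [hz] with ξ hξ
    linear_combination hξ
  · have i1 := fun η => bh.integral_mul_movingAverage isBracketWeight_one (angularFourier ψ) η 0 t
    have i2 := fun η => bh.integral_mul_movingAverage isBracketWeight_one (angularFourier ψ) η 0 s
    have i3 := fun η => bK.intervalIntegral_movingAverage isBracketWeight_bracket
      (angularFourier ψ) η (c := fun _ => 0) continuous_const s t
    have i4 := fun (η : 𝓢(Space d, ℂ)) (j : Fin d) => bh.intervalIntegral_movingAverage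
      isBracketWeight_one (angularFourier (coordMul j ψ)) (coordMul j η) (c := fun _ => 0)
      continuous_const s t
    have e4 : ∀ (η : 𝓢(Space d, ℂ)) (ξ : Space d), η ξ * (-(Complex.I * ((2 * Real.pi / m : ℝ) : ℂ)) *
        ∑ j, (ξ j : ℂ) * ∫ r in s..t,
          movingAverage h (fun _ => 1) (angularFourier (coordMul j ψ)) 0 r ξ) =
        -(Complex.I * ((2 * Real.pi / m : ℝ) : ℂ)) * ∑ j, coordMul j η ξ * ∫ r in s..t,
          movingAverage h (fun _ => 1) (angularFourier (coordMul j ψ)) 0 r ξ := fun η ξ => by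
      simp only [coordMul_apply, Finset.mul_sum]
      exact Finset.sum_congr rfl fun j _ => by ring
    have i5 : ∀ η : 𝓢(Space d, ℂ), Integrable fun ξ =>
        -(Complex.I * ((2 * Real.pi / m : ℝ) : ℂ)) * ∑ j, coordMul j η ξ * ∫ r in s..t,
          movingAverage h (fun _ => 1) (angularFourier (coordMul j ψ)) 0 r ξ := fun η =>
      (integrable_finsetSum _ fun j _ => (i4 η j).1).const_mul _
    have hz := ae_eq_zero_of_integral_schwartz_mul (f := fun ξ =>
      movingAverage h (fun _ => 1) (angularFourier ψ) 0 t ξ -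
      movingAverage h (fun _ => 1) (angularFourier ψ) 0 s ξ -
        (∫ r in s..t, movingAverage K (fun y => (japaneseBracket y : ℂ)) (angularFourier ψ) 0 r ξ) -
        (-(Complex.I * ((2 * Real.pi / m : ℝ) : ℂ)) * ∑ j, (ξ j : ℂ) * ∫ r in s..t,
          movingAverage h (fun _ => 1) (angularFourier (coordMul j ψ)) 0 r ξ)) ?_ ?_
    · filter_upwards [hz] with ξ hξ
      linear_combination hξ
    · intro η
      refine ((((i1 η).1.sub (i2 η).1).sub (i3 η).1).sub (i5 η)).congr (.of_forall fun ξ => ?_)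
      simp only [Pi.sub_apply, mul_sub, e4]
    · intro η
      have a1 := integral_sub (((i1 η).1.sub (i2 η).1).sub (i3 η).1) (i5 η)
      have a2 := integral_sub ((i1 η).1.sub (i2 η).1) (i3 η).1
      have a3 := integral_sub (i1 η).1 (i2 η).1
      simp only [Pi.sub_apply] at a1 a2 a3
      simp only [mul_sub, e4]
      rw [a1, a2, a3, (i1 η).2, (i2 η).2, (i3 η).2, integral_const_mul,
        integral_finsetSum _ fun j _ => (i4 η j).1]
      simp only [fun j => (i4 η j).2]
      -- With `α = 0` the packet never moves and the transport term survives with coefficient `-iβ`;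
      -- the reference time is then irrelevant.
      have key := packetPairing_transport hħ hm hT hL hcont hsol hG 0 0 η ψ hs ht
      simp only [zero_mul, zero_sub] at key
      have n1 : ∀ q : Space d × Space d, ‖(1 : ℂ)‖ ≤ 1 * japaneseBracket q.1 := fun q => by
        simpa using one_le_japaneseBracket q.1
      rw [intervalIntegral.integral_add, intervalIntegral.integral_const_mul,
        intervalIntegral.integral_finsetSum] at key
      · rw [packetPairing_one_eq (h3 t), packetPairing_one_eq (h3 s)] at key
        simp only [packetPairing_relPotential_eq (k3 _), packetPairing_one_eq (h3 _)] at key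
        rw [key]
        push_cast
        ring
      · exact fun j _ => hG.intervalIntegrable_packetPairing _ _ measurable_const n1 0 s t
      · refine IntervalIntegrable.const_mul ?_ _
        have h := IntervalIntegrable.sum (μ := volume) (a := s) (b := t) Finset.univ
          (f := fun j r => packetPairing G (fun _ => 1) (coordMul j η) (coordMul j ψ) 0 r)
          fun j _ => hG.intervalIntegrable_packetPairing (coordMul j η) (coordMul j ψ)
            measurable_const n1 0 s t
        rwa [Finset.sum_fn] at h
      · exact hG.intervalIntegrable_packetPairing _ _ (continuous_relPotential ħ V).measurable
          (norm_relPotential_le hħ hL) 0 s t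

end FourierTransport

end

section

open Filter Topology
open scoped FourierTransform ContDiff

/-! ### Inequalities for integrals -/

section WeightedCauchySchwarz

variable {α : Type*} [MeasurableSpace α] {μ : Measure α}

theorem lintegral_mul_mul_sq_le {f g w : α → ℝ≥0∞} (hf : AEMeasurable f μ) (hg : AEMeasurable g μ)
    (hw : AEMeasurable w μ) :
    (∫⁻ x, f x * (g x * w x) ∂μ) ^ 2 ≤
      (∫⁻ x, f x ^ 2 * w x ∂μ) * ∫⁻ x, g x ^ 2 * w x ∂μ := by
  have hs : ∀ x : ℝ≥0∞, (x ^ (1 / 2 : ℝ)) ^ 2 = x := fun x => by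
    rw [← ENNReal.rpow_natCast, ← ENNReal.rpow_mul]; norm_num
  have hw' : AEMeasurable (fun x => w x ^ (1 / 2 : ℝ)) μ := hw.pow_const _
  have h := lintegral_mul_sq_le (hf.mul hw') (hg.mul hw')
  simp only [Pi.mul_apply, mul_pow, hs] at h
  refine le_trans (le_of_eq ?_) h
  congr 1
  refine lintegral_congr fun x => ?_
  calc f x * (g x * w x) = f x * (g x * (w x ^ (1 / 2 : ℝ)) ^ 2) := by rw [hs]
    _ = _ := by ring

theorem add_sq_le_two_mul (x y : ℝ≥0∞) : (x + y) ^ 2 ≤ 2 * x ^ 2 + 2 * y ^ 2 := by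
  have h := ENNReal.rpow_add_le_mul_rpow_add_rpow x y (p := 2) (by norm_num)
  rw [← mul_add]
  norm_num at h
  simpa using h

theorem sum_sq_le_card_mul {ι : Type*} (s : Finset ι) (f : ι → ℝ≥0∞) :
    (∑ i ∈ s, f i) ^ 2 ≤ 2 ^ s.card * ∑ i ∈ s, f i ^ 2 := by
  classical
  induction s using Finset.induction_on with
  | empty => simp
  | insert a s ha ih =>
    rw [Finset.sum_insert ha, Finset.sum_insert ha, Finset.card_insert_of_notMem ha]
    calc (f a + ∑ i ∈ s, f i) ^ 2 ≤ 2 * f a ^ 2 + 2 * (∑ i ∈ s, f i) ^ 2 := add_sq_le_two_mul _ _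
      _ ≤ 2 * (2 ^ s.card * f a ^ 2) + 2 * (2 ^ s.card * ∑ i ∈ s, f i ^ 2) := by
        gcongr
        exact le_mul_of_one_le_left' (one_le_pow₀ (by norm_num))
      _ = _ := by ring

end WeightedCauchySchwarz

section TimeAveraging

variable {d : ℕ}

/-- The length `T (1 + |ξ|)^{-1/2}` of the time average at frequency `ξ`. -/
def averagingTime (T : ℝ) (ξ : Space d) : ℝ := T / Real.sqrt (1 + ‖ξ‖)

theorem averagingTime_pos {T : ℝ} (hT : 0 < T) (ξ : Space d) : 0 < averagingTime T ξ := by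
  unfold averagingTime; positivity

theorem averagingTime_le {T : ℝ} (hT : 0 < T) (ξ : Space d) : averagingTime T ξ ≤ T := by
  refine div_le_self hT.le ?_
  rw [Real.one_le_sqrt]
  linarith [norm_nonneg ξ]

theorem continuous_averagingTime (T : ℝ) : Continuous (averagingTime (d := d) T) := by
  unfold averagingTime
  refine continuous_const.div (by fun_prop) fun ξ => ?_
  positivity

theorem averagingTime_sq (T : ℝ) (ξ : Space d) : averagingTime T ξ ^ 2 = T ^ 2 / (1 + ‖ξ‖) := by
  rw [averagingTime, div_pow, Real.sq_sqrt (by positivity)]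

/-- The indicator function of `|s - t| < δ(ξ)`. -/
def nearIndicator (T s t : ℝ) (ξ : Space d) : ℝ≥0∞ :=
  if |s - t| < averagingTime T ξ then 1 else 0

theorem measurable_nearIndicator (T : ℝ) :
    Measurable fun p : ℝ × ℝ × Space d => nearIndicator T p.1 p.2.1 p.2.2 := by
  refine Measurable.ite (measurableSet_lt ?_ ?_) measurable_const measurable_const
  · exact (by fun_prop : Continuous fun p : ℝ × ℝ × Space d => |p.1 - p.2.1|).measurable
  · exact ((continuous_averagingTime T).comp
      (continuous_snd.comp continuous_snd)).measurable

theorem lintegral_nearIndicator_le (T t : ℝ) (ξ : Space d) (S : Set ℝ) :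
    ∫⁻ s in S, nearIndicator T s t ξ ≤ 2 * ENNReal.ofReal (averagingTime T ξ) := by
  have e : (fun s => nearIndicator T s t ξ) =
      (Metric.ball t (averagingTime T ξ)).indicator 1 := by
    ext s
    simp only [nearIndicator, indicator, Metric.mem_ball, Real.dist_eq, Pi.one_apply]
  refine (setLIntegral_le_lintegral _ _).trans ?_
  rw [e, lintegral_indicator_one measurableSet_ball, Real.volume_ball,
    ENNReal.ofReal_mul (by norm_num)]
  simp

/-- Near an endpoint part of the window leaves the interval, but the half pointing towards `0` stays
inside because its length is at most `T`. -/
theorem le_lintegral_nearIndicator {T t : ℝ} (hT : 0 < T) (ht : t ∈ Icc (-T) T) (ξ : Space d) :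
    ENNReal.ofReal (averagingTime T ξ) ≤ ∫⁻ s in Icc (-T) T, nearIndicator T s t ξ := by
  have e : (fun s => nearIndicator T s t ξ) =
      (Metric.ball t (averagingTime T ξ)).indicator 1 := by
    ext s
    simp only [nearIndicator, indicator, Metric.mem_ball, Real.dist_eq, Pi.one_apply]
  have hδ := averagingTime_pos hT ξ
  have hδT := averagingTime_le hT ξ
  rw [e, lintegral_indicator_one measurableSet_ball, Measure.restrict_apply measurableSet_ball]
  rcases le_total t 0 with h | h
  · calc ENNReal.ofReal (averagingTime T ξ) = volume (Ico t (t + averagingTime T ξ)) := by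
          rw [Real.volume_Ico]; congr 1; ring
      _ ≤ _ := by
          refine measure_mono fun s hs => ⟨?_, ?_, ?_⟩
          · rw [Metric.mem_ball, Real.dist_eq, abs_lt]
            constructor <;> linarith [hs.1, hs.2]
          · linarith [hs.1, ht.1]
          · linarith [hs.2]
  · calc ENNReal.ofReal (averagingTime T ξ) = volume (Ioc (t - averagingTime T ξ) t) := by
          rw [Real.volume_Ioc]; congr 1; ring
      _ ≤ _ := by
          refine measure_mono fun s hs => ⟨?_, ?_, ?_⟩
          · rw [Metric.mem_ball, Real.dist_eq, abs_lt]
            constructor <;> linarith [hs.1, hs.2]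
          · linarith [hs.1]
          · linarith [hs.2, ht.2]

theorem lintegral_lintegral_lintegral_swap {ν : Measure ℝ} [SFinite ν]
    {F : (ℝ × ℝ) × Space d → ℝ≥0∞} (hF : Measurable F) :
    ∫⁻ t, ∫⁻ s, (∫⁻ ξ, F ((t, s), ξ)) ∂ν ∂ν = ∫⁻ ξ, ∫⁻ t, ∫⁻ s, F ((t, s), ξ) ∂ν ∂ν := by
  have a1 : ∀ t, ∫⁻ s, (∫⁻ ξ, F ((t, s), ξ)) ∂ν = ∫⁻ ξ, ∫⁻ s, F ((t, s), ξ) ∂ν := fun t => by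
    refine lintegral_lintegral_swap (f := fun s ξ => F ((t, s), ξ)) ?_
    exact (hF.comp (by fun_prop :
      Measurable fun p : ℝ × Space d => ((t, p.1), p.2))).aemeasurable
  simp_rw [a1]
  refine lintegral_lintegral_swap (f := fun t ξ => ∫⁻ s, F ((t, s), ξ) ∂ν) ?_
  exact (Measurable.lintegral_prod_right (f := fun (p : ℝ × Space d) s => F ((p.1, s), p.2))
    (hF.comp (by fun_prop :
      Measurable fun p : (ℝ × Space d) × ℝ => ((p.1.1, p.2), p.1.2)))).aemeasurable

theorem lintegral_lintegral_lintegral_add {ν : Measure ℝ} [SFinite ν]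
    {F : (ℝ × ℝ) × Space d → ℝ≥0∞} (hF : Measurable F) (G : (ℝ × ℝ) × Space d → ℝ≥0∞) :
    ∫⁻ t, ∫⁻ s, (∫⁻ ξ, (2 * F ((t, s), ξ) + 2 * G ((t, s), ξ))) ∂ν ∂ν =
      2 * (∫⁻ t, ∫⁻ s, (∫⁻ ξ, F ((t, s), ξ)) ∂ν ∂ν) +
        2 * ∫⁻ t, ∫⁻ s, (∫⁻ ξ, G ((t, s), ξ)) ∂ν ∂ν := by
  have a1 : ∀ t s, ∫⁻ ξ, (2 * F ((t, s), ξ) + 2 * G ((t, s), ξ)) =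
      2 * (∫⁻ ξ, F ((t, s), ξ)) + 2 * ∫⁻ ξ, G ((t, s), ξ) := fun t s => by
    have m : Measurable fun ξ => 2 * F ((t, s), ξ) :=
      (hF.comp measurable_prodMk_left).const_mul 2
    rw [lintegral_add_left m, lintegral_const_mul' _ _ ENNReal.ofNat_ne_top,
      lintegral_const_mul' _ _ ENNReal.ofNat_ne_top]
  have m2 : Measurable fun p : ℝ × ℝ => ∫⁻ ξ, F (p, ξ) := hF.lintegral_prod_right'
  have a2 : ∀ t, ∫⁻ s, (2 * (∫⁻ ξ, F ((t, s), ξ)) + 2 * ∫⁻ ξ, G ((t, s), ξ)) ∂ν =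
      2 * (∫⁻ s, (∫⁻ ξ, F ((t, s), ξ)) ∂ν) + 2 * ∫⁻ s, (∫⁻ ξ, G ((t, s), ξ)) ∂ν := fun t => by
    have m : Measurable fun s => 2 * ∫⁻ ξ, F ((t, s), ξ) :=
      (m2.comp measurable_prodMk_left).const_mul 2
    rw [lintegral_add_left m, lintegral_const_mul' _ _ ENNReal.ofNat_ne_top,
      lintegral_const_mul' _ _ ENNReal.ofNat_ne_top]
  have m3 : Measurable fun t => 2 * ∫⁻ s, (∫⁻ ξ, F ((t, s), ξ)) ∂ν :=
    (m2.lintegral_prod_right').const_mul 2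
  simp_rw [a1, a2]
  rw [lintegral_add_left m3, lintegral_const_mul' _ _ ENNReal.ofNat_ne_top,
    lintegral_const_mul' _ _ ENNReal.ofNat_ne_top]

/-- Averaging of the pointwise inequality over the window in `s`, using `δ(ξ)(1 + |ξ|) = T(1 +
|ξ|)^{1/2}`. The window may be dropped for `P`, whose dispersion in time is exploited later; `Q`
does not depend on `s`, so it only picks up the length of the window. -/
theorem lintegral_sqrt_mul_sq_le_of_averaging {T : ℝ} (hT : 0 < T) {A : ℝ × Space d → ℝ≥0∞}
    {P : ℝ × ℝ × Space d → ℝ≥0∞} {Q : ℝ × Space d → ℝ≥0∞} (hA : Measurable A) (hP : Measurable P)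
    (hQ : Measurable Q)
    (h : ∀ s ∈ Icc (-T) T, ∀ t ∈ Icc (-T) T, ∀ᵐ ξ : Space d, |s - t| < averagingTime T ξ →
      A (t, ξ) ≤ P (s, t, ξ) + Q (t, ξ)) :
    ∫⁻ t in Icc (-T) T, ∫⁻ ξ, ENNReal.ofReal (Real.sqrt (1 + ‖ξ‖)) * A (t, ξ) ^ 2 ≤
      ENNReal.ofReal T⁻¹ *
        (2 * (∫⁻ ξ, ∫⁻ t in Icc (-T) T, ∫⁻ s in Icc (-T) T,
            ENNReal.ofReal (1 + ‖ξ‖) * P (s, t, ξ) ^ 2) +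
          4 * ∫⁻ ξ, ∫⁻ t in Icc (-T) T,
            ENNReal.ofReal (1 + ‖ξ‖) * ENNReal.ofReal (averagingTime T ξ) * Q (t, ξ) ^ 2) := by
  have ma : Measurable fun ξ : Space d => ENNReal.ofReal (1 + ‖ξ‖) := by fun_prop
  have me := measurable_nearIndicator (d := d) T
  have h1 : ∀ t ∈ Icc (-T) T, ∀ ξ : Space d,
      ENNReal.ofReal (Real.sqrt (1 + ‖ξ‖)) * A (t, ξ) ^ 2 ≤ ENNReal.ofReal T⁻¹ *
        ∫⁻ s in Icc (-T) T, nearIndicator T s t ξ * (ENNReal.ofReal (1 + ‖ξ‖) * A (t, ξ) ^ 2) :=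
    fun t ht ξ => by
    have mm : Measurable fun s => nearIndicator T s t ξ :=
      me.comp (by fun_prop : Measurable fun s : ℝ => (s, t, ξ))
    rw [lintegral_mul_const _ mm]
    -- The weight aimed at is the window length times `1 + |ξ|`; the factor `1 + |ξ|` is exactly
    -- what dispersion can pay for.
    have e : ENNReal.ofReal (Real.sqrt (1 + ‖ξ‖)) = ENNReal.ofReal T⁻¹ *
        (ENNReal.ofReal (averagingTime T ξ) * ENNReal.ofReal (1 + ‖ξ‖)) := by
      rw [← ENNReal.ofReal_mul (averagingTime_pos hT ξ).le, ← ENNReal.ofReal_mul (by positivity)]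
      congr 1
      have hs : 0 < Real.sqrt (1 + ‖ξ‖) := by positivity
      have hs2 : Real.sqrt (1 + ‖ξ‖) ^ 2 = 1 + ‖ξ‖ := Real.sq_sqrt (by positivity)
      rw [averagingTime]
      nth_rewrite 3 [← hs2]
      field_simp
    rw [e, mul_assoc, mul_assoc (ENNReal.ofReal (averagingTime T ξ))]
    gcongr
    exact le_lintegral_nearIndicator hT ht ξ
  have h2 : ∀ s ∈ Icc (-T) T, ∀ t ∈ Icc (-T) T,
      ∫⁻ ξ, nearIndicator T s t ξ * (ENNReal.ofReal (1 + ‖ξ‖) * A (t, ξ) ^ 2) ≤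
      ∫⁻ ξ, (2 * (ENNReal.ofReal (1 + ‖ξ‖) * P (s, t, ξ) ^ 2) +
        2 * (nearIndicator T s t ξ * (ENNReal.ofReal (1 + ‖ξ‖) * Q (t, ξ) ^ 2))) :=
    fun s hs t ht => by
    refine lintegral_mono_ae ?_
    filter_upwards [h s hs t ht] with ξ hξ
    by_cases hst : |s - t| < averagingTime T ξ
    · simp only [nearIndicator, hst, if_true, one_mul]
      calc _ ≤ ENNReal.ofReal (1 + ‖ξ‖) * (2 * P (s, t, ξ) ^ 2 + 2 * Q (t, ξ) ^ 2) := by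
            gcongr
            exact (pow_le_pow_left' (hξ hst) 2).trans (add_sq_le_two_mul _ _)
        _ = _ := by ring
    · simp [nearIndicator, hst]
  have mAe : Measurable fun p : (ℝ × ℝ) × Space d =>
      nearIndicator T p.1.2 p.1.1 p.2 * (ENNReal.ofReal (1 + ‖p.2‖) * A (p.1.1, p.2) ^ 2) :=
    (me.comp (by fun_prop : Measurable fun p : (ℝ × ℝ) × Space d => (p.1.2, p.1.1, p.2))).mul
      ((ma.comp measurable_snd).mul ((hA.comp (by fun_prop :
        Measurable fun p : (ℝ × ℝ) × Space d => (p.1.1, p.2))).pow_const 2))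
  have mP : Measurable fun p : (ℝ × ℝ) × Space d =>
      ENNReal.ofReal (1 + ‖p.2‖) * P (p.1.2, p.1.1, p.2) ^ 2 :=
    (ma.comp measurable_snd).mul ((hP.comp (by fun_prop :
        Measurable fun p : (ℝ × ℝ) × Space d => (p.1.2, p.1.1, p.2))).pow_const 2)
  have mQ0 : Measurable fun p : (ℝ × ℝ) × Space d =>
      (ENNReal.ofReal (1 + ‖p.2‖) * Q (p.1.1, p.2) ^ 2) :=
    (ma.comp measurable_snd).mul ((hQ.comp (by fun_prop :
        Measurable fun p : (ℝ × ℝ) × Space d => (p.1.1, p.2))).pow_const 2)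
  have mQ : Measurable fun p : (ℝ × ℝ) × Space d =>
      nearIndicator T p.1.2 p.1.1 p.2 * (ENNReal.ofReal (1 + ‖p.2‖) * Q (p.1.1, p.2) ^ 2) :=
    (me.comp (by fun_prop : Measurable fun p : (ℝ × ℝ) × Space d => (p.1.2, p.1.1, p.2))).mul mQ0
  calc _ ≤ ∫⁻ t in Icc (-T) T, ∫⁻ ξ, ENNReal.ofReal T⁻¹ * ∫⁻ s in Icc (-T) T,
          nearIndicator T s t ξ * (ENNReal.ofReal (1 + ‖ξ‖) * A (t, ξ) ^ 2) :=
        setLIntegral_mono' measurableSet_Icc fun t ht => lintegral_mono fun ξ => h1 t ht ξ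
    _ = ENNReal.ofReal T⁻¹ * ∫⁻ t in Icc (-T) T, ∫⁻ s in Icc (-T) T, ∫⁻ ξ,
          nearIndicator T s t ξ * (ENNReal.ofReal (1 + ‖ξ‖) * A (t, ξ) ^ 2) := by
        simp_rw [lintegral_const_mul' _ _ (ENNReal.ofReal_ne_top (r := T⁻¹))]
        congr 1
        refine lintegral_congr fun t => ?_
        refine lintegral_lintegral_swap (f := fun ξ s =>
          nearIndicator T s t ξ * (ENNReal.ofReal (1 + ‖ξ‖) * A (t, ξ) ^ 2)) ?_
        exact (mAe.comp (by fun_prop :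
          Measurable fun p : Space d × ℝ => ((t, p.2), p.1))).aemeasurable
    _ ≤ ENNReal.ofReal T⁻¹ * ∫⁻ t in Icc (-T) T, ∫⁻ s in Icc (-T) T,
          ∫⁻ ξ, (2 * (ENNReal.ofReal (1 + ‖ξ‖) * P (s, t, ξ) ^ 2) +
        2 * (nearIndicator T s t ξ * (ENNReal.ofReal (1 + ‖ξ‖) * Q (t, ξ) ^ 2))) := by
        gcongr ENNReal.ofReal T⁻¹ * ?_
        exact setLIntegral_mono' measurableSet_Icc fun t ht =>
          setLIntegral_mono' measurableSet_Icc fun s hs => h2 s hs t ht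
    _ = ENNReal.ofReal T⁻¹ *
        (2 * (∫⁻ ξ, ∫⁻ t in Icc (-T) T, ∫⁻ s in Icc (-T) T,
            ENNReal.ofReal (1 + ‖ξ‖) * P (s, t, ξ) ^ 2) +
          2 * (∫⁻ ξ, ∫⁻ t in Icc (-T) T, ∫⁻ s in Icc (-T) T,
            nearIndicator T s t ξ * (ENNReal.ofReal (1 + ‖ξ‖) * Q (t, ξ) ^ 2))) := by
        have e1 := lintegral_lintegral_lintegral_add (ν := volume.restrict (Icc (-T) T)) mP
          (fun p => nearIndicator T p.1.2 p.1.1 p.2 *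
            (ENNReal.ofReal (1 + ‖p.2‖) * Q (p.1.1, p.2) ^ 2))
        have e2 := lintegral_lintegral_lintegral_swap (ν := volume.restrict (Icc (-T) T)) mP
        have e3 := lintegral_lintegral_lintegral_swap (ν := volume.restrict (Icc (-T) T)) mQ
        simp only at e1 e2 e3
        rw [e1, e2, e3]
    _ ≤ _ := by
        gcongr ENNReal.ofReal T⁻¹ * (2 * ?_ + ?_)
        · exact le_rfl
        rw [show (4 : ℝ≥0∞) = 2 * 2 by norm_num, mul_assoc]
        gcongr 2 * ?_
        rw [← lintegral_const_mul' 2 _ ENNReal.ofNat_ne_top]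
        refine lintegral_mono fun ξ => ?_
        rw [← lintegral_const_mul' 2 _ ENNReal.ofNat_ne_top]
        refine lintegral_mono fun t => ?_
        have mm : Measurable fun s => nearIndicator T s t ξ :=
          me.comp (by fun_prop : Measurable fun s : ℝ => (s, t, ξ))
        rw [lintegral_mul_const _ mm]
        calc _ ≤ 2 * ENNReal.ofReal (averagingTime T ξ) *
              (ENNReal.ofReal (1 + ‖ξ‖) * Q (t, ξ) ^ 2) := by
              gcongr
              exact lintegral_nearIndicator_le T t ξ _
          _ = _ := by ring

end TimeAveraging

end

section

open Filter Topology
open scoped FourierTransform ContDiff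

/-! ### Gain of regularity by time averaging -/

section VelocityAveraging

variable {d : ℕ}

theorem exists_decay_bound (χ : 𝓢(Space d, ℂ)) :
    ∃ C : ℝ, 0 ≤ C ∧ ∀ z, ‖χ z‖ * (1 + ‖z‖ ^ 2) ≤ C := by
  obtain ⟨C0, hC0, h0⟩ := χ.decay 0 0
  obtain ⟨C2, hC2, h2⟩ := χ.decay 2 0
  simp only [norm_iteratedFDeriv_zero, pow_zero, one_mul] at h0 h2
  exact ⟨C0 + C2, by positivity, fun z => by nlinarith [h0 z, h2 z]⟩

theorem lintegral_inv_one_add_sq_comp {k : ℝ} (hk : 0 < k) (u : ℝ) :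
    ∫⁻ t, ENNReal.ofReal (1 + (u + t * k) ^ 2)⁻¹ = ENNReal.ofReal (Real.pi / k) := by
  have hi : Integrable fun t : ℝ => (1 + (u + t * k) ^ 2)⁻¹ :=
    (integrable_inv_one_add_sq.comp_add_left u).comp_mul_right' hk.ne'
  rw [← ofReal_integral_eq_lintegral_ofReal hi (.of_forall fun t => by positivity)]
  congr 1
  have h1 := Measure.integral_comp_mul_right (fun x : ℝ => (1 + (u + x) ^ 2)⁻¹) k
  rw [h1, integral_add_left_eq_self (fun x : ℝ => (1 + x ^ 2)⁻¹) u, integral_univ_inv_one_add_sq,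
    abs_of_pos (inv_pos.2 hk), smul_eq_mul]
  field_simp

/-- This is the dispersive heart of the averaging lemma. For `|ξ| > 1` the argument of `χ` moves
along `ξ` with speed `β|ξ|`, and quadratic decay in that single direction makes the time integral
`O(1/|ξ|)`, uniformly in `y`. For `|ξ| ≤ 1` the length of the interval suffices. -/
theorem exists_bound_time_integral (χ : 𝓢(Space d, ℂ)) {β T : ℝ} (hβ : 0 < β) (hT : 0 < T) :
    ∃ C : ℝ≥0, ∀ (s : ℝ) (y ξ : Space d), ENNReal.ofReal (1 + ‖ξ‖) *
      ∫⁻ t in Icc (-T) T, ‖χ (y - ((s - t) * β) • ξ)‖ₑ ≤ C := by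
  obtain ⟨C, hC0, hC⟩ := exists_decay_bound χ
  refine ⟨(4 * T * C + 2 * C * Real.pi / β).toNNReal, fun s y ξ => ?_⟩
  rw [← ENNReal.ofReal.eq_1]
  rcases le_or_gt ‖ξ‖ 1 with h | h
  · have hb : ∀ z, ‖χ z‖ₑ ≤ ENNReal.ofReal C := fun z => by
      rw [← ofReal_norm]
      refine ENNReal.ofReal_le_ofReal ((le_mul_of_one_le_right (norm_nonneg _) ?_).trans (hC z))
      nlinarith [sq_nonneg ‖z‖]
    calc _ ≤ ENNReal.ofReal 2 * ∫⁻ t in Icc (-T) T, ENNReal.ofReal C := by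
          gcongr
          · linarith
          · exact hb _
      _ = ENNReal.ofReal (4 * T * C) := by
          rw [setLIntegral_const, Real.volume_Icc, ← ENNReal.ofReal_mul hC0,
            ← ENNReal.ofReal_mul (by norm_num)]
          congr 1
          ring
      _ ≤ _ := ENNReal.ofReal_le_ofReal (le_add_of_nonneg_right (by positivity))
  · have hξ : 0 < ‖ξ‖ := by linarith
    -- `u + tβ|ξ|` is the component of the moving argument in the direction of `ξ`.
    set u := inner ℝ y ξ / ‖ξ‖ - s * β * ‖ξ‖ with hu
    have hb : ∀ t, ‖χ (y - ((s - t) * β) • ξ)‖ₑ ≤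
        ENNReal.ofReal C * ENNReal.ofReal (1 + (u + t * (β * ‖ξ‖)) ^ 2)⁻¹ := fun t => by
      rw [← ofReal_norm, ← ENNReal.ofReal_mul hC0]
      refine ENNReal.ofReal_le_ofReal ?_
      set z := y - ((s - t) * β) • ξ with hz
      have h1 : u + t * (β * ‖ξ‖) = inner ℝ z ξ / ‖ξ‖ := by
        rw [hz, inner_sub_left, real_inner_smul_left, real_inner_self_eq_norm_sq, hu]
        field_simp
        ring
      have h2 : (u + t * (β * ‖ξ‖)) ^ 2 ≤ ‖z‖ ^ 2 := by
        rw [h1, div_pow, div_le_iff₀ (by positivity), ← mul_pow, ← sq_abs (inner ℝ z ξ)]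
        exact pow_le_pow_left₀ (abs_nonneg _) (abs_real_inner_le_norm z ξ) 2
      rw [← div_eq_mul_inv, le_div_iff₀ (by positivity)]
      refine le_trans ?_ (hC z)
      gcongr
    calc _ ≤ ENNReal.ofReal (2 * ‖ξ‖) * ∫⁻ t,
          ENNReal.ofReal C * ENNReal.ofReal (1 + (u + t * (β * ‖ξ‖)) ^ 2)⁻¹ := by
          refine mul_le_mul' (ENNReal.ofReal_le_ofReal (by linarith)) ?_
          exact (setLIntegral_le_lintegral _ _).trans (lintegral_mono hb)
      _ = ENNReal.ofReal (2 * C * Real.pi / β) := by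
          rw [lintegral_const_mul' _ _ ENNReal.ofReal_ne_top,
            lintegral_inv_one_add_sq_comp (by positivity), ← ENNReal.ofReal_mul hC0,
            ← ENNReal.ofReal_mul (by positivity)]
          congr 1
          field_simp
      _ ≤ _ := ENNReal.ofReal_le_ofReal (le_add_of_nonneg_left (by positivity))

/-- After translation the weight splits, by the Peetre inequality, into a factor in `z` and a weight
that `χ` absorbs. -/
theorem exists_bound_weight_integral (χ : 𝓢(Space d, ℂ)) :
    ∃ C : ℝ≥0, ∀ z : Space d, ∫⁻ y, ENNReal.ofReal (japaneseBracket y) ^ 2 * ‖χ (y - z)‖ₑ ≤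
      C * ENNReal.ofReal (1 + ‖z‖ ^ 2) := by
  set f := japaneseMul (japaneseMul χ)
  have hfin : ∫⁻ y, ‖f y‖ₑ ≠ ⊤ := f.integrable.2.ne
  refine ⟨4 * (∫⁻ y, ‖f y‖ₑ).toNNReal, fun z => ?_⟩
  have h := lintegral_sub_right_eq_self
    (fun y => ENNReal.ofReal (japaneseBracket (y + z)) ^ 2 * ‖χ y‖ₑ) z (μ := volume)
  simp only [sub_add_cancel] at h
  rw [h]
  have hb : ∀ y, ENNReal.ofReal (japaneseBracket (y + z)) ^ 2 * ‖χ y‖ₑ ≤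
      4 * ENNReal.ofReal (1 + ‖z‖ ^ 2) * ‖f y‖ₑ := fun y => by
    have h1 := japaneseBracket_add_smul_sq_le 1 y z
    rw [one_smul, japaneseBracket_sq z] at h1
    have hf : ‖f y‖ₑ = ENNReal.ofReal (japaneseBracket y ^ 2) * ‖χ y‖ₑ := by
      simp only [f, japaneseMul_apply, enorm_mul]
      rw [← mul_assoc, ← sq, ← ofReal_norm, Complex.norm_real, Real.norm_eq_abs,
        abs_of_pos (japaneseBracket_pos y), ENNReal.ofReal_pow (japaneseBracket_pos y).le]
    rw [hf, ← mul_assoc, ← ENNReal.ofReal_pow (japaneseBracket_pos _).le]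
    refine mul_le_mul_left ?_ _
    rw [show (4 : ℝ≥0∞) = ENNReal.ofReal 4 by simp, ← ENNReal.ofReal_mul (by norm_num),
      ← ENNReal.ofReal_mul (by positivity)]
    exact ENNReal.ofReal_le_ofReal (by linarith)
  refine (lintegral_mono hb).trans (le_of_eq ?_)
  rw [lintegral_const_mul' _ _ (by finiteness)]
  push_cast
  rw [ENNReal.coe_toNNReal hfin]
  ring

variable {F : ℝ × Space d × Space d → ℂ} {N : ℝ≥0} {ρ : Space d → ℂ}

theorem IsBoundedFamily.measurable_enorm_sq (hF : IsBoundedFamily F N) :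
    Measurable fun p : ℝ × Space d × Space d => ‖F p‖ₑ ^ 2 :=
  hF.stronglyMeasurable.enorm.pow_const 2

theorem IsBoundedFamily.lintegral_lintegral_sq_le (hF : IsBoundedFamily F N) (r : ℝ) :
    ∫⁻ ξ, ∫⁻ y, ‖F (r, y, ξ)‖ₑ ^ 2 ≤ N := by
  have h := hF.lintegral_sq_le r
  have hm : Measurable fun p : Space d × Space d => ‖F (r, p)‖ₑ ^ 2 :=
    hF.measurable_enorm_sq.comp measurable_prodMk_left
  rw [Measure.volume_eq_prod, lintegral_prod_symm _ hm.aemeasurable] at h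
  exact h

theorem IsBoundedFamily.lintegral_mass_le (hF : IsBoundedFamily F N) (T : ℝ) :
    ∫⁻ ξ, ∫⁻ s in Icc (-T) T, ∫⁻ y, ‖F (s, y, ξ)‖ₑ ^ 2 ≤ ENNReal.ofReal (2 * T) * N := by
  have hm := hF.measurable_enorm_sq
  have m1 : Measurable fun p : Space d × ℝ => ∫⁻ y, ‖F (p.2, y, p.1)‖ₑ ^ 2 :=
    Measurable.lintegral_prod_right (f := fun (p : Space d × ℝ) y => ‖F (p.2, y, p.1)‖ₑ ^ 2)
      (hm.comp (by fun_prop : Measurable fun p : (Space d × ℝ) × Space d => (p.1.2, p.2, p.1.1)))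
  rw [lintegral_lintegral_swap (f := fun ξ s => ∫⁻ y, ‖F (s, y, ξ)‖ₑ ^ 2) m1.aemeasurable]
  calc _ ≤ ∫⁻ s in Icc (-T) T, (N : ℝ≥0∞) := by
        exact lintegral_mono fun s => hF.lintegral_lintegral_sq_le s
    _ = _ := by
        rw [setLIntegral_const, Real.volume_Icc, mul_comm]
        congr 2
        ring

/-- `F` does not depend on `t`, so Tonelli allows integration of the profile over `t` first, at
fixed `(s, y)`, where the dispersive bound applies. -/
theorem IsBoundedFamily.lintegral_profile_le (hF : IsBoundedFamily F N) (χ : 𝓢(Space d, ℂ))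
    {β T : ℝ} {C : ℝ≥0} (hC : ∀ (s : ℝ) (y ξ : Space d), ENNReal.ofReal (1 + ‖ξ‖) *
      ∫⁻ t in Icc (-T) T, ‖χ (y - ((s - t) * β) • ξ)‖ₑ ≤ C) (ξ : Space d) :
    ENNReal.ofReal (1 + ‖ξ‖) * (∫⁻ t in Icc (-T) T, ∫⁻ s in Icc (-T) T, ∫⁻ y,
      ‖F (s, y, ξ)‖ₑ ^ 2 * ‖χ (y - ((s - t) * β) • ξ)‖ₑ) ≤
      C * ∫⁻ s in Icc (-T) T, ∫⁻ y, ‖F (s, y, ξ)‖ₑ ^ 2 := by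
  have hm := hF.measurable_enorm_sq
  have mχ : Measurable fun p : (ℝ × ℝ) × Space d => ‖χ (p.2 - ((p.1.2 - p.1.1) * β) • ξ)‖ₑ := by
    have := χ.continuous
    exact (by fun_prop : Continuous fun p : (ℝ × ℝ) × Space d =>
      χ (p.2 - ((p.1.2 - p.1.1) * β) • ξ)).enorm.measurable
  have mm : Measurable fun p : (ℝ × ℝ) × Space d =>
      ‖F (p.1.2, p.2, ξ)‖ₑ ^ 2 * ‖χ (p.2 - ((p.1.2 - p.1.1) * β) • ξ)‖ₑ :=
    (hm.comp (by fun_prop : Measurable fun p : (ℝ × ℝ) × Space d => (p.1.2, p.2, ξ))).mul mχ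
  have m3 : Measurable fun p : ℝ × ℝ => ∫⁻ y,
      ‖F (p.2, y, ξ)‖ₑ ^ 2 * ‖χ (y - ((p.2 - p.1) * β) • ξ)‖ₑ := mm.lintegral_prod_right'
  rw [lintegral_lintegral_swap (f := fun t s => ∫⁻ y,
    ‖F (s, y, ξ)‖ₑ ^ 2 * ‖χ (y - ((s - t) * β) • ξ)‖ₑ) m3.aemeasurable, ← lintegral_const_mul' _ _ ENNReal.ofReal_ne_top,
    ← lintegral_const_mul' _ _ ENNReal.coe_ne_top]
  refine lintegral_mono fun s => ?_
  have m4 : Measurable fun p : ℝ × Space d =>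
      ‖F (s, p.2, ξ)‖ₑ ^ 2 * ‖χ (p.2 - ((s - p.1) * β) • ξ)‖ₑ := by
    have h1 : Measurable fun p : ℝ × Space d => ((p.1, s), p.2) := by fun_prop
    simpa only [Function.comp_def] using mm.comp h1
  rw [lintegral_lintegral_swap (f := fun t y =>
    ‖F (s, y, ξ)‖ₑ ^ 2 * ‖χ (y - ((s - t) * β) • ξ)‖ₑ) m4.aemeasurable,
    ← lintegral_const_mul' _ _ ENNReal.ofReal_ne_top,
    ← lintegral_const_mul' _ _ ENNReal.coe_ne_top]
  refine lintegral_mono fun y => ?_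
  have m2 : Measurable fun t => ‖χ (y - ((s - t) * β) • ξ)‖ₑ :=
    by
    have h1 : Measurable fun t : ℝ => ((t, s), y) := by fun_prop
    simpa only [Function.comp_def] using mχ.comp h1
  rw [lintegral_const_mul _ m2]
  calc _ = ‖F (s, y, ξ)‖ₑ ^ 2 * (ENNReal.ofReal (1 + ‖ξ‖) *
        ∫⁻ t in Icc (-T) T, ‖χ (y - ((s - t) * β) • ξ)‖ₑ) := by ring
    _ ≤ ‖F (s, y, ξ)‖ₑ ^ 2 * C := by gcongr; exact hC s y ξ
    _ = _ := mul_comm _ _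

theorem IsBoundedFamily.lintegral_movingAverage_zero_sq_le (hF : IsBoundedFamily F N)
    (hρ : IsBracketWeight ρ) (χ : 𝓢(Space d, ℂ)) (r : ℝ) :
    ∫⁻ ξ, ‖movingAverage F ρ χ 0 r ξ‖ₑ ^ 2 ≤ N * ∫⁻ y, ‖japaneseMul χ y‖ₑ ^ 2 := by
  have hm := hF.measurable_enorm_sq
  have h : ∀ ξ, ‖movingAverage F ρ χ 0 r ξ‖ₑ ^ 2 ≤
      (∫⁻ y, ‖F (r, y, ξ)‖ₑ ^ 2) * ∫⁻ y, ‖japaneseMul χ y‖ₑ ^ 2 := fun ξ => by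
    refine (enorm_integral_mul_sq_le ?_ ?_).trans ?_
    · exact (hF.stronglyMeasurable.comp_measurable
        (by fun_prop : Measurable fun y : Space d => (r, y, ξ))).aestronglyMeasurable
    · simp only [zero_smul, sub_zero]
      exact (hρ.continuous.mul χ.continuous).aestronglyMeasurable
    · gcongr with y
      simp only [zero_smul, sub_zero, japaneseMul_apply, enorm_mul]
      gcongr
      rw [← ofReal_norm, ← ofReal_norm, Complex.norm_real, Real.norm_eq_abs,
        abs_of_pos (japaneseBracket_pos _)]
      exact ENNReal.ofReal_le_ofReal (hρ.norm_le _)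
  refine (lintegral_mono h).trans ?_
  have m1 : Measurable fun ξ => ∫⁻ y, ‖F (r, y, ξ)‖ₑ ^ 2 :=
    Measurable.lintegral_prod_right (f := fun (ξ : Space d) y => ‖F (r, y, ξ)‖ₑ ^ 2)
      (hm.comp (by fun_prop : Measurable fun p : Space d × Space d => (r, p.2, p.1)))
  rw [lintegral_mul_const _ m1]
  gcongr
  exact hF.lintegral_lintegral_sq_le r

/-- Cauchy-Schwarz with weight `|χ|`: one copy of the profile must stay beside `|F|²` for the
dispersive bound. -/
theorem IsBoundedFamily.movingAverage_sq_le (hF : IsBoundedFamily F N) (χ : 𝓢(Space d, ℂ))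
    (b r : ℝ) (ξ : Space d) :
    ‖movingAverage F (fun _ => 1) χ b r ξ‖ₑ ^ 2 ≤
      (∫⁻ y, ‖F (r, y, ξ)‖ₑ ^ 2 * ‖χ (y - b • ξ)‖ₑ) * ∫⁻ y, ‖χ y‖ₑ := by
  have h1 : AEMeasurable fun y => ‖F (r, y, ξ)‖ₑ :=
    (hF.stronglyMeasurable.comp_measurable
      (by fun_prop : Measurable fun y : Space d => (r, y, ξ))).enorm.aemeasurable
  have h2 : AEMeasurable fun y => ‖χ (y - b • ξ)‖ₑ := by
    have := χ.continuous
    exact (by fun_prop : Continuous fun y => χ (y - b • ξ)).enorm.measurable.aemeasurable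
  have h := lintegral_mul_mul_sq_le (g := fun _ => 1) h1 aemeasurable_const h2
  simp only [one_mul, one_pow] at h
  rw [lintegral_sub_right_eq_self (fun y => ‖χ y‖ₑ)] at h
  refine le_trans ?_ h
  gcongr
  refine (enorm_integral_le_lintegral_enorm _).trans (le_of_eq ?_)
  simp only [enorm_mul, one_mul]

end VelocityAveraging

end

section

open Filter Topology
open scoped FourierTransform ContDiff

/-! ### The source term and the space regularity of the averages. -/

section AveragingEstimate

variable {d : ℕ}

/-- The source term `∫_{|r - t| < δ(ξ)} ∫ |K(r, y, ξ)| (1 + |y|²)^{1/2} |χ(y - (r - t) β ξ)| dy dr`. -/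
def sourceAverage (β T : ℝ) (K : ℝ × Space d × Space d → ℂ) (χ : 𝓢(Space d, ℂ))
    (p : ℝ × Space d) : ℝ≥0∞ :=
  ∫⁻ q : ℝ × Space d, ‖K (q.1, q.2, p.2)‖ₑ * (ENNReal.ofReal (japaneseBracket q.2) *
    (nearIndicator T q.1 p.1 p.2 * ‖χ (q.2 - ((q.1 - p.1) * β) • p.2)‖ₑ))
    ∂((volume.restrict (Icc (-T) T)).prod volume)

variable {K : ℝ × Space d × Space d → ℂ} {N : ℝ≥0}

theorem measurable_profile (β : ℝ) (χ : 𝓢(Space d, ℂ)) :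
    Measurable fun p : (ℝ × Space d) × ℝ × Space d =>
      ‖χ (p.2.2 - ((p.2.1 - p.1.1) * β) • p.1.2)‖ₑ := by
  have := χ.continuous
  exact (by fun_prop : Continuous fun p : (ℝ × Space d) × ℝ × Space d =>
    χ (p.2.2 - ((p.2.1 - p.1.1) * β) • p.1.2)).enorm.measurable

theorem measurable_nearIndicator_comp (T : ℝ) :
    Measurable fun p : (ℝ × Space d) × ℝ × Space d => nearIndicator T p.2.1 p.1.1 p.1.2 := by
  have h1 : Measurable fun p : (ℝ × Space d) × ℝ × Space d => (p.2.1, p.1.1, p.1.2) := by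
    fun_prop
  simpa only [Function.comp_def] using (measurable_nearIndicator T).comp h1

theorem measurable_ofReal_japaneseBracket :
    Measurable fun y : Space d => ENNReal.ofReal (japaneseBracket y) :=
  ENNReal.measurable_ofReal.comp continuous_japaneseBracket.measurable

theorem measurable_sourceAverage (β T : ℝ) (hK : StronglyMeasurable K) (χ : 𝓢(Space d, ℂ)) :
    Measurable (sourceAverage β T K χ) := by
  have m1 : Measurable fun p : (ℝ × Space d) × ℝ × Space d => ‖K (p.2.1, p.2.2, p.1.2)‖ₑ :=
    (hK.comp_measurable (by fun_prop :
      Measurable fun p : (ℝ × Space d) × ℝ × Space d => (p.2.1, p.2.2, p.1.2))).enorm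
  have m2 : Measurable fun p : (ℝ × Space d) × ℝ × Space d =>
      ENNReal.ofReal (japaneseBracket p.2.2) :=
    measurable_ofReal_japaneseBracket.comp (measurable_snd.comp measurable_snd)
  exact Measurable.lintegral_prod_right'
    (m1.mul (m2.mul ((measurable_nearIndicator_comp T).mul (measurable_profile β χ))))

/-- Cauchy-Schwarz separates `|K|²` from `⟨y⟩²`, each weighted by the profile. Dispersion makes the
first factor `O(1/(1 + |ξ|))` after integration in `t`. The second is `O(δ(1 + |ξ|))`, as the
profile moves by at most `δβ|ξ|` within the window. With the prefactor this leaves `δ²(1 + |ξ|) =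
T²`, which fixes the choice of `δ`. -/
theorem IsBoundedFamily.lintegral_sourceAverage_le (hK : IsBoundedFamily K N) {χ : 𝓢(Space d, ℂ)}
    {β T : ℝ} (hT : 0 < T) {C₁ C₂ : ℝ≥0}
    (h₁ : ∀ (s : ℝ) (y ξ : Space d), ENNReal.ofReal (1 + ‖ξ‖) *
      ∫⁻ t in Icc (-T) T, ‖χ (y - ((s - t) * β) • ξ)‖ₑ ≤ C₁)
    (h₂ : ∀ z : Space d, ∫⁻ y, ENNReal.ofReal (japaneseBracket y) ^ 2 * ‖χ (y - z)‖ₑ ≤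
      C₂ * ENNReal.ofReal (1 + ‖z‖ ^ 2)) (ξ : Space d) :
    ∫⁻ t in Icc (-T) T, ENNReal.ofReal (1 + ‖ξ‖) * ENNReal.ofReal (averagingTime T ξ) *
      sourceAverage β T K χ (t, ξ) ^ 2 ≤
    2 * C₁ * C₂ * ENNReal.ofReal (T ^ 2 * (1 + T ^ 2 * β ^ 2)) *
      ∫⁻ s in Icc (-T) T, ∫⁻ y, ‖K (s, y, ξ)‖ₑ ^ 2 := by
  set δ := averagingTime T ξ with hδ
  have hδ0 : 0 < δ := averagingTime_pos hT ξ
  have mK : Measurable fun q : ℝ × Space d => ‖K (q.1, q.2, ξ)‖ₑ :=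
    (hK.stronglyMeasurable.comp_measurable (by fun_prop :
      Measurable fun q : ℝ × Space d => (q.1, q.2, ξ))).enorm
  have mJ : Measurable fun q : ℝ × Space d => ENNReal.ofReal (japaneseBracket q.2) :=
    measurable_ofReal_japaneseBracket.comp measurable_snd
  have mχ : ∀ t, Measurable fun q : ℝ × Space d => ‖χ (q.2 - ((q.1 - t) * β) • ξ)‖ₑ := fun t => by
    have h1 : Measurable fun q : ℝ × Space d => ((t, ξ), q) := by fun_prop
    simpa only [Function.comp_def] using (measurable_profile β χ).comp h1
  have mn : ∀ t, Measurable fun q : ℝ × Space d => nearIndicator T q.1 t ξ := fun t => by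
    have h1 : Measurable fun q : ℝ × Space d => ((t, ξ), q) := by fun_prop
    simpa only [Function.comp_def] using (measurable_nearIndicator_comp T).comp h1
  have hnear : ∀ s t, nearIndicator T s t ξ ≤ 1 := fun s t => by
    unfold nearIndicator; split_ifs <;> simp
  have b1 : ∀ t, ∫⁻ q : ℝ × Space d, ‖K (q.1, q.2, ξ)‖ₑ ^ 2 *
      (nearIndicator T q.1 t ξ * ‖χ (q.2 - ((q.1 - t) * β) • ξ)‖ₑ)
      ∂((volume.restrict (Icc (-T) T)).prod volume) ≤
      ∫⁻ s in Icc (-T) T, ∫⁻ y, ‖K (s, y, ξ)‖ₑ ^ 2 * ‖χ (y - ((s - t) * β) • ξ)‖ₑ := fun t => by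
    have m : Measurable fun q : ℝ × Space d => ‖K (q.1, q.2, ξ)‖ₑ ^ 2 *
      (nearIndicator T q.1 t ξ * ‖χ (q.2 - ((q.1 - t) * β) • ξ)‖ₑ) :=
      (mK.pow_const 2).mul ((mn t).mul (mχ t))
    rw [lintegral_prod _ m.aemeasurable]
    refine lintegral_mono fun s => lintegral_mono fun y => ?_
    simp only
    gcongr
    exact (mul_le_mul_left (hnear s t) _).trans (one_mul _).le
  have b2 : ∀ t, ∫⁻ q : ℝ × Space d, ENNReal.ofReal (japaneseBracket q.2) ^ 2 *
      (nearIndicator T q.1 t ξ * ‖χ (q.2 - ((q.1 - t) * β) • ξ)‖ₑ)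
      ∂((volume.restrict (Icc (-T) T)).prod volume) ≤
      2 * ENNReal.ofReal δ * (C₂ * ENNReal.ofReal ((1 + T ^ 2 * β ^ 2) * (1 + ‖ξ‖))) := fun t => by
    have m : Measurable fun q : ℝ × Space d => ENNReal.ofReal (japaneseBracket q.2) ^ 2 *
      (nearIndicator T q.1 t ξ * ‖χ (q.2 - ((q.1 - t) * β) • ξ)‖ₑ) :=
      (mJ.pow_const 2).mul ((mn t).mul (mχ t))
    rw [lintegral_prod _ m.aemeasurable]
    calc _ ≤ ∫⁻ s in Icc (-T) T, nearIndicator T s t ξ *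
          (C₂ * ENNReal.ofReal ((1 + T ^ 2 * β ^ 2) * (1 + ‖ξ‖))) := by
          refine lintegral_mono fun s => ?_
          simp only
          by_cases hst : |s - t| < averagingTime T ξ
          · simp only [nearIndicator, hst, if_true, one_mul]
            refine (h₂ _).trans ?_
            gcongr
            rw [norm_smul, mul_pow, Real.norm_eq_abs, sq_abs, mul_pow]
            have h3 : (s - t) ^ 2 ≤ δ ^ 2 := by
              rw [← sq_abs]
              exact pow_le_pow_left₀ (abs_nonneg _) hst.le 2
            have h4 : δ ^ 2 * (1 + ‖ξ‖) = T ^ 2 := by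
              rw [hδ, averagingTime_sq]; field_simp
            -- Inside the window the squared displacement is at most `T²β²(1 + |ξ|)`, one power of
            -- `|ξ|` instead of two.
            have h5 : (s - t) ^ 2 * β ^ 2 * ‖ξ‖ ^ 2 ≤ δ ^ 2 * β ^ 2 * (1 + ‖ξ‖) ^ 2 := by
              gcongr
              linarith
            have h6 : δ ^ 2 * β ^ 2 * (1 + ‖ξ‖) ^ 2 = T ^ 2 * β ^ 2 * (1 + ‖ξ‖) := by
              rw [← h4]; ring
            nlinarith [norm_nonneg ξ]
          · simp [nearIndicator, hst]
      _ ≤ _ := by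
          have mm : Measurable fun s => nearIndicator T s t ξ := by
            have h1 : Measurable fun s : ℝ => (s, (0 : Space d)) := by fun_prop
            simpa only [Function.comp_def] using (mn t).comp h1
          rw [lintegral_mul_const _ mm]
          gcongr
          exact lintegral_nearIndicator_le T t ξ _
  have b3 : ∀ t, sourceAverage β T K χ (t, ξ) ^ 2 ≤
      (∫⁻ s in Icc (-T) T, ∫⁻ y, ‖K (s, y, ξ)‖ₑ ^ 2 * ‖χ (y - ((s - t) * β) • ξ)‖ₑ) *
      (2 * ENNReal.ofReal δ * (C₂ * ENNReal.ofReal ((1 + T ^ 2 * β ^ 2) * (1 + ‖ξ‖)))) := fun t =>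
    (lintegral_mul_mul_sq_le mK.aemeasurable mJ.aemeasurable
      ((mn t).mul (mχ t)).aemeasurable).trans (mul_le_mul' (b1 t) (b2 t))
  calc _ ≤ ∫⁻ t in Icc (-T) T, ENNReal.ofReal (1 + ‖ξ‖) * ENNReal.ofReal δ *
        ((∫⁻ s in Icc (-T) T, ∫⁻ y, ‖K (s, y, ξ)‖ₑ ^ 2 * ‖χ (y - ((s - t) * β) • ξ)‖ₑ) *
      (2 * ENNReal.ofReal δ * (C₂ * ENNReal.ofReal ((1 + T ^ 2 * β ^ 2) * (1 + ‖ξ‖))))) := by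
        gcongr with t
        exact b3 t
    _ = 2 * C₂ * (ENNReal.ofReal δ ^ 2 * ENNReal.ofReal ((1 + T ^ 2 * β ^ 2) * (1 + ‖ξ‖))) *
        (ENNReal.ofReal (1 + ‖ξ‖) * (∫⁻ t in Icc (-T) T, ∫⁻ s in Icc (-T) T, ∫⁻ y,
          ‖K (s, y, ξ)‖ₑ ^ 2 * ‖χ (y - ((s - t) * β) • ξ)‖ₑ)) := by
        rw [lintegral_const_mul' _ _ (by finiteness), lintegral_mul_const' _ _ (by finiteness)]
        ring
    _ ≤ 2 * C₂ * (ENNReal.ofReal δ ^ 2 * ENNReal.ofReal ((1 + T ^ 2 * β ^ 2) * (1 + ‖ξ‖))) *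
        (C₁ * ∫⁻ s in Icc (-T) T, ∫⁻ y, ‖K (s, y, ξ)‖ₑ ^ 2) := by
        exact mul_le_mul_right (hK.lintegral_profile_le χ h₁ ξ) _
    _ = _ := by
        have : ENNReal.ofReal δ ^ 2 * ENNReal.ofReal ((1 + T ^ 2 * β ^ 2) * (1 + ‖ξ‖)) =
            ENNReal.ofReal (T ^ 2 * (1 + T ^ 2 * β ^ 2)) := by
          rw [← ENNReal.ofReal_pow hδ0.le, ← ENNReal.ofReal_mul (by positivity)]
          congr 1
          rw [hδ, averagingTime_sq]
          field_simp
        rw [this]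
        ring

theorem enorm_intervalIntegral_le {f : ℝ → ℂ} {s t : ℝ} :
    ‖∫ r in s..t, f r‖ₑ ≤ ∫⁻ r in uIoc s t, ‖f r‖ₑ := by
  have h : ‖∫ r in s..t, f r‖ₑ = ‖∫ r in uIoc s t, f r‖ₑ := by
    rw [← ofReal_norm, intervalIntegral.norm_intervalIntegral_eq, ofReal_norm]
  rw [h]
  exact enorm_integral_le_lintegral_enorm _

theorem uIoc_subset_near {T s t : ℝ} (hs : s ∈ Icc (-T) T) (ht : t ∈ Icc (-T) T) {r : ℝ}
    (hr : r ∈ uIoc s t) : r ∈ Icc (-T) T ∧ |r - t| ≤ |s - t| := by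
  refine ⟨uIcc_subset_Icc hs ht (uIoc_subset_uIcc hr), ?_⟩
  have h := abs_sub_right_of_mem_uIcc (uIoc_subset_uIcc hr)
  rwa [abs_sub_comm r, abs_sub_comm s]

variable {h : ℝ × Space d × Space d → ℂ} {M : ℝ≥0}

/-- All times between `s` and `t` lie in the window around `t`, so the source integral may be
enlarged to the whole window and no longer depends on `s`. -/
theorem IsTransportPair.enorm_le {β T : ℝ} (hp : IsTransportPair β T h K M N) (ψ : 𝓢(Space d, ℂ))
    {s t : ℝ} (hs : s ∈ Icc (-T) T) (ht : t ∈ Icc (-T) T) :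
    ∀ᵐ ξ : Space d, |s - t| < averagingTime T ξ →
      ‖movingAverage h (fun _ => 1) (angularFourier ψ) 0 t ξ‖ₑ ≤
        ‖movingAverage h (fun _ => 1) (angularFourier ψ) ((s - t) * β) s ξ‖ₑ +
          sourceAverage β T K (angularFourier ψ) (t, ξ) := by
  filter_upwards [hp.moving ψ s hs t ht] with ξ hξ hst
  rw [hξ]
  refine (enorm_add_le _ _).trans (add_le_add le_rfl ?_)
  have mint : Measurable fun q : ℝ × Space d => ‖K (q.1, q.2, ξ)‖ₑ *
      (ENNReal.ofReal (japaneseBracket q.2) * (nearIndicator T q.1 t ξ *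
        ‖angularFourier ψ (q.2 - ((q.1 - t) * β) • ξ)‖ₑ)) := by
    have h1 : Measurable fun q : ℝ × Space d => ((t, ξ), q) := by fun_prop
    have mK : Measurable fun q : ℝ × Space d => ‖K (q.1, q.2, ξ)‖ₑ :=
      (hp.snd.stronglyMeasurable.comp_measurable (by fun_prop :
        Measurable fun q : ℝ × Space d => (q.1, q.2, ξ))).enorm
    have mJ : Measurable fun q : ℝ × Space d => ENNReal.ofReal (japaneseBracket q.2) :=
      measurable_ofReal_japaneseBracket.comp measurable_snd
    have a1 := (measurable_profile β (angularFourier ψ)).comp h1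
    have a2 := (measurable_nearIndicator_comp T).comp h1
    simp only [Function.comp_def] at a1 a2
    exact mK.mul (mJ.mul (a2.mul a1))
  rw [sourceAverage, lintegral_prod _ mint.aemeasurable]
  refine enorm_intervalIntegral_le.trans ?_
  calc _ ≤ ∫⁻ r in uIoc s t, ∫⁻ y, ‖K (r, y, ξ)‖ₑ *
      (ENNReal.ofReal (japaneseBracket y) * (nearIndicator T r t ξ *
        ‖angularFourier ψ (y - ((r - t) * β) • ξ)‖ₑ)) := by
        refine setLIntegral_mono' measurableSet_uIoc fun r hr => ?_
        have hr' := uIoc_subset_near hs ht hr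
        have hn : nearIndicator T r t ξ = 1 := by
          simp [nearIndicator, hr'.2.trans_lt hst]
        refine (enorm_integral_le_lintegral_enorm _).trans (le_of_eq ?_)
        refine lintegral_congr fun y => ?_
        rw [enorm_mul, enorm_mul, hn, one_mul, ← ofReal_norm (japaneseBracket y : ℂ),
          Complex.norm_real, Real.norm_eq_abs, abs_of_pos (japaneseBracket_pos y)]
    _ ≤ _ := lintegral_mono_set fun r hr => (uIoc_subset_near hs ht hr).1

/-- The velocity average gains a quarter of a derivative. -/
theorem exists_bound_sqrt_weight {β T : ℝ} (hβ : 0 < β) (hT : 0 < T) (ψ : 𝓢(Space d, ℂ))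
    (M N : ℝ≥0) : ∃ C : ℝ≥0, ∀ h K : ℝ × Space d × Space d → ℂ, IsTransportPair β T h K M N →
      ∫⁻ t in Icc (-T) T, ∫⁻ ξ, ENNReal.ofReal (Real.sqrt (1 + ‖ξ‖)) *
        ‖movingAverage h (fun _ => 1) (angularFourier ψ) 0 t ξ‖ₑ ^ 2 ≤ C := by
  set χ := angularFourier ψ
  obtain ⟨C₁, h₁⟩ := exists_bound_time_integral χ hβ hT
  obtain ⟨C₂, h₂⟩ := exists_bound_weight_integral χ
  set Z : ℝ≥0∞ := ENNReal.ofReal T⁻¹ *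
    (2 * ((∫⁻ y, ‖χ y‖ₑ) * C₁ * (ENNReal.ofReal (2 * T) * M)) +
      4 * (2 * C₁ * C₂ * ENNReal.ofReal (T ^ 2 * (1 + T ^ 2 * β ^ 2)) *
        (ENNReal.ofReal (2 * T) * N))) with hZ
  have hχ : ∫⁻ y, ‖χ y‖ₑ ≠ ⊤ := χ.integrable.2.ne
  have hfin : Z ≠ ⊤ := by
    rw [hZ]
    finiteness
  refine ⟨Z.toNNReal, fun h K hp => ?_⟩
  rw [ENNReal.coe_toNNReal hfin]
  have mA : Measurable fun p : ℝ × Space d => ‖movingAverage h (fun _ => 1) χ 0 p.1 p.2‖ₑ := by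
    have h1 : Measurable fun p : ℝ × Space d => ((0 : ℝ), p.1, p.2) := by fun_prop
    have := (stronglyMeasurable_movingAverage hp.fst.stronglyMeasurable
      (continuous_const (y := (1 : ℂ))) χ).comp_measurable h1
    simpa only [Function.comp_def] using this.enorm
  have mP : Measurable fun p : ℝ × ℝ × Space d =>
      ‖movingAverage h (fun _ => 1) χ ((p.1 - p.2.1) * β) p.1 p.2.2‖ₑ := by
    have h1 : Measurable fun p : ℝ × ℝ × Space d => ((p.1 - p.2.1) * β, p.1, p.2.2) := by fun_prop
    have := (stronglyMeasurable_movingAverage hp.fst.stronglyMeasurable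
      (continuous_const (y := (1 : ℂ))) χ).comp_measurable h1
    simpa only [Function.comp_def] using this.enorm
  -- The transported term is then controlled by the mass of `h` and the source by that of `K`, each
  -- through the dispersive bound.
  have key := lintegral_sqrt_mul_sq_le_of_averaging hT mA mP
    (measurable_sourceAverage β T hp.snd.stronglyMeasurable χ)
    (fun s hs t ht => hp.enorm_le ψ hs ht)
  refine key.trans ?_
  rw [hZ]
  gcongr
  · rw [mul_assoc, ← mul_assoc]
    calc _ ≤ ∫⁻ ξ, (∫⁻ y, ‖χ y‖ₑ) * C₁ * ∫⁻ s in Icc (-T) T, ∫⁻ y, ‖h (s, y, ξ)‖ₑ ^ 2 := by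
          refine lintegral_mono fun ξ => ?_
          calc _ ≤ ∫⁻ t in Icc (-T) T, ∫⁻ s in Icc (-T) T, ENNReal.ofReal (1 + ‖ξ‖) *
                ((∫⁻ y, ‖h (s, y, ξ)‖ₑ ^ 2 * ‖χ (y - ((s - t) * β) • ξ)‖ₑ) * ∫⁻ y, ‖χ y‖ₑ) := by
                gcongr with t s
                exact hp.fst.movingAverage_sq_le χ _ s ξ
            _ = (∫⁻ y, ‖χ y‖ₑ) * (ENNReal.ofReal (1 + ‖ξ‖) *
                (∫⁻ t in Icc (-T) T, ∫⁻ s in Icc (-T) T, ∫⁻ y,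
                  ‖h (s, y, ξ)‖ₑ ^ 2 * ‖χ (y - ((s - t) * β) • ξ)‖ₑ)) := by
                simp_rw [lintegral_const_mul' _ _ (ENNReal.ofReal_ne_top (r := 1 + ‖ξ‖)),
                  lintegral_mul_const' _ _ hχ]
                ring
            _ ≤ _ := by
                rw [mul_assoc]
                exact mul_le_mul_right (hp.fst.lintegral_profile_le χ h₁ ξ) _
      _ ≤ _ := by
          rw [lintegral_const_mul' _ _ (by finiteness)]
          gcongr
          exact hp.fst.lintegral_mass_le T
  · calc _ ≤ ∫⁻ ξ, 2 * C₁ * C₂ * ENNReal.ofReal (T ^ 2 * (1 + T ^ 2 * β ^ 2)) *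
          ∫⁻ s in Icc (-T) T, ∫⁻ y, ‖K (s, y, ξ)‖ₑ ^ 2 :=
          lintegral_mono fun ξ => hp.snd.lintegral_sourceAverage_le hT h₁ h₂ ξ
      _ ≤ _ := by
          rw [lintegral_const_mul' _ _ (by finiteness)]
          gcongr
          exact hp.snd.lintegral_mass_le T

end AveragingEstimate

end

section

open Filter Topology
open scoped FourierTransform ContDiff

/-! ### Regularity in time -/

section TimeRegularity

variable {d : ℕ}

/-- The kernel `|τ|^{-1/2}` restricted to `|τ| < (1 + |ξ|)⁻¹`. -/
def nearKernel (τ : ℝ) (ξ : Space d) : ℝ≥0∞ :=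
  if |τ| * (1 + ‖ξ‖) < 1 then ENNReal.ofReal (|τ| ^ (-(1 / 2) : ℝ)) else 0

/-- The kernel `|τ|^{-3/2}` restricted to `|τ| ≥ (1 + |ξ|)⁻¹`. -/
def farKernel (τ : ℝ) (ξ : Space d) : ℝ≥0∞ :=
  if |τ| * (1 + ‖ξ‖) < 1 then 0 else ENNReal.ofReal (|τ| ^ (-(3 / 2) : ℝ))

theorem measurable_nearKernel : Measurable fun p : ℝ × Space d => nearKernel p.1 p.2 := by
  refine Measurable.ite (measurableSet_lt ?_ measurable_const) ?_ measurable_const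
  · exact (by fun_prop : Continuous fun p : ℝ × Space d => |p.1| * (1 + ‖p.2‖)).measurable
  · exact ENNReal.measurable_ofReal.comp
      ((by fun_prop : Continuous fun p : ℝ × Space d => |p.1|).measurable.pow_const _)

theorem measurable_farKernel : Measurable fun p : ℝ × Space d => farKernel p.1 p.2 := by
  refine Measurable.ite (measurableSet_lt ?_ measurable_const) measurable_const ?_
  · exact (by fun_prop : Continuous fun p : ℝ × Space d => |p.1| * (1 + ‖p.2‖)).measurable
  · exact ENNReal.measurable_ofReal.comp
      ((by fun_prop : Continuous fun p : ℝ × Space d => |p.1|).measurable.pow_const _)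

theorem two_mul_ofReal (x : ℝ) : 2 * ENNReal.ofReal x = ENNReal.ofReal (2 * x) := by
  rw [ENNReal.ofReal_mul (by norm_num)]; simp

theorem four_mul_ofReal (x : ℝ) : 4 * ENNReal.ofReal x = ENNReal.ofReal (4 * x) := by
  rw [ENNReal.ofReal_mul (by norm_num)]; simp

/-- On `|τ| < 1/a`, `a = 1 + |ξ|`, the integrand `2|τ|^{1/2}` is at most `2a^{-1/2}`, and the
interval has length `2/a`. -/
theorem lintegral_nearKernel_le (ξ : Space d) :
    ∫⁻ τ, nearKernel τ ξ * (2 * ENNReal.ofReal |τ|) ≤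
      4 * ENNReal.ofReal ((1 + ‖ξ‖) ^ (-(3 / 2) : ℝ)) := by
  have ha : 0 < 1 + ‖ξ‖ := by positivity
  have hb : ∀ τ, nearKernel τ ξ * (2 * ENNReal.ofReal |τ|) ≤
      (Metric.ball (0 : ℝ) (1 + ‖ξ‖)⁻¹).indicator
        (fun _ => ENNReal.ofReal (2 * (1 + ‖ξ‖) ^ (-(1 / 2) : ℝ))) τ := fun τ => by
    by_cases h : |τ| * (1 + ‖ξ‖) < 1
    · have h' : |τ| < (1 + ‖ξ‖)⁻¹ := by
        rw [← one_div, lt_div_iff₀ ha]; exact h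
      have hmem : τ ∈ Metric.ball (0 : ℝ) (1 + ‖ξ‖)⁻¹ := by simpa using h'
      rw [indicator_of_mem hmem]
      simp only [nearKernel, h, if_true]
      rw [two_mul_ofReal, ← ENNReal.ofReal_mul (by positivity)]
      refine ENNReal.ofReal_le_ofReal ?_
      have e : |τ| ^ (-(1 / 2) : ℝ) * (2 * |τ|) = 2 * |τ| ^ (1 / 2 : ℝ) := by
        rcases (abs_nonneg τ).eq_or_lt with h0 | h0
        · rw [← h0]; simp
        · have : |τ| ^ (1 / 2 : ℝ) = |τ| ^ (-(1 / 2) : ℝ) * |τ| := by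
            rw [← Real.rpow_add_one h0.ne']; norm_num
          rw [this]; ring
      rw [e, Real.rpow_neg ha.le, ← Real.inv_rpow ha.le]
      gcongr
    · simp [nearKernel, h]
  refine (lintegral_mono hb).trans (le_of_eq ?_)
  rw [lintegral_indicator_const measurableSet_ball, Real.volume_ball, four_mul_ofReal,
    ← ENNReal.ofReal_mul (by positivity)]
  congr 1
  have : (1 + ‖ξ‖) ^ (-(3 / 2) : ℝ) = (1 + ‖ξ‖) ^ (-(1 / 2) : ℝ) * (1 + ‖ξ‖)⁻¹ := by
    rw [← Real.rpow_neg_one (1 + ‖ξ‖), ← Real.rpow_add ha]; norm_num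
  rw [this]; ring

theorem lintegral_Ici_rpow_neg {c : ℝ} (hc : 0 < c) :
    ∫⁻ τ in Ici c, ENNReal.ofReal (|τ| ^ (-(3 / 2) : ℝ)) =
      ENNReal.ofReal (2 * c ^ (-(1 / 2) : ℝ)) := by
  rw [setLIntegral_congr Ioi_ae_eq_Ici.symm]
  have h1 : ∫⁻ τ in Ioi c, ENNReal.ofReal (|τ| ^ (-(3 / 2) : ℝ)) =
      ∫⁻ τ in Ioi c, ENNReal.ofReal (τ ^ (-(3 / 2) : ℝ)) :=
    setLIntegral_congr_fun measurableSet_Ioi fun τ hτ => by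
      simp only [abs_of_pos (hc.trans hτ)]
  rw [h1, ← ofReal_integral_eq_lintegral_ofReal
    (integrableOn_Ioi_rpow_of_lt (by norm_num) hc)
    ((ae_restrict_mem measurableSet_Ioi).mono fun τ hτ =>
      Real.rpow_nonneg (hc.le.trans (le_of_lt hτ)) _),
    integral_Ioi_rpow_of_lt (by norm_num) hc]
  congr 1
  norm_num
  ring

theorem lintegral_farKernel_le (ξ : Space d) :
    ∫⁻ τ, farKernel τ ξ ≤ 4 * ENNReal.ofReal (Real.sqrt (1 + ‖ξ‖)) := by
  have ha : 0 < 1 + ‖ξ‖ := by positivity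
  set c := (1 + ‖ξ‖)⁻¹ with hc
  have hc0 : 0 < c := by positivity
  have hb : ∀ τ, farKernel τ ξ ≤
      (Ici c).indicator (fun τ => ENNReal.ofReal (|τ| ^ (-(3 / 2) : ℝ))) τ +
      (Ici c).indicator (fun τ => ENNReal.ofReal (|τ| ^ (-(3 / 2) : ℝ))) (-τ) := fun τ => by
    by_cases h : |τ| * (1 + ‖ξ‖) < 1
    · simp [farKernel, h]
    · have h' : c ≤ |τ| := by
        rw [hc, inv_le_iff_one_le_mul₀ ha]; linarith
      simp only [farKernel, h, if_false]
      rcases le_total 0 τ with h0 | h0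
      · rw [abs_of_nonneg h0] at h'
        rw [indicator_of_mem (s := Ici c) (mem_Ici.2 h')]
        exact le_self_add
      · rw [abs_of_nonpos h0] at h'
        rw [indicator_of_mem (s := Ici c) (mem_Ici.2 h') , abs_neg]
        exact le_add_self
  refine (lintegral_mono hb).trans (le_of_eq ?_)
  have hm : Measurable fun τ => (Ici c).indicator
      (fun τ => ENNReal.ofReal (|τ| ^ (-(3 / 2) : ℝ))) τ :=
    Measurable.indicator (by fun_prop) measurableSet_Ici
  rw [lintegral_add_left hm, lintegral_neg_eq_self (fun τ => (Ici c).indicator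
      (fun τ => ENNReal.ofReal (|τ| ^ (-(3 / 2) : ℝ))) τ),
    lintegral_indicator measurableSet_Ici, lintegral_Ici_rpow_neg hc0, ← two_mul,
    two_mul_ofReal, four_mul_ofReal]
  congr 1
  rw [hc, Real.rpow_neg (by positivity), ← Real.inv_rpow (by positivity), inv_inv,
    Real.sqrt_eq_rpow]
  ring

/-- For small increments Cauchy-Schwarz in `r` gains a factor `|t - s|`, turning the exponent `-3/2`
into `-1/2`; for large ones the triangle inequality is enough. The exponent `3/2 = 1 + 2·(1/4)` is
that of a quarter derivative in one dimension. -/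
theorem enorm_sub_sq_mul_le {a b : ℂ} {B : ℝ → ℝ≥0∞} (hB : Measurable B) {T s t : ℝ}
    (hs : s ∈ Icc (-T) T) (ht : t ∈ Icc (-T) T) (h : ‖a - b‖ₑ ≤ ∫⁻ r in uIoc s t, B r)
    (ξ : Space d) :
    ‖a - b‖ₑ ^ 2 * ENNReal.ofReal (|t - s| ^ (-(3 / 2) : ℝ)) ≤
      nearKernel (t - s) ξ *
        (∫⁻ r in Icc (-T) T, (if |r - t| ≤ |t - s| then 1 else 0) * B r ^ 2) +
      farKernel (t - s) ξ * (2 * ‖a‖ₑ ^ 2 + 2 * ‖b‖ₑ ^ 2) := by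
  by_cases hn : |t - s| * (1 + ‖ξ‖) < 1
  · simp only [nearKernel, farKernel, hn, if_true, zero_mul, add_zero]
    have h1 : ‖a - b‖ₑ ^ 2 ≤ ENNReal.ofReal |t - s| *
        ∫⁻ r in Icc (-T) T, (if |r - t| ≤ |t - s| then 1 else 0) * B r ^ 2 := by
      have h2 := lintegral_mul_sq_le (μ := volume.restrict (uIoc s t)) (f := fun _ => 1)
        aemeasurable_const hB.aemeasurable
      simp only [one_mul, one_pow, lintegral_const, Measure.restrict_apply MeasurableSet.univ,
        univ_inter, Real.volume_uIoc] at h2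
      refine (pow_le_pow_left' h 2).trans (h2.trans ?_)
      refine mul_le_mul_right ?_ _
      calc ∫⁻ r in uIoc s t, B r ^ 2 ≤ ∫⁻ r in uIoc s t, (if |r - t| ≤ |t - s| then 1 else 0) * B r ^ 2 := by
            refine setLIntegral_mono' measurableSet_uIoc fun r hr => ?_
            have := (uIoc_subset_near hs ht hr).2
            rw [abs_sub_comm s] at this
            simp [this]
        _ ≤ _ := lintegral_mono_set fun r hr => (uIoc_subset_near hs ht hr).1
    have e : ENNReal.ofReal (|t - s| ^ (-(1 / 2) : ℝ)) =
        ENNReal.ofReal |t - s| * ENNReal.ofReal (|t - s| ^ (-(3 / 2) : ℝ)) := by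
      rw [← ENNReal.ofReal_mul (abs_nonneg _)]
      congr 1
      rcases (abs_nonneg (t - s)).eq_or_lt with h0 | h0
      · rw [← h0]; simp
      · rw [mul_comm, ← Real.rpow_add_one h0.ne']; norm_num
    rw [e]
    calc _ ≤ (ENNReal.ofReal |t - s| *
        ∫⁻ r in Icc (-T) T, (if |r - t| ≤ |t - s| then 1 else 0) * B r ^ 2) *
          ENNReal.ofReal (|t - s| ^ (-(3 / 2) : ℝ)) := by gcongr
      _ = _ := by ring
  · simp only [nearKernel, farKernel, hn, if_false, zero_mul, zero_add]
    rw [mul_comm]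
    gcongr
    refine le_trans ?_ (add_sq_le_two_mul _ _)
    gcongr
    exact enorm_sub_le

/-- In the variables `r` and `τ = t - s`, the times `t` with `|r - t| ≤ |τ|` form an interval of
length `2|τ|`; this is the factor paired with the near kernel. -/
theorem lintegral_nearKernel_average_le {B : ℝ → ℝ≥0∞} (hB : Measurable B) (T : ℝ) (ξ : Space d) :
    ∫⁻ t in Icc (-T) T, ∫⁻ s in Icc (-T) T, nearKernel (t - s) ξ *
        (∫⁻ r in Icc (-T) T, (if |r - t| ≤ |t - s| then 1 else 0) * B r ^ 2) ≤
      4 * ENNReal.ofReal ((1 + ‖ξ‖) ^ (-(3 / 2) : ℝ)) * ∫⁻ r in Icc (-T) T, B r ^ 2 := by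
  have mk : Measurable fun τ : ℝ => nearKernel τ ξ := by
    have h1 : Measurable fun τ : ℝ => (τ, ξ) := by fun_prop
    simpa only [Function.comp_def] using measurable_nearKernel.comp h1
  have mi : Measurable fun p : (ℝ × ℝ) × ℝ =>
      (if |p.2 - p.1.1| ≤ |p.1.2| then (1 : ℝ≥0∞) else 0) :=
    Measurable.ite (measurableSet_le (by fun_prop) (by fun_prop)) measurable_const
      measurable_const
  have m0 : Measurable fun p : (ℝ × ℝ) × ℝ => nearKernel p.1.2 ξ *
      ((if |p.2 - p.1.1| ≤ |p.1.2| then 1 else 0) * B p.2 ^ 2) := by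
    have h1 : Measurable fun p : (ℝ × ℝ) × ℝ => nearKernel p.1.2 ξ :=
      mk.comp (measurable_snd.comp measurable_fst)
    exact h1.mul (mi.mul ((hB.comp measurable_snd).pow_const 2))
  have m1 : Measurable fun p : ℝ × ℝ => ∫⁻ r in Icc (-T) T, nearKernel p.2 ξ *
      ((if |r - p.1| ≤ |p.2| then 1 else 0) * B r ^ 2) := m0.lintegral_prod_right'
  calc _ ≤ ∫⁻ t in Icc (-T) T, ∫⁻ τ, ∫⁻ r in Icc (-T) T, nearKernel τ ξ *
        ((if |r - t| ≤ |τ| then 1 else 0) * B r ^ 2) := by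
        refine lintegral_mono fun t => ?_
        refine (setLIntegral_le_lintegral _ _).trans ?_
        have h1 := lintegral_sub_left_eq_self (fun τ => nearKernel τ ξ *
          ∫⁻ r in Icc (-T) T, (if |r - t| ≤ |τ| then 1 else 0) * B r ^ 2) t (μ := volume)
        rw [h1]
        refine lintegral_mono fun τ => ?_
        simp only
        rw [lintegral_const_mul]
        exact Measurable.mul (Measurable.ite (measurableSet_le (by fun_prop) (by fun_prop))
          measurable_const measurable_const) (hB.pow_const 2)
    _ = ∫⁻ r in Icc (-T) T, ∫⁻ τ, ∫⁻ t in Icc (-T) T, nearKernel τ ξ *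
        ((if |r - t| ≤ |τ| then 1 else 0) * B r ^ 2) := by
        rw [lintegral_lintegral_swap (f := fun t τ => ∫⁻ r in Icc (-T) T, nearKernel τ ξ *
          ((if |r - t| ≤ |τ| then 1 else 0) * B r ^ 2)) m1.aemeasurable]
        have m2 : ∀ τ, Measurable fun p : ℝ × ℝ => nearKernel τ ξ *
            ((if |p.2 - p.1| ≤ |τ| then 1 else 0) * B p.2 ^ 2) := fun τ => by
          have h1 : Measurable fun p : ℝ × ℝ => ((p.1, τ), p.2) := by fun_prop
          simpa only [Function.comp_def] using m0.comp h1
        have a1 : ∀ τ, ∫⁻ t in Icc (-T) T, ∫⁻ r in Icc (-T) T, nearKernel τ ξ *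
            ((if |r - t| ≤ |τ| then 1 else 0) * B r ^ 2) =
            ∫⁻ r in Icc (-T) T, ∫⁻ t in Icc (-T) T, nearKernel τ ξ *
            ((if |r - t| ≤ |τ| then 1 else 0) * B r ^ 2) := fun τ =>
          lintegral_lintegral_swap (f := fun t r => nearKernel τ ξ *
            ((if |r - t| ≤ |τ| then 1 else 0) * B r ^ 2)) (m2 τ).aemeasurable
        simp_rw [a1]
        have m3 : Measurable fun p : ℝ × ℝ => ∫⁻ t in Icc (-T) T, nearKernel p.1 ξ *
            ((if |p.2 - t| ≤ |p.1| then 1 else 0) * B p.2 ^ 2) := by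
          have h1 : Measurable fun p : (ℝ × ℝ) × ℝ => ((p.2, p.1.1), p.1.2) := by fun_prop
          have h2 := m0.comp h1
          simp only [Function.comp_def] at h2
          exact h2.lintegral_prod_right'
        exact lintegral_lintegral_swap (f := fun τ r => ∫⁻ t in Icc (-T) T, nearKernel τ ξ *
            ((if |r - t| ≤ |τ| then 1 else 0) * B r ^ 2)) m3.aemeasurable
    _ ≤ ∫⁻ r in Icc (-T) T, 4 * ENNReal.ofReal ((1 + ‖ξ‖) ^ (-(3 / 2) : ℝ)) * B r ^ 2 := by
        refine lintegral_mono fun r => ?_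
        calc _ ≤ ∫⁻ τ, nearKernel τ ξ * (2 * ENNReal.ofReal |τ|) * B r ^ 2 := by
              refine lintegral_mono fun τ => ?_
              have mi' : Measurable fun t : ℝ => (if |r - t| ≤ |τ| then (1 : ℝ≥0∞) else 0) :=
                Measurable.ite (measurableSet_le (by fun_prop) (by fun_prop)) measurable_const
                  measurable_const
              simp only
              rw [lintegral_const_mul _ (mi'.mul_const _), lintegral_mul_const _ mi', mul_assoc]
              gcongr
              have e : (fun t => (if |r - t| ≤ |τ| then (1 : ℝ≥0∞) else 0)) =
                  (Metric.closedBall r |τ|).indicator 1 := by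
                ext t
                simp only [indicator, Metric.mem_closedBall, Real.dist_eq, Pi.one_apply,
                  abs_sub_comm t r]
              refine (setLIntegral_le_lintegral _ _).trans ?_
              rw [e, lintegral_indicator_one measurableSet_closedBall, Real.volume_closedBall,
                ENNReal.ofReal_mul (by norm_num)]
              simp
          _ ≤ _ := by
              have m4 : Measurable fun τ : ℝ => nearKernel τ ξ * (2 * ENNReal.ofReal |τ|) :=
                mk.mul (by fun_prop)
              rw [lintegral_mul_const _ m4]
              gcongr
              exact lintegral_nearKernel_le ξ
    _ = _ := lintegral_const_mul _ (hB.pow_const 2)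

theorem lintegral_farKernel_average_le {B : ℝ → ℝ≥0∞} (hB : Measurable B) (T : ℝ) (ξ : Space d) :
    ∫⁻ t in Icc (-T) T, ∫⁻ s in Icc (-T) T, farKernel (t - s) ξ * (2 * B t ^ 2 + 2 * B s ^ 2) ≤
      16 * ENNReal.ofReal (Real.sqrt (1 + ‖ξ‖)) * ∫⁻ r in Icc (-T) T, B r ^ 2 := by
  have mk : Measurable fun τ : ℝ => farKernel τ ξ := by
    have h1 : Measurable fun τ : ℝ => (τ, ξ) := by fun_prop
    simpa only [Function.comp_def] using measurable_farKernel.comp h1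
  have mB := hB.pow_const 2
  have m1 : Measurable fun p : ℝ × ℝ => farKernel (p.1 - p.2) ξ * (2 * B p.1 ^ 2) :=
    (mk.comp (measurable_fst.sub measurable_snd)).mul ((mB.comp measurable_fst).const_mul 2)
  have m2 : Measurable fun p : ℝ × ℝ => farKernel (p.1 - p.2) ξ * (2 * B p.2 ^ 2) :=
    (mk.comp (measurable_fst.sub measurable_snd)).mul ((mB.comp measurable_snd).const_mul 2)
  have hsym : ∀ t s : ℝ, farKernel (t - s) ξ = farKernel (s - t) ξ := fun t s => by
    simp only [farKernel, abs_sub_comm t s]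
  have h1 : ∫⁻ t in Icc (-T) T, ∫⁻ s in Icc (-T) T, farKernel (t - s) ξ * (2 * B t ^ 2) ≤
      8 * ENNReal.ofReal (Real.sqrt (1 + ‖ξ‖)) * ∫⁻ r in Icc (-T) T, B r ^ 2 := by
    rw [← lintegral_const_mul _ mB]
    refine lintegral_mono fun t => ?_
    have m3 : Measurable fun s => farKernel (t - s) ξ :=
      mk.comp (measurable_const.sub measurable_id)
    rw [lintegral_mul_const _ m3]
    calc _ ≤ (4 * ENNReal.ofReal (Real.sqrt (1 + ‖ξ‖))) * (2 * B t ^ 2) := by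
          gcongr
          refine (setLIntegral_le_lintegral _ _).trans ?_
          rw [lintegral_sub_left_eq_self (fun τ => farKernel τ ξ) t]
          exact lintegral_farKernel_le ξ
      _ = _ := by ring
  have h2 : ∫⁻ t in Icc (-T) T, ∫⁻ s in Icc (-T) T, farKernel (t - s) ξ * (2 * B s ^ 2) ≤
      8 * ENNReal.ofReal (Real.sqrt (1 + ‖ξ‖)) * ∫⁻ r in Icc (-T) T, B r ^ 2 := by
    rw [lintegral_lintegral_swap (f := fun t s => farKernel (t - s) ξ * (2 * B s ^ 2))
      m2.aemeasurable]
    refine le_trans (le_of_eq ?_) h1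
    refine lintegral_congr fun s => lintegral_congr fun t => ?_
    rw [hsym]
  have m4 : ∀ t, Measurable fun s => farKernel (t - s) ξ * (2 * B t ^ 2) := fun t =>
    (mk.comp (measurable_const.sub measurable_id)).mul_const _
  have m5 : Measurable fun t => ∫⁻ s in Icc (-T) T, farKernel (t - s) ξ * (2 * B t ^ 2) :=
    m1.lintegral_prod_right'
  simp_rw [mul_add, lintegral_add_left (m4 _)]
  rw [lintegral_add_left m5]
  refine (add_le_add h1 h2).trans (le_of_eq ?_)
  rw [← add_mul, ← add_mul]
  norm_num

/-- Here `B` plays the role of `|∂ₜA|`. The threshold `1/(1 + |ξ|)` reflects that a time derivative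
costs one power of the frequency: the two weights `(1 + |ξ|)^{-3/2}` and `(1 + |ξ|)^{1/2}` differ by
exactly two powers. -/
theorem lintegral_time_increment_le {T : ℝ} {A : ℝ × Space d → ℂ} {B : ℝ × Space d → ℝ≥0∞}
    (hA : StronglyMeasurable A) (hB : Measurable B)
    (h : ∀ s ∈ Icc (-T) T, ∀ t ∈ Icc (-T) T, ∀ᵐ ξ : Space d,
      ‖A (t, ξ) - A (s, ξ)‖ₑ ≤ ∫⁻ r in uIoc s t, B (r, ξ)) :
    ∫⁻ t in Icc (-T) T, ∫⁻ s in Icc (-T) T,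
      (∫⁻ ξ, ‖A (t, ξ) - A (s, ξ)‖ₑ ^ 2) * ENNReal.ofReal (|t - s| ^ (-(3 / 2) : ℝ)) ≤
    2 * (4 * ∫⁻ r in Icc (-T) T, ∫⁻ ξ,
        ENNReal.ofReal ((1 + ‖ξ‖) ^ (-(3 / 2) : ℝ)) * B (r, ξ) ^ 2) +
      2 * (16 * ∫⁻ t in Icc (-T) T, ∫⁻ ξ,
        ENNReal.ofReal (Real.sqrt (1 + ‖ξ‖)) * ‖A (t, ξ)‖ₑ ^ 2) := by
  have mA : Measurable fun p : ℝ × Space d => ‖A p‖ₑ := hA.enorm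
  have mAξ : ∀ ξ, Measurable fun r => ‖A (r, ξ)‖ₑ := fun ξ => mA.comp (by fun_prop)
  have mBξ : ∀ ξ, Measurable fun r => B (r, ξ) := fun ξ => hB.comp (by fun_prop)
  have mdiff : Measurable fun p : (ℝ × ℝ) × Space d => (p.1.1 - p.1.2, p.2) := by fun_prop
  have m1 : Measurable fun p : (ℝ × ℝ) × Space d => nearKernel (p.1.1 - p.1.2) p.2 *
        (∫⁻ r in Icc (-T) T, (if |r - p.1.1| ≤ |p.1.1 - p.1.2| then 1 else 0) *
          B (r, p.2) ^ 2) := by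
    have k := measurable_nearKernel.comp mdiff
    simp only [Function.comp_def] at k
    refine k.mul ?_
    have h1 : Measurable fun q : ((ℝ × ℝ) × Space d) × ℝ =>
        (if |q.2 - q.1.1.1| ≤ |q.1.1.1 - q.1.1.2| then (1 : ℝ≥0∞) else 0) :=
      Measurable.ite (measurableSet_le (by fun_prop) (by fun_prop)) measurable_const
        measurable_const
    have h2 : Measurable fun q : ((ℝ × ℝ) × Space d) × ℝ => B (q.2, q.1.2) :=
      hB.comp (by fun_prop)
    exact (h1.mul (h2.pow_const 2)).lintegral_prod_right'
  have m2 : Measurable fun p : (ℝ × ℝ) × Space d => farKernel (p.1.1 - p.1.2) p.2 *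
      (2 * ‖A (p.1.1, p.2)‖ₑ ^ 2 + 2 * ‖A (p.1.2, p.2)‖ₑ ^ 2) := by
    have k := measurable_farKernel.comp mdiff
    simp only [Function.comp_def] at k
    have h1 : Measurable fun p : (ℝ × ℝ) × Space d => ‖A (p.1.1, p.2)‖ₑ := mA.comp (by fun_prop)
    have h2 : Measurable fun p : (ℝ × ℝ) × Space d => ‖A (p.1.2, p.2)‖ₑ := mA.comp (by fun_prop)
    exact k.mul (((h1.pow_const 2).const_mul 2).add ((h2.pow_const 2).const_mul 2))
  calc _ ≤ ∫⁻ t in Icc (-T) T, ∫⁻ s in Icc (-T) T, ∫⁻ ξ,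
        (2 * (nearKernel (t - s) ξ *
          (∫⁻ r in Icc (-T) T, (if |r - t| ≤ |t - s| then 1 else 0) * B (r, ξ) ^ 2)) +
        2 * (farKernel (t - s) ξ * (2 * ‖A (t, ξ)‖ₑ ^ 2 + 2 * ‖A (s, ξ)‖ₑ ^ 2))) := by
        refine setLIntegral_mono' measurableSet_Icc fun t ht =>
          setLIntegral_mono' measurableSet_Icc fun s hs => ?_
        rw [← lintegral_mul_const' _ _ ENNReal.ofReal_ne_top]
        refine lintegral_mono_ae ?_
        filter_upwards [h s hs t ht] with ξ hξ
        refine (enorm_sub_sq_mul_le (mBξ ξ) hs ht hξ ξ).trans ?_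
        exact add_le_add (le_mul_of_one_le_left' (by norm_num))
          (le_mul_of_one_le_left' (by norm_num))
    _ = 2 * (∫⁻ ξ, ∫⁻ t in Icc (-T) T, ∫⁻ s in Icc (-T) T, nearKernel (t - s) ξ *
          (∫⁻ r in Icc (-T) T, (if |r - t| ≤ |t - s| then 1 else 0) * B (r, ξ) ^ 2)) +
        2 * ∫⁻ ξ, ∫⁻ t in Icc (-T) T, ∫⁻ s in Icc (-T) T,
          farKernel (t - s) ξ * (2 * ‖A (t, ξ)‖ₑ ^ 2 + 2 * ‖A (s, ξ)‖ₑ ^ 2) := by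
        have e1 := lintegral_lintegral_lintegral_add (ν := volume.restrict (Icc (-T) T)) m1
          (fun p => farKernel (p.1.1 - p.1.2) p.2 *
            (2 * ‖A (p.1.1, p.2)‖ₑ ^ 2 + 2 * ‖A (p.1.2, p.2)‖ₑ ^ 2))
        have e2 := lintegral_lintegral_lintegral_swap (ν := volume.restrict (Icc (-T) T)) m1
        have e3 := lintegral_lintegral_lintegral_swap (ν := volume.restrict (Icc (-T) T)) m2
        simp only at e1 e2 e3
        rw [e1, e2, e3]
    _ ≤ _ := by
        have w1 : Measurable fun p : ℝ × Space d =>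
            ENNReal.ofReal ((1 + ‖p.2‖) ^ (-(3 / 2) : ℝ)) * B p ^ 2 := by
          refine Measurable.mul (ENNReal.measurable_ofReal.comp ?_) (hB.pow_const 2)
          exact (by fun_prop : Measurable fun p : ℝ × Space d => 1 + ‖p.2‖).pow_const _
        have w2 : Measurable fun p : ℝ × Space d =>
            ENNReal.ofReal (Real.sqrt (1 + ‖p.2‖)) * ‖A p‖ₑ ^ 2 :=
          Measurable.mul (by fun_prop) (mA.pow_const 2)
        refine add_le_add (mul_le_mul_right ?_ 2) (mul_le_mul_right ?_ 2)
        · rw [lintegral_lintegral_swap (f := fun r ξ =>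
            ENNReal.ofReal ((1 + ‖ξ‖) ^ (-(3 / 2) : ℝ)) * B (r, ξ) ^ 2) w1.aemeasurable,
            ← lintegral_const_mul' _ _ ENNReal.ofNat_ne_top]
          refine lintegral_mono fun ξ => ?_
          refine (lintegral_nearKernel_average_le (mBξ ξ) T ξ).trans (le_of_eq ?_)
          rw [lintegral_const_mul' _ _ ENNReal.ofReal_ne_top, mul_assoc]
        · rw [lintegral_lintegral_swap (f := fun t ξ =>
            ENNReal.ofReal (Real.sqrt (1 + ‖ξ‖)) * ‖A (t, ξ)‖ₑ ^ 2) w2.aemeasurable,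
            ← lintegral_const_mul' _ _ ENNReal.ofNat_ne_top]
          refine lintegral_mono fun ξ => ?_
          refine (lintegral_farKernel_average_le (mAξ ξ) T ξ).trans (le_of_eq ?_)
          rw [lintegral_const_mul' _ _ ENNReal.ofReal_ne_top, mul_assoc]

end TimeRegularity

end

section

open Filter Topology
open scoped FourierTransform ContDiff

/-! ### The time derivative of the averages and the combined Fourier side bounds. -/

section TimeSource

variable {d : ℕ} {h K : ℝ × Space d × Space d → ℂ} {M N : ℝ≥0}

/-- A majorant of the time derivative of the velocity average on the Fourier side. -/
def timeSource (β : ℝ) (h K : ℝ × Space d × Space d → ℂ) (ψ : 𝓢(Space d, ℂ))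
    (p : ℝ × Space d) : ℝ≥0∞ :=
  ENNReal.ofReal β * (∑ j, ‖(p.2 j : ℂ)‖ₑ *
      ‖movingAverage h (fun _ => 1) (angularFourier (coordMul j ψ)) 0 p.1 p.2‖ₑ) +
    ‖movingAverage K (fun y => (japaneseBracket y : ℂ)) (angularFourier ψ) 0 p.1 p.2‖ₑ

theorem IsBoundedFamily.stronglyMeasurable_movingAverage_zero {F : ℝ × Space d × Space d → ℂ}
    (hF : IsBoundedFamily F N) {ρ : Space d → ℂ} (hρ : Continuous ρ) (χ : 𝓢(Space d, ℂ)) :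
    StronglyMeasurable fun p : ℝ × Space d => movingAverage F ρ χ 0 p.1 p.2 := by
  have h1 : Measurable fun p : ℝ × Space d => ((0 : ℝ), p.1, p.2) := by fun_prop
  simpa only [Function.comp_def] using
    (stronglyMeasurable_movingAverage hF.stronglyMeasurable hρ χ).comp_measurable h1

theorem continuous_ofReal_japaneseBracket :
    Continuous fun y : Space d => (japaneseBracket y : ℂ) :=
  Complex.continuous_ofReal.comp continuous_japaneseBracket

theorem IsTransportPair.measurable_timeSource {β T : ℝ} (hp : IsTransportPair β T h K M N)
    (ψ : 𝓢(Space d, ℂ)) : Measurable (timeSource β h K ψ) := by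
  refine Measurable.add (Measurable.const_mul (Finset.measurable_sum _ fun j _ => ?_) _)
    (hp.snd.stronglyMeasurable_movingAverage_zero continuous_ofReal_japaneseBracket _).enorm
  refine Measurable.mul ?_
    (hp.fst.stronglyMeasurable_movingAverage_zero continuous_const _).enorm
  fun_prop

theorem IsTransportPair.enorm_sub_le {β T : ℝ} (hβ : 0 ≤ β) (hp : IsTransportPair β T h K M N)
    (ψ : 𝓢(Space d, ℂ)) {s t : ℝ} (hs : s ∈ Icc (-T) T) (ht : t ∈ Icc (-T) T) :
    ∀ᵐ ξ : Space d,
      ‖movingAverage h (fun _ => 1) (angularFourier ψ) 0 t ξ -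
        movingAverage h (fun _ => 1) (angularFourier ψ) 0 s ξ‖ₑ ≤
        ∫⁻ r in uIoc s t, timeSource β h K ψ (r, ξ) := by
  filter_upwards [hp.atRest ψ s hs t ht] with ξ hξ
  rw [hξ]
  have mA : ∀ j, Measurable fun r =>
      ‖movingAverage h (fun _ => 1) (angularFourier (coordMul j ψ)) 0 r ξ‖ₑ := fun j => by
    have h1 : Measurable fun r : ℝ => (r, ξ) := by fun_prop
    simpa only [Function.comp_def] using
      ((hp.fst.stronglyMeasurable_movingAverage_zero continuous_const _).comp_measurable h1).enorm
  have mS : Measurable fun r => ENNReal.ofReal β * ∑ j, ‖(ξ j : ℂ)‖ₑ *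
      ‖movingAverage h (fun _ => 1) (angularFourier (coordMul j ψ)) 0 r ξ‖ₑ :=
    Measurable.const_mul (Finset.measurable_sum _ fun j _ => (mA j).const_mul _) _
  simp only [timeSource]
  rw [lintegral_add_left mS, lintegral_const_mul' _ _ ENNReal.ofReal_ne_top,
    lintegral_finsetSum _ fun j _ => (mA j).const_mul _]
  refine (enorm_add_le _ _).trans (add_le_add ?_ enorm_intervalIntegral_le)
  rw [enorm_mul]
  have e : ‖-(Complex.I * (β : ℂ))‖ₑ = ENNReal.ofReal β := by
    rw [← ofReal_norm, norm_neg, norm_mul, Complex.norm_I, one_mul, Complex.norm_real,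
      Real.norm_of_nonneg hβ]
  rw [e]
  refine mul_le_mul_right ((enorm_sum_le _ _).trans (Finset.sum_le_sum fun j _ => ?_)) _
  rw [enorm_mul, lintegral_const_mul _ (mA j)]
  exact mul_le_mul_right enorm_intervalIntegral_le _

/-- The two powers of `|ξ|` lost in the time derivative raise the weight `-3/2` to `1/2`, the weight
of the space estimate. -/
theorem weight_mul_enorm_coord_sq_le (ξ : Space d) (j : Fin d) :
    ENNReal.ofReal ((1 + ‖ξ‖) ^ (-(3 / 2) : ℝ)) * ‖(ξ j : ℂ)‖ₑ ^ 2 ≤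
      ENNReal.ofReal (Real.sqrt (1 + ‖ξ‖)) := by
  have ha : 0 < 1 + ‖ξ‖ := by positivity
  have h1 : ‖(ξ j : ℂ)‖ ≤ 1 + ‖ξ‖ := by
    rw [Complex.norm_real]
    linarith [PiLp.norm_apply_le ξ j]
  rw [← ofReal_norm, ← ENNReal.ofReal_pow (norm_nonneg _), ← ENNReal.ofReal_mul (by positivity)]
  refine ENNReal.ofReal_le_ofReal ?_
  calc _ ≤ (1 + ‖ξ‖) ^ (-(3 / 2) : ℝ) * (1 + ‖ξ‖) ^ 2 := by gcongr
    _ = _ := by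
      rw [← Real.rpow_natCast (1 + ‖ξ‖) 2, ← Real.rpow_add ha, Real.sqrt_eq_rpow]
      norm_num

theorem weight_mul_timeSource_sq_le (β : ℝ) (ψ : 𝓢(Space d, ℂ)) (r : ℝ) (ξ : Space d) :
    ENNReal.ofReal ((1 + ‖ξ‖) ^ (-(3 / 2) : ℝ)) * timeSource β h K ψ (r, ξ) ^ 2 ≤
      2 * ENNReal.ofReal β ^ 2 * 2 ^ d * (∑ j, ENNReal.ofReal (Real.sqrt (1 + ‖ξ‖)) *
        ‖movingAverage h (fun _ => 1) (angularFourier (coordMul j ψ)) 0 r ξ‖ₑ ^ 2) +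
      2 * ‖movingAverage K (fun y => (japaneseBracket y : ℂ)) (angularFourier ψ) 0 r ξ‖ₑ ^ 2 := by
  set W := ENNReal.ofReal ((1 + ‖ξ‖) ^ (-(3 / 2) : ℝ)) with hW
  have hW1 : W ≤ 1 := by
    rw [hW, ← ENNReal.ofReal_one]
    exact ENNReal.ofReal_le_ofReal
      (Real.rpow_le_one_of_one_le_of_nonpos (by linarith [norm_nonneg ξ]) (by norm_num))
  simp only [timeSource]
  refine (mul_le_mul_right (add_sq_le_two_mul _ _) W).trans ?_
  rw [mul_add]
  refine add_le_add ?_ ?_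
  · have h1 := sum_sq_le_card_mul (Finset.univ : Finset (Fin d)) (fun j => ‖(ξ j : ℂ)‖ₑ *
      ‖movingAverage h (fun _ => 1) (angularFourier (coordMul j ψ)) 0 r ξ‖ₑ)
    rw [Finset.card_univ, Fintype.card_fin] at h1
    rw [mul_pow]
    calc _ ≤ W * (2 * (ENNReal.ofReal β ^ 2 * (2 ^ d * ∑ j, (‖(ξ j : ℂ)‖ₑ *
          ‖movingAverage h (fun _ => 1) (angularFourier (coordMul j ψ)) 0 r ξ‖ₑ) ^ 2))) := by
          gcongr
      _ = 2 * ENNReal.ofReal β ^ 2 * 2 ^ d * (∑ j, W * ‖(ξ j : ℂ)‖ₑ ^ 2 *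
          ‖movingAverage h (fun _ => 1) (angularFourier (coordMul j ψ)) 0 r ξ‖ₑ ^ 2) := by
          simp_rw [mul_assoc W, ← Finset.mul_sum, mul_pow]
          ring
      _ ≤ _ := by
          gcongr with j
          exact weight_mul_enorm_coord_sq_le ξ j
  · exact mul_le_of_le_one_left' hW1

/-- Bounds for the velocity average on the Fourier side: uniformly in time, of order `1/4` in
space, and of order `1/4` in time. -/
structure IsAverageBound (T : ℝ) (A : ℝ × Space d → ℂ) (C : ℝ≥0) : Prop where
  stronglyMeasurable : StronglyMeasurable A
  lintegral_sq_le : ∀ t, ∫⁻ ξ, ‖A (t, ξ)‖ₑ ^ 2 ≤ C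
  lintegral_space_le : ∫⁻ t in Icc (-T) T, ∫⁻ ξ, ENNReal.ofReal (Real.sqrt (1 + ‖ξ‖)) *
    ‖A (t, ξ)‖ₑ ^ 2 ≤ C
  lintegral_time_le : ∫⁻ t in Icc (-T) T, ∫⁻ s in Icc (-T) T,
    (∫⁻ ξ, ‖A (t, ξ) - A (s, ξ)‖ₑ ^ 2) * ENNReal.ofReal (|t - s| ^ (-(3 / 2) : ℝ)) ≤ C

theorem exists_isAverageBound {β T : ℝ} (hβ : 0 < β) (hT : 0 < T) (ψ : 𝓢(Space d, ℂ))
    (M N : ℝ≥0) : ∃ C : ℝ≥0, ∀ h K : ℝ × Space d × Space d → ℂ, IsTransportPair β T h K M N →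
      IsAverageBound T
        (fun p => movingAverage h (fun _ => 1) (angularFourier ψ) 0 p.1 p.2) C := by
  obtain ⟨C₁, h₁⟩ := exists_bound_sqrt_weight hβ hT ψ M N
  -- The time derivative of the average against `ψ` involves the averages against `v_j ψ`, so their
  -- space regularity is needed too.
  choose C₂ h₂ using fun j => exists_bound_sqrt_weight hβ hT (coordMul j ψ) M N
  set J : ℝ≥0∞ := ∫⁻ y, ‖japaneseMul (angularFourier ψ) y‖ₑ ^ 2 with hJ
  have hJt : J ≠ ⊤ := (lintegral_sq_lt_top_of_memLp
    ((japaneseMul (angularFourier ψ)).memLp 2 volume)).ne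
  set Z : ℝ≥0∞ := 2 * ENNReal.ofReal β ^ 2 * 2 ^ d * (∑ j, (C₂ j : ℝ≥0∞)) +
    2 * (N * J * ENNReal.ofReal (2 * T)) with hZ
  have hZt : Z ≠ ⊤ := by
    have : ∑ j, (C₂ j : ℝ≥0∞) ≠ ⊤ := by
      rw [← ENNReal.ofNNReal_finsetSum]; exact ENNReal.coe_ne_top
    finiteness
  set Y : ℝ≥0∞ := M * J + C₁ + (2 * (4 * Z) + 2 * (16 * C₁)) with hY
  have hYt : Y ≠ ⊤ := by rw [hY]; finiteness
  refine ⟨Y.toNNReal, fun h K hp => ?_⟩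
  have mA := hp.fst.stronglyMeasurable_movingAverage_zero (continuous_const (y := (1 : ℂ)))
    (angularFourier ψ)
  refine ⟨mA, fun t => ?_, ?_, ?_⟩ <;> rw [ENNReal.coe_toNNReal hYt]
  · refine (hp.fst.lintegral_movingAverage_zero_sq_le isBracketWeight_one _ t).trans ?_
    rw [hY, add_assoc]
    exact le_self_add
  · refine (h₁ h K hp).trans ?_
    rw [hY]
    exact le_add_self.trans le_self_add
  · have key := lintegral_time_increment_le mA (hp.measurable_timeSource ψ)
      (fun s hs t ht => hp.enorm_sub_le hβ.le ψ hs ht)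
    refine key.trans (le_trans ?_ (by rw [hY]; exact le_add_self : 2 * (4 * Z) + 2 * (16 * (C₁ : ℝ≥0∞)) ≤ Y))
    refine add_le_add (mul_le_mul_right (mul_le_mul_right ?_ _) _)
      (mul_le_mul_right (mul_le_mul_right (h₁ h K hp) _) _)
    have mj : ∀ j, Measurable fun p : ℝ × Space d => ENNReal.ofReal (Real.sqrt (1 + ‖p.2‖)) *
        ‖movingAverage h (fun _ => 1) (angularFourier (coordMul j ψ)) 0 p.1 p.2‖ₑ ^ 2 := fun j => by
      have h1 : Measurable fun p : ℝ × Space d => ENNReal.ofReal (Real.sqrt (1 + ‖p.2‖)) := by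
        fun_prop
      exact h1.mul ((hp.fst.stronglyMeasurable_movingAverage_zero
        (continuous_const (y := (1 : ℂ))) (angularFourier (coordMul j ψ))).enorm.pow_const 2)
    have mj' : ∀ j r, Measurable fun ξ : Space d => ENNReal.ofReal (Real.sqrt (1 + ‖ξ‖)) *
        ‖movingAverage h (fun _ => 1) (angularFourier (coordMul j ψ)) 0 r ξ‖ₑ ^ 2 := fun j r => by
      have h1 : Measurable fun ξ : Space d => (r, ξ) := by fun_prop
      simpa only [Function.comp_def] using (mj j).comp h1
    have mj'' : ∀ j, Measurable fun r : ℝ => ∫⁻ ξ : Space d,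
        ENNReal.ofReal (Real.sqrt (1 + ‖ξ‖)) *
        ‖movingAverage h (fun _ => 1) (angularFourier (coordMul j ψ)) 0 r ξ‖ₑ ^ 2 := fun j =>
      (mj j).lintegral_prod_right'
    calc _ ≤ ∫⁻ r in Icc (-T) T, (2 * ENNReal.ofReal β ^ 2 * 2 ^ d * (∑ j, ∫⁻ ξ : Space d,
          ENNReal.ofReal (Real.sqrt (1 + ‖ξ‖)) *
          ‖movingAverage h (fun _ => 1) (angularFourier (coordMul j ψ)) 0 r ξ‖ₑ ^ 2) +
          2 * (N * J)) := by
          refine lintegral_mono fun r => ?_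
          refine (lintegral_mono fun ξ => weight_mul_timeSource_sq_le β ψ r ξ).trans ?_
          have m1 : Measurable fun ξ : Space d => 2 * ENNReal.ofReal β ^ 2 * 2 ^ d *
              (∑ j, ENNReal.ofReal (Real.sqrt (1 + ‖ξ‖)) *
              ‖movingAverage h (fun _ => 1) (angularFourier (coordMul j ψ)) 0 r ξ‖ₑ ^ 2) :=
            Measurable.const_mul (Finset.measurable_sum _ fun j _ => mj' j r) _
          rw [lintegral_add_left m1, lintegral_const_mul' _ _ (by finiteness),
            lintegral_finsetSum _ fun j _ => mj' j r,
            lintegral_const_mul' _ _ ENNReal.ofNat_ne_top]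
          gcongr
          exact hp.snd.lintegral_movingAverage_zero_sq_le isBracketWeight_bracket _ r
      _ ≤ Z := by
          rw [lintegral_add_right _ measurable_const, lintegral_const_mul' _ _ (by finiteness),
            lintegral_finsetSum _ fun j _ => mj'' j, lintegral_const,
            Measure.restrict_apply MeasurableSet.univ, univ_inter, Real.volume_Icc, hZ, mul_assoc 2 ((N : ℝ≥0∞) * J),
            show T - -T = 2 * T by ring]
          gcongr with j
          exact h₂ j h K hp

end TimeSource

end

section

open Filter Topology
open scoped FourierTransform ContDiff

/-! ### Plancherel's theorem for weak Fourier pairs -/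

section Plancherel

variable {d : ℕ}

theorem denseRange_toL2 :
    DenseRange (SchwartzMap.toLpCLM ℂ (E := Space d) ℂ 2 volume).toLinearMap :=
  SchwartzMap.denseRange_toLpCLM ENNReal.ofNat_ne_top

theorem continuous_fourierL2 : Continuous fun g : L2 d => (𝓕 g : L2 d) :=
  (MeasureTheory.Lp.fourierTransformₗᵢ (Space d) ℂ).continuous

theorem integral_fourierL2_mul (g : L2 d) (η : 𝓢(Space d, ℂ)) :
    ∫ ξ, (𝓕 g : L2 d) ξ * η ξ = ∫ x, g x * 𝓕 η x := by
  refine denseRange_toL2.induction_on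
    (p := fun g : L2 d => ∫ ξ, (𝓕 g : L2 d) ξ * η ξ = ∫ x, g x * 𝓕 η x) g ?_ ?_
  · have h1 := (continuous_integral_mul (η.memLp 2 volume)).comp continuous_fourierL2
    have h2 := continuous_integral_mul ((𝓕 η).memLp 2 volume)
    simp only [Function.comp_def] at h1
    exact isClosed_eq h1 h2
  · intro f
    have h1 : (𝓕 ((SchwartzMap.toLpCLM ℂ (E := Space d) ℂ 2 volume).toLinearMap f) : L2 d) =
        (𝓕 f).toLp 2 := SchwartzMap.toLp_fourier_eq f
    rw [h1]
    refine Eq.trans ?_ ((SchwartzMap.integral_fourier_mul_eq f η).trans ?_)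
    · refine integral_congr_ae ?_
      filter_upwards [(𝓕 f).coeFn_toLp 2] with p hp
      rw [hp]
    · refine integral_congr_ae ?_
      filter_upwards [f.coeFn_toLp 2] with p hp
      rw [← hp]
      rfl

/-- If `f` is, up to a factor, the inverse Fourier transform of `F`, then `‖f‖₂ ≤ ‖F‖₂`. -/
theorem lintegral_sq_le_of_integral_fourier_eq {f F : Space d → ℂ} (hf : MemLp f 2 volume)
    (hF : MemLp F 2 volume) {c : ℂ} (hc : ‖c‖ ≤ 1)
    (h : ∀ η : 𝓢(Space d, ℂ), ∫ x, f x * 𝓕 η x = c * ∫ ξ, F ξ * η ξ) :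
    ∫⁻ x, ‖f x‖ₑ ^ 2 ≤ ∫⁻ ξ, ‖F ξ‖ₑ ^ 2 := by
  set g : L2 d := hf.toLp f with hg
  have hi : ∀ η : 𝓢(Space d, ℂ), Integrable fun ξ => (𝓕 g : L2 d) ξ * η ξ := fun η =>
    integrable_mul_of_memLp (Lp.memLp _) (η.memLp 2)
  have hi' : ∀ η : 𝓢(Space d, ℂ), Integrable fun ξ => F ξ * η ξ := fun η =>
    integrable_mul_of_memLp hF (η.memLp 2)
  have e : ∀ (η : 𝓢(Space d, ℂ)) (ξ : Space d), η ξ * ((𝓕 g : L2 d) ξ - c * F ξ) =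
      (𝓕 g : L2 d) ξ * η ξ - c * (F ξ * η ξ) := fun η ξ => by ring
  -- Transposing the transform in the hypothesis identifies the Fourier transform of `f` with `c F`;
  -- Plancherel then applies.
  have h0 : ∀ᵐ ξ, (𝓕 g : L2 d) ξ - c * F ξ = 0 := by
    refine ae_eq_zero_of_integral_schwartz_mul (fun η => ?_) fun η => ?_
    · simp_rw [e]
      exact (hi η).sub ((hi' η).const_mul c)
    · simp_rw [e]
      rw [integral_sub (hi η) ((hi' η).const_mul c), integral_const_mul, ← h η,
        integral_fourierL2_mul, sub_eq_zero]
      refine integral_congr_ae ?_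
      filter_upwards [hf.coeFn_toLp] with x hx
      rw [hg, hx]
  have h1 : ‖(𝓕 g : L2 d)‖ₑ = ‖g‖ₑ := by
    rw [← enorm_norm, MeasureTheory.Lp.norm_fourier_eq, enorm_norm]
  calc ∫⁻ x, ‖f x‖ₑ ^ 2 = ‖g‖ₑ ^ 2 := (enorm_toLp_sq hf).symm
    _ = ∫⁻ ξ, ‖(𝓕 g : L2 d) ξ‖ₑ ^ 2 := by rw [← h1, enorm_Lp_sq]
    _ ≤ _ := by
      refine lintegral_mono_ae ?_
      filter_upwards [h0] with ξ hξ
      rw [sub_eq_zero.1 hξ, enorm_mul]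
      have : ‖c‖ₑ ≤ 1 := by
        rw [← ofReal_norm, ← ENNReal.ofReal_one]; exact ENNReal.ofReal_le_ofReal hc
      gcongr
      exact mul_le_of_le_one_left' this

/-- Translation by `z` of the Fourier transform, on the Fourier side. -/
def modulate (z : Space d) (η : 𝓢(Space d, ℂ)) : 𝓢(Space d, ℂ) :=
  𝓕⁻ (SchwartzMap.compSubConstCLM ℂ z (𝓕 η))

theorem fourier_modulate (z : Space d) (η : 𝓢(Space d, ℂ)) (x : Space d) :
    𝓕 (modulate z η) x = 𝓕 η (x - z) := by
  rw [modulate, FourierTransform.fourier_fourierInv_eq]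
  simp

theorem modulate_apply (z : Space d) (η : 𝓢(Space d, ℂ)) (ξ : Space d) :
    modulate z η ξ = Complex.exp (2 * Real.pi * (inner ℝ z ξ : ℝ) * Complex.I) * η ξ := by
  have h1 : ∀ φ : 𝓢(Space d, ℂ), (𝓕⁻ φ) ξ =
      ∫ x, Complex.exp (2 * Real.pi * (inner ℝ x ξ : ℝ) * Complex.I) * φ x := fun φ => by
    rw [SchwartzMap.fourierInv_coe, Real.fourierInv_eq']
    refine integral_congr_ae (.of_forall fun x => ?_)
    simp
  have h2 : η = 𝓕⁻ (𝓕 η) := (FourierTransform.fourierInv_fourier_eq η).symm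
  conv_rhs => rw [h2]
  rw [modulate, h1, h1, ← integral_const_mul]
  refine Eq.trans ?_ (integral_sub_right_eq_self (fun x : Space d =>
    Complex.exp (2 * Real.pi * (inner ℝ z ξ : ℝ) * Complex.I) *
      (Complex.exp (2 * Real.pi * (inner ℝ x ξ : ℝ) * Complex.I) * 𝓕 η x)) z)
  refine integral_congr_ae (.of_forall fun x => ?_)
  simp only [SchwartzMap.compSubConstCLM_apply]
  rw [← mul_assoc, ← Complex.exp_add]
  congr 2
  rw [inner_sub_left]
  push_cast
  ring

/-- The translate of `f` is again a weak Fourier pair, with `F` multiplied by a character, so the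
preceding inequality applies to the difference. -/
theorem lintegral_translate_sub_sq_le {f F : Space d → ℂ} (hf : MemLp f 2 volume)
    (hF : MemLp F 2 volume) {c : ℂ} (hc : ‖c‖ ≤ 1)
    (h : ∀ η : 𝓢(Space d, ℂ), ∫ x, f x * 𝓕 η x = c * ∫ ξ, F ξ * η ξ) (z : Space d) :
    ∫⁻ x, ‖f (x + z) - f x‖ₑ ^ 2 ≤
      ∫⁻ ξ, ‖Complex.exp (2 * Real.pi * (inner ℝ z ξ : ℝ) * Complex.I) - 1‖ₑ ^ 2 *
        ‖F ξ‖ₑ ^ 2 := by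
  have hfz : MemLp (fun x => f (x + z)) 2 volume :=
    hf.comp_measurePreserving (measurePreserving_add_right volume z)
  have hb : ∀ ξ : Space d,
      ‖Complex.exp (2 * Real.pi * (inner ℝ z ξ : ℝ) * Complex.I) * F ξ‖ = ‖F ξ‖ := fun ξ => by
    rw [norm_mul, show (2 * Real.pi * (inner ℝ z ξ : ℝ) * Complex.I : ℂ) =
      ((2 * Real.pi * inner ℝ z ξ : ℝ) : ℂ) * Complex.I by push_cast; ring,
      Complex.norm_exp_ofReal_mul_I, one_mul]
  have hFz : MemLp (fun ξ => Complex.exp (2 * Real.pi * (inner ℝ z ξ : ℝ) * Complex.I) * F ξ) 2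
      volume := by
    refine hF.of_le (AEStronglyMeasurable.mul ?_ hF.1) (.of_forall fun ξ => (hb ξ).le)
    exact (by fun_prop : Continuous fun ξ : Space d =>
      Complex.exp (2 * Real.pi * (inner ℝ z ξ : ℝ) * Complex.I)).aestronglyMeasurable
  have key := lintegral_sq_le_of_integral_fourier_eq (hfz.sub hf) (hFz.sub hF) hc fun η => by
    have i1 := integrable_mul_of_memLp hfz ((𝓕 η).memLp 2 volume)
    have i2 := integrable_mul_of_memLp hf ((𝓕 η).memLp 2 volume)
    have i3 := integrable_mul_of_memLp hFz (η.memLp 2 volume)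
    have i4 := integrable_mul_of_memLp hF (η.memLp 2 volume)
    simp only [Pi.sub_apply, sub_mul]
    rw [integral_sub i1 i2, integral_sub i3 i4, mul_sub, h η]
    congr 1
    rw [← integral_sub_right_eq_self _ z]
    simp only [sub_add_cancel, ← fourier_modulate]
    rw [h (modulate z η)]
    congr 1
    refine integral_congr_ae (.of_forall fun ξ => ?_)
    simp only [modulate_apply]
    ring
  refine key.trans (le_of_eq (lintegral_congr fun ξ => ?_))
  rw [← mul_pow, ← enorm_mul]
  simp only [Pi.sub_apply]
  congr 2
  ring

end Plancherel

end

section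

open Filter Topology
open scoped FourierTransform ContDiff

/-! ### Homogeneous kernels -/

section HomogeneousKernel

/-- Scaling `z` by `r`; the condition on `p` is integrability at infinity. It is used to integrate
out the space or the time variable of the Slobodeckij kernel. -/
theorem exists_lintegral_rpow_le {E : Type*} [NormedAddCommGroup E] [NormedSpace ℝ E]
    [MeasurableSpace E] [BorelSpace E] [FiniteDimensional ℝ E] (μ : Measure E) [μ.IsAddHaarMeasure]
    {p : ℝ} (hp : Module.finrank ℝ E < p) : ∃ C : ℝ≥0, ∀ r : ℝ, 0 < r →
      ∫⁻ z, ENNReal.ofReal ((r ^ 2 + ‖z‖ ^ 2) ^ (-p / 2)) ∂μ ≤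
        C * ENNReal.ofReal (r ^ ((Module.finrank ℝ E : ℝ) - p)) := by
  have hfin := (integrable_rpow_neg_one_add_norm_sq (μ := μ) hp).lintegral_lt_top
  refine ⟨(∫⁻ z, ENNReal.ofReal ((1 + ‖z‖ ^ 2) ^ (-p / 2)) ∂μ).toNNReal, fun r hr => ?_⟩
  rw [ENNReal.coe_toNNReal hfin.ne]
  have hm : Measurable fun z : E => ENNReal.ofReal ((1 + ‖z‖ ^ 2) ^ (-p / 2)) := by fun_prop
  have e : ∀ z : E, ENNReal.ofReal ((r ^ 2 + ‖z‖ ^ 2) ^ (-p / 2)) =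
      ENNReal.ofReal (r ^ (-p)) * ENNReal.ofReal ((1 + ‖r⁻¹ • z‖ ^ 2) ^ (-p / 2)) := fun z => by
    rw [← ENNReal.ofReal_mul (by positivity)]
    congr 1
    have h1 : r ^ 2 + ‖z‖ ^ 2 = r ^ 2 * (1 + ‖r⁻¹ • z‖ ^ 2) := by
      rw [norm_smul, norm_inv, Real.norm_of_nonneg hr.le]
      field_simp
    rw [h1, Real.mul_rpow (by positivity) (by positivity), ← Real.rpow_natCast r 2,
      ← Real.rpow_mul hr.le]
    congr 2
    push_cast
    ring
  simp_rw [e]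
  rw [lintegral_const_mul' _ _ ENNReal.ofReal_ne_top,
    lintegral_addHaar_comp_smul μ (inv_pos.2 hr) hm, ← mul_assoc,
    ← ENNReal.ofReal_mul (by positivity), mul_comm]
  refine le_of_eq ?_
  congr 2
  rw [inv_pow, inv_inv, sub_eq_neg_add, Real.rpow_add hr, Real.rpow_natCast]

variable {d : ℕ}

theorem integrableOn_Ioi_rpow_mul_min :
    IntegrableOn (fun y : ℝ => y ^ (-(3 / 2) : ℝ) * min 1 (y ^ 2)) (Ioi 0) := by
  rw [← Ioc_union_Ioi_eq_Ioi (zero_le_one' ℝ)]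
  refine IntegrableOn.union ?_ ?_
  · have h : IntegrableOn (fun y : ℝ => y ^ (1 / 2 : ℝ)) (Ioc 0 1) :=
      (intervalIntegrable_iff_integrableOn_Ioc_of_le zero_le_one).1
        (intervalIntegral.intervalIntegrable_rpow' (by norm_num))
    refine h.congr_fun (fun y hy => ?_) measurableSet_Ioc
    simp only
    rw [min_eq_right (pow_le_one₀ hy.1.le hy.2), ← Real.rpow_natCast y 2, ← Real.rpow_add hy.1]
    norm_num
  · have h : IntegrableOn (fun y : ℝ => y ^ (-(3 / 2) : ℝ)) (Ioi 1) :=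
      integrableOn_Ioi_rpow_of_lt (by norm_num) zero_lt_one
    refine h.congr_fun (fun y hy => ?_) measurableSet_Ioi
    simp only
    rw [min_eq_left (one_le_pow₀ (le_of_lt hy)), mul_one]

/-- In polar coordinates the integrand is `r^{-3/2} min(1, r²)`, which is `r^{1/2}` near the origin
and `r^{-3/2}` at infinity. -/
theorem lintegral_rpow_norm_mul_min_lt_top :
    ∫⁻ y : Space d, ENNReal.ofReal (‖y‖ ^ (-((d : ℝ) + 1 / 2)) * min 1 (‖y‖ ^ 2)) < ⊤ := by
  rcases Nat.eq_zero_or_pos d with rfl | hd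
  -- In dimension zero there are no polar coordinates; the only point is the origin, where the
  -- minimum vanishes.
  · have : ∀ y : Space 0, ENNReal.ofReal (‖y‖ ^ (-(((0 : ℕ) : ℝ) + 1 / 2)) * min 1 (‖y‖ ^ 2)) = 0 :=
      fun y => by rw [Subsingleton.elim y 0]; simp
    simp_rw [this]
    simp
  · have : Nonempty (Fin d) := ⟨⟨0, hd⟩⟩
    refine Integrable.lintegral_lt_top (f := fun y : Space d =>
      ‖y‖ ^ (-((d : ℝ) + 1 / 2)) * min 1 (‖y‖ ^ 2)) ?_
    refine (integrable_fun_norm_addHaar volume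
      (f := fun r : ℝ => r ^ (-((d : ℝ) + 1 / 2)) * min 1 (r ^ 2))).2 ?_
    refine integrableOn_Ioi_rpow_mul_min.congr_fun (fun y hy => ?_) measurableSet_Ioi
    have hy' : (0 : ℝ) < y := hy
    simp only [finrank_euclideanSpace, Fintype.card_fin, smul_eq_mul]
    rw [← mul_assoc, ← Real.rpow_natCast y (d - 1), ← Real.rpow_add hy', Nat.cast_sub hd]
    congr 2
    push_cast
    ring

theorem enorm_exp_sub_one_sq_le (z ξ : Space d) :
    ‖Complex.exp (2 * Real.pi * (inner ℝ z ξ : ℝ) * Complex.I) - 1‖ₑ ^ 2 ≤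
      ENNReal.ofReal ((2 * Real.pi) ^ 2 * min 1 (((1 + ‖ξ‖) * ‖z‖) ^ 2)) := by
  rw [← ofReal_norm, ← ENNReal.ofReal_pow (norm_nonneg _)]
  refine ENNReal.ofReal_le_ofReal ?_
  set θ : ℝ := 2 * Real.pi * inner ℝ z ξ with hθ
  have e : Complex.exp (2 * Real.pi * (inner ℝ z ξ : ℝ) * Complex.I) =
      Complex.exp (Complex.I * θ) := by
    rw [hθ]; push_cast; ring_nf
  rw [e]
  have hpi := Real.pi_gt_three
  have h1 : ‖Complex.exp (Complex.I * θ) - 1‖ ≤ 2 * Real.pi := by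
    refine (norm_sub_le _ _).trans ?_
    rw [mul_comm, Complex.norm_exp_ofReal_mul_I, norm_one]
    linarith
  have h2 : ‖Complex.exp (Complex.I * θ) - 1‖ ≤ 2 * Real.pi * ((1 + ‖ξ‖) * ‖z‖) := by
    refine Real.norm_exp_I_mul_ofReal_sub_one_le.trans ?_
    rw [hθ, norm_mul, Real.norm_of_nonneg (by positivity)]
    have h3 : ‖(inner ℝ z ξ : ℝ)‖ ≤ ‖z‖ * ‖ξ‖ := norm_inner_le_norm z ξ
    gcongr
    nlinarith [norm_nonneg z, norm_nonneg ξ]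
  rcases le_total 1 (((1 + ‖ξ‖) * ‖z‖) ^ 2) with h | h
  · rw [min_eq_left h, mul_one]
    gcongr
  · rw [min_eq_right h, ← mul_pow]
    gcongr

/-- After dilation by `1 + |ξ|` the integral is bounded by a fixed finite one. The kernel exponent
`d + 1/2` exceeds the dimension by `1/2`, which is the power of `1 + |ξ|` that appears. -/
theorem exists_lintegral_exp_sub_one_le (d : ℕ) : ∃ C : ℝ≥0, ∀ ξ : Space d,
    ∫⁻ z : Space d, ENNReal.ofReal (‖z‖ ^ (-((d : ℝ) + 1 / 2))) *
      ‖Complex.exp (2 * Real.pi * (inner ℝ z ξ : ℝ) * Complex.I) - 1‖ₑ ^ 2 ≤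
      C * ENNReal.ofReal (Real.sqrt (1 + ‖ξ‖)) := by
  set J := ∫⁻ y : Space d, ENNReal.ofReal (‖y‖ ^ (-((d : ℝ) + 1 / 2)) * min 1 (‖y‖ ^ 2)) with hJ
  have hJt : J ≠ ⊤ := lintegral_rpow_norm_mul_min_lt_top.ne
  refine ⟨(ENNReal.ofReal ((2 * Real.pi) ^ 2) * J).toNNReal, fun ξ => ?_⟩
  rw [ENNReal.coe_toNNReal (by finiteness)]
  have ha : 0 < 1 + ‖ξ‖ := by positivity
  have hm : Measurable fun y : Space d =>
      ENNReal.ofReal (‖y‖ ^ (-((d : ℝ) + 1 / 2)) * min 1 (‖y‖ ^ 2)) := by fun_prop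
  have h := lintegral_addHaar_comp_smul volume ha hm
  rw [finrank_euclideanSpace, Fintype.card_fin] at h
  calc _ ≤ ∫⁻ z : Space d, ENNReal.ofReal ((2 * Real.pi) ^ 2 * (1 + ‖ξ‖) ^ ((d : ℝ) + 1 / 2)) *
        ENNReal.ofReal (‖(1 + ‖ξ‖) • z‖ ^ (-((d : ℝ) + 1 / 2)) *
          min 1 (‖(1 + ‖ξ‖) • z‖ ^ 2)) := by
        refine lintegral_mono fun z => ?_
        refine (mul_le_mul_right (enorm_exp_sub_one_sq_le z ξ) _).trans (le_of_eq ?_)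
        rw [← ENNReal.ofReal_mul (by positivity), ← ENNReal.ofReal_mul (by positivity)]
        congr 1
        rw [norm_smul, Real.norm_of_nonneg ha.le, Real.mul_rpow ha.le (norm_nonneg z)]
        have : (1 + ‖ξ‖) ^ ((d : ℝ) + 1 / 2) * (1 + ‖ξ‖) ^ (-((d : ℝ) + 1 / 2)) = 1 := by
          rw [← Real.rpow_add ha]; simp
        generalize min 1 (((1 + ‖ξ‖) * ‖z‖) ^ 2) = μ
        generalize (1 + ‖ξ‖) ^ ((d : ℝ) + 1 / 2) = a at this ⊢
        generalize (1 + ‖ξ‖) ^ (-((d : ℝ) + 1 / 2)) = b at this ⊢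
        calc _ = (2 * Real.pi) ^ 2 * ‖z‖ ^ (-((d : ℝ) + 1 / 2)) *
              μ * 1 := by ring
          _ = _ := by linear_combination ((2 * Real.pi) ^ 2 * ‖z‖ ^ (-((d : ℝ) + 1 / 2)) * μ) * (-this)
    _ = _ := by
        rw [lintegral_const_mul' _ _ ENNReal.ofReal_ne_top, h, ← hJ, ← mul_assoc,
          ← ENNReal.ofReal_mul (by positivity), mul_right_comm (ENNReal.ofReal ((2 * Real.pi) ^ 2)),
          ← ENNReal.ofReal_mul (by positivity)]
        congr 2
        rw [Real.rpow_add ha, Real.rpow_natCast, Real.sqrt_eq_rpow]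
        field_simp

end HomogeneousKernel

end

section

open Filter Topology
open scoped FourierTransform ContDiff

/-! ### The Sobolev norm in space-time -/

section SobolevNorm

variable {d : ℕ}

/-- The kernel `|(τ, z)|^{-(d + 3/2)}` on `ℝ × ℝ^d`. -/
def slobodeckijKernel (τ : ℝ) (z : Space d) : ℝ≥0∞ :=
  ENNReal.ofReal ((τ ^ 2 + ‖z‖ ^ 2) ^ (-((d : ℝ) + 3 / 2) / 2))

theorem measurable_slobodeckijKernel :
    Measurable fun p : ℝ × Space d => slobodeckijKernel p.1 p.2 := by
  unfold slobodeckijKernel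
  fun_prop

theorem exists_lintegral_slobodeckijKernel_space (d : ℕ) : ∃ C : ℝ≥0, ∀ τ : ℝ, τ ≠ 0 →
    ∫⁻ z : Space d, slobodeckijKernel τ z ≤ C * ENNReal.ofReal (|τ| ^ (-(3 / 2) : ℝ)) := by
  obtain ⟨C, hC⟩ := exists_lintegral_rpow_le (volume : Measure (Space d))
    (p := (d : ℝ) + 3 / 2) (by rw [finrank_euclideanSpace, Fintype.card_fin]; linarith)
  refine ⟨C, fun τ hτ => ?_⟩
  have h := hC |τ| (abs_pos.2 hτ)
  rw [finrank_euclideanSpace, Fintype.card_fin, sq_abs,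
    show (d : ℝ) - ((d : ℝ) + 3 / 2) = -(3 / 2) by ring] at h
  exact h

theorem exists_lintegral_slobodeckijKernel_time (d : ℕ) : ∃ C : ℝ≥0, ∀ z : Space d, z ≠ 0 →
    ∫⁻ τ : ℝ, slobodeckijKernel τ z ≤ C * ENNReal.ofReal (‖z‖ ^ (-((d : ℝ) + 1 / 2))) := by
  obtain ⟨C, hC⟩ := exists_lintegral_rpow_le (volume : Measure ℝ)
    (p := (d : ℝ) + 3 / 2) (by
      rw [Module.finrank_self]; push_cast; linarith [(Nat.cast_nonneg d : (0 : ℝ) ≤ d)])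
  refine ⟨C, fun z hz => ?_⟩
  have h := hC ‖z‖ (norm_pos_iff.2 hz)
  rw [Module.finrank_self, Nat.cast_one,
    show (1 : ℝ) - ((d : ℝ) + 3 / 2) = -((d : ℝ) + 1 / 2) by ring] at h
  refine le_trans (le_of_eq (lintegral_congr fun τ => ?_)) h
  rw [slobodeckijKernel, add_comm, Real.norm_eq_abs, sq_abs]

/-- Off the diagonal both sides agree, as `d + 1 + 2·(1/4) = d + 3/2`; on the diagonal the numerator
vanishes, so the convention for division by zero is harmless. -/
theorem enorm_sq_div_spaceTimeDist_le (u : ℝ × Space d → ℂ) (z z' : ℝ × Space d) :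
    ‖u z - u z'‖ₑ ^ 2 /
        ENNReal.ofReal (spaceTimeDist z z' ^ ((d : ℝ) + 1 + 2 * (1 / 4 : ℝ))) ≤
      ‖u z - u z'‖ₑ ^ 2 * slobodeckijKernel (z.1 - z'.1) (z.2 - z'.2) := by
  by_cases h : z = z'
  · simp [h]
  have hpos : 0 < (z.1 - z'.1) ^ 2 + ‖z.2 - z'.2‖ ^ 2 := by
    by_contra hn
    have h1 : (z.1 - z'.1) ^ 2 = 0 := by nlinarith [sq_nonneg (z.1 - z'.1), sq_nonneg ‖z.2 - z'.2‖]
    have h2 : ‖z.2 - z'.2‖ ^ 2 = 0 := by nlinarith [sq_nonneg (z.1 - z'.1), sq_nonneg ‖z.2 - z'.2‖]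
    exact h (Prod.ext (sub_eq_zero.1 (pow_eq_zero_iff two_ne_zero |>.1 h1))
      (sub_eq_zero.1 (norm_eq_zero.1 (pow_eq_zero_iff two_ne_zero |>.1 h2))))
  have hd : 0 < spaceTimeDist z z' := Real.sqrt_pos.2 hpos
  rw [div_eq_mul_inv, ← ENNReal.ofReal_inv_of_pos (by positivity), ← Real.rpow_neg hd.le]
  refine mul_le_mul_right (le_of_eq ?_) _
  rw [slobodeckijKernel, spaceTimeDist, Real.sqrt_eq_rpow, ← Real.rpow_mul hpos.le]
  congr 2
  ring

/-- The increment does not involve the second space variable, so the kernel is integrated in it,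
leaving `|t - s|^{-3/2}`. -/
theorem lintegral_increment_time_le {ν : Measure ℝ} [SFinite ν] {u : ℝ × Space d → ℂ}
    (hu : StronglyMeasurable u) {C : ℝ≥0}
    (hC : ∀ τ : ℝ, τ ≠ 0 → ∫⁻ z : Space d, slobodeckijKernel τ z ≤
      C * ENNReal.ofReal (|τ| ^ (-(3 / 2) : ℝ))) :
    ∫⁻ z, ∫⁻ z', ‖u (z.1, z.2) - u (z'.1, z.2)‖ₑ ^ 2 *
        slobodeckijKernel (z.1 - z'.1) (z.2 - z'.2) ∂(ν.prod volume) ∂(ν.prod volume) ≤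
      C * ∫⁻ t, ∫⁻ s, (∫⁻ x, ‖u (t, x) - u (s, x)‖ₑ ^ 2) *
        ENNReal.ofReal (|t - s| ^ (-(3 / 2) : ℝ)) ∂ν ∂ν := by
  have mu := hu.measurable
  have mk := measurable_slobodeckijKernel (d := d)
  have mF : Measurable fun q : (ℝ × Space d) × (ℝ × Space d) =>
      ‖u (q.1.1, q.1.2) - u (q.2.1, q.1.2)‖ₑ ^ 2 *
        slobodeckijKernel (q.1.1 - q.2.1) (q.1.2 - q.2.2) := by
    have h1 : Measurable fun q : (ℝ × Space d) × (ℝ × Space d) =>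
        (q.1.1 - q.2.1, q.1.2 - q.2.2) := by fun_prop
    have h2 := mk.comp h1
    simp only [Function.comp_def] at h2
    exact Measurable.mul (by fun_prop) h2
  have mN : Measurable fun q : (ℝ × ℝ) × Space d => ‖u (q.1.1, q.2) - u (q.1.2, q.2)‖ₑ ^ 2 := by
    fun_prop
  rw [lintegral_prod _ mF.lintegral_prod_right'.aemeasurable]
  calc _ ≤ ∫⁻ t, ∫⁻ x : Space d, ∫⁻ s, ‖u (t, x) - u (s, x)‖ₑ ^ 2 *
        (C * ENNReal.ofReal (|t - s| ^ (-(3 / 2) : ℝ))) ∂ν ∂volume ∂ν := by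
        refine lintegral_mono fun t => lintegral_mono fun x => ?_
        have m1 : Measurable fun z' : ℝ × Space d => ‖u (t, x) - u (z'.1, x)‖ₑ ^ 2 *
            slobodeckijKernel (t - z'.1) (x - z'.2) := by
          have h1 : Measurable fun z' : ℝ × Space d => ((t, x), z') := by fun_prop
          simpa only [Function.comp_def] using mF.comp h1
        simp only
        rw [lintegral_prod _ m1.aemeasurable]
        refine lintegral_mono fun s => ?_
        simp only
        rw [lintegral_const_mul' _ _ (by finiteness)]
        by_cases hts : t = s
        · simp [hts]
        · refine mul_le_mul_right ?_ _
          rw [lintegral_sub_left_eq_self (fun y : Space d => slobodeckijKernel (t - s) y) x]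
          exact hC _ (sub_ne_zero.2 hts)
    _ = ∫⁻ t, ∫⁻ s, C * ((∫⁻ x, ‖u (t, x) - u (s, x)‖ₑ ^ 2) *
        ENNReal.ofReal (|t - s| ^ (-(3 / 2) : ℝ))) ∂ν ∂ν := by
        refine lintegral_congr fun t => ?_
        have m2 : Measurable fun q : Space d × ℝ => ‖u (t, q.1) - u (q.2, q.1)‖ₑ ^ 2 *
            (C * ENNReal.ofReal (|t - q.2| ^ (-(3 / 2) : ℝ))) := by fun_prop
        rw [lintegral_lintegral_swap (f := fun x s => ‖u (t, x) - u (s, x)‖ₑ ^ 2 *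
            (C * ENNReal.ofReal (|t - s| ^ (-(3 / 2) : ℝ)))) m2.aemeasurable]
        refine lintegral_congr fun s => ?_
        rw [lintegral_mul_const' _ _ (by finiteness)]
        ring
    _ = _ := by
        simp_rw [lintegral_const_mul' _ _ (ENNReal.coe_ne_top (r := C))]

/-- Here the free variable is the first time. Enlarging its range from `S` to `ℝ` leaves a multiple
of `|z|^{-(d + 1/2)}`. -/
theorem lintegral_increment_space_le {S : Set ℝ} {u : ℝ × Space d → ℂ}
    (hu : StronglyMeasurable u) {C : ℝ≥0}
    (hC : ∀ z : Space d, z ≠ 0 → ∫⁻ τ : ℝ, slobodeckijKernel τ z ≤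
      C * ENNReal.ofReal (‖z‖ ^ (-((d : ℝ) + 1 / 2)))) :
    ∫⁻ z, ∫⁻ z', ‖u (z'.1, z.2) - u (z'.1, z'.2)‖ₑ ^ 2 *
        slobodeckijKernel (z.1 - z'.1) (z.2 - z'.2)
          ∂((volume.restrict S).prod volume) ∂((volume.restrict S).prod volume) ≤
      C * ∫⁻ t in S, ∫⁻ z : Space d, (∫⁻ x, ‖u (t, x + z) - u (t, x)‖ₑ ^ 2) *
        ENNReal.ofReal (‖z‖ ^ (-((d : ℝ) + 1 / 2))) := by
  have mu := hu.measurable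
  have mk := measurable_slobodeckijKernel (d := d)
  have mF : Measurable fun q : (ℝ × Space d) × (ℝ × Space d) =>
      ‖u (q.2.1, q.1.2) - u (q.2.1, q.2.2)‖ₑ ^ 2 *
        slobodeckijKernel (q.1.1 - q.2.1) (q.1.2 - q.2.2) := by
    have h1 : Measurable fun q : (ℝ × Space d) × (ℝ × Space d) =>
        (q.1.1 - q.2.1, q.1.2 - q.2.2) := by fun_prop
    have h2 := mk.comp h1
    simp only [Function.comp_def] at h2
    exact Measurable.mul (by fun_prop) h2
  have mF' : Measurable fun q : (ℝ × Space d) × (ℝ × Space d) =>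
      ‖u (q.1.1, q.2.2) - u (q.1.1, q.1.2)‖ₑ ^ 2 *
        slobodeckijKernel (q.2.1 - q.1.1) (q.2.2 - q.1.2) := by
    simpa only [Function.comp_def, Prod.swap] using mF.comp measurable_swap
  rw [lintegral_lintegral_swap (f := fun z z' : ℝ × Space d =>
    ‖u (z'.1, z.2) - u (z'.1, z'.2)‖ₑ ^ 2 * slobodeckijKernel (z.1 - z'.1) (z.2 - z'.2))
    mF.aemeasurable, lintegral_prod _ mF'.lintegral_prod_right'.aemeasurable]
  calc _ ≤ ∫⁻ s in S, ∫⁻ y : Space d, ∫⁻ z : Space d, ‖u (s, y + z) - u (s, y)‖ₑ ^ 2 *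
        (C * ENNReal.ofReal (‖z‖ ^ (-((d : ℝ) + 1 / 2)))) := by
        refine lintegral_mono fun s => lintegral_mono fun y => ?_
        have m1 : Measurable fun z : ℝ × Space d => ‖u (s, z.2) - u (s, y)‖ₑ ^ 2 *
            slobodeckijKernel (z.1 - s) (z.2 - y) := by
          have h1 : Measurable fun z : ℝ × Space d => ((s, y), z) := by fun_prop
          simpa only [Function.comp_def] using mF'.comp h1
        simp only
        rw [lintegral_prod_symm _ m1.aemeasurable,
          ← lintegral_add_left_eq_self _ y]
        refine lintegral_mono fun z => ?_
        simp only [add_sub_cancel_left]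
        rw [lintegral_const_mul' _ _ (by finiteness)]
        by_cases hz : z = 0
        · simp [hz]
        · refine mul_le_mul_right ?_ _
          refine (setLIntegral_le_lintegral _ _).trans ?_
          rw [lintegral_sub_right_eq_self (fun τ : ℝ => slobodeckijKernel τ z) s]
          exact hC _ hz
    _ = ∫⁻ t in S, ∫⁻ z : Space d, C * ((∫⁻ x, ‖u (t, x + z) - u (t, x)‖ₑ ^ 2) *
        ENNReal.ofReal (‖z‖ ^ (-((d : ℝ) + 1 / 2)))) := by
        refine lintegral_congr fun t => ?_
        have m2 : Measurable fun q : Space d × Space d => ‖u (t, q.1 + q.2) - u (t, q.1)‖ₑ ^ 2 *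
            (C * ENNReal.ofReal (‖q.2‖ ^ (-((d : ℝ) + 1 / 2)))) := by fun_prop
        rw [lintegral_lintegral_swap (f := fun x z : Space d => ‖u (t, x + z) - u (t, x)‖ₑ ^ 2 *
            (C * ENNReal.ofReal (‖z‖ ^ (-((d : ℝ) + 1 / 2))))) m2.aemeasurable]
        refine lintegral_congr fun s => ?_
        rw [lintegral_mul_const' _ _ (by finiteness)]
        ring
    _ = _ := by
        simp_rw [lintegral_const_mul' _ _ (ENNReal.coe_ne_top (r := C))]

/-- The increment is split at the intermediate point with the second time and the first position;
this stays in the domain because the domain is a product. -/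
theorem lintegral_slobodeckij_le {S : Set ℝ} {u : ℝ × Space d → ℂ} (hu : StronglyMeasurable u)
    {C₁ C₂ : ℝ≥0}
    (h₁ : ∀ τ : ℝ, τ ≠ 0 → ∫⁻ z : Space d, slobodeckijKernel τ z ≤
      C₁ * ENNReal.ofReal (|τ| ^ (-(3 / 2) : ℝ)))
    (h₂ : ∀ z : Space d, z ≠ 0 → ∫⁻ τ : ℝ, slobodeckijKernel τ z ≤
      C₂ * ENNReal.ofReal (‖z‖ ^ (-((d : ℝ) + 1 / 2)))) :
    ∫⁻ z in S ×ˢ univ, ∫⁻ z' in S ×ˢ univ, ‖u z - u z'‖ₑ ^ 2 /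
        ENNReal.ofReal (spaceTimeDist z z' ^ ((d : ℝ) + 1 + 2 * (1 / 4 : ℝ))) ≤
      2 * (C₁ * ∫⁻ t in S, ∫⁻ s in S, (∫⁻ x, ‖u (t, x) - u (s, x)‖ₑ ^ 2) *
        ENNReal.ofReal (|t - s| ^ (-(3 / 2) : ℝ))) +
      2 * (C₂ * ∫⁻ t in S, ∫⁻ z : Space d, (∫⁻ x, ‖u (t, x + z) - u (t, x)‖ₑ ^ 2) *
        ENNReal.ofReal (‖z‖ ^ (-((d : ℝ) + 1 / 2)))) := by
  have mu := hu.measurable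
  have mk : Measurable fun q : (ℝ × Space d) × (ℝ × Space d) =>
      slobodeckijKernel (q.1.1 - q.2.1) (q.1.2 - q.2.2) := by
    have h1 : Measurable fun q : (ℝ × Space d) × (ℝ × Space d) =>
        (q.1.1 - q.2.1, q.1.2 - q.2.2) := by fun_prop
    simpa only [Function.comp_def] using measurable_slobodeckijKernel.comp h1
  have hν : (volume : Measure (ℝ × Space d)).restrict (S ×ˢ univ) =
      (volume.restrict S).prod volume := by
    rw [Measure.volume_eq_prod, ← Measure.prod_restrict, Measure.restrict_univ]
  have mF₁ : Measurable fun q : (ℝ × Space d) × (ℝ × Space d) =>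
      2 * (‖u (q.1.1, q.1.2) - u (q.2.1, q.1.2)‖ₑ ^ 2 *
        slobodeckijKernel (q.1.1 - q.2.1) (q.1.2 - q.2.2)) :=
    Measurable.const_mul (Measurable.mul (by fun_prop) mk) _
  rw [hν]
  calc _ ≤ ∫⁻ z, ∫⁻ z', (2 * (‖u (z.1, z.2) - u (z'.1, z.2)‖ₑ ^ 2 *
          slobodeckijKernel (z.1 - z'.1) (z.2 - z'.2)) +
        2 * (‖u (z'.1, z.2) - u (z'.1, z'.2)‖ₑ ^ 2 *
          slobodeckijKernel (z.1 - z'.1) (z.2 - z'.2)))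
          ∂((volume.restrict S).prod volume) ∂((volume.restrict S).prod volume) := by
        refine lintegral_mono fun z => lintegral_mono fun z' => ?_
        refine (enorm_sq_div_spaceTimeDist_le u z z').trans ?_
        rw [← mul_assoc, ← mul_assoc, ← add_mul]
        refine mul_le_mul_left ?_ _
        refine le_trans ?_ (add_sq_le_two_mul _ _)
        gcongr
        calc ‖u z - u z'‖ₑ = ‖(u (z.1, z.2) - u (z'.1, z.2)) + (u (z'.1, z.2) - u (z'.1, z'.2))‖ₑ := by
              congr 1
              simp only [Prod.mk.eta]
              ring
          _ ≤ _ := enorm_add_le _ _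
    _ = 2 * (∫⁻ z, ∫⁻ z', ‖u (z.1, z.2) - u (z'.1, z.2)‖ₑ ^ 2 *
          slobodeckijKernel (z.1 - z'.1) (z.2 - z'.2)
            ∂((volume.restrict S).prod volume) ∂((volume.restrict S).prod volume)) +
        2 * ∫⁻ z, ∫⁻ z', ‖u (z'.1, z.2) - u (z'.1, z'.2)‖ₑ ^ 2 *
          slobodeckijKernel (z.1 - z'.1) (z.2 - z'.2)
            ∂((volume.restrict S).prod volume) ∂((volume.restrict S).prod volume) := by
        have m1 : ∀ z : ℝ × Space d, Measurable fun z' : ℝ × Space d =>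
            2 * (‖u (z.1, z.2) - u (z'.1, z.2)‖ₑ ^ 2 *
            slobodeckijKernel (z.1 - z'.1) (z.2 - z'.2)) := fun z => by
          have h1 : Measurable fun z' : ℝ × Space d => (z, z') := by fun_prop
          simpa only [Function.comp_def] using mF₁.comp h1
        simp_rw [lintegral_add_left (m1 _)]
        rw [lintegral_add_left mF₁.lintegral_prod_right']
        simp_rw [lintegral_const_mul' _ _ (ENNReal.ofNat_ne_top (n := 2))]
    _ ≤ _ := add_le_add (mul_le_mul_right (lintegral_increment_time_le hu h₁) _)
        (mul_le_mul_right (lintegral_increment_space_le hu h₂) _)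

/-- Time increments pass to the Fourier side by linearity and Plancherel at fixed times. For space
increments the translation formula and Tonelli reproduce the weight `(1 + |ξ|)^{1/2}`. -/
theorem exists_sobolevNorm_le (d : ℕ) (T : ℝ) (C : ℝ≥0) : ∃ C' : ℝ≥0,
    ∀ (u A : ℝ × Space d → ℂ) (c : ℂ), StronglyMeasurable u → IsAverageBound T A C → ‖c‖ ≤ 1 →
      (∀ᵐ t ∂(volume.restrict (Ioo (-T) T)), MemLp (fun x => u (t, x)) 2 volume ∧
        ∀ η : 𝓢(Space d, ℂ), ∫ x, u (t, x) * 𝓕 η x = c * ∫ ξ, A (t, ξ) * η ξ) →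
      sobolevNorm (1 / 4) (Ioo (-T) T ×ˢ (univ : Set (Space d))) u ≤ C' := by
  obtain ⟨C₁, h₁⟩ := exists_lintegral_slobodeckijKernel_space d
  obtain ⟨C₂, h₂⟩ := exists_lintegral_slobodeckijKernel_time d
  obtain ⟨C₃, h₃⟩ := exists_lintegral_exp_sub_one_le d
  set Y : ℝ≥0∞ := C * ENNReal.ofReal (2 * T) + (2 * (C₁ * C) + 2 * (C₂ * (C₃ * C))) with hY
  have hYt : Y ^ (1 / 2 : ℝ) ≠ ⊤ := ENNReal.rpow_ne_top_of_nonneg (by norm_num) (by finiteness)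
  refine ⟨(Y ^ (1 / 2 : ℝ)).toNNReal, fun u A c hu hA hc hpair => ?_⟩
  rw [ENNReal.coe_toNNReal hYt, sobolevNorm]
  refine ENNReal.rpow_le_rpow ?_ (by norm_num)
  have mu := hu.measurable
  have mA := hA.stronglyMeasurable.measurable
  have hAm : ∀ t, MemLp (fun ξ => A (t, ξ)) 2 volume := fun t => by
    have h1 : StronglyMeasurable fun ξ => A (t, ξ) :=
      hA.stronglyMeasurable.comp_measurable measurable_prodMk_left
    rw [memLp_two_iff_lintegral h1.aestronglyMeasurable]
    exact (hA.lintegral_sq_le t).trans_lt ENNReal.coe_lt_top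
  have hν : (volume : Measure (ℝ × Space d)).restrict (Ioo (-T) T ×ˢ univ) =
      (volume.restrict (Ioo (-T) T)).prod volume := by
    rw [Measure.volume_eq_prod, ← Measure.prod_restrict, Measure.restrict_univ]
  have hI : (volume : Measure ℝ).restrict (Ioo (-T) T) = volume.restrict (Icc (-T) T) :=
    Measure.restrict_congr_set Ioo_ae_eq_Icc
  refine add_le_add ?_ ((lintegral_slobodeckij_le hu h₁ h₂).trans (add_le_add
    (mul_le_mul_right (mul_le_mul_right ?_ _) _) (mul_le_mul_right (mul_le_mul_right ?_ _) _)))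
  · rw [hν, lintegral_prod _ (by fun_prop)]
    calc _ ≤ ∫⁻ t in Ioo (-T) T, (C : ℝ≥0∞) := by
          refine lintegral_mono_ae ?_
          filter_upwards [hpair] with t ht
          exact (lintegral_sq_le_of_integral_fourier_eq ht.1 (hAm t) hc ht.2).trans
            (hA.lintegral_sq_le t)
      _ = _ := by
          rw [lintegral_const, Measure.restrict_apply MeasurableSet.univ, univ_inter,
            Real.volume_Ioo, show T - -T = 2 * T by ring]
  · refine le_trans ?_ hA.lintegral_time_le
    rw [← hI]
    refine lintegral_mono_ae ?_
    filter_upwards [hpair] with t ht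
    refine lintegral_mono_ae ?_
    filter_upwards [hpair] with s hs
    refine mul_le_mul_left ?_ _
    refine lintegral_sq_le_of_integral_fourier_eq (ht.1.sub hs.1) ((hAm t).sub (hAm s)) hc
      fun η => ?_
    have i1 := integrable_mul_of_memLp ht.1 ((𝓕 η).memLp 2 volume)
    have i2 := integrable_mul_of_memLp hs.1 ((𝓕 η).memLp 2 volume)
    have i3 := integrable_mul_of_memLp (hAm t) (η.memLp 2 volume)
    have i4 := integrable_mul_of_memLp (hAm s) (η.memLp 2 volume)
    simp only [sub_mul]
    rw [integral_sub i1 i2, integral_sub i3 i4, mul_sub, ht.2, hs.2]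
  · calc _ ≤ ∫⁻ t in Ioo (-T) T, ∫⁻ ξ, C₃ * (ENNReal.ofReal (Real.sqrt (1 + ‖ξ‖)) *
          ‖A (t, ξ)‖ₑ ^ 2) := by
          refine lintegral_mono_ae ?_
          filter_upwards [hpair] with t ht
          have mE : Measurable fun q : Space d × Space d =>
              ‖Complex.exp (2 * Real.pi * (inner ℝ q.1 q.2 : ℝ) * Complex.I) - 1‖ₑ ^ 2 :=
            ((by fun_prop : Continuous fun q : Space d × Space d =>
              Complex.exp (2 * Real.pi * (inner ℝ q.1 q.2 : ℝ) * Complex.I) - 1).enorm.measurable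
              ).pow_const 2
          have m1 : Measurable fun q : Space d × Space d =>
              ‖A (t, q.2)‖ₑ ^ 2 * (ENNReal.ofReal (‖q.1‖ ^ (-((d : ℝ) + 1 / 2))) *
              ‖Complex.exp (2 * Real.pi * (inner ℝ q.1 q.2 : ℝ) * Complex.I) - 1‖ₑ ^ 2) :=
            Measurable.mul (by fun_prop) (Measurable.mul (by fun_prop) mE)
          calc _ ≤ ∫⁻ z : Space d, ∫⁻ ξ, ‖A (t, ξ)‖ₑ ^ 2 *
                (ENNReal.ofReal (‖z‖ ^ (-((d : ℝ) + 1 / 2))) *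
                ‖Complex.exp (2 * Real.pi * (inner ℝ z ξ : ℝ) * Complex.I) - 1‖ₑ ^ 2) := by
                refine lintegral_mono fun z => ?_
                refine (mul_le_mul_left
                  (lintegral_translate_sub_sq_le ht.1 (hAm t) hc ht.2 z) _).trans ?_
                rw [← lintegral_mul_const' _ _ ENNReal.ofReal_ne_top]
                refine le_of_eq (lintegral_congr fun ξ => ?_)
                ring
            _ = ∫⁻ ξ, ∫⁻ z : Space d, ‖A (t, ξ)‖ₑ ^ 2 *
                (ENNReal.ofReal (‖z‖ ^ (-((d : ℝ) + 1 / 2))) *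
                ‖Complex.exp (2 * Real.pi * (inner ℝ z ξ : ℝ) * Complex.I) - 1‖ₑ ^ 2) :=
                lintegral_lintegral_swap (f := fun z ξ : Space d => ‖A (t, ξ)‖ₑ ^ 2 *
                (ENNReal.ofReal (‖z‖ ^ (-((d : ℝ) + 1 / 2))) *
                ‖Complex.exp (2 * Real.pi * (inner ℝ z ξ : ℝ) * Complex.I) - 1‖ₑ ^ 2))
                m1.aemeasurable
            _ ≤ _ := by
                refine lintegral_mono fun ξ => ?_
                rw [lintegral_const_mul' _ _ (by finiteness)]
                refine (mul_le_mul_right (h₃ ξ) _).trans (le_of_eq ?_)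
                ring
      _ ≤ _ := by
          simp_rw [lintegral_const_mul' _ _ (ENNReal.coe_ne_top (r := C₃))]
          rw [hI]
          exact mul_le_mul_right hA.lintegral_space_le _

end SobolevNorm

end

section

open Filter Topology
open scoped FourierTransform ContDiff

/-! ### Existence of the density matrix and of the Wigner function -/

section Existence

variable {d : ℕ}

theorem exists_isRelKernel {ħ T : ℝ} (hħ : 0 < ħ) {R : ℝ → L2 d →L[ℂ] L2 d}
    (hpos : ∀ t ∈ Icc (-T) T, (R t).IsPositive)
    (hcont : ∀ f g : L2 d, ContinuousOn (fun t => inner ℂ f (R t g)) (Icc (-T) T)) {M : ℝ≥0}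
    (hHS : ∀ t ∈ Icc (-T) T, ∃ τ : ℝ, HasTrace (R t ∘L R t) (τ : ℂ) ∧ τ ≤ M * ħ ^ d) :
    ∃ G, IsRelKernel ħ T R G M := by
  classical
  have hfact : Fact ((2 : ℝ≥0∞) ≠ ⊤) := ⟨by norm_num⟩
  obtain ⟨w, b, -⟩ := exists_hilbertBasis ℂ (L2 d)
  -- Outside `[-T, T]` nothing is known of `R`; extension by zero keeps measurability and the
  -- Hilbert-Schmidt bound for every `t`.
  let A : ℝ → L2 d →L[ℂ] L2 d := fun t => if t ∈ Icc (-T) T then R t else 0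
  have hA : ∀ t ∈ Icc (-T) T, A t = R t := fun t ht => if_pos ht
  have hA' : ∀ t ∉ Icc (-T) T, A t = 0 := fun t ht => if_neg ht
  have hsum : ∀ t, ∃ τ : ℝ, HasSum (fun j => ‖A t (b j)‖ ^ 2) τ ∧ τ ≤ M * ħ ^ d := fun t => by
    by_cases ht : t ∈ Icc (-T) T
    · obtain ⟨τ, h1, h2⟩ := hHS t ht
      rw [hA t ht]
      exact ⟨τ, hasSum_norm_sq_of_hasTrace b (hpos t ht) h1, h2⟩
    · refine ⟨0, ?_, by positivity⟩
      simp only [hA' t ht, zero_apply, norm_zero, ne_eq, OfNat.ofNat_ne_zero,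
        not_false_eq_true, zero_pow]
      exact hasSum_zero
  choose τ hτ hτM using hsum
  have hm : ∀ f g : L2 d, Measurable fun t => inner ℂ f (A t g) := fun f g => by
    have h1 := (hcont f g).measurable_piecewise
      (continuousOn_const (c := (0 : ℂ)) (s := (Icc (-T) T)ᶜ)) measurableSet_Icc
    convert h1 using 1
    ext t
    by_cases ht : t ∈ Icc (-T) T
    · rw [piecewise_eq_of_mem _ _ _ ht, hA t ht]
    · rw [piecewise_eq_of_notMem _ _ _ ht, hA' t ht]; simp
  obtain ⟨k, hk, hkA⟩ := exists_jointlyMeasurable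
    (stronglyMeasurable_hsKernel b (fun t => (hτ t).summable) hm)
  have hkm : ∀ t, MemLp (fun p => k (t, p)) 2 volume := fun t =>
    (memLp_congr_ae (hkA t)).2 (Lp.memLp _)
  refine ⟨fun q => k (q.1, relMap ħ q.2), ?_, fun t ht => ⟨fun p => k (t, p), ?_, ?_⟩, fun t => ?_⟩
  · have h1 : Measurable fun q : ℝ × Space d × Space d => (q.1, relMap ħ q.2) :=
      measurable_fst.prodMk ((continuous_relMap ħ).measurable.comp measurable_snd)
    simpa only [Function.comp_def] using hk.comp_measurable h1
  · refine isIntegralKernel_of_inner (hkm t) fun f g => ?_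
    have e : (hkm t).toLp (fun p => k (t, p)) = hsKernel b (A t) :=
      Lp.ext ((hkm t).coeFn_toLp.trans (hkA t))
    rw [e, inner_tensorL2_hsKernel b (hτ t).summable, hA t ht]
  · exact EventuallyEq.rfl
  · simp only
    rw [lintegral_sq_comp_relMap hħ (k := fun p => k (t, p))]
    have e : ∫⁻ p, ‖k (t, p)‖ₑ ^ 2 = ENNReal.ofReal (τ t) := by
      rw [← norm_sq_hsKernel b (hτ t), ENNReal.ofReal_pow (norm_nonneg _), ofReal_norm,
        enorm_Lp_sq]
      refine lintegral_congr_ae ?_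
      filter_upwards [hkA t] with p hp
      rw [hp]
    rw [e, ← ENNReal.ofReal_mul (by positivity), ← ENNReal.ofReal_coe_nnreal]
    refine ENNReal.ofReal_le_ofReal ?_
    rw [inv_mul_le_iff₀ (by positivity), mul_comm]
    exact hτM t

theorem ae_weylKernel_eq {ħ T : ℝ} (hħ : 0 < ħ) {R : ℝ → L2 d →L[ℂ] L2 d}
    {G : ℝ × Space d × Space d → ℂ} {M : ℝ≥0} (hG : IsRelKernel ħ T R G M) {t : ℝ}
    (ht : t ∈ Icc (-T) T) {k : Space d × Space d → ℂ} (hk : IsIntegralKernel (R t) k) :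
    ∀ᵐ p : Space d × Space d, weylKernel ħ k p = G (t, p.2, p.1) := by
  obtain ⟨k', hk', hG'⟩ := hG.exists_kernel t ht
  have hs : Measure.QuasiMeasurePreserving (Prod.swap : Space d × Space d → Space d × Space d)
      volume volume := (Measure.measurePreserving_swap (μ := volume) (ν := volume)
        ).quasiMeasurePreserving
  have h1 := hs.ae ((quasiMeasurePreserving_relMap hħ).ae (hk.ae_eq hk'))
  filter_upwards [h1, hs.ae hG'] with p hp hp'
  exact hp.trans hp'.symm

/-- Dilation of the second variable. -/
def dilateSnd {r : ℝ} (hr : r ≠ 0) : (Space d × Space d) ≃L[ℝ] (Space d × Space d) :=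
  (ContinuousLinearEquiv.refl ℝ (Space d)).prodCongr
    (ContinuousLinearEquiv.smulLeft (Units.mk0 r hr))

theorem dilateSnd_apply {r : ℝ} (hr : r ≠ 0) (p : Space d × Space d) :
    dilateSnd hr p = (p.1, r • p.2) := rfl

theorem map_dilateSnd {r : ℝ} (hr : 0 < r) :
    Measure.map (dilateSnd (d := d) hr.ne') volume =
      ENNReal.ofReal ((r ^ d)⁻¹) • (volume : Measure (Space d × Space d)) := by
  have h := Measure.map_addHaar_smul (volume : Measure (Space d)) hr.ne'
  rw [finrank_euclideanSpace, Fintype.card_fin, abs_of_pos (by positivity)] at h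
  have h2 := Measure.map_prod_map (volume : Measure (Space d)) (volume : Measure (Space d))
    measurable_id (measurable_const_smul r)
  rw [Measure.map_id] at h2
  calc Measure.map (dilateSnd (d := d) hr.ne') volume =
        Measure.map (Prod.map id fun x : Space d => r • x)
          ((volume : Measure (Space d)).prod volume) := rfl
    _ = (volume : Measure (Space d)).prod (ENNReal.ofReal ((r ^ d)⁻¹) • volume) := by
        rw [← h2]; exact congrArg _ h
    _ = _ := by rw [Measure.prod_smul_right]; rfl

/-- Substituting `2πv` for `v` passes between the kernels `exp(-i v·y)` and `exp(-2πi v·y)`. -/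
theorem integral_exp_mul_eq_partialFourier (Φ : 𝓢(Space d × Space d, ℂ)) (p : Space d × Space d) :
    ∫ v : Space d, Complex.exp (-(Complex.I * ((inner ℝ v p.2 : ℝ) : ℂ))) * Φ (p.1, v) =
      ((2 * Real.pi) ^ d : ℝ) * partialFourier (SchwartzMap.compCLMOfContinuousLinearEquiv ℂ
        (dilateSnd (d := d) Real.two_pi_pos.ne') Φ) p := by
  rw [partialFourier_eq_integral]
  have h := Measure.integral_comp_smul (volume : Measure (Space d)) (fun v : Space d =>
    Complex.exp (-(Complex.I * ((inner ℝ v p.2 : ℝ) : ℂ))) * Φ (p.1, v)) (2 * Real.pi)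
  have e : ∀ v : Space d, Complex.exp (-(2 * Real.pi * inner ℝ v p.2 : ℝ) * Complex.I) *
      (SchwartzMap.compCLMOfContinuousLinearEquiv ℂ
        (dilateSnd (d := d) Real.two_pi_pos.ne') Φ) (p.1, v) =
      Complex.exp (-(Complex.I * ((inner ℝ ((2 * Real.pi) • v) p.2 : ℝ) : ℂ))) *
        Φ (p.1, (2 * Real.pi) • v) := fun v => by
    have h0 : (SchwartzMap.compCLMOfContinuousLinearEquiv ℂ
        (dilateSnd (d := d) Real.two_pi_pos.ne') Φ) (p.1, v) = Φ (p.1, (2 * Real.pi) • v) := rfl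
    rw [h0, inner_smul_left]
    congr 2
    simp only [conj_trivial]
    push_cast
    ring
  simp_rw [e]
  rw [h, finrank_euclideanSpace, Fintype.card_fin, abs_of_pos (by positivity), Complex.real_smul,
    ← mul_assoc, ← Complex.ofReal_mul, mul_inv_cancel₀ (by positivity), Complex.ofReal_one, one_mul]

/-- With the roles of `x` and `y` exchanged, the partial Fourier transform of the density matrix,
dilated in `v` to change the normalisation of the exponential, is a Wigner function. -/
theorem exists_isWignerFunction {ħ T : ℝ} (hħ : 0 < ħ) {R : ℝ → L2 d →L[ℂ] L2 d}
    {G : ℝ × Space d × Space d → ℂ} {M : ℝ≥0} (hG : IsRelKernel ħ T R G M) :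
    ∃ w, IsWignerFunction ħ T R w := by
  have hπ := Real.two_pi_pos
  set c : ℝ := ((2 * Real.pi) ^ d)⁻¹ with hc
  have hc0 : 0 < c := by positivity
  have hs : MeasurePreserving (Prod.swap : Space d × Space d → Space d × Space d)
      volume volume := Measure.measurePreserving_swap (μ := volume) (ν := volume)
  have hH : StronglyMeasurable fun q : ℝ × Space d × Space d => G (q.1, q.2.2, q.2.1) := by
    have h1 : Measurable fun q : ℝ × Space d × Space d => (q.1, q.2.2, q.2.1) := by fun_prop
    simpa only [Function.comp_def] using hG.stronglyMeasurable.comp_measurable h1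
  obtain ⟨g, g1, g2, g3⟩ := exists_partialFourier_family hH (M := M) fun t => by
    have h1 : Measurable fun p : Space d × Space d => ‖G (t, p)‖ₑ ^ 2 := by
      have h2 : Measurable fun p : Space d × Space d => (t, p) := by fun_prop
      simpa only [Function.comp_def] using
        ((hG.stronglyMeasurable.comp_measurable h2).enorm.pow_const 2)
    exact (hs.lintegral_comp h1).trans_le (hG.lintegral_sq_le t)
  have gm : ∀ t, MemLp (fun p => g (t, p)) 2 volume := fun t => by
    have h1 : StronglyMeasurable fun p => g (t, p) := g1.comp_measurable measurable_prodMk_left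
    rw [memLp_two_iff_lintegral h1.aestronglyMeasurable]
    exact (g2 t).trans_lt ENNReal.coe_lt_top
  have wm : StronglyMeasurable fun q : ℝ × Space d × Space d =>
      (c : ℂ) * g (q.1, q.2.1, (2 * Real.pi)⁻¹ • q.2.2) := by
    have h1 : Measurable fun q : ℝ × Space d × Space d =>
      (q.1, q.2.1, (2 * Real.pi)⁻¹ • q.2.2) := by fun_prop
    simpa only [Function.comp_def] using (g1.comp_measurable h1).const_mul (c : ℂ)
  have hemb : MeasurableEmbedding (dilateSnd (d := d) hπ.ne') :=
    (dilateSnd (d := d) hπ.ne').toHomeomorph.measurableEmbedding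
  refine ⟨fun q => c * g (q.1, q.2.1, (2 * Real.pi)⁻¹ • q.2.2), wm.aestronglyMeasurable, ?_⟩
  filter_upwards [ae_restrict_mem measurableSet_Ioo] with t ht
  obtain ⟨k, hk, -⟩ := hG.exists_kernel t (Ioo_subset_Icc_self ht)
  refine ⟨k, hk, ?_, fun Φ => ?_⟩
  · have h2 := map_dilateSnd (d := d) (inv_pos.2 hπ)
    have h3 : MemLp (fun p => g (t, p)) 2 (Measure.map (dilateSnd (d := d) (inv_pos.2 hπ).ne')
        volume) := by
      rw [h2]; exact (gm t).smul_measure ENNReal.ofReal_ne_top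
    have h4 := (h3.comp_of_map
      (dilateSnd (d := d) (inv_pos.2 hπ).ne').continuous.measurable.aemeasurable).const_mul (c : ℂ)
    exact h4
  · set Ψ := SchwartzMap.compCLMOfContinuousLinearEquiv ℂ (dilateSnd (d := d) hπ.ne') Φ with hΨ
    have h1 : ∫ p : Space d × Space d, (c * g (t, p.1, (2 * Real.pi)⁻¹ • p.2)) * Φ p =
        ∫ p, g (t, p) * Ψ p := by
      have h2 := hemb.integral_map (μ := volume) fun p : Space d × Space d =>
        (c * g (t, p.1, (2 * Real.pi)⁻¹ • p.2)) * Φ p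
      rw [map_dilateSnd hπ, integral_smul_measure, ENNReal.toReal_ofReal hc0.le] at h2
      have h3 : ∀ p : Space d × Space d, (c * g (t, (dilateSnd hπ.ne' p).1,
          (2 * Real.pi)⁻¹ • (dilateSnd hπ.ne' p).2)) * Φ (dilateSnd hπ.ne' p) =
          c * (g (t, p) * Ψ p) := fun p => by
        rw [dilateSnd_apply, smul_smul, inv_mul_cancel₀ hπ.ne', one_smul, mul_assoc]
        rfl
      simp_rw [h3] at h2
      rw [integral_const_mul, Complex.real_smul] at h2
      exact mul_left_cancel₀ (Complex.ofReal_ne_zero.2 hc0.ne') h2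
    rw [h1, g3 t Ψ]
    refine integral_congr_ae ?_
    filter_upwards [ae_weylKernel_eq hħ hG (Ioo_subset_Icc_self ht) hk] with p hp
    rw [hp, integral_exp_mul_eq_partialFourier, ← hΨ]
    have h5 : (c : ℂ) * ((2 * Real.pi) ^ d : ℝ) = 1 := by
      rw [← Complex.ofReal_mul, hc, inv_mul_cancel₀ (by positivity), Complex.ofReal_one]
    calc _ = (c * ((2 * Real.pi) ^ d : ℝ) : ℂ) * (G (t, p.2, p.1) * partialFourier Ψ p) := by
          rw [h5, one_mul]
      _ = _ := by ring

end Existence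

end

section

open Filter Topology
open scoped FourierTransform ContDiff

/-! ### Velocity averages of the Wigner function -/

section VelocityAverage

variable {d : ℕ}

theorem IsWignerTransform.congr_ae {ħ : ℝ} {A : L2 d →L[ℂ] L2 d} {W W' : Space d × Space d → ℂ}
    (hW : IsWignerTransform ħ A W) (h : W =ᵐ[volume] W') : IsWignerTransform ħ A W' := by
  obtain ⟨k, hk, h1, h2⟩ := hW
  refine ⟨k, hk, (memLp_congr_ae h).1 h1, fun Φ => ?_⟩
  rw [← h2 Φ]
  refine integral_congr_ae ?_
  filter_upwards [h] with p hp
  rw [hp]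

theorem restrict_prod_univ {E : Type*} [MeasureSpace E] [SFinite (volume : Measure E)]
    (S : Set ℝ) : (volume : Measure (ℝ × E)).restrict (S ×ˢ univ) =
      (volume.restrict S).prod volume := by
  rw [Measure.volume_eq_prod, ← Measure.prod_restrict, Measure.restrict_univ]

theorem IsWignerFunction.exists_stronglyMeasurable {ħ T : ℝ} {R : ℝ → L2 d →L[ℂ] L2 d}
    {w : ℝ × Space d × Space d → ℂ} (hw : IsWignerFunction ħ T R w) :
    ∃ w', StronglyMeasurable w' ∧ IsWignerFunction ħ T R w' ∧
      ∀ᵐ z ∂(volume.restrict (Ioo (-T) T ×ˢ (univ : Set (Space d)))),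
        ∀ᵐ v, w (z.1, z.2, v) = w' (z.1, z.2, v) := by
  obtain ⟨w', hwm, h1⟩ := hw.aestronglyMeasurable
  rw [restrict_prod_univ] at h1
  refine ⟨w', hwm, ⟨hwm.aestronglyMeasurable, ?_⟩, ?_⟩
  · filter_upwards [Measure.ae_ae_of_ae_prod h1, hw.isWignerTransform] with t ht ht'
    exact ht'.congr_ae ht
  · rw [restrict_prod_univ]
    have h2 := (measurePreserving_prodAssoc (volume.restrict (Ioo (-T) T))
      (volume : Measure (Space d)) (volume : Measure (Space d))).quasiMeasurePreserving.ae h1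
    exact Measure.ae_ae_of_ae_prod h2

/-- The Fourier transform in `x` of the velocity average is `(2π)^{-d}` times the average of `h`
against the transform of `ψ`. Without that factor, each side is the pairing of the density matrix
with the transform of `ψ` in `y` times the transform of `η` in `x`. -/
theorem IsWignerTransform.integral_mul_fourier {ħ T : ℝ} (hħ : 0 < ħ) {R : ℝ → L2 d →L[ℂ] L2 d}
    {G h : ℝ × Space d × Space d → ℂ} {M N : ℝ≥0} (hG : IsRelKernel ħ T R G M)
    (hh : IsBoundedFamily h N) (hGh : ∀ t (Φ : 𝓢(Space d × Space d, ℂ)),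
        ∫ p, h (t, p) * Φ p = ∫ p, G (t, p) * partialFourier Φ p)
    {t : ℝ} (ht : t ∈ Icc (-T) T) {W : Space d × Space d → ℂ} (hW : IsWignerTransform ħ (R t) W)
    (ψ η : 𝓢(Space d, ℂ)) :
    ∫ x, (∫ v, W (x, v) * ψ v) * 𝓕 η x = ((((2 * Real.pi) ^ d)⁻¹ : ℝ) : ℂ) *
      ∫ ξ, movingAverage h (fun _ => 1) (angularFourier ψ) 0 t ξ * η ξ := by
  obtain ⟨k, hk, hWm, hWi⟩ := hW
  set c : ℝ := ((2 * Real.pi) ^ d)⁻¹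
  set χ := angularFourier ψ with hχ
  have hi : Integrable (fun p : Space d × Space d => W p * schwartzTensor (𝓕 η) ψ p)
      (volume.prod volume) :=
    integrable_mul_of_memLp hWm ((schwartzTensor (𝓕 η) ψ).memLp 2 volume)
  have e1 : ∫ x, (∫ v, W (x, v) * ψ v) * 𝓕 η x =
      ∫ p, W p * schwartzTensor (𝓕 η) ψ p := by
    rw [Measure.volume_eq_prod, integral_prod _ hi]
    refine integral_congr_ae (.of_forall fun x => ?_)
    simp only [schwartzTensor_apply]
    rw [← integral_mul_const]
    refine integral_congr_ae (.of_forall fun v => ?_)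
    simp only
    ring
  have e2 : ∀ p : Space d × Space d,
      ∫ v : Space d, Complex.exp (-(Complex.I * ((inner ℝ v p.2 : ℝ) : ℂ))) *
        schwartzTensor (𝓕 η) ψ (p.1, v) = 𝓕 η p.1 * χ p.2 := fun p => by
    rw [hχ, angularFourier_apply, ← integral_const_mul]
    refine integral_congr_ae (.of_forall fun v => ?_)
    simp only [schwartzTensor_apply]
    rw [mul_comm Complex.I, ← neg_mul]
    ring
  -- For zero displacement the sheared test function is a tensor product, and the transform acts on
  -- the second factor only.
  have e3 : ∀ q : Space d × Space d,
      partialFourier (shearedTest χ η 0) q = χ q.1 * 𝓕 η q.2 := fun q => by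
    have h1 : slice (shearedTest χ η 0) q.1 = χ q.1 • η := by
      ext v
      rw [slice_apply, shearedTest_apply]
      simp
    rw [partialFourier, h1, FourierTransform.fourier_smul]
    rfl
  have e4 : ∫ ξ, movingAverage h (fun _ => 1) χ 0 t ξ * η ξ =
      ∫ p, h (t, p) * shearedTest χ η 0 p := by
    have := (hh.integral_mul_movingAverage isBracketWeight_one χ η 0 t).2
    simp only [one_mul] at this
    rw [← this]
    exact integral_congr_ae (.of_forall fun ξ => mul_comm _ _)
  have e5 : ∫ q : Space d × Space d, G (t, q) * (χ q.1 * 𝓕 η q.2) =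
      ∫ p : Space d × Space d, G (t, p.2, p.1) * (χ p.2 * 𝓕 η p.1) :=
    (integral_prod_swap (μ := volume) (ν := volume) fun q : Space d × Space d =>
      G (t, q) * (χ q.1 * 𝓕 η q.2)).symm
  rw [e1, hWi, e4, hGh]
  simp_rw [e2, e3]
  rw [e5, ← integral_const_mul]
  refine integral_congr_ae ?_
  filter_upwards [ae_weylKernel_eq hħ hG ht hk] with p hp
  rw [hp]
  ring

theorem IsWignerFunction.ae_integrable_mul {ħ T : ℝ} {R : ℝ → L2 d →L[ℂ] L2 d}
    {w : ℝ × Space d × Space d → ℂ} (hw : IsWignerFunction ħ T R w) (hwm : StronglyMeasurable w)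
    (ψ : 𝓢(Space d, ℂ)) :
    ∀ᵐ z ∂(volume.restrict (Ioo (-T) T ×ˢ (univ : Set (Space d)))),
      Integrable fun v : Space d => w (z.1, z.2, v) * ψ v := by
  have hm : StronglyMeasurable fun q : (ℝ × Space d) × Space d => w (q.1.1, q.1.2, q.2) * ψ q.2 := by
    have h1 : Measurable fun q : (ℝ × Space d) × Space d => (q.1.1, q.1.2, q.2) := by fun_prop
    have h2 := hwm.comp_measurable h1
    simp only [Function.comp_def] at h2
    exact h2.mul (ψ.continuous.comp continuous_snd).stronglyMeasurable
  rw [restrict_prod_univ, Measure.ae_prod_iff_ae_ae (measurableSet_integrable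
    (f := fun (z : ℝ × Space d) v => w (z.1, z.2, v) * ψ v) hm)]
  filter_upwards [hw.isWignerTransform] with t ht
  obtain ⟨k, -, hW⟩ := ht
  filter_upwards [ae_memLp_slice hW.memLp] with x hx
  exact integrable_mul_of_memLp hx (ψ.memLp 2 volume)

theorem stronglyMeasurable_velocityAverage {w : ℝ × Space d × Space d → ℂ}
    (hw : StronglyMeasurable w) (ψ : 𝓢(Space d, ℂ)) :
    StronglyMeasurable (velocityAverage ψ w) := by
  have h1 : Measurable fun q : (ℝ × Space d) × Space d => (q.1.1, q.1.2, q.2) := by fun_prop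
  have h2 := hw.comp_measurable h1
  simp only [Function.comp_def] at h2
  exact (h2.mul (ψ.continuous.comp continuous_snd).stronglyMeasurable).integral_prod_right'

theorem sobolevNorm_congr_ae {s : ℝ} {Ω : Set (ℝ × Space d)} {u u' : ℝ × Space d → ℂ}
    (h : u =ᵐ[volume.restrict Ω] u') : sobolevNorm s Ω u = sobolevNorm s Ω u' := by
  rw [sobolevNorm, sobolevNorm]
  congr 2
  · refine lintegral_congr_ae ?_
    filter_upwards [h] with z hz
    rw [hz]
  · refine lintegral_congr_ae ?_
    filter_upwards [h] with z hz
    refine lintegral_congr_ae ?_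
    filter_upwards [h] with z' hz'
    rw [hz, hz']

end VelocityAverage

end

end SemiclassicalAveraging

end

/-! ### The uniform bound for the velocity averages. -/

open SemiclassicalAveraging in
/-- Semi-classical averaging lemma. -/
theorem theorem4 (d : ℕ) (m : ℝ) (hm : 0 < m) (T : ℝ) (hT : 0 < T)
    (V : C(Space d, ℝ)) (hV : ∃ L : ℝ≥0, LipschitzWith L V)
    (R : ℝ → ℝ → L2 d →L[ℂ] L2 d)
    (hdens : ∀ ħ ∈ Ioc (0 : ℝ) 1, ∀ t ∈ Icc (-T) T, IsDensityOperator (R ħ t))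
    (hcont : ∀ ħ ∈ Ioc (0 : ℝ) 1, ∀ f g : L2 d,
      ContinuousOn (fun t => inner ℂ f (R ħ t g)) (Icc (-T) T))
    (hsol : ∀ ħ ∈ Ioc (0 : ℝ) 1, IsWeakVonNeumannSolution ħ m T V (R ħ))
    (C : ℝ) (hC : 0 < C)
    (hHS : ∀ ħ ∈ Ioc (0 : ℝ) 1, ∀ t ∈ Icc (-T) T,
      ∃ τ : ℝ, HasTrace (R ħ t ∘L R ħ t) (τ : ℂ) ∧ τ ≤ C ^ 2 * (2 * Real.pi * ħ) ^ d)
    (ψ : 𝓢(Space d, ℂ)) :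
    ∃ C' : ℝ≥0, ∀ ħ ∈ Ioc (0 : ℝ) 1,
      (∃ w : ℝ × Space d × Space d → ℂ, IsWignerFunction ħ T (R ħ) w) ∧
      ∀ w : ℝ × Space d × Space d → ℂ, IsWignerFunction ħ T (R ħ) w →
        (∀ᵐ z ∂(volume.restrict (Ioo (-T) T ×ˢ (univ : Set (Space d)))),
          Integrable fun v : Space d => w (z.1, z.2, v) * ψ v) ∧
        AEStronglyMeasurable (velocityAverage ψ w)
          (volume.restrict (Ioo (-T) T ×ˢ (univ : Set (Space d)))) ∧
        sobolevNorm (1 / 4) (Ioo (-T) T ×ˢ (univ : Set (Space d))) (velocityAverage ψ w)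
          ≤ (C' : ℝ≥0∞) := by
  obtain ⟨L, hL⟩ := hV
  have hM0 : 0 ≤ C ^ 2 * (2 * Real.pi) ^ d := by positivity
  -- The squared norms of `h` and `K` are at most `C²(2π)^d` and `L²C²(2π)^d`. All constants are
  -- fixed here, before `ħ` is introduced.
  obtain ⟨C₁, h₁⟩ := exists_isAverageBound (β := 2 * Real.pi / m) (by positivity) hT ψ
    ⟨C ^ 2 * (2 * Real.pi) ^ d, hM0⟩ (L ^ 2 * ⟨C ^ 2 * (2 * Real.pi) ^ d, hM0⟩)
  obtain ⟨C', h'⟩ := exists_sobolevNorm_le d T C₁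
  refine ⟨C', fun ħ hħ => ?_⟩
  obtain ⟨G, hG⟩ := exists_isRelKernel (M := ⟨C ^ 2 * (2 * Real.pi) ^ d, hM0⟩) hħ.1
    (fun t ht => (hdens ħ hħ t ht).isPositive) (hcont ħ hħ) fun t ht => by
      obtain ⟨τ, h1, h2⟩ := hHS ħ hħ t ht
      refine ⟨τ, h1, h2.trans (le_of_eq ?_)⟩
      rw [mul_pow (2 * Real.pi), ← mul_assoc]
      rfl
  obtain ⟨h, K, hp, hGh⟩ := hG.exists_transportPair hħ.1 hm hT hL (hcont ħ hħ) (hsol ħ hħ)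
  refine ⟨exists_isWignerFunction hħ.1 hG, fun w hw => ?_⟩
  -- Changing `w` on a null set alters its velocity average only on a null set, which neither
  -- integrability nor the Sobolev norm detects.
  obtain ⟨w', hwm, hw', hww⟩ := hw.exists_stronglyMeasurable
  have hav : velocityAverage ψ w =ᵐ[volume.restrict (Ioo (-T) T ×ˢ (univ : Set (Space d)))]
      velocityAverage ψ w' := by
    filter_upwards [hww] with z hz
    refine integral_congr_ae ?_
    filter_upwards [hz] with v hv
    rw [hv]
  have hum := stronglyMeasurable_velocityAverage hwm ψ
  refine ⟨?_, hum.aestronglyMeasurable.congr hav.symm, ?_⟩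
  · filter_upwards [hww, hw'.ae_integrable_mul hwm ψ] with z hz hi
    refine hi.congr ?_
    filter_upwards [hz] with v hv
    rw [hv]
  · rw [sobolevNorm_congr_ae hav]
    refine h' _ _ ((((2 * Real.pi) ^ d)⁻¹ : ℝ) : ℂ) hum (h₁ h K hp) ?_ ?_
    · rw [Complex.norm_real, Real.norm_of_nonneg (by positivity)]
      exact inv_le_one_of_one_le₀ (one_le_pow₀ (by linarith [Real.pi_gt_three]))
    · filter_upwards [hw'.isWignerTransform, ae_restrict_mem measurableSet_Ioo] with t hW ht
      refine ⟨?_, fun η => hW.integral_mul_fourier hħ.1 hG hp.fst hGh (Ioo_subset_Icc_self ht) ψ η⟩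
      obtain ⟨k, -, hk⟩ := hW
      exact memLp_integral_kernel_mul hk.memLp (ψ.memLp 2 volume)
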